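/- **Setting.** Let $0<\varepsilon<1$, $\eta=\frac{2\varepsilon}{1-\varepsilon}$, $k_\pm=1\pm\frac{\sqrt{2\eta+\eta^2}}{1+\eta}$. In double-null gauge the metric is $-\Omega^2\,dp\,dq+r^2\gamma$ with $\Omega,r>0$ functions of $(p,q)$ and $\gamma$ the round metric of $\mathbb S^2$; the fluid has density $\rho>0$, pressure $\varepsilon\rho$ and future-directed velocity $(u^p,u^q)$, $u^p,u^q>0$, $u^pu^q=\Omega^{-2}$. Put $T^{pp}=(1+\varepsilon)\rho(u^p)^2$, $T^{qq}=(1+\varepsilon)\rho(u^q)^2$, $T^{pq}=(1-\varepsilon)\rho\,\Omega^{-2}$. The Einstein–Euler system consists of the wave equations $$\partial_p\partial_q r=-\tfrac{\Omega^2}{4r}-\tfrac1r\partial_pr\,\partial_qr+\pi r\Omega^4T^{pq},\qquad \partial_p\partial_q\log\Omega=-(1+\eta)\pi\Omega^4T^{pq}+\tfrac{\Omega^2}{4r^2}+\tfrac1{r^2}\partial_pr\,\partial_qr,\tag{1}$$ the constraints $$\partial_q(\Omega^{-2}\partial_qr)=-\pi r\Omega^2T^{pp},\qquad \partial_p(\Omega^{-2}\partial_pr)=-\pi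 r\Omega^2T^{qq},\tag{2}$$ and the Euler equations $$\partial_p(\Omega^4r^2T^{pp})+\tfrac{\Omega^2}{r^{2\eta}}\partial_q(\Omega^2r^{2+2\eta}T^{pq})=0,\qquad \partial_p(\Omega^2r^{2+2\eta}T^{pq})+\tfrac{r^{2\eta}}{\Omega^2}\partial_q(\Omega^4r^2T^{qq})=0.\tag{3}$$ Let $f^+=\frac{(1-\varepsilon)^{k_+}}{1+\varepsilon}r^{(2+2\eta)k_+-2}\rho^{k_+-1}(u^q)^2$ and $f^-=\frac{1+\varepsilon}{(1-\varepsilon)^{k_-}}\frac{r^{2-(2+2\eta)k_-}\rho^{1-k_-}}{(u^q)^2}$; conversely $\rho=\frac{(f^+f^-)^{1/(k_+-k_-)}}{(1-\varepsilon)r^{2+2\eta}}$ and $(u^q)^2=(1+\eta)r^{-2\eta}(f^+/f^-)^{1/2}$. With $\mathcal U=(1+\eta)\Omega^2(u^q)^2$, the reformulated evolution system for $[f^\pm,\Omega,r]$ is (1) together with $$\partial_pf^\pm+k_\pm\,\mathcal U\,\partial_qf^\pm\pm2k_\pm\Big(2\tfrac{\partial_q\Omega}{\Omega}-2\eta\tfrac{\partial_qr}{r}\Big)\mathcal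 U f^\pm=0.\tag{4}$$ **Domain and norms.** Let $q_0>0$, $p_0<0$, $\mathcal D=\{p_0<p<0,\ q>q_0\}$, $\underline{\mathcal C}=\{q=q_0,\ p_0\le p\le0\}$, $\mathcal C=\{p=p_0,\ q\ge q_0\}$. Fix $0<\theta<1$ and $N_\pm>0$ with $N_+=N_--4\eta$ and $N_->\frac{k_+-k_-}2+2\eta$, and put $$\begin{aligned}|||[f^\pm,\Omega,r]|||={}&\sum_{\pm}\Big(\|\log(q^{N_\pm}f^\pm)\|_\infty+\sum_{j=1}^2\|q^j\partial_q^j\log f^\pm\|_\infty\Big)+\|\log\Omega\|_\infty+\sum_{j=1}^3\|q^{j+\theta}\partial_q^j\log\Omega\|_\infty\\&+\sum_{j=0}^3\|q^{j-2}\partial_q^j(r^2)\|_\infty+\Big\|\frac{q^2}{r^2}\Big\|_\infty+\Big\|\frac q{\partial_q(r^2)}\Big\|_\infty,\end{aligned}$$ with $L^\infty$-norms over $\mathcal D$. The data norm is the same expression with $L^\infty$-norms over $\mathcal C\cup\underline{\mathcal C}$, plus $\|q^{-1}\partial_p(r^2)|_{\underline{\mathcal C}}\|_\infty+\|m|_{\underline{\mathcal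 C}}\|_\infty$, where $m=\frac r2\big(1+\frac{4\partial_pr\,\partial_qr}{\Omega^2}\big)$ is the Hawking mass. **Data.** Let $A_0>q_0$. The characteristic data $[\hat f^\pm,\hat\Omega,\hat r]$ on $\mathcal C\cup\underline{\mathcal C}$ are required to satisfy: (i) on $\underline{\mathcal C}$ (including transversal derivatives) and on the segment $\{p=p_0,\ q_0\le q\le A_0\}$ of $\mathcal C$ they coincide with the restriction of a $C^\infty$ solution of the full system (1)–(3) that is defined on a neighbourhood of these two segments (for instance the exactly self-similar relativistic Larson–Penston solution); (ii) $\hat f^\pm,\hat\Omega,\hat r>0$, $\hat f^\pm\in W^{2,\infty}$, $\hat\Omega,\hat r/q\in W^{3,\infty}$, and the data norm is finite; (iii) the first equation of (2) holds on $\mathcal C$ and the second holds on $\underline{\mathcal C}$. **Theorem.** For every $M<\infty$ there is $\delta_0>0$, depending only on $M$, $\varepsilon$, $N_\pm$, $\theta$ and $q_0$, such that for every $\delta\in(0,\delta_0)$, with $p_0=-\delta$, and for all data satisfying (i)–(iii) with data norm at most $M$, there exists a unique solution $[f^\pm,\Omega,r]$ on $\overline{\mathcal D}$ of the system (1), (4),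 attaining the data on $\mathcal C\cup\underline{\mathcal C}$, with $f^\pm,\Omega,r>0$, $f^\pm\in W^{2,\infty}(\overline{\mathcal D})$, $\Omega,\frac rq\in W^{3,\infty}(\overline{\mathcal D})$ and $|||[f^\pm,\Omega,r]|||<\infty$. This solution is asymptotically flat, i.e. for every $p\in[p_0,0]$ the limit $\lim_{q\to\infty}m(p,q)$ exists and is finite. Moreover the corresponding $(\rho,u^p,u^q,\Omega,r)$ solves the full system (1)–(3) in $\mathcal D$, including the constraints. -/

import Mathlib

open MeasureTheory Set Filter Topology
open scoped ENNReal NNReal ContDiff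

noncomputable section

namespace EinsteinEuler

/-! ### Weak derivatives and the spaces `W^{k,∞}` -/

section Sobolev

variable {E : Type*} [NormedAddCommGroup E] [NormedSpace ℝ E] [MeasureSpace E]

/-- `g` is the `j`-th order weak derivative of `u` in the direction `v` on the open set `U`. -/
def IsWeakDeriv (U : Set E) (v : E) (j : ℕ) (u g : E → ℝ) : Prop :=
  LocallyIntegrableOn u U volume ∧ LocallyIntegrableOn g U volume ∧
    ∀ φ : E → ℝ, ContDiff ℝ ∞ φ → HasCompactSupport φ → tsupport φ ⊆ U →
      ∫ x in U, u x * iteratedFDeriv ℝ j φ x (fun _ => v) = (-1) ^ j * ∫ x in U, g x * φ x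

/-- The Sobolev space `W^{k,∞}(U)`: all weak derivatives of order at most `k` exist
and are essentially bounded. -/
def MemW (U : Set E) : ℕ → (E → ℝ) → Prop
  | 0, u => MemLp u ⊤ (volume.restrict U)
  | k + 1, u => MemLp u ⊤ (volume.restrict U) ∧
      ∀ v : E, ∃ g : E → ℝ, IsWeakDeriv U v 1 u g ∧ MemW U k g

/-- `‖w ∂_v^j u‖_{L^∞(U)}` with the weak derivative `∂_v^j u` (unique up to null sets);
the value is `∞` if that derivative does not exist. -/
def weakSup (U : Set E) (v : E) (w : E → ℝ) (j : ℕ) (u : E → ℝ) : ℝ≥0∞ :=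
  ⨅ (g : E → ℝ) (_ : IsWeakDeriv U v j u g),
    eLpNormEssSup (fun x => w x * g x) (volume.restrict U)

end Sobolev

/-! ### Constants and algebraic relations of the fluid -/

/-- `η = 2ε / (1 - ε)`. -/
def eta (ε : ℝ) : ℝ := 2 * ε / (1 - ε)

/-- `k₊ = 1 + √(2η + η²) / (1 + η)`. -/
def kPlus (ε : ℝ) : ℝ := 1 + √(2 * eta ε + eta ε ^ 2) / (1 + eta ε)

/-- `k₋ = 1 - √(2η + η²) / (1 + η)`. -/
def kMinus (ε : ℝ) : ℝ := 1 - √(2 * eta ε + eta ε ^ 2) / (1 + eta ε)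

/-- `f⁺` as a function of the values of `r`, `ρ`, `u^q`. -/
def fPlusOf (ε r ρ uq : ℝ) : ℝ :=
  (1 - ε) ^ kPlus ε / (1 + ε) * r ^ ((2 + 2 * eta ε) * kPlus ε - 2) * ρ ^ (kPlus ε - 1) * uq ^ 2

/-- `f⁻` as a function of the values of `r`, `ρ`, `u^q`. -/
def fMinusOf (ε r ρ uq : ℝ) : ℝ :=
  (1 + ε) / (1 - ε) ^ kMinus ε *
    (r ^ (2 - (2 + 2 * eta ε) * kMinus ε) * ρ ^ (1 - kMinus ε) / uq ^ 2)

/-- The density recovered from the values `a = f⁺`, `b = f⁻` and `r`. -/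
def rhoOf (ε a b r : ℝ) : ℝ :=
  1 / (1 - ε) * (a * b) ^ (1 / (kPlus ε - kMinus ε)) / r ^ (2 + 2 * eta ε)

/-- The velocity component `u^q > 0` recovered from the values `a = f⁺`, `b = f⁻` and `r`. -/
def uQOf (ε a b r : ℝ) : ℝ :=
  √((1 + eta ε) * r ^ (-(2 * eta ε)) * √(a / b))

/-- The velocity component `u^p`, from the normalisation `u^p u^q = Ω⁻²`. -/
def uPOf (ε a b Om r : ℝ) : ℝ := 1 / (Om ^ 2 * uQOf ε a b r)

/-! ### Unknowns on the `(p, q)`-plane -/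

/-- Fluid and metric unknowns of the Einstein-Euler system in double-null gauge
`-Ω² dp dq + r² γ`. A point of the plane is `z = (p, q)`. -/
structure FluidMetric where
  rho : ℝ × ℝ → ℝ
  uP : ℝ × ℝ → ℝ
  uQ : ℝ × ℝ → ℝ
  Om : ℝ × ℝ → ℝ
  r : ℝ × ℝ → ℝ

/-- The reformulated unknowns `[f⁺, f⁻, Ω, r]`. -/
structure Fields where
  fP : ℝ × ℝ → ℝ
  fM : ℝ × ℝ → ℝ
  Om : ℝ × ℝ → ℝ
  r : ℝ × ℝ → ℝ

/-- Passage from `(ρ, u, Ω, r)` to `[f⁺, f⁻, Ω, r]`. -/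
def FluidMetric.toFields (ε : ℝ) (S : FluidMetric) : Fields where
  fP z := fPlusOf ε (S.r z) (S.rho z) (S.uQ z)
  fM z := fMinusOf ε (S.r z) (S.rho z) (S.uQ z)
  Om := S.Om
  r := S.r

/-- Passage from `[f⁺, f⁻, Ω, r]` to `(ρ, u, Ω, r)`. -/
def Fields.toFluidMetric (ε : ℝ) (F : Fields) : FluidMetric where
  rho z := rhoOf ε (F.fP z) (F.fM z) (F.r z)
  uP z := uPOf ε (F.fP z) (F.fM z) (F.Om z) (F.r z)
  uQ z := uQOf ε (F.fP z) (F.fM z) (F.r z)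
  Om := F.Om
  r := F.r

/-- `∂_p`. -/
def dp (u : ℝ × ℝ → ℝ) (z : ℝ × ℝ) : ℝ := deriv (fun s => u (s, z.2)) z.1

/-- `∂_q`. -/
def dq (u : ℝ × ℝ → ℝ) (z : ℝ × ℝ) : ℝ := deriv (fun s => u (z.1, s)) z.2

/-- `T^{pp}`. -/
def FluidMetric.Tpp (ε : ℝ) (S : FluidMetric) (z : ℝ × ℝ) : ℝ :=
  (1 + ε) * S.rho z * S.uP z ^ 2

/-- `T^{qq}`. -/
def FluidMetric.Tqq (ε : ℝ) (S : FluidMetric) (z : ℝ × ℝ) : ℝ :=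
  (1 + ε) * S.rho z * S.uQ z ^ 2

/-- `T^{pq}`. -/
def FluidMetric.Tpq (ε : ℝ) (S : FluidMetric) (z : ℝ × ℝ) : ℝ :=
  (1 - ε) * S.rho z / S.Om z ^ 2

/-! ### The equations, at a point -/

/-- The wave equation for `r`. -/
def RWaveAt (ε : ℝ) (S : FluidMetric) (z : ℝ × ℝ) : Prop :=
  dp (dq S.r) z = -(S.Om z ^ 2 / (4 * S.r z)) - 1 / S.r z * dp S.r z * dq S.r z
    + Real.pi * S.r z * S.Om z ^ 4 * S.Tpq ε z

/-- The wave equation for `log Ω`. -/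
def OmegaWaveAt (ε : ℝ) (S : FluidMetric) (z : ℝ × ℝ) : Prop :=
  dp (dq fun x => Real.log (S.Om x)) z =
    -((1 + eta ε) * Real.pi * S.Om z ^ 4 * S.Tpq ε z) + S.Om z ^ 2 / (4 * S.r z ^ 2)
    + 1 / S.r z ^ 2 * dp S.r z * dq S.r z

/-- The outgoing constraint. -/
def ConstraintQAt (ε : ℝ) (S : FluidMetric) (z : ℝ × ℝ) : Prop :=
  dq (fun x => dq S.r x / S.Om x ^ 2) z = -(Real.pi * S.r z * S.Om z ^ 2 * S.Tpp ε z)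

/-- The ingoing constraint. -/
def ConstraintPAt (ε : ℝ) (S : FluidMetric) (z : ℝ × ℝ) : Prop :=
  dp (fun x => dp S.r x / S.Om x ^ 2) z = -(Real.pi * S.r z * S.Om z ^ 2 * S.Tqq ε z)

/-- The first Euler equation. -/
def ContinuityAt (ε : ℝ) (S : FluidMetric) (z : ℝ × ℝ) : Prop :=
  dp (fun x => S.Om x ^ 4 * S.r x ^ 2 * S.Tpp ε x) z
    + S.Om z ^ 2 / S.r z ^ (2 * eta ε) *
      dq (fun x => S.Om x ^ 2 * S.r x ^ (2 + 2 * eta ε) * S.Tpq ε x) z = 0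

/-- The second Euler equation. -/
def MomentumAt (ε : ℝ) (S : FluidMetric) (z : ℝ × ℝ) : Prop :=
  dp (fun x => S.Om x ^ 2 * S.r x ^ (2 + 2 * eta ε) * S.Tpq ε x) z
    + S.r z ^ (2 * eta ε) / S.Om z ^ 2 *
      dq (fun x => S.Om x ^ 4 * S.r x ^ 2 * S.Tqq ε x) z = 0

/-- The full Einstein-Euler system in double-null gauge (wave equations, constraints, Euler
equations), with the normalisation of the velocity. -/
def EinsteinEulerAt (ε : ℝ) (S : FluidMetric) (z : ℝ × ℝ) : Prop :=
  S.uP z * S.uQ z = 1 / S.Om z ^ 2 ∧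
    RWaveAt ε S z ∧ OmegaWaveAt ε S z ∧ ConstraintQAt ε S z ∧ ConstraintPAt ε S z ∧
    ContinuityAt ε S z ∧ MomentumAt ε S z

/-- The effective transport velocity `𝒰 = (1 + η) Ω² (u^q)²`. -/
def Fields.speed (ε : ℝ) (F : Fields) (z : ℝ × ℝ) : ℝ :=
  (1 + eta ε) * F.Om z ^ 2 * uQOf ε (F.fP z) (F.fM z) (F.r z) ^ 2

/-- The transport equation for `f⁺`. -/
def FPlusTransportAt (ε : ℝ) (F : Fields) (z : ℝ × ℝ) : Prop :=
  dp F.fP z + kPlus ε * F.speed ε z * dq F.fP z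
    + 2 * kPlus ε * (2 * (dq F.Om z / F.Om z) - 2 * eta ε * (dq F.r z / F.r z))
      * F.speed ε z * F.fP z = 0

/-- The transport equation for `f⁻`. -/
def FMinusTransportAt (ε : ℝ) (F : Fields) (z : ℝ × ℝ) : Prop :=
  dp F.fM z + kMinus ε * F.speed ε z * dq F.fM z
    - 2 * kMinus ε * (2 * (dq F.Om z / F.Om z) - 2 * eta ε * (dq F.r z / F.r z))
      * F.speed ε z * F.fM z = 0

/-- The evolutionary part of the system: the two wave equations for the metric and the two
transport equations for `f^±`. -/
def EvolutionAt (ε : ℝ) (F : Fields) (z : ℝ × ℝ) : Prop :=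
  RWaveAt ε (F.toFluidMetric ε) z ∧ OmegaWaveAt ε (F.toFluidMetric ε) z ∧
    FPlusTransportAt ε F z ∧ FMinusTransportAt ε F z

/-! ### Domain, norms -/

/-- The semi-infinite rectangle `𝒟 = {p₀ < p < 0, q > q₀}`. -/
def domD (p0 q0 : ℝ) : Set (ℝ × ℝ) := Ioo p0 0 ×ˢ Ioi q0

/-- Its closure `{p₀ ≤ p ≤ 0, q ≥ q₀}`. -/
def domDbar (p0 q0 : ℝ) : Set (ℝ × ℝ) := Icc p0 0 ×ˢ Ici q0

/-- The weighted norm `|||[f^±, Ω, r]|||` on `𝒟`. -/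
def totalNorm (θ Np Nm p0 q0 : ℝ) (F : Fields) : ℝ≥0∞ :=
  let N (w : ℝ) (j : ℕ) (u : ℝ × ℝ → ℝ) : ℝ≥0∞ :=
    weakSup (domD p0 q0) ((0, 1) : ℝ × ℝ) (fun z => z.2 ^ w) j u
  N 0 0 (fun z => Real.log (z.2 ^ Np * F.fP z))
    + ∑ j ∈ Finset.Icc (1 : ℕ) 2, N j j (fun z => Real.log (F.fP z))
    + N 0 0 (fun z => Real.log (z.2 ^ Nm * F.fM z))
    + ∑ j ∈ Finset.Icc (1 : ℕ) 2, N j j (fun z => Real.log (F.fM z))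
    + N 0 0 (fun z => Real.log (F.Om z))
    + ∑ j ∈ Finset.Icc (1 : ℕ) 3, N (j + θ) j (fun z => Real.log (F.Om z))
    + ∑ j ∈ Finset.range 4, N (j - 2) j (fun z => F.r z ^ 2)
    + essSup (fun z => ‖z.2 ^ 2‖ₑ / ‖F.r z ^ 2‖ₑ) (volume.restrict (domD p0 q0))
    + essSup (fun z => ‖z.2‖ₑ / ‖dq (fun x => F.r x ^ 2) z‖ₑ) (volume.restrict (domD p0 q0))

/-- The data `[f^±, Ω, r]` on the outgoing curve `𝒞 = {p = p₀, q ≥ q₀}`, as functions of `q`. -/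
structure OutgoingData where
  fP : ℝ → ℝ
  fM : ℝ → ℝ
  Om : ℝ → ℝ
  r : ℝ → ℝ

/-- Hawking mass `m = r/2 (1 + 4 ∂_p r ∂_q r / Ω²)`, in terms of the values of
`r`, `∂_p r`, `∂_q r`, `Ω`. -/
def massOf (r rp rq Om : ℝ) : ℝ := r / 2 * (1 + 4 * rp * rq / Om ^ 2)

/-- The data norm on `𝒞 ∪ 𝒞̲`, where `𝒞̲ = {q = q₀, p₀ ≤ p ≤ 0}`. The data on `𝒞̲`, including the
transversal `q`-derivatives, are those of the fields `G`, given near `𝒞̲`; the data on `𝒞` are `d`.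
An `L^∞`-norm over the union is the maximum of the norms over the two pieces. -/
def dataNorm (θ Np Nm p0 q0 : ℝ) (G : Fields) (d : OutgoingData) : ℝ≥0∞ :=
  let Nout (w : ℝ) (j : ℕ) (u : ℝ → ℝ) : ℝ≥0∞ :=
    weakSup (Ioi q0) (1 : ℝ) (fun q => q ^ w) j u
  let Nin (w : ℝ) (j : ℕ) (u : ℝ × ℝ → ℝ) : ℝ≥0∞ :=
    ⨆ p ∈ Icc p0 0, ‖q0 ^ w * iteratedDeriv j (fun s => u (p, s)) q0‖ₑ
  max (Nout 0 0 (fun q => Real.log (q ^ Np * d.fP q)))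
      (Nin 0 0 (fun z => Real.log (z.2 ^ Np * G.fP z)))
    + ∑ j ∈ Finset.Icc (1 : ℕ) 2, max (Nout j j (fun q => Real.log (d.fP q)))
        (Nin j j (fun z => Real.log (G.fP z)))
    + max (Nout 0 0 (fun q => Real.log (q ^ Nm * d.fM q)))
        (Nin 0 0 (fun z => Real.log (z.2 ^ Nm * G.fM z)))
    + ∑ j ∈ Finset.Icc (1 : ℕ) 2, max (Nout j j (fun q => Real.log (d.fM q)))
        (Nin j j (fun z => Real.log (G.fM z)))
    + max (Nout 0 0 (fun q => Real.log (d.Om q))) (Nin 0 0 (fun z => Real.log (G.Om z)))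
    + ∑ j ∈ Finset.Icc (1 : ℕ) 3, max (Nout (j + θ) j (fun q => Real.log (d.Om q)))
        (Nin (j + θ) j (fun z => Real.log (G.Om z)))
    + ∑ j ∈ Finset.range 4, max (Nout (j - 2) j (fun q => d.r q ^ 2))
        (Nin (j - 2) j (fun z => G.r z ^ 2))
    + max (essSup (fun q => ‖q ^ 2‖ₑ / ‖d.r q ^ 2‖ₑ) (volume.restrict (Ioi q0)))
        (⨆ p ∈ Icc p0 0, ‖q0 ^ 2‖ₑ / ‖G.r (p, q0) ^ 2‖ₑ)
    + max (essSup (fun q => ‖q‖ₑ / ‖deriv (fun s => d.r s ^ 2) q‖ₑ) (volume.restrict (Ioi q0)))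
        (⨆ p ∈ Icc p0 0, ‖q0‖ₑ / ‖dq (fun x => G.r x ^ 2) (p, q0)‖ₑ)
    + (⨆ p ∈ Icc p0 0, ‖q0⁻¹ * dp (fun x => G.r x ^ 2) (p, q0)‖ₑ)
    + ⨆ p ∈ Icc p0 0,
        ‖massOf (G.r (p, q0)) (dp G.r (p, q0)) (dq G.r (p, q0)) (G.Om (p, q0))‖ₑ

/-! ### The characteristic problem -/

/-- `B` is a smooth solution of the Einstein-Euler system, with positive density and
future-directed velocity, on the open set `V`. -/
structure IsSmoothSolutionOn (ε : ℝ) (V : Set (ℝ × ℝ)) (B : FluidMetric) : Prop where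
  isOpen : IsOpen V
  smooth_rho : ContDiffOn ℝ ∞ B.rho V
  smooth_uP : ContDiffOn ℝ ∞ B.uP V
  smooth_uQ : ContDiffOn ℝ ∞ B.uQ V
  smooth_Om : ContDiffOn ℝ ∞ B.Om V
  smooth_r : ContDiffOn ℝ ∞ B.r V
  pos : ∀ z ∈ V, 0 < B.rho z ∧ 0 < B.uP z ∧ 0 < B.uQ z ∧ 0 < B.Om z ∧ 0 < B.r z
  eqns : ∀ z ∈ V, EinsteinEulerAt ε B z

/-- Admissible characteristic data. On `𝒞̲` and on the segment `{p = p₀, q₀ ≤ q ≤ A₀}` of `𝒞` the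
data are those of the exact smooth solution `B`; in particular the ingoing constraint holds
on `𝒞̲`. On `𝒞` the data are positive, of class `W^{2,∞}` (for `f^±`) and `W^{3,∞}`
(for `Ω`, `r/q`; always the continuously differentiable representatives), and satisfy the outgoing
constraint. -/
structure IsAdmissibleData (ε p0 q0 A0 : ℝ) (V : Set (ℝ × ℝ)) (B : FluidMetric)
    (d : OutgoingData) : Prop where
  background : IsSmoothSolutionOn ε V B
  ingoing_subset : ∀ p ∈ Icc p0 0, (p, q0) ∈ V
  outgoing_subset : ∀ q ∈ Icc q0 A0, (p0, q) ∈ V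
  eq_background : ∀ q ∈ Icc q0 A0,
    d.fP q = (B.toFields ε).fP (p0, q) ∧ d.fM q = (B.toFields ε).fM (p0, q) ∧
      d.Om q = B.Om (p0, q) ∧ d.r q = B.r (p0, q)
  pos : ∀ q ∈ Ici q0, 0 < d.fP q ∧ 0 < d.fM q ∧ 0 < d.Om q ∧ 0 < d.r q
  fP_C1 : ContDiffOn ℝ 1 d.fP (Ici q0)
  fM_C1 : ContDiffOn ℝ 1 d.fM (Ici q0)
  Om_C2 : ContDiffOn ℝ 2 d.Om (Ici q0)
  r_C2 : ContDiffOn ℝ 2 d.r (Ici q0)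
  fP_mem : MemW (Ioi q0) 2 d.fP
  fM_mem : MemW (Ioi q0) 2 d.fM
  Om_mem : MemW (Ioi q0) 3 d.Om
  r_mem : MemW (Ioi q0) 3 (fun q => d.r q / q)
  constraint : ∀ q ∈ Ioi q0,
    deriv (fun s => deriv d.r s / d.Om s ^ 2) q =
      -(Real.pi * d.r q * d.Om q ^ 2 *
        ((1 + ε) * rhoOf ε (d.fP q) (d.fM q) (d.r q)
          * uPOf ε (d.fP q) (d.fM q) (d.Om q) (d.r q) ^ 2))

/-- `F` solves the characteristic problem on `𝒟` in the class `f^± ∈ W^{2,∞}`,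
`Ω, r/q ∈ W^{3,∞}`, with finite weighted norm (functions are identified with their
continuously differentiable representatives on the closure of `𝒟`). -/
structure IsCharacteristicSolution (ε θ Np Nm p0 q0 : ℝ) (B : FluidMetric) (d : OutgoingData)
    (F : Fields) : Prop where
  pos : ∀ z ∈ domDbar p0 q0, 0 < F.fP z ∧ 0 < F.fM z ∧ 0 < F.Om z ∧ 0 < F.r z
  fP_C1 : ContDiffOn ℝ 1 F.fP (domDbar p0 q0)
  fM_C1 : ContDiffOn ℝ 1 F.fM (domDbar p0 q0)
  Om_C2 : ContDiffOn ℝ 2 F.Om (domDbar p0 q0)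
  r_C2 : ContDiffOn ℝ 2 F.r (domDbar p0 q0)
  fP_mem : MemW (domD p0 q0) 2 F.fP
  fM_mem : MemW (domD p0 q0) 2 F.fM
  Om_mem : MemW (domD p0 q0) 3 F.Om
  r_mem : MemW (domD p0 q0) 3 (fun z => F.r z / z.2)
  norm_lt_top : totalNorm θ Np Nm p0 q0 F < ⊤
  eqns : ∀ z ∈ domD p0 q0, EvolutionAt ε F z
  ingoing : ∀ p ∈ Icc p0 0,
    F.fP (p, q0) = (B.toFields ε).fP (p, q0) ∧ F.fM (p, q0) = (B.toFields ε).fM (p, q0) ∧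
      F.Om (p, q0) = B.Om (p, q0) ∧ F.r (p, q0) = B.r (p, q0)
  outgoing : ∀ q ∈ Ici q0,
    F.fP (p0, q) = d.fP q ∧ F.fM (p0, q) = d.fM q ∧ F.Om (p0, q) = d.Om q ∧ F.r (p0, q) = d.r q

/-- Asymptotic flatness: on each outgoing curve `p = const`, `p₀ ≤ p ≤ 0`, the Hawking mass has
a finite limit at infinity (one-sided `∂_p` at the two end points). -/
def AsymptoticallyFlat (p0 : ℝ) (F : Fields) : Prop :=
  ∀ p ∈ Icc p0 0, ∃ mInf : ℝ,
    Tendsto (fun q => massOf (F.r (p, q)) (derivWithin (fun s => F.r (s, q)) (Icc p0 0) p)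
      (dq F.r (p, q)) (F.Om (p, q))) atTop (𝓝 mInf)

end EinsteinEuler

end

open MeasureTheory Set Filter Topology
open scoped ENNReal NNReal ContDiff
open Real (abs_exp add_one_le_exp exp exp_add exp_le_exp exp_log exp_mul exp_nat_mul exp_neg
  exp_pos exp_sub exp_zero hasDerivAt_exp hasDerivAt_log log log_exp log_injOn_pos
  log_le_iff_le_exp log_le_log log_lt_log norm_eq_abs rpow_add rpow_def_of_pos rpow_pos_of_pos
  rpow_zero)
open Function (uncurry)

noncomputable section

namespace EinsteinEuler

theorem _root_.Convex.abs_image_sub_le {s : Set ℝ} (hs : Convex ℝ s) {f f' : ℝ → ℝ} {C x y : ℝ}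
    (hf : ∀ x ∈ s, HasDerivWithinAt f (f' x) s x) (hC : ∀ x ∈ s, |f' x| ≤ C) (hx : x ∈ s)
    (hy : y ∈ s) : |f y - f x| ≤ C * |y - x| :=
  hs.norm_image_sub_le_of_norm_hasDerivWithin_le hf hC hx hy

theorem abs_le_add {a b c B C : ℝ} (h : a = b + c) (hb : |b| ≤ B) (hc : |c| ≤ C) : |a| ≤ B + C :=
  h ▸ (abs_add_le b c).trans (add_le_add hb hc)

theorem abs_mul_le {a b A B : ℝ} (ha : |a| ≤ A) (hb : |b| ≤ B) : |a * b| ≤ A * B := by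
  rw [abs_mul]; exact mul_le_mul ha hb (abs_nonneg _) ((abs_nonneg _).trans ha)

/-! ### Functions with Lipschitz derivative, through the quadratic Taylor estimate -/

/-- `f` and `f'` are bounded by `K` on `J` and `f'` is a derivative of `f` with quadratic
remainder. -/
structure C11On (J : Set ℝ) (K : ℝ) (f f' : ℝ → ℝ) : Prop where
  bound : ∀ x ∈ J, |f x| ≤ K
  bound' : ∀ x ∈ J, |f' x| ≤ K
  taylor : ∀ x ∈ J, ∀ y ∈ J, |f y - f x - f' x * (y - x)| ≤ K * (y - x) ^ 2

namespace C11On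

variable {J J' : Set ℝ} {K L : ℝ} {f f' g g' : ℝ → ℝ}

theorem nonneg (h : C11On J K f f') {x : ℝ} (hx : x ∈ J) : 0 ≤ K :=
  (abs_nonneg _).trans (h.bound x hx)

theorem mono (h : C11On J K f f') (hKL : K ≤ L) : C11On J L f f' where
  bound x hx := (h.bound x hx).trans hKL
  bound' x hx := (h.bound' x hx).trans hKL
  taylor x hx y hy := (h.taylor x hx y hy).trans (by gcongr)

theorem mono_set (h : C11On J K f f') (hJ : J' ⊆ J) : C11On J' K f f' where
  bound x hx := h.bound x (hJ hx)
  bound' x hx := h.bound' x (hJ hx)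
  taylor x hx y hy := h.taylor x (hJ hx) y (hJ hy)

theorem congr (h : C11On J K f f') (hf : ∀ x ∈ J, g x = f x) (hf' : ∀ x ∈ J, g' x = f' x) :
    C11On J K g g' where
  bound x hx := by rw [hf x hx]; exact h.bound x hx
  bound' x hx := by rw [hf' x hx]; exact h.bound' x hx
  taylor x hx y hy := by rw [hf x hx, hf y hy, hf' x hx]; exact h.taylor x hx y hy

theorem lip_deriv (h : C11On J K f f') {x y : ℝ} (hx : x ∈ J) (hy : y ∈ J) :
    |f' y - f' x| ≤ 2 * K * |y - x| := by
  rcases eq_or_ne x y with rfl | hne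
  · simp
  have h1 := abs_le.1 (h.taylor x hx y hy)
  have h2 := abs_le.1 (h.taylor y hy x hx)
  have hpos : 0 < |y - x| := abs_pos.2 (sub_ne_zero.2 hne.symm)
  have h3 : |(f' y - f' x) * (y - x)| ≤ 2 * K * (y - x) ^ 2 := by
    rw [abs_le]; constructor <;> nlinarith
  rw [abs_mul, ← sq_abs (y - x)] at h3
  nlinarith

theorem lip (h : C11On J K f f') {x y : ℝ} (hx : x ∈ J) (hy : y ∈ J) :
    |f y - f x| ≤ 2 * K * |y - x| := by
  have hK := h.nonneg hx
  rcases le_total |y - x| 1 with h1 | h1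
  · refine (abs_le_add (by ring) (h.taylor x hx y hy) (abs_mul_le (h.bound' x hx)
      (le_refl |y - x|))).trans ?_
    rw [← sq_abs]
    nlinarith [mul_le_mul_of_nonneg_left h1 (mul_nonneg hK (abs_nonneg (y - x)))]
  · have h2 : |f y - f x| ≤ |f y| + |f x| := abs_sub _ _
    nlinarith [h.bound x hx, h.bound y hy]

theorem lip_add (h : C11On J K f f') {x k : ℝ} (hx : x ∈ J) (hy : x + k ∈ J) (hk : 0 ≤ k) :
    |f (x + k) - f x| ≤ 2 * K * k := by
  simpa [abs_of_nonneg hk] using h.lip hx hy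

theorem lip_deriv_add (h : C11On J K f f') {x k : ℝ} (hx : x ∈ J) (hy : x + k ∈ J) (hk : 0 ≤ k) :
    |f' (x + k) - f' x| ≤ 2 * K * k := by
  simpa [abs_of_nonneg hk] using h.lip_deriv hx hy

theorem continuousOn (h : C11On J K f f') : ContinuousOn f J := by
  rcases J.eq_empty_or_nonempty with rfl | ⟨x0, hx0⟩
  · simp
  have hK := h.nonneg hx0
  refine LipschitzOnWith.continuousOn (K := (2 * K).toNNReal) ?_
  refine LipschitzOnWith.of_dist_le_mul fun x hx y hy => ?_
  rw [Real.dist_eq, Real.dist_eq, Real.coe_toNNReal _ (by positivity)]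
  exact h.lip hy hx

theorem _root_.hasDerivWithinAt_of_quadratic {J : Set ℝ} {K a : ℝ} {f : ℝ → ℝ} {x : ℝ}
    (h : ∀ y ∈ J, |f y - f x - a * (y - x)| ≤ K * (y - x) ^ 2) : HasDerivWithinAt f a J x := by
  rw [hasDerivWithinAt_iff_isLittleO]
  refine (Asymptotics.IsBigO.of_bound K (g := fun y => ‖y - x‖ ^ 2) ?_).trans_isLittleO
    ((Asymptotics.isLittleO_pow_sub_sub x one_lt_two).mono nhdsWithin_le_nhds)
  filter_upwards [self_mem_nhdsWithin] with y hy
  simpa [mul_comm (y - x) a] using h y hy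

theorem hasDerivWithinAt (h : C11On J K f f') {x : ℝ} (hx : x ∈ J) :
    HasDerivWithinAt f (f' x) J x :=
  hasDerivWithinAt_of_quadratic fun y hy => h.taylor x hx y hy

theorem hasDerivAt (h : C11On J K f f') {x : ℝ} (hx : J ∈ 𝓝 x) : HasDerivAt f (f' x) x :=
  (h.hasDerivWithinAt (mem_of_mem_nhds hx)).hasDerivAt hx

/-- A bounded function with bounded Lipschitz derivative. -/
theorem of_hasDeriv (hJ : Convex ℝ J) (hd : ∀ x ∈ J, HasDerivWithinAt f (f' x) J x)
    (hb : ∀ x ∈ J, |f x| ≤ K) (hb' : ∀ x ∈ J, |f' x| ≤ K)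
    (hl : ∀ x ∈ J, ∀ y ∈ J, |f' y - f' x| ≤ K * |y - x|) : C11On J K f f' where
  bound := hb
  bound' := hb'
  taylor x hx y hy := by
    have hK : 0 ≤ K := (abs_nonneg _).trans (hb x hx)
    have hseg : uIcc x y ⊆ J := by
      rw [← segment_eq_uIcc]; exact hJ.segment_subset hx hy
    have h1 := (convex_uIcc x y).abs_image_sub_le
      (f := fun z => f z - f' x * z) (f' := fun z => f' z - f' x) (C := K * |y - x|)
      (x := x) (y := y) (fun z hz => (((hd z (hseg hz)).mono hseg).sub
        ((hasDerivWithinAt_id z _).const_mul (f' x))).congr_deriv (by simp))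
      (fun z hz => (hl x hx z (hseg hz)).trans (mul_le_mul_of_nonneg_left
        (abs_sub_left_of_mem_uIcc hz) hK)) left_mem_uIcc right_mem_uIcc
    calc |f y - f x - f' x * (y - x)| = |f y - f' x * y - (f x - f' x * x)| := by ring_nf
      _ ≤ K * |y - x| * |y - x| := h1
      _ = K * (y - x) ^ 2 := by rw [← sq_abs (y - x)]; ring

theorem of_hasDeriv_max {A B : ℝ} (hJ : Convex ℝ J) (hd : ∀ x ∈ J, HasDerivWithinAt f (f' x) J x)
    (hb : ∀ x ∈ J, |f x| ≤ A) (hb' : ∀ x ∈ J, |f' x| ≤ B)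
    (hl : ∀ x ∈ J, ∀ y ∈ J, |f' y - f' x| ≤ L * |y - x|) : C11On J (max A (max B L)) f f' :=
  of_hasDeriv hJ hd (fun x hx => (hb x hx).trans (le_max_left _ _))
    (fun x hx => (hb' x hx).trans ((le_max_left _ _).trans (le_max_right _ _)))
    fun x hx y hy => (hl x hx y hy).trans (by gcongr; exact (le_max_right _ _).trans (le_max_right _ _))

theorem const (c : ℝ) : C11On J |c| (fun _ => c) (fun _ => 0) where
  bound _ _ := le_rfl
  bound' _ _ := by simp
  taylor x _ y _ := by simp; positivity

theorem add (hf : C11On J K f f') (hg : C11On J L g g') :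
    C11On J (K + L) (fun x => f x + g x) (fun x => f' x + g' x) where
  bound x hx := (abs_add_le _ _).trans (add_le_add (hf.bound x hx) (hg.bound x hx))
  bound' x hx := (abs_add_le _ _).trans (add_le_add (hf.bound' x hx) (hg.bound' x hx))
  taylor x hx y hy := by
    exact (abs_le_add (by ring) (hf.taylor x hx y hy) (hg.taylor x hx y hy)).trans
      (le_of_eq (by ring))

theorem neg (hf : C11On J K f f') : C11On J K (fun x => -f x) (fun x => -f' x) where
  bound x hx := by rw [abs_neg]; exact hf.bound x hx
  bound' x hx := by rw [abs_neg]; exact hf.bound' x hx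
  taylor x hx y hy := by
    rw [show -f y - -f x - -f' x * (y - x) = -(f y - f x - f' x * (y - x)) by ring, abs_neg]
    exact hf.taylor x hx y hy

theorem sub (hf : C11On J K f f') (hg : C11On J L g g') :
    C11On J (K + L) (fun x => f x - g x) (fun x => f' x - g' x) := by
  simpa [sub_eq_add_neg] using hf.add hg.neg

theorem mul (hf : C11On J K f f') (hg : C11On J L g g') :
    C11On J (6 * K * L) (fun x => f x * g x) (fun x => f' x * g x + f x * g' x) where
  bound x hx := (abs_mul_le (hf.bound x hx) (hg.bound x hx)).trans (by
    nlinarith [mul_nonneg (hf.nonneg hx) (hg.nonneg hx)])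
  bound' x hx := (abs_le_add rfl (abs_mul_le (hf.bound' x hx) (hg.bound x hx))
    (abs_mul_le (hf.bound x hx) (hg.bound' x hx))).trans (by
    nlinarith [mul_nonneg (hf.nonneg hx) (hg.nonneg hx)])
  taylor x hx y hy := (abs_le_add (by ring) (abs_le_add rfl
    (abs_mul_le (hf.taylor x hx y hy) (hg.bound x hx)) (abs_mul_le (hf.bound x hx)
    (hg.taylor x hx y hy))) (abs_mul_le (hf.lip hx hy) (hg.lip hx hy))).trans
    (le_of_eq (by rw [← sq_abs]; ring))

theorem _root_.Real.abs_exp_sub_exp_le {a b K : ℝ} (ha : |a| ≤ K) (hb : |b| ≤ K) :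
    |exp b - exp a| ≤ exp K * |b - a| :=
  (convex_Icc (-K) K).abs_image_sub_le (fun x _ => (hasDerivAt_exp x).hasDerivWithinAt)
    (fun x hx => by rw [abs_exp]; exact Real.exp_le_exp.2 hx.2) (abs_le.1 ha) (abs_le.1 hb)

theorem _root_.Real.abs_exp_sub_sub_le {a b K : ℝ} (ha : |a| ≤ K) (hb : |b| ≤ K) :
    |exp b - exp a - exp a * (b - a)| ≤ exp K * (b - a) ^ 2 := by
  have hb1 : ∀ x ∈ Icc (-K) K, |exp x| ≤ exp K := fun x hx => by
    rw [abs_exp]; exact Real.exp_le_exp.2 hx.2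
  exact (of_hasDeriv (convex_Icc (-K) K) (fun x _ => (hasDerivAt_exp x).hasDerivWithinAt) hb1 hb1
    fun x hx y hy => Real.abs_exp_sub_exp_le (abs_le.2 hx) (abs_le.2 hy)).taylor a (abs_le.1 ha) b
    (abs_le.1 hb)

protected theorem exp (hf : C11On J K f f') :
    C11On J (exp K * (1 + K + 4 * K ^ 2)) (fun x => exp (f x)) (fun x => exp (f x) * f' x) := by
  have he : ∀ x ∈ J, |exp (f x)| ≤ exp K := fun x hx => by
    rw [abs_exp]; exact Real.exp_le_exp.2 ((le_abs_self _).trans (hf.bound x hx))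
  refine ⟨fun x hx => (he x hx).trans ?_, fun x hx => (abs_mul_le (he x hx) (hf.bound' x hx)).trans
    (mul_le_mul_of_nonneg_left ?_ (exp_pos K).le), fun x hx y hy => ?_⟩
  · have := hf.nonneg hx
    exact le_mul_of_one_le_right (exp_pos K).le (by nlinarith)
  · nlinarith
  · have h2 : (f y - f x) ^ 2 ≤ 4 * K ^ 2 * (y - x) ^ 2 := by
      rw [← sq_abs, ← sq_abs (y - x)]
      calc _ ≤ (2 * K * |y - x|) ^ 2 := by gcongr; exact hf.lip hx hy
        _ = _ := by ring
    refine (abs_le_add (by ring) (Real.abs_exp_sub_sub_le (hf.bound x hx) (hf.bound y hy))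
      (abs_mul_le (he x hx) (hf.taylor x hx y hy))).trans ?_
    nlinarith [mul_le_mul_of_nonneg_left h2 (exp_pos K).le, mul_nonneg (exp_pos K).le (sq_nonneg (y - x))]

/-- `e^{-a x}` with `a ≥ 0` on a half-line. -/
protected theorem exp_neg {a : ℝ} (ha : 0 ≤ a) (x0 : ℝ) :
    C11On (Ici x0) ((1 + a + a ^ 2) * exp (-(a * x0))) (fun x => exp (-(a * x)))
      (fun x => -a * exp (-(a * x))) := by
  have hle : ∀ x ∈ Ici x0, exp (-(a * x)) ≤ exp (-(a * x0)) := fun x hx => by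
    gcongr; exact hx
  have hp := exp_pos (-(a * x0))
  have hp1 := mul_nonneg ha hp.le
  have hp2 := mul_nonneg (sq_nonneg a) hp.le
  have hb : ∀ x ∈ Ici x0, |-a * exp (-(a * x))| ≤ a * exp (-(a * x0)) := fun x hx => by
    rw [abs_mul, abs_exp, abs_neg, abs_of_nonneg ha]
    exact mul_le_mul_of_nonneg_left (hle x hx) ha
  have hd1 : ∀ x, HasDerivAt (fun x => exp (-(a * x))) (-a * exp (-(a * x))) x :=
    fun x => by simpa [mul_comm] using ((hasDerivAt_id x).const_mul a).neg.exp
  refine of_hasDeriv (convex_Ici x0) (fun x _ => (hd1 x).hasDerivWithinAt) (fun x hx => ?_)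
    (fun x hx => (hb x hx).trans (by linarith)) fun x hx y hy =>
    ((convex_Ici x0).abs_image_sub_le (C := a * (a * exp (-(a * x0))))
      (fun z _ => ((hd1 z).const_mul (-a)).hasDerivWithinAt) (fun z hz =>
      abs_mul_le (by rw [abs_neg, abs_of_nonneg ha]) (hb z hz)) hx hy).trans
      (mul_le_mul_of_nonneg_right (by linarith) (abs_nonneg _))
  rw [abs_exp]; linarith [hle x hx]

/-- Two functions glued at a point where values and derivatives agree. -/
theorem glue {c : ℝ} (hf : C11On (J ∩ Iic c) K f f') (hg : C11On (J ∩ Ici c) K g g') (hc : c ∈ J)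
    (h0 : f c = g c) (h1 : f' c = g' c) :
    C11On J K (fun x => if x ≤ c then f x else g x) (fun x => if x ≤ c then f' x else g' x) where
  bound x hx := by
    split_ifs with h
    · exact hf.bound x ⟨hx, h⟩
    · exact hg.bound x ⟨hx, (not_le.1 h).le⟩
  bound' x hx := by
    split_ifs with h
    · exact hf.bound' x ⟨hx, h⟩
    · exact hg.bound' x ⟨hx, (not_le.1 h).le⟩
  taylor x hx y hy := by
    have hcf : c ∈ J ∩ Iic c := ⟨hc, le_refl c⟩
    have hcg : c ∈ J ∩ Ici c := ⟨hc, le_refl c⟩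
    have key : ∀ {J1 J2 : Set ℝ} {f f' g g' : ℝ → ℝ}, C11On J1 K f f' → C11On J2 K g g' →
        c ∈ J1 → c ∈ J2 → x ∈ J1 → y ∈ J2 → f c = g c → f' c = g' c → 0 ≤ (c - x) * (y - c) →
        |g y - f x - f' x * (y - x)| ≤ K * (y - x) ^ 2 := by
      intro J1 J2 f f' g g' hf hg c1 c2 hx hy h0 h1 hp
      refine (abs_le_add (b := g y - g c - g' c * (y - c) + (f c - f x - f' x * (c - x)))
        (c := (f' c - f' x) * (y - c)) (by rw [h0, h1]; ring) (abs_le_add rfl (hg.taylor c c2 y hy) (hf.taylor x hx c c1))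
        (abs_mul_le (hf.lip_deriv hx c1) (le_refl |y - c|))).trans_eq ?_
      rw [mul_assoc (2 * K), ← abs_mul, abs_of_nonneg hp]; ring
    split_ifs with hy1 hx1 hx1
    · exact hf.taylor x ⟨hx, hx1⟩ y ⟨hy, hy1⟩
    · have hx2 := (not_le.1 hx1).le
      exact key hg hf hcg hcf ⟨hx, hx2⟩ ⟨hy, hy1⟩ h0.symm h1.symm (by nlinarith)
    · have hy2 := (not_le.1 hy1).le
      exact key hf hg hcf hcg ⟨hx, hx1⟩ ⟨hy, hy2⟩ h0 h1 (by nlinarith)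
    · exact hg.taylor x ⟨hx, (not_le.1 hx1).le⟩ y ⟨hy, (not_le.1 hy1).le⟩

/-- Pointwise limits of functions with uniform bounds. -/
theorem of_tendsto {F F' : ℕ → ℝ → ℝ} (h : ∀ n, C11On J K (F n) (F' n))
    (hF : ∀ x ∈ J, Tendsto (fun n => F n x) atTop (𝓝 (f x)))
    (hF' : ∀ x ∈ J, Tendsto (fun n => F' n x) atTop (𝓝 (f' x))) : C11On J K f f' where
  bound x hx := le_of_tendsto (hF x hx).abs (Eventually.of_forall fun n => (h n).bound x hx)
  bound' x hx := le_of_tendsto (hF' x hx).abs (Eventually.of_forall fun n => (h n).bound' x hx)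
  taylor x hx y hy := le_of_tendsto
    ((((hF y hy).sub (hF x hx)).sub ((hF' x hx).mul_const (y - x))).abs)
    (Eventually.of_forall fun n => (h n).taylor x hx y hy)

/-- On a right half-line, the derivative is controlled by the size of the function. -/
theorem abs_deriv_le {x0 e : ℝ} (h : C11On (Ici x0) K f f') (he0 : 0 < e) (he : ∀ x ∈ Ici x0, |f x| ≤ e ^ 2)
    {x : ℝ} (hx : x ∈ Ici x0) : |f' x| ≤ (2 + K) * e := by
  have hy : x + e ∈ Ici x0 := by simp only [mem_Ici] at *; linarith
  have h1 := abs_le.1 (h.taylor x hx _ hy)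
  have h2 := abs_le.1 (he x hx)
  have h3 := abs_le.1 (he _ hy)
  have h4 : |f' x * e| ≤ (2 + K) * e * e := by
    rw [abs_le]; simp only [add_sub_cancel_left] at h1; constructor <;> nlinarith
  rw [abs_mul, abs_of_pos he0] at h4
  exact le_of_mul_le_mul_right h4 he0

end C11On

/-! ### Weighted integrals from the left end point -/

theorem weightedIntegral_abs_le {c a b C : ℝ}
    (hC : ∀ x, c ≤ x → exp (-(a * x)) * ∫ y in c..x, exp (b * y) ≤ C) {X : ℝ} (hX : c ≤ X)
    {f : ℝ → ℝ} {k : ℝ} (hk : 0 ≤ k) (hfk : ∀ y ∈ Icc c X, |f y| ≤ k) :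
    |exp (-(a * X)) * ∫ y in c..X, exp (b * y) * f y| ≤ C * k := by
  have h1 : |∫ y in c..X, exp (b * y) * f y| ≤ ∫ y in c..X, exp (b * y) * k := by
    rw [← norm_eq_abs]
    refine intervalIntegral.norm_integral_le_of_norm_le hX ?_ ?_
    · refine Eventually.of_forall fun y hy => ?_
      rw [norm_eq_abs, abs_mul, abs_exp]
      exact mul_le_mul_of_nonneg_left (hfk y ⟨hy.1.le, hy.2⟩) (exp_pos _).le
    · exact Continuous.intervalIntegrable (by fun_prop) _ _
  rw [intervalIntegral.integral_mul_const] at h1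
  rw [abs_mul, abs_exp]
  calc _ ≤ exp (-(a * X)) * ((∫ y in c..X, exp (b * y)) * k) :=
        mul_le_mul_of_nonneg_left h1 (exp_pos _).le
    _ = (exp (-(a * X)) * ∫ y in c..X, exp (b * y)) * k := by ring
    _ ≤ C * k := mul_le_mul_of_nonneg_right (hC X hX) hk

theorem hasDerivWithinAt_primitive {c : ℝ} {g : ℝ → ℝ} (hgc : ContinuousOn g (Ici c)) {x : ℝ}
    (hx : x ∈ Ici c) : HasDerivWithinAt (fun x => ∫ y in c..x, g y) (g x) (Ici c) x := by
  have hint : IntervalIntegrable g volume c x := ContinuousOn.intervalIntegrable (by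
    rw [uIcc_of_le hx]; exact hgc.mono Icc_subset_Ici_self)
  rcases eq_or_lt_of_le (mem_Ici.1 hx) with rfl | hlt
  · refine intervalIntegral.integral_hasDerivWithinAt_right hint (t := Ioi c) ?_ ?_
    · exact ⟨Ioi c, self_mem_nhdsWithin,
        (hgc.mono Ioi_subset_Ici_self).aestronglyMeasurable measurableSet_Ioi⟩
    · exact (hgc c self_mem_Ici).mono Ioi_subset_Ici_self
  · refine (intervalIntegral.integral_hasDerivAt_right hint ?_ ?_).hasDerivWithinAt
    · exact ⟨Ioi c, Ioi_mem_nhds hlt,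
        (hgc.mono Ioi_subset_Ici_self).aestronglyMeasurable measurableSet_Ioi⟩
    · exact hgc.continuousAt (Ici_mem_nhds hlt)

theorem hasDerivWithinAt_weightedIntegral {c : ℝ} (a b : ℝ) {f : ℝ → ℝ} (hf : ContinuousOn f (Ici c))
    {x : ℝ} (hx : x ∈ Ici c) :
    HasDerivWithinAt (fun x => exp (-(a * x)) * ∫ y in c..x, exp (b * y) * f y)
      (-a * (exp (-(a * x)) * ∫ y in c..x, exp (b * y) * f y) +
        exp (-((a - b) * x)) * f x) (Ici c) x := by
  have d1 : HasDerivAt (fun x => exp (-(a * x))) (-a * exp (-(a * x))) x := by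
    simpa [mul_comm] using ((hasDerivAt_id x).const_mul a).neg.exp
  have d2 := hasDerivWithinAt_primitive (g := fun y => exp (b * y) * f y)
    ((by fun_prop : Continuous fun y => exp (b * y)).continuousOn.mul hf) hx
  refine (d1.hasDerivWithinAt.mul d2).congr_deriv ?_
  have : exp (-((a - b) * x)) = exp (-(a * x)) * exp (b * x) := by
    rw [← exp_add]; ring_nf
  rw [this]; ring

/-! ### Causal operators on functions of one variable -/

variable {ι : Type*}

/-- A causal operator on families of functions on `[x0, ∞)`: it preserves continuity, is bounded
and Lipschitz on bounded families, and preserves boundedness of the function and Lipschitz bounds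
of its derivative. -/
structure Good (x0 : ℝ) (F : (ι → ℝ → ℝ) → ℝ → ℝ) : Prop where
  cont : ∀ X v, (∀ i, ContinuousOn (v i) (Icc x0 X)) → ContinuousOn (F v) (Icc x0 X)
  est : ∀ K, ∃ K', 0 ≤ K' ∧ ∀ X, x0 ≤ X → ∀ v w, (∀ i, ContinuousOn (v i) (Icc x0 X)) →
    (∀ i, ContinuousOn (w i) (Icc x0 X)) → (∀ i, ∀ y ∈ Icc x0 X, |v i y| ≤ K) →
    (∀ i, ∀ y ∈ Icc x0 X, |w i y| ≤ K) →
      |F v X| ≤ K' ∧ ∀ e, 0 ≤ e → (∀ i, ∀ y ∈ Icc x0 X, |v i y - w i y| ≤ e) →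
        |F v X - F w X| ≤ K' * e
  reg : ∀ K, ∃ K', ∀ v v' : ι → ℝ → ℝ, (∀ i, C11On (Ici x0) K (v i) (v' i)) →
    ∃ g', C11On (Ici x0) K' (F v) g'

namespace Good

variable {x0 : ℝ} {F G : (ι → ℝ → ℝ) → ℝ → ℝ}

theorem proj (i : ι) : Good x0 (fun v : ι → ℝ → ℝ => v i) where
  cont _ _ h := h i
  est K := ⟨max K 1, by positivity, fun X hX v w _ _ hv _ =>
    ⟨(hv i X ⟨hX, le_rfl⟩).trans (le_max_left _ _), fun e he h =>
      (h i X ⟨hX, le_rfl⟩).trans (by nlinarith [le_max_right K 1])⟩⟩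
  reg K := ⟨K, fun _ v' h => ⟨v' i, h i⟩⟩

theorem of_fun {g g' : ℝ → ℝ} {C : ℝ} (hg : C11On (Ici x0) C g g') :
    Good x0 (fun _ : ι → ℝ → ℝ => g) where
  cont _ _ _ := hg.continuousOn.mono Icc_subset_Ici_self
  est _ := ⟨C, hg.nonneg self_mem_Ici, fun X hX _ _ _ _ _ _ => ⟨hg.bound X hX, fun e he _ => by
    rw [sub_self, abs_zero]; exact mul_nonneg (hg.nonneg (x := X) hX) he⟩⟩
  reg _ := ⟨C, fun _ _ _ => ⟨g', hg⟩⟩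

theorem const (c : ℝ) : Good x0 (fun _ : ι → ℝ → ℝ => fun _ => c) := of_fun (C11On.const c)

theorem add (hF : Good x0 F) (hG : Good x0 G) : Good x0 (fun v x => F v x + G v x) where
  cont X v h := (hF.cont X v h).add (hG.cont X v h)
  est K := by
    obtain ⟨K1, p1, h1⟩ := hF.est K
    obtain ⟨K2, p2, h2⟩ := hG.est K
    refine ⟨K1 + K2, by positivity, fun X hX v w hv hw bv bw => ?_⟩
    obtain ⟨a1, b1⟩ := h1 X hX v w hv hw bv bw
    obtain ⟨a2, b2⟩ := h2 X hX v w hv hw bv bw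
    exact ⟨abs_le_add rfl a1 a2, fun e he h =>
      (abs_le_add (by ring) (b1 e he h) (b2 e he h)).trans (le_of_eq (by ring))⟩
  reg K := by
    obtain ⟨K1, h1⟩ := hF.reg K
    obtain ⟨K2, h2⟩ := hG.reg K
    refine ⟨K1 + K2, fun v v' h => ?_⟩
    obtain ⟨g1, a1⟩ := h1 v v' h
    obtain ⟨g2, a2⟩ := h2 v v' h
    exact ⟨_, a1.add a2⟩

theorem mul (hF : Good x0 F) (hG : Good x0 G) : Good x0 (fun v x => F v x * G v x) where
  cont X v h := (hF.cont X v h).mul (hG.cont X v h)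
  est K := by
    obtain ⟨K1, p1, h1⟩ := hF.est K
    obtain ⟨K2, p2, h2⟩ := hG.est K
    refine ⟨K1 * K2 + K1 * K2, by positivity, fun X hX v w hv hw bv bw => ?_⟩
    obtain ⟨a1, b1⟩ := h1 X hX v w hv hw bv bw
    obtain ⟨a2, b2⟩ := h2 X hX v w hv hw bv bw
    exact ⟨(abs_mul_le a1 a2).trans (by linarith [mul_nonneg p1 p2]), fun e he h =>
      (abs_le_add (by ring) (abs_mul_le (b1 e he h) (h2 X hX w v hw hv bw bv).1)
        (abs_mul_le a1 (b2 e he h))).trans (le_of_eq (by ring))⟩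
  reg K := by
    obtain ⟨K1, h1⟩ := hF.reg K
    obtain ⟨K2, h2⟩ := hG.reg K
    refine ⟨6 * K1 * K2, fun v v' h => ?_⟩
    obtain ⟨g1, a1⟩ := h1 v v' h
    obtain ⟨g2, a2⟩ := h2 v v' h
    exact ⟨_, a1.mul a2⟩

protected theorem exp (hF : Good x0 F) : Good x0 (fun v x => exp (F v x)) where
  cont X v h := (hF.cont X v h).rexp
  est K := by
    obtain ⟨K1, p1, h1⟩ := hF.est K
    refine ⟨exp K1 + exp K1 * K1, by positivity, fun X hX v w hv hw bv bw => ?_⟩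
    obtain ⟨a1, b1⟩ := h1 X hX v w hv hw bv bw
    have hp := exp_pos K1
    refine ⟨?_, fun e he h => (Real.abs_exp_sub_exp_le (h1 X hX w v hw hv bw bv).1 a1).trans ?_⟩
    · rw [abs_exp]
      linarith [Real.exp_le_exp.2 ((le_abs_self _).trans a1), mul_nonneg hp.le p1]
    · nlinarith [mul_le_mul_of_nonneg_left (b1 e he h) hp.le, mul_nonneg hp.le he]
  reg K := by
    obtain ⟨K1, h1⟩ := hF.reg K
    refine ⟨exp K1 * (1 + K1 + 4 * K1 ^ 2), fun v v' h => ?_⟩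
    obtain ⟨g1, a1⟩ := h1 v v' h
    exact ⟨_, a1.exp⟩

/-- Weighted integrals from the left end point. -/
theorem integral (hF : Good x0 F) {a b C : ℝ} (ha : 0 ≤ a) (hba : b ≤ a)
    (hC : ∀ x, x0 ≤ x → exp (-(a * x)) * ∫ y in x0..x, exp (b * y) ≤ C) :
    Good x0 (fun v x => exp (-(a * x)) * ∫ y in x0..x, exp (b * y) * F v y) := by
  have hcont : ∀ X v, (∀ i, ContinuousOn (v i) (Icc x0 X)) →
      ContinuousOn (fun y => exp (b * y) * F v y) (Icc x0 X) := fun X v h =>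
    ContinuousOn.mul (by fun_prop) (hF.cont X v h)
  have hC0 : 0 ≤ C := by simpa using hC x0 le_rfl
  refine ⟨fun X v h => ContinuousOn.mul (by fun_prop) ?_, fun K => ?_, fun K => ?_⟩
  · rcases le_or_gt x0 X with hX | hX
    · have h1 := intervalIntegral.continuousOn_primitive_interval
        (f := fun y => exp (b * y) * F v y) (a := x0) (b := X) (μ := volume)
        (by rw [uIcc_of_le hX]; exact (hcont X v h).integrableOn_Icc)
      rwa [uIcc_of_le hX] at h1
    · simp [Icc_eq_empty_of_lt hX]
  · obtain ⟨K1, p1, h1⟩ := hF.est K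
    refine ⟨C * K1, by positivity, fun X hX v w hv hw bv bw => ?_⟩
    have hsub : ∀ y ∈ Icc x0 X, Icc x0 y ⊆ Icc x0 X := fun y hy => Icc_subset_Icc_right hy.2
    have key : ∀ y ∈ Icc x0 X, _ := fun y hy => h1 y hy.1 v w
      (fun i => (hv i).mono (hsub y hy)) (fun i => (hw i).mono (hsub y hy))
      (fun i z hz => bv i z (hsub y hy hz)) (fun i z hz => bw i z (hsub y hy hz))
    have hint : ∀ v, (∀ i, ContinuousOn (v i) (Icc x0 X)) →
        IntervalIntegrable (fun y => exp (b * y) * F v y) volume x0 X := fun v hv =>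
      ContinuousOn.intervalIntegrable (by rw [uIcc_of_le hX]; exact hcont X v hv)
    refine ⟨weightedIntegral_abs_le hC hX p1 fun y hy => (key y hy).1, fun e he h => ?_⟩
    rw [← mul_sub, ← intervalIntegral.integral_sub (hint v hv) (hint w hw), mul_assoc]
    simp only [← mul_sub]
    exact weightedIntegral_abs_le hC hX (by positivity) fun y hy =>
      (key y hy).2 e he fun i z hz => h i z (hsub y hy hz)
  · obtain ⟨K1, h1⟩ := hF.reg K
    set A := C * |K1|
    set P := 6 * ((1 + (a - b) + (a - b) ^ 2) * exp (-((a - b) * x0))) * |K1|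
    refine ⟨max A (max (a * A + P) (a * (a * A + P) + 2 * P)), fun v v' h => ?_⟩
    obtain ⟨f', hf⟩ := h1 v v' h
    replace hf := hf.mono (le_abs_self K1)
    have hprod := (C11On.exp_neg (sub_nonneg.2 hba) x0).mul hf
    have hn : |-a| ≤ a := by rw [abs_neg, abs_of_nonneg ha]
    have hd : ∀ x ∈ Ici x0, _ := fun x hx =>
      hasDerivWithinAt_weightedIntegral a b hf.continuousOn hx
    have hI : ∀ x ∈ Ici x0, |exp (-(a * x)) * ∫ y in x0..x, exp (b * y) * F v y| ≤ A := fun x hx =>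
      weightedIntegral_abs_le hC hx (abs_nonneg _) fun y hy => hf.bound y hy.1
    have hd1 : ∀ x ∈ Ici x0, |_| ≤ a * A + P := fun x hx =>
      abs_le_add rfl (abs_mul_le hn (hI x hx)) (hprod.bound x hx)
    exact ⟨_, C11On.of_hasDeriv_max (convex_Ici x0) hd hI hd1 fun x hx y hy =>
      (abs_le_add (by ring) (abs_mul_le hn ((convex_Ici x0).abs_image_sub_le hd hd1 hx hy))
        (hprod.lip hx hy)).trans (le_of_eq (by ring))⟩

end Good

/-! ### The linear transport equation on the line -/

theorem abs_le_of_abs_deriv_le {T k κ : ℝ} {D D' : ℝ → ℝ}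
    (hD : ∀ r ∈ Icc 0 T, HasDerivWithinAt D (D' r) (Icc 0 T) r) (hk : 0 ≤ k) (hκ : 0 ≤ κ)
    (h : ∀ r ∈ Icc 0 T, |D' r| ≤ k * |D r| + κ) {r t : ℝ} (hr : r ∈ Icc 0 T) (ht : t ∈ Icc 0 T) :
    |D r| ≤ exp ((k + 1) * T) * (|D t| + κ) := by
  have fwd : ∀ {D D' : ℝ → ℝ} {t r : ℝ},
      (∀ r ∈ Icc 0 T, HasDerivWithinAt D (D' r) (Icc 0 T) r) →
      (∀ r ∈ Icc 0 T, |D' r| ≤ k * |D r| + κ) → t ∈ Icc 0 T → r ∈ Icc 0 T → t ≤ r →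
      |D r| ≤ exp ((k + 1) * T) * (|D t| + κ) := by
    intro D D' t r hD h ht hr htr
    have hs : Icc t r ⊆ Icc 0 T := Icc_subset_Icc ht.1 hr.2
    have := norm_le_gronwallBound_of_norm_deriv_right_le (δ := |D t|) (ε := κ) (K := k + 1)
      (fun s h1 => (hD s (hs h1)).continuousWithinAt.mono hs) (fun s h1 =>
      (hD s (hs (Ico_subset_Icc_self h1))).mono_of_mem_nhdsWithin (Icc_mem_nhdsGE_of_mem
      ⟨ht.1.trans h1.1, h1.2.trans_le hr.2⟩)) le_rfl (fun s h1 => (h s (hs (Ico_subset_Icc_self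
      h1))).trans (by gcongr; · simp
                      · rfl)) r ⟨htr, le_rfl⟩
    rw [gronwallBound_of_K_ne_0 (by positivity)] at this
    have h2 : exp ((k + 1) * (r - t)) ≤ exp ((k + 1) * T) := by gcongr; linarith [ht.1, hr.2]
    have h3 : κ / (k + 1) ≤ κ := div_le_self hκ (by linarith)
    have h4 : 1 ≤ exp ((k + 1) * (r - t)) :=
      Real.one_le_exp (mul_nonneg (by positivity) (sub_nonneg.2 htr))
    refine this.trans ?_
    nlinarith [mul_le_mul_of_nonneg_left h2 (abs_nonneg (D t)),
      mul_le_mul h3 (sub_le_sub_right h2 1) (by linarith) hκ]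
  rcases le_total t r with htr | htr
  · exact fwd hD h ht hr htr
  have hm : ∀ {s}, s ∈ Icc 0 T → T - s ∈ Icc 0 T := fun hs =>
    ⟨by linarith [hs.2], by linarith [hs.1]⟩
  simpa using fwd (D := fun s => D (T - s)) (D' := fun s => D' (T - s) * -1) (fun s hs =>
    (hD _ (hm hs)).comp s ((hasDerivWithinAt_id s _).const_sub T) fun x hx => hm hx)
    (fun s hs => by simpa using h _ (hm hs)) (hm ht) (hm hr) (by linarith)

/-- Joint continuity of the derivative of a jointly continuous family. -/
theorem continuousOn_deriv_of_c11 {α : Type*} [TopologicalSpace α] {S : Set α} {J : Set ℝ} {K : ℝ}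
    {f f' : α → ℝ → ℝ} (hJ : IsUpperSet J) (hf : ∀ t ∈ S, C11On J K (f t) (f' t))
    (hc : ContinuousOn (uncurry f) (S ×ˢ J)) :
    ContinuousOn (uncurry f') (S ×ˢ J) := by
  have hm : ∀ {d x : ℝ}, 0 < d → x ∈ J → x + d ∈ J := fun hd => hJ (by linarith)
  refine TendstoUniformlyOn.continuousOn (p := 𝓝[>] 0)
    (F := fun (d : ℝ) (z : α × ℝ) => (f z.1 (z.2 + d) - f z.1 z.2) / d)
    (Metric.tendstoUniformlyOn_iff.2 fun ε hε => ?_) (Eventually.frequently ?_)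
  · filter_upwards [Ioo_mem_nhdsGT (show 0 < ε / (|K| + 1) by positivity)] with d hd z hz
    have h1 := (hf z.1 hz.1).taylor _ hz.2 _ (hm hd.1 hz.2)
    have h2 := (lt_div_iff₀ (by positivity)).1 hd.2
    rw [add_sub_cancel_left] at h1
    have hd1 : d ≠ 0 := hd.1.ne'
    rw [dist_comm, Real.dist_eq, show (f z.1 (z.2 + d) - f z.1 z.2) / d - uncurry f' z =
      (f z.1 (z.2 + d) - f z.1 z.2 - f' z.1 z.2 * d) / d by simp only [uncurry]; field_simp,
      abs_div, abs_of_pos hd.1, div_lt_iff₀ hd.1]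
    nlinarith [hd.1, le_abs_self K]
  · filter_upwards [self_mem_nhdsWithin] with d hd
    exact ((hc.comp (f := fun z : α × ℝ => (z.1, z.2 + d)) (by fun_prop) fun z hz =>
      ⟨hz.1, hm hd hz.2⟩).sub hc).div_const d

theorem hasDerivWithinAt_integral_Icc {T : ℝ} {a : ℝ → ℝ} (ha : ContinuousOn a (Icc 0 T)) {t r : ℝ}
    (ht : t ∈ Icc 0 T) (hr : r ∈ Icc 0 T) :
    HasDerivWithinAt (fun r => ∫ ρ in t..r, a ρ) (a r) (Icc 0 T) r := by
  have hT : (0 : ℝ) ≤ T := ht.1.trans ht.2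
  have hc : Continuous (IccExtend hT ((Icc 0 T).domRestrict a)) :=
    (continuousOn_iff_continuous_domRestrict.1 ha).Icc_extend'
  have h1 := (hc.integral_hasStrictDerivAt t r).hasDerivAt.hasDerivWithinAt (s := Icc 0 T)
  rw [IccExtend_of_mem hT _ hr] at h1
  have h2 : ∀ s ∈ Icc 0 T, ∫ ρ in t..s, a ρ =
      ∫ ρ in t..s, IccExtend hT ((Icc 0 T).domRestrict a) ρ := fun s hs =>
    intervalIntegral.integral_congr fun ρ hρ => by
      rw [IccExtend_of_mem hT _ (ordConnected_Icc.uIcc_subset ht hs hρ)]; rfl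
  exact h1.congr h2 (h2 r hr)

section Flow

variable {T K : ℝ} {c c' : ℝ → ℝ → ℝ}

theorem exists_characteristic (hc : ∀ t ∈ Icc 0 T, C11On univ K (c t) (c' t))
    (hcc : ContinuousOn (uncurry c) (Icc 0 T ×ˢ univ)) {t : ℝ} (ht : t ∈ Icc 0 T) (x : ℝ) :
    ∃ y : ℝ → ℝ, y t = x ∧ ∀ r ∈ Icc 0 T, HasDerivWithinAt y (c r (y r)) (Icc 0 T) r := by
  have hT : 0 ≤ T := ht.1.trans ht.2
  have hK : 0 ≤ K := (hc t ht).nonneg (mem_univ 0)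
  have hpl : IsPicardLindelof c (tmin := 0) (tmax := T) ⟨t, ht⟩ x (K * T).toNNReal 0
      K.toNNReal (2 * K).toNNReal := by
    refine ⟨fun s hs => ?_, fun y _ => ?_, fun s hs y _ => ?_, ?_⟩
    · refine LipschitzOnWith.of_dist_le_mul fun y _ z _ => ?_
      rw [Real.dist_eq, Real.dist_eq, Real.coe_toNNReal _ (by positivity)]
      exact (hc s hs).lip (mem_univ _) (mem_univ _)
    · exact hcc.comp (by fun_prop : Continuous fun s : ℝ => (s, y)).continuousOn
        fun s hs => ⟨hs, mem_univ _⟩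
    · rw [norm_eq_abs, Real.coe_toNNReal _ hK]; exact (hc s hs).bound y (mem_univ _)
    · rw [Real.coe_toNNReal _ hK, Real.coe_toNNReal _ (by positivity)]
      simp only [NNReal.coe_zero, sub_zero]
      gcongr
      exact max_le (by linarith [ht.1]) (by linarith [ht.2])
  exact hpl.exists_eq_forall_mem_Icc_hasDerivWithinAt₀

theorem characteristic_dist_le (hc : ∀ t ∈ Icc 0 T, C11On univ K (c t) (c' t)) {y z : ℝ → ℝ}
    (hy : ∀ r ∈ Icc 0 T, HasDerivWithinAt y (c r (y r)) (Icc 0 T) r)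
    (hz : ∀ r ∈ Icc 0 T, HasDerivWithinAt z (c r (z r)) (Icc 0 T) r) {r t : ℝ} (hr : r ∈ Icc 0 T)
    (ht : t ∈ Icc 0 T) : |z r - y r| ≤ exp ((2 * K + 1) * T) * |z t - y t| := by
  simpa using abs_le_of_abs_deriv_le (fun s hs => (hz s hs).sub (hy s hs)) (κ := 0)
    (mul_nonneg zero_le_two ((hc t ht).nonneg (mem_univ 0))) le_rfl
    (fun s hs => by simpa using (hc s hs).lip (mem_univ (y s)) (mem_univ (z s))) hr ht

/-- The derivative of the flow along the characteristic `y` through time `t`. -/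
def flowDeriv (c' : ℝ → ℝ → ℝ) (y : ℝ → ℝ) (t r : ℝ) : ℝ := exp (∫ ρ in t..r, c' ρ (y ρ))

theorem flowDeriv_spec (hc : ∀ t ∈ Icc 0 T, C11On univ K (c t) (c' t))
    (hcc : ContinuousOn (uncurry c) (Icc 0 T ×ˢ univ)) {y : ℝ → ℝ}
    (hy : ContinuousOn y (Icc 0 T)) {t : ℝ} (ht : t ∈ Icc 0 T) :
    (∀ r ∈ Icc 0 T, HasDerivWithinAt (flowDeriv c' y t) (flowDeriv c' y t r * c' r (y r))
      (Icc 0 T) r) ∧ ∀ r ∈ Icc 0 T, |flowDeriv c' y t r| ≤ exp ((K + 1) * T) := by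
  have h2 : ∀ r ∈ Icc 0 T, HasDerivWithinAt (flowDeriv c' y t) (flowDeriv c' y t r * c' r (y r))
      (Icc 0 T) r := fun r hr => (hasDerivWithinAt_integral_Icc
    ((continuousOn_deriv_of_c11 isUpperSet_univ hc hcc).comp (continuousOn_id.prodMk hy)
      fun s hs => ⟨hs, mem_univ _⟩) ht hr).exp
  refine ⟨h2, fun r hr => ?_⟩
  simpa [flowDeriv] using abs_le_of_abs_deriv_le (k := K) (κ := 0) h2
    ((hc t ht).nonneg (mem_univ 0)) le_rfl (fun s hs => by
    rw [mul_comm, add_zero]; exact abs_mul_le ((hc s hs).bound' _ (mem_univ _)) le_rfl) hr ht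

theorem flow_taylor (hc : ∀ t ∈ Icc 0 T, C11On univ K (c t) (c' t))
    (hcc : ContinuousOn (uncurry c) (Icc 0 T ×ˢ univ)) {y z : ℝ → ℝ}
    (hy : ∀ r ∈ Icc 0 T, HasDerivWithinAt y (c r (y r)) (Icc 0 T) r)
    (hz : ∀ r ∈ Icc 0 T, HasDerivWithinAt z (c r (z r)) (Icc 0 T) r) {r t : ℝ} (hr : r ∈ Icc 0 T)
    (ht : t ∈ Icc 0 T) :
    |z r - y r - flowDeriv c' y t r * (z t - y t)| ≤
      exp ((K + 1) * T) * (K * (exp ((2 * K + 1) * T) * |z t - y t|) ^ 2) := by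
  have hK : 0 ≤ K := (hc t ht).nonneg (mem_univ 0)
  have hJ := (flowDeriv_spec hc hcc (fun s hs => (hy s hs).continuousWithinAt) ht).1
  have := abs_le_of_abs_deriv_le (D := fun s => z s - y s - flowDeriv c' y t s * (z t - y t))
    (κ := K * (exp ((2 * K + 1) * T) * |z t - y t|) ^ 2)
    (fun s hs => ((hz s hs).sub (hy s hs)).sub ((hJ s hs).mul_const _)) hK (by positivity)
    (fun s hs => by
      rw [add_comm]
      refine abs_le_add (b := c s (z s) - c s (y s) - c' s (y s) * (z s - y s))
        (c := c' s (y s) * (z s - y s - flowDeriv c' y t s * (z t - y t))) (by ring)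
        (((hc s hs).taylor _ (mem_univ _) _ (mem_univ _)).trans ?_)
        (abs_mul_le ((hc s hs).bound' _ (mem_univ _)) le_rfl)
      rw [← sq_abs (z s - y s)]
      gcongr; exact characteristic_dist_le hc hy hz hs ht) hr ht
  simpa [flowDeriv] using this

end Flow

theorem intervalIntegral_abs_le {T C : ℝ} {f : ℝ → ℝ} (hf : ∀ r ∈ Icc 0 T, |f r| ≤ C) {t t' : ℝ}
    (ht : t ∈ Icc 0 T) (ht' : t' ∈ Icc 0 T) : |∫ r in t..t', f r| ≤ C * |t' - t| := by
  rw [← norm_eq_abs]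
  exact intervalIntegral.norm_integral_le_of_norm_le_const fun r hr =>
    hf r (ordConnected_Icc.uIcc_subset ht ht' (uIoc_subset_uIcc hr))

/-- The Cauchy problem for the linear transport equation `∂_t w + c ∂_x w = s` on the line. -/
theorem exists_linear_transport {T K : ℝ} (hT : 0 ≤ T) {c c' s s' : ℝ → ℝ → ℝ} {w0 w0' : ℝ → ℝ}
    (hc : ∀ t ∈ Icc 0 T, C11On univ K (c t) (c' t))
    (hcc : ContinuousOn (uncurry c) (Icc 0 T ×ˢ univ))
    (hs : ∀ t ∈ Icc 0 T, C11On univ K (s t) (s' t))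
    (hsc : ContinuousOn (uncurry s) (Icc 0 T ×ˢ univ))
    (hw0 : C11On univ K w0 w0') :
    ∃ (w w' : ℝ → ℝ → ℝ) (L : ℝ), (∀ t ∈ Icc 0 T, C11On univ L (w t) (w' t)) ∧
      ContinuousOn (uncurry w) (Icc 0 T ×ˢ univ) ∧ (∀ x, w 0 x = w0 x) ∧
      ∀ t ∈ Icc 0 T, ∀ x, HasDerivWithinAt (fun τ => w τ x) (s t x - c t x * w' t x)
        (Icc 0 T) t := by
  have h0 : (0 : ℝ) ∈ Icc 0 T := ⟨le_rfl, hT⟩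
  have hK : 0 ≤ K := hw0.nonneg (mem_univ 0)
  have hu := fun x : ℝ => mem_univ x
  choose! X hXt hXd using fun t (ht : t ∈ Icc 0 T) => exists_characteristic hc hcc ht
  have hXc : ∀ t ∈ Icc 0 T, ∀ x, ContinuousOn (X t x) (Icc 0 T) := fun t ht x r hr =>
    (hXd t ht x r hr).continuousWithinAt
  set J : ℝ → ℝ → ℝ → ℝ := fun t x r => flowDeriv c' (X t x) t r
  set w : ℝ → ℝ → ℝ := fun t x => w0 (X t x 0) + ∫ r in (0 : ℝ)..t, s r (X t x r) with hw
  set w' : ℝ → ℝ → ℝ := fun t x => w0' (X t x 0) * J t x 0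
    + ∫ r in (0 : ℝ)..t, s' r (X t x r) * J t x r with hw'
  have hcX : ∀ {s : ℝ → ℝ → ℝ}, ContinuousOn (uncurry s) (Icc 0 T ×ˢ univ) → ∀ t ∈ Icc 0 T, ∀ x,
      ContinuousOn (fun r => s r (X t x r)) (Icc 0 T) :=
    fun hs t ht x => hs.comp (continuousOn_id.prodMk (hXc t ht x)) fun r hr => ⟨hr, hu _⟩
  have hsX := hcX hsc
  have hs'X := hcX (continuousOn_deriv_of_c11 isUpperSet_univ hs hsc)
  have hint : ∀ {f : ℝ → ℝ}, ContinuousOn f (Icc 0 T) → ∀ {a b : ℝ}, a ∈ Icc 0 T → b ∈ Icc 0 T →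
      IntervalIntegrable f volume a b := fun hf a b ha hb =>
    (hf.mono (ordConnected_Icc.uIcc_subset ha hb)).intervalIntegrable
  set E := exp ((2 * K + 1) * T)
  set E1 := exp ((K + 1) * T)
  set C := K * E ^ 2 + K * (E1 * (K * E ^ 2)) with hC
  have hC0 : 0 ≤ C := by positivity
  have hKE : 0 ≤ K * E1 := by positivity
  -- Taylor estimate for the composition with the flow
  have hcomp : ∀ t ∈ Icc 0 T, ∀ x z, ∀ r ∈ Icc 0 T, ∀ f f' : ℝ → ℝ, C11On univ K f f' →
      |f (X t z r) - f (X t x r) - f' (X t x r) * J t x r * (z - x)| ≤ C * (z - x) ^ 2 := by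
    intro t ht x z r hr f f' hf
    have a2 := characteristic_dist_le hc (hXd t ht x) (hXd t ht z) hr ht
    have a3 := flow_taylor hc hcc (hXd t ht x) (hXd t ht z) hr ht
    rw [hXt t ht, hXt t ht] at a2 a3
    refine (abs_le_add (by ring) ((hf.taylor _ (hu _) _ (hu _)).trans (mul_le_mul_of_nonneg_left
      (sq_le_sq' (abs_le.1 a2).1 (abs_le.1 a2).2) hK)) (abs_mul_le (hf.bound' _ (hu _))
      a3)).trans_eq ?_
    rw [mul_pow, sq_abs, hC]; ring
  set S := K + K * E1 + C
  set L := S + S * T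
  have hI : ∀ t ∈ Icc 0 T, ∀ {a B m : ℝ} {f : ℝ → ℝ}, 0 ≤ m → 0 ≤ B → B ≤ S → |a| ≤ B * m →
      (∀ r ∈ Icc 0 T, |f r| ≤ B * m) → |a + ∫ r in (0 : ℝ)..t, f r| ≤ L * m := by
    intro t ht a B m f hm hB0 hB ha hf
    refine (abs_le_add rfl ha (intervalIntegral_abs_le hf h0 ht)).trans ?_
    rw [sub_zero, abs_of_nonneg ht.1]
    calc _ = (B + B * t) * m := by ring
      _ ≤ (S + S * T) * m := by gcongr; exacts [ht.1, ht.2]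
  have hreg : ∀ t ∈ Icc 0 T, C11On univ L (w t) (w' t) := by
    refine fun t ht => ⟨fun x _ => ?_, fun x _ => ?_, fun x _ z _ => ?_⟩
    · simpa using hI t ht (B := K) zero_le_one hK (by linarith) (by simpa using hw0.bound _ (hu _))
        fun r hr => by simpa using (hs r hr).bound (X t x r) (hu _)
    · have hJb := (flowDeriv_spec hc hcc (hXc t ht x) ht).2
      simpa using hI t ht zero_le_one hKE (by linarith)
        (by simpa using abs_mul_le (hw0.bound' (X t x 0) (hu _)) (hJb 0 h0))
        fun r hr => by simpa using abs_mul_le ((hs r hr).bound' (X t x r) (hu _)) (hJb r hr)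
    · have hJc : ContinuousOn (J t x) (Icc 0 T) := fun r hr =>
        ((flowDeriv_spec hc hcc (hXc t ht x) ht).1 r hr).continuousWithinAt
      convert hI t ht (sq_nonneg (z - x)) hC0 (by linarith) (hcomp t ht x z 0 h0 w0 w0' hw0)
        fun r hr => hcomp t ht x z r hr _ _ (hs r hr) using 2
      rw [intervalIntegral.integral_sub, intervalIntegral.integral_sub,
        intervalIntegral.integral_mul_const]
      · simp only [hw, hw']; ring
      · exact hint (hsX t ht z) h0 ht
      · exact hint (hsX t ht x) h0 ht
      · exact hint ((hsX t ht z).sub (hsX t ht x)) h0 ht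
      · exact hint (((hs'X t ht x).mul hJc).mul continuousOn_const) h0 ht
  have hL0 : 0 ≤ L := (hreg 0 h0).nonneg (hu 0)
  -- the solution along a characteristic
  have hflow : ∀ t ∈ Icc 0 T, ∀ x, ∀ τ ∈ Icc 0 T,
      w τ (X t x τ) = w t x + ∫ r in t..τ, s r (X t x r) := by
    intro t ht x τ hτ
    have huniq : ∀ r ∈ Icc 0 T, X τ (X t x τ) r = X t x r := fun r hr => by
      have := characteristic_dist_le hc (hXd t ht x) (hXd τ hτ (X t x τ)) hr hτ
      rw [hXt τ hτ, sub_self, abs_zero, mul_zero] at this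
      exact sub_eq_zero.1 (abs_nonpos_iff.1 this)
    simp only [hw]
    rw [intervalIntegral.integral_congr (g := fun r => s r (X t x r)) fun r hr => by
      simp only [huniq r (ordConnected_Icc.uIcc_subset h0 hτ hr)], huniq 0 h0, add_assoc,
      intervalIntegral.integral_add_adjacent_intervals
      (hint (hsX t ht x) h0 ht) (hint (hsX t ht x) ht hτ)]
  have hXlip : ∀ t ∈ Icc 0 T, ∀ x, ∀ τ ∈ Icc 0 T, |X t x τ - x| ≤ K * |τ - t| := fun t ht x τ hτ => by
    simpa [hXt t ht] using (convex_Icc 0 T).abs_image_sub_le (hXd t ht x)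
      (fun r hr => (hc r hr).bound _ (hu _)) ht hτ
  have hwt : ∀ x, ∀ t ∈ Icc 0 T, ∀ τ ∈ Icc 0 T, |w τ x - w t x| ≤ (2 * L * K + K) * |τ - t| := by
    intro x t ht τ hτ
    have b1 := (hreg τ hτ).lip (hu (X t x τ)) (hu x)
    rw [abs_sub_comm x] at b1
    refine (abs_le_add (by rw [hflow t ht x τ hτ]; ring) (b1.trans (mul_le_mul_of_nonneg_left
      (hXlip t ht x τ hτ) (by positivity))) (intervalIntegral_abs_le (C := K)
      (f := fun r => s r (X t x r)) (fun r hr => (hs r hr).bound _ (hu _)) ht hτ)).trans_eq (by ring)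
  have hwc : ContinuousOn (uncurry w) (Icc 0 T ×ˢ univ) :=
    continuousOn_prod_of_continuousOn_lipschitzOnWith _ (2 * L * K + K).toNNReal
      (fun t ht => (hreg t ht).continuousOn) fun x _ => LipschitzOnWith.of_dist_le_mul
      fun τ hτ t ht => by
        rw [Real.coe_toNNReal _ (by positivity)]; exact hwt x t ht τ hτ
  refine ⟨w, w', L, hreg, hwc, fun x => by simp [hw, hXt 0 h0], fun t ht x => ?_⟩
  -- the time derivative
  have hId := hasDerivWithinAt_integral_Icc (hsX t ht x) ht ht
  have hyd := hXd t ht x t ht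
  rw [hXt t ht] at hId hyd
  have hprod : HasDerivWithinAt (fun τ => w' τ x * (X t x τ - x)) (w' t x * c t x)
      (Icc 0 T) t := by
    rw [hasDerivWithinAt_iff_tendsto_slope]
    refine ((((continuousOn_deriv_of_c11 isUpperSet_univ hreg hwc).uncurry_right x (hu x) t
      ht).tendsto.mono_left (nhdsWithin_mono t (sdiff_subset (t := {t})))).mul
      (hasDerivWithinAt_iff_tendsto_slope.1 hyd)).congr fun τ => ?_
    simp only [slope_def_field, hXt t ht]
    ring
  have hrem : HasDerivWithinAt (fun τ => w τ (X t x τ) - w τ x - w' τ x * (X t x τ - x)) 0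
      (Icc 0 T) t := by
    refine hasDerivWithinAt_of_quadratic (K := L * K ^ 2) fun τ hτ => ?_
    simp only [hXt t ht, sub_self, mul_zero, sub_zero, zero_mul]
    refine ((hreg τ hτ).taylor x (hu _) (X t x τ) (hu _)).trans ?_
    rw [mul_assoc, ← sq_abs (X t x τ - x), ← sq_abs (τ - t), ← mul_pow]
    have := hXlip t ht x τ hτ
    gcongr
  have e : ∀ τ ∈ Icc 0 T, w τ x = w t x + (∫ r in t..τ, s r (X t x r)) - w' τ x * (X t x τ - x)
      - (w τ (X t x τ) - w τ x - w' τ x * (X t x τ - x)) := fun τ hτ => by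
    linarith [hflow t ht x τ hτ]
  exact ((((hId.const_add (w t x)).sub hprod).sub hrem).congr e (e t ht)).congr_deriv (by ring)

/-! ### Maximum principle and a priori estimates -/

theorem hasDerivAt_nonneg_of_left_max {f : ℝ → ℝ} {f' a b : ℝ} (hf : HasDerivAt f f' a) (hb : b < a)
    (h : ∀ y ∈ Icc b a, f y ≤ f a) : 0 ≤ f' := by
  have h1 := (hasDerivAt_iff_tendsto_slope.1 hf).mono_left
    (nhdsWithin_mono a (fun y hy => ne_of_lt hy : Iio a ⊆ {a}ᶜ))
  refine ge_of_tendsto h1 ?_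
  filter_upwards [Ioo_mem_nhdsLT hb] with y hy
  rw [slope_def_field]
  exact div_nonneg_of_nonpos (sub_nonpos.2 (h y ⟨hy.1.le, hy.2.le⟩)) (sub_nonpos.2 hy.2.le)

/-- Maximum principle for transport with nonnegative speed on a rectangle. -/
theorem transport_max_principle {T x0 X D S : ℝ} {w wt wx c : ℝ → ℝ → ℝ} (hT : 0 < T) (hX : x0 < X)
    (hc : ContinuousOn (uncurry w) (Icc 0 T ×ˢ Icc x0 X))
    (hdt : ∀ t ∈ Ioo 0 T, ∀ x ∈ Ioo x0 X, HasDerivAt (fun τ => w τ x) (wt t x) t)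
    (hdx : ∀ t ∈ Ioo 0 T, ∀ x ∈ Ioo x0 X, HasDerivAt (w t) (wx t x) x)
    (hpos : ∀ t ∈ Ioo 0 T, ∀ x ∈ Ioo x0 X, 0 ≤ c t x)
    (hS : ∀ t ∈ Ioo 0 T, ∀ x ∈ Ioo x0 X, D + S * t < w t x → wt t x + c t x * wx t x ≤ S)
    (h0 : ∀ x ∈ Icc x0 X, w 0 x ≤ D) (hb : ∀ t ∈ Icc 0 T, w t x0 ≤ D + S * t) :
    ∀ t ∈ Icc 0 T, ∀ x ∈ Icc x0 X, w t x ≤ D + S * t := by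
  have hcl : closure (Ioo 0 T ×ˢ Ioo x0 X) = Icc 0 T ×ˢ Icc x0 X := by
    rw [closure_prod_eq, closure_Ioo hT.ne, closure_Ioo hX.ne]
  refine fun t ht x hx => le_on_closure (f := uncurry w) (g := fun z : ℝ × ℝ => D + S * z.1) ?_
    (hc.mono hcl.subset) (by fun_prop) (hcl.superset (show (t, x) ∈ _ from ⟨ht, hx⟩))
  -- interior points
  rintro ⟨t1, x1⟩ ⟨ht1, hx1⟩
  simp only at ht1 hx1 ⊢
  by_contra! hlt
  obtain ⟨ε, hε, hε1⟩ : ∃ ε > 0, D + S * t1 + ε * t1 < w t1 x1 := by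
    refine ⟨(w t1 x1 - (D + S * t1)) / (2 * t1),
      div_pos (sub_pos.2 hlt) (by linarith [ht1.1]), ?_⟩
    rw [div_mul_eq_mul_div, mul_div_mul_right _ _ ht1.1.ne']
    simp only [uncurry] at hlt; linarith
  obtain ⟨⟨t, x⟩, ⟨ht, hx⟩, hmax⟩ := (isCompact_Icc.prod isCompact_Icc).exists_isMaxOn
    (f := fun z : ℝ × ℝ => uncurry w z - (D + S * z.1 + ε * z.1))
    ⟨(t1, x1), ⟨ht1.1.le, le_rfl⟩, ⟨hx1.1.le, le_rfl⟩⟩ ((hc.mono (prod_mono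
    (Icc_subset_Icc_right ht1.2.le) (Icc_subset_Icc_right hx1.2.le))).sub (by fun_prop))
  simp only at ht hx
  have hmax' : ∀ τ ∈ Icc 0 t1, ∀ y ∈ Icc x0 x1,
      w τ y - (D + S * τ + ε * τ) ≤ w t x - (D + S * t + ε * t) := fun τ hτ y hy =>
    hmax (show (τ, y) ∈ Icc 0 t1 ×ˢ Icc x0 x1 from ⟨hτ, hy⟩)
  have hpos1 : 0 < w t x - (D + S * t + ε * t) :=
    lt_of_lt_of_le (by linarith) (hmax' t1 ⟨ht1.1.le, le_rfl⟩ x1 ⟨hx1.1.le, le_rfl⟩)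
  have ht0 : 0 < t := ht.1.lt_of_ne fun h => by
    subst h; linarith [h0 x ⟨hx.1, hx.2.trans hx1.2.le⟩]
  have hx0 : x0 < x := hx.1.lt_of_ne fun h => by
    subst h; nlinarith [hb t ⟨ht.1, ht.2.trans ht1.2.le⟩]
  have htT : t ∈ Ioo 0 T := ⟨ht0, ht.2.trans_lt ht1.2⟩
  have hxX : x ∈ Ioo x0 X := ⟨hx0, hx.2.trans_lt hx1.2⟩
  have d1 := hasDerivAt_nonneg_of_left_max ((hdt t htT x hxX).sub
    ((((hasDerivAt_id t).const_mul S).const_add D).add ((hasDerivAt_id t).const_mul ε))) ht0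
    fun τ hτ => hmax' τ ⟨hτ.1, hτ.2.trans ht.2⟩ x hx
  have d2 := hasDerivAt_nonneg_of_left_max (hdx t htT x hxX) hx0 fun y hy => by
    linarith [hmax' t ht y ⟨hy.1, hy.2.trans hx.2⟩]
  nlinarith [hS t htT x hxX (by nlinarith), mul_nonneg (hpos t htT x hxX) d2]

/-- Damped transport. -/
theorem transport_abs_le_of_damping {T x0 X D S lam : ℝ} {w wt wx c : ℝ → ℝ → ℝ} (hT : 0 < T)
    (hX : x0 < X) (hc : ContinuousOn (uncurry w) (Icc 0 T ×ˢ Icc x0 X))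
    (hdt : ∀ t ∈ Ioo 0 T, ∀ x ∈ Ioo x0 X, HasDerivAt (fun τ => w τ x) (wt t x) t)
    (hdx : ∀ t ∈ Ioo 0 T, ∀ x ∈ Ioo x0 X, HasDerivAt (w t) (wx t x) x)
    (hpos : ∀ t ∈ Ioo 0 T, ∀ x ∈ Ioo x0 X, 0 ≤ c t x) (hlam : 0 ≤ lam) (hS0 : 0 ≤ S)
    (hS : ∀ t ∈ Ioo 0 T, ∀ x ∈ Ioo x0 X, |wt t x + c t x * wx t x + lam * w t x| ≤ S + lam * D)
    (h0 : ∀ x ∈ Icc x0 X, |w 0 x| ≤ D) (hb : ∀ t ∈ Icc 0 T, |w t x0| ≤ D) :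
    ∀ t ∈ Icc 0 T, ∀ x ∈ Icc x0 X, |w t x| ≤ D + S * t := by
  have hm : ∀ t ∈ Ioo 0 T, ∀ {y}, D + S * t < y → lam * D ≤ lam * y := fun t ht y h =>
    mul_le_mul_of_nonneg_left (by nlinarith [ht.1]) hlam
  intro t ht x hx
  rw [abs_le', and_comm]
  constructor
  · exact transport_max_principle (w := fun t x => -w t x) (c := c) hT hX hc.neg
      (fun t ht x hx => (hdt t ht x hx).neg) (fun t ht x hx => (hdx t ht x hx).neg) hpos
      (fun t ht x hx h => by linarith [(abs_le.1 (hS t ht x hx)).1, hm t ht h])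
      (fun x hx => by linarith [(abs_le.1 (h0 x hx)).1])
      (fun t ht => by nlinarith [(abs_le.1 (hb t ht)).1, ht.1]) t ht x hx
  · exact transport_max_principle hT hX hc hdt hdx hpos
      (fun t ht x hx h => by linarith [(abs_le.1 (hS t ht x hx)).2, hm t ht h])
      (fun x hx => (abs_le.1 (h0 x hx)).2)
      (fun t ht => by nlinarith [(abs_le.1 (hb t ht)).2, ht.1]) t ht x hx

theorem transport_abs_le {T x0 X D S : ℝ} {w wt wx c : ℝ → ℝ → ℝ} (hT : 0 < T) (hX : x0 < X)
    (hc : ContinuousOn (uncurry w) (Icc 0 T ×ˢ Icc x0 X))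
    (hdt : ∀ t ∈ Ioo 0 T, ∀ x ∈ Ioo x0 X, HasDerivAt (fun τ => w τ x) (wt t x) t)
    (hdx : ∀ t ∈ Ioo 0 T, ∀ x ∈ Ioo x0 X, HasDerivAt (w t) (wx t x) x)
    (hpos : ∀ t ∈ Ioo 0 T, ∀ x ∈ Ioo x0 X, 0 ≤ c t x) (hS0 : 0 ≤ S)
    (hS : ∀ t ∈ Ioo 0 T, ∀ x ∈ Ioo x0 X, |wt t x + c t x * wx t x| ≤ S)
    (h0 : ∀ x ∈ Icc x0 X, |w 0 x| ≤ D) (hb : ∀ t ∈ Icc 0 T, |w t x0| ≤ D) :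
    ∀ t ∈ Icc 0 T, ∀ x ∈ Icc x0 X, |w t x| ≤ D + S * t :=
  transport_abs_le_of_damping (lam := 0) hT hX hc hdt hdx hpos le_rfl hS0
    (by simpa using hS) h0 hb

theorem lip_of_lip_small {x0 C η : ℝ} {f : ℝ → ℝ} (hη : 0 < η)
    (h : ∀ x ∈ Ici x0, ∀ k, 0 < k → k < η → |f (x + k) - f x| ≤ C * k) {x y : ℝ}
    (hx : x ∈ Ici x0) (hy : y ∈ Ici x0) : |f y - f x| ≤ C * |y - x| := by
  wlog hxy : x ≤ y generalizing x y
  · rw [abs_sub_comm, abs_sub_comm y x]; exact this hy hx (not_le.1 hxy).le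
  rcases eq_or_lt_of_le hxy with rfl | hlt
  · simp
  obtain ⟨n, hn⟩ := exists_nat_gt ((y - x) / η)
  have hn0 : (0 : ℝ) < n := lt_trans (div_pos (by linarith) hη) hn
  set k := (y - x) / n with hk
  have hk0 : 0 < k := div_pos (by linarith) hn0
  have hkη : k < η := by rw [hk, div_lt_iff₀ hn0]; rwa [div_lt_iff₀ hη, mul_comm] at hn
  have key : ∀ i : ℕ, |f (x + i * k) - f x| ≤ C * (i * k) := by
    intro i
    induction i with
    | zero => simp
    | succ i ih =>
      have hxi : x + i * k ∈ Ici x0 :=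
        le_add_of_le_of_nonneg hx (mul_nonneg i.cast_nonneg hk0.le)
      refine (abs_le_add (b := f (x + i * k + k) - f (x + i * k)) (c := f (x + i * k) - f x) ?_
        (h _ hxi k hk0 hkη) ih).trans_eq ?_ <;> (push_cast; ring_nf)
  rw [abs_of_pos (sub_pos.2 hlt)]
  simpa [hk, mul_div_cancel₀ _ hn0.ne'] using key n

namespace C11On

theorem second_diff {J : Set ℝ} {K : ℝ} {f f' : ℝ → ℝ} (hf : C11On J K f f') (hJ : J.OrdConnected)
    {x h k : ℝ} (hh : 0 ≤ h) (hk : 0 ≤ k) (hx : x ∈ J) (hxhk : x + h + k ∈ J) :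
    |f (x + h + k) - f (x + h) - f (x + k) + f x| ≤ 2 * K * (h * k) := by
  have hJy : ∀ y ∈ Icc x (x + k), y ∈ J ∧ y + h ∈ J := fun y hy =>
    ⟨hJ.out hx hxhk ⟨hy.1, by linarith [hy.2]⟩,
      hJ.out hx hxhk ⟨by linarith [hy.1], by linarith [hy.2]⟩⟩
  have := (convex_Icc x (x + k)).abs_image_sub_le (f := fun y => f (y + h) - f y)
    (C := 2 * K * h) (fun y hy => (((hf.hasDerivWithinAt (hJy y hy).2).comp y
    ((hasDerivWithinAt_id y _).add_const h) fun z hz => (hJy z hz).2).sub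
    ((hf.hasDerivWithinAt (hJy y hy).1).mono fun z hz => (hJy z hz).1)).congr_deriv
    (by rw [mul_one])) (fun y hy => hf.lip_deriv_add (hJy y hy).1 (hJy y hy).2 hh)
    (left_mem_Icc.2 (by linarith)) (right_mem_Icc.2 (by linarith))
  rw [add_sub_cancel_left, abs_of_nonneg hk] at this
  rw [add_right_comm]; convert this using 1 <;> ring_nf

end C11On

theorem exists_fixed_bound {P : ℝ → Prop} {a B : ℝ} (h0 : P B) (h : ∀ B, P B → P (a + B / 2))
    (hcl : ∀ u : ℕ → ℝ, Tendsto u atTop (𝓝 (2 * a)) → (∀ n, P (u n)) → P (2 * a)) : P (2 * a) := by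
  refine hcl (fun n => 2 * a + (B - 2 * a) * (1 / 2) ^ n) ?_ fun n => ?_
  · simpa using ((tendsto_pow_atTop_nhds_zero_of_lt_one (r := (1 / 2 : ℝ)) (by norm_num)
      (by norm_num)).const_mul (B - 2 * a)).const_add (2 * a)
  · induction n with
    | zero => simpa using h0
    | succ n ih => convert h _ ih using 1; ring

/-- A bound on the derivative, from the increments of the data and of the source. -/
theorem transport_deriv_bound {T x0 η D G : ℝ} {w w' c s : ℝ → ℝ → ℝ} (hT : 0 < T) (hη : 0 < η)
    (hwc : ContinuousOn (uncurry w) (Icc 0 T ×ˢ Ici x0))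
    (hdx : ∀ t ∈ Icc 0 T, ∀ x ∈ Ici x0, HasDerivWithinAt (w t) (w' t x) (Ici x0) x)
    (hdt : ∀ t ∈ Ioo 0 T, ∀ x ∈ Ioi x0, HasDerivAt (fun τ => w τ x) (s t x - c t x * w' t x) t)
    (hcpos : ∀ t ∈ Icc 0 T, ∀ x ∈ Ici x0, 0 ≤ c t x) (hG0 : 0 ≤ G)
    (hG : ∀ t ∈ Icc 0 T, ∀ x ∈ Ici x0, ∀ k > 0,
      |s t (x + k) - s t x - (c t (x + k) - c t x) * w' t (x + k)| ≤ G * k)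
    (h0 : ∀ x ∈ Ici x0, ∀ k > 0, k < η → |w 0 (x + k) - w 0 x| ≤ D * k)
    (hb : ∀ t ∈ Icc 0 T, ∀ k > 0, k < η → |w t (x0 + k) - w t x0| ≤ D * k) :
    ∀ t ∈ Icc 0 T, ∀ x ∈ Ici x0, |w' t x| ≤ D + G * t := by
  intro t ht x hx
  have hI : Ioo 0 T ⊆ Icc 0 T := Ioo_subset_Icc_self
  have hda : ∀ t ∈ Icc 0 T, ∀ x ∈ Ioi x0, HasDerivAt (w t) (w' t x) x := fun t ht x hx =>
    (hdx t ht x (Ioi_subset_Ici_self hx)).hasDerivAt (Ici_mem_nhds hx)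
  have h1 := (hdx t ht x hx).mono (Ioi_subset_Ici hx : Ioi x ⊆ Ici x0)
  rw [hasDerivWithinAt_iff_tendsto_slope' (by simp)] at h1
  refine le_of_tendsto h1.abs ?_
  filter_upwards [Ioo_mem_nhdsGT (show x < x + η by linarith)] with y hy
  obtain ⟨k, rfl⟩ : ∃ k, y = x + k := ⟨y - x, by ring⟩
  have hk : 0 < k := by linarith [hy.1]
  have hkη : k < η := by linarith [hy.2]
  rw [slope_def_field, add_sub_cancel_left, abs_div, abs_of_pos hk, div_le_iff₀ hk]
  have hm : ∀ {x}, x ∈ Ioi x0 → x + k ∈ Ioi x0 := fun h => lt_add_of_lt_of_pos h hk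
  refine (transport_abs_le (X := x + 1) (w := fun t x => w t (x + k) - w t x)
    (wx := fun t x => w' t (x + k) - w' t x) (c := c) (S := G * k) (D := D * k) hT
    (lt_add_of_le_of_pos hx one_pos)
    (ContinuousOn.sub (hwc.comp (f := fun z : ℝ × ℝ => (z.1, z.2 + k)) (by fun_prop) fun z hz =>
      ⟨hz.1, hz.2.1.trans (by simp [hk.le])⟩) (hwc.mono (prod_mono le_rfl Icc_subset_Ici_self)))
    (fun t ht x hx => (hdt t ht _ (hm hx.1)).sub (hdt t ht x hx.1))
    (fun t ht x hx => ((hda t (hI ht) _ (hm hx.1)).comp_add_const x k).sub (hda t (hI ht) x hx.1))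
    (fun t ht x hx => hcpos t (hI ht) x hx.1.le) (by positivity)
    (fun t ht x hx => ?_) (fun x hx => h0 x hx.1 k hk hkη) (fun t ht => hb t ht k hk hkη) t ht x
    ⟨hx, by linarith⟩).trans (by linarith)
  convert hG t (hI ht) x hx.1.le k hk using 2
  ring

/-- A priori bound for transport in a quarter strip, in terms of initial and boundary data only,
for a short time. -/
theorem transport_c11_bound {T x0 x1 D K' L : ℝ} {w w' c c' s s' : ℝ → ℝ → ℝ} (hT : 0 < T)
    (hx1 : x0 < x1) (hD : 0 ≤ D)
    (hw : ∀ t ∈ Icc 0 T, C11On (Ici x0) L (w t) (w' t))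
    (hwc : ContinuousOn (uncurry w) (Icc 0 T ×ˢ Ici x0))
    (hc : ∀ t ∈ Icc 0 T, C11On (Ici x0) K' (c t) (c' t))
    (hcpos : ∀ t ∈ Icc 0 T, ∀ x ∈ Ici x0, 0 ≤ c t x)
    (hs : ∀ t ∈ Icc 0 T, C11On (Ici x0) K' (s t) (s' t))
    (hdt : ∀ t ∈ Ioo 0 T, ∀ x ∈ Ioi x0,
      HasDerivAt (fun τ => w τ x) (s t x - c t x * w' t x) t)
    (h0 : C11On (Ici x0) D (w 0) (w' 0))
    (hb : ∀ t ∈ Icc 0 T, C11On (Icc x0 x1) D (w t) (w' t))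
    (hsmall : T * K' ≤ 1 / 8) :
    ∀ t ∈ Icc 0 T, C11On (Ici x0) (8 * D + 2) (w t) (w' t) := by
  have hT0 : (0 : ℝ) ∈ Icc 0 T := ⟨le_rfl, hT.le⟩
  have hK' : 0 ≤ K' := (hc 0 hT0).nonneg self_mem_Ici
  have hdx : ∀ t ∈ Icc 0 T, ∀ x ∈ Ici x0, HasDerivWithinAt (w t) (w' t x) (Ici x0) x :=
    fun t ht x hx => (hw t ht).hasDerivWithinAt hx
  have hI : Ioo 0 T ⊆ Icc 0 T := Ioo_subset_Icc_self
  have hKt : ∀ t ∈ Icc 0 T, ∀ a, 0 ≤ a → K' * a * t ≤ a / 8 := fun t ht a ha => by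
    nlinarith [mul_le_mul_of_nonneg_right hsmall ha, mul_le_mul_of_nonneg_left ht.2
      (mul_nonneg hK' ha)]
  have hm : ∀ {x k}, x ∈ Ici x0 → 0 < k → x + k ∈ Ici x0 := fun hx hk =>
    hx.trans (le_add_of_nonneg_right hk.le)
  have hw0 : ∀ t ∈ Icc 0 T, ∀ x ∈ Ici x0, |w t x| ≤ D + K' * T := by
    intro t ht x hx
    refine (transport_abs_le (X := x + 1) (c := c) (S := K') (D := D) hT
      (lt_add_of_le_of_pos hx one_pos) (hwc.mono (prod_mono le_rfl Icc_subset_Ici_self))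
      (fun t ht x hx => hdt t ht x hx.1) (fun t ht x hx => (hdx t (hI ht) x hx.1.le).hasDerivAt
      (Ici_mem_nhds hx.1)) (fun t ht x hx => hcpos t (hI ht) x hx.1.le) hK' (fun t ht x hx => by
        rw [sub_add_cancel]; exact (hs t (hI ht)).bound x hx.1.le)
      (fun x hx => h0.bound x hx.1) (fun t ht => (hb t ht).bound x0 ⟨le_rfl, hx1.le⟩) t ht x
      ⟨hx, by linarith⟩).trans ?_
    gcongr; exact ht.2
  set B := 2 * (2 * D + 1 / 4) with hB
  have hw1 : ∀ t ∈ Icc 0 T, ∀ x ∈ Ici x0, |w' t x| ≤ B := by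
    refine exists_fixed_bound (P := fun B => ∀ t ∈ Icc 0 T, ∀ x ∈ Ici x0, |w' t x| ≤ B)
      (fun t ht => (hw t ht).bound') (fun B hB t ht x hx => ?_)
      fun u hu h t ht x hx => ge_of_tendsto' hu fun n => h n t ht x hx
    have hB0 : 0 ≤ B := (abs_nonneg _).trans (hB t ht x hx)
    refine (transport_deriv_bound (D := 2 * D) (G := 2 * K' + 2 * K' * B) hT (sub_pos.2 hx1) hwc
      hdx hdt hcpos (by positivity) (fun t ht x hx k hk => ?_)
      (fun x hx k hk _ => h0.lip_add hx (hm hx hk) hk.le) (fun t ht k hk hk' => (hb t ht).lip_add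
      ⟨le_rfl, hx1.le⟩ ⟨by linarith, by linarith⟩ hk.le) t ht x hx).trans ?_
    · have a := abs_mul_le ((hc t ht).lip_add hx (hm hx hk) hk.le) (hB t ht _ (hm hx hk))
      linarith [abs_sub (s t (x + k) - s t x) ((c t (x + k) - c t x) * w' t (x + k)),
        (hs t ht).lip_add hx (hm hx hk) hk.le]
    · linarith [hKt t ht 1 zero_le_one, hKt t ht B hB0]
  have hw2 : ∀ t ∈ Icc 0 T, ∀ x ∈ Ici x0, ∀ k > 0, |w' t (x + k) - w' t x| ≤
      2 * (2 * D + 1 / 4 + B / 4) * k := by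
    refine exists_fixed_bound (P := fun L => ∀ t ∈ Icc 0 T, ∀ x ∈ Ici x0, ∀ k > 0,
      |w' t (x + k) - w' t x| ≤ L * k) (fun t ht x hx k hk =>
        (hw t ht).lip_deriv_add hx (hm hx hk) hk.le) (fun L hL t ht x hx k hk => ?_)
      fun u hu h t ht x hx k hk => ge_of_tendsto' (hu.mul_const k) fun n => h n t ht x hx k hk
    have hL0 : 0 ≤ L := nonneg_of_mul_nonneg_left ((abs_nonneg _).trans (hL t ht x hx k hk)) hk
    have hB0 : 0 ≤ B := by positivity
    have := lip_of_lip_small (η := (x1 - x0) / 2) (by linarith) (fun x hx h hh hhη => ?_) hx (hm hx hk)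
      (C := 2 * D + 1 / 4 + B / 4 + L / 2) (f := w' t)
    · rwa [add_sub_cancel_left, abs_of_pos hk] at this
    refine (transport_deriv_bound (D := 2 * D * h) (η := (x1 - x0) / 2)
      (G := (2 * K' + 2 * K' * B + 4 * K' * L) * h) (w := fun t x => w t (x + h) - w t x)
      (w' := fun t x => w' t (x + h) - w' t x) (c := c)
      (s := fun t x => s t (x + h) - s t x - (c t (x + h) - c t x) * w' t (x + h)) hT (by linarith)
      ((hwc.comp (f := fun z : ℝ × ℝ => (z.1, z.2 + h)) (by fun_prop) fun z hz =>
        ⟨hz.1, hm hz.2 hh⟩).sub hwc)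
      (fun t ht x hx => (((hdx t ht _ (hm hx hh)).comp x ((hasDerivWithinAt_id x _).add_const h)
          fun z hz => hm hz hh).congr_deriv (mul_one _)).sub (hdx t ht x hx))
      (fun t ht x hx => ((hdt t ht _ (lt_add_of_lt_of_pos hx hh)).sub (hdt t ht x hx)).congr_deriv
        (by ring)) hcpos (by positivity) (fun t ht x hx k hk => ?_) (fun x hx k hk _ => ?_)
      (fun t ht k hk hk' => ?_) t ht x hx).trans ?_
    · have hxh := hm hx hh
      have hxk := hm hx hk
      have hxhk := hm hxh hk
      have a1 := (hs t ht).second_diff ordConnected_Ici hh.le hk.le hx hxhk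
      have m1 := abs_mul_le ((hc t ht).lip_add hx hxh hh.le) (hL t ht _ hxh k hk)
      have m2 := abs_mul_le ((hc t ht).lip_add hx hxk hk.le) (hL t ht _ hxk h hh)
      have m3 := abs_mul_le ((hc t ht).second_diff ordConnected_Ici hh.le hk.le hx hxhk)
        (hw1 t ht _ hxhk)
      rw [add_right_comm x k h] at m2 ⊢
      exact (abs_le_add (by ring) a1 ((abs_neg _).trans_le (abs_le_add rfl
        (abs_le_add rfl m1 m2) m3))).trans_eq (by ring)
    · have := h0.second_diff ordConnected_Ici hh.le hk.le hx (hm (hm hx hh) hk)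
      rw [add_right_comm x k h]
      convert this using 1 <;> ring_nf
    · have := (hb t ht).second_diff ordConnected_Icc (x := x0) hh.le hk.le ⟨le_rfl, hx1.le⟩
        ⟨by linarith, by linarith⟩
      rw [add_right_comm x0 k h]
      convert this using 1 <;> ring_nf
    · linarith [hKt t ht h hh.le, hKt t ht (B * h) (by positivity), hKt t ht (L * h) (by positivity)]
  intro t ht
  refine C11On.of_hasDeriv (convex_Ici x0) (hdx t ht) (fun x hx => (hw0 t ht x hx).trans (by linarith))
    (fun x hx => (hw1 t ht x hx).trans (by linarith)) fun x hx y hy =>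
    lip_of_lip_small one_pos (fun x hx k hk _ => (hw2 t ht x hx k hk).trans ?_) hx hy
  exact mul_le_mul_of_nonneg_right (by linarith) hk.le

/-! ### Smooth compactly supported functions of two variables -/

/-- `∂_t` of a function of `(t, x)`. -/
def dt (g : ℝ → ℝ → ℝ) (t x : ℝ) : ℝ := deriv (fun τ => g τ x) t

/-- `∂_x` of a function of `(t, x)`. -/
def dx (g : ℝ → ℝ → ℝ) (t x : ℝ) : ℝ := deriv (g t) x

section SmoothCompact

variable {g : ℝ → ℝ → ℝ}

theorem hasDerivAt_fst_of_differentiable {f : ℝ × ℝ → ℝ} {t x : ℝ} (h : DifferentiableAt ℝ f (t, x)) :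
    HasDerivAt (fun τ => f (τ, x)) (fderiv ℝ f (t, x) (1, 0)) t := by
  have h2 : HasDerivAt (fun τ : ℝ => (τ, x)) (1, 0) t := (hasDerivAt_id t).prodMk (hasDerivAt_const t x)
  exact h.hasFDerivAt.comp_hasDerivAt t h2

theorem hasDerivAt_snd_of_differentiable {f : ℝ × ℝ → ℝ} {t x : ℝ} (h : DifferentiableAt ℝ f (t, x)) :
    HasDerivAt (fun y => f (t, y)) (fderiv ℝ f (t, x) (0, 1)) x := by
  have h2 : HasDerivAt (fun y : ℝ => (t, y)) (0, 1) x := (hasDerivAt_const x t).prodMk (hasDerivAt_id x)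
  exact h.hasFDerivAt.comp_hasDerivAt x h2

theorem hasDerivAt_dt (hg : ContDiff ℝ ∞ (uncurry g)) (t x : ℝ) :
    HasDerivAt (fun τ => g τ x) (dt g t x) t :=
  (hasDerivAt_fst_of_differentiable (f := uncurry g)
    ((hg.differentiable (by simp)) (t, x))).differentiableAt.hasDerivAt

theorem hasDerivAt_dx (hg : ContDiff ℝ ∞ (uncurry g)) (t x : ℝ) :
    HasDerivAt (g t) (dx g t x) x :=
  (hasDerivAt_snd_of_differentiable (f := uncurry g)
    ((hg.differentiable (by simp)) (t, x))).differentiableAt.hasDerivAt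

theorem uncurry_dt (hg : ContDiff ℝ ∞ (uncurry g)) :
    uncurry (dt g) = fun z => fderiv ℝ (uncurry g) z (1, 0) := by
  ext ⟨t, x⟩
  exact (hasDerivAt_fst_of_differentiable (f := uncurry g)
    ((hg.differentiable (by simp)) (t, x))).deriv

theorem uncurry_dx (hg : ContDiff ℝ ∞ (uncurry g)) :
    uncurry (dx g) = fun z => fderiv ℝ (uncurry g) z (0, 1) := by
  ext ⟨t, x⟩
  exact (hasDerivAt_snd_of_differentiable (f := uncurry g)
    ((hg.differentiable (by simp)) (t, x))).deriv

theorem contDiff_dt (hg : ContDiff ℝ ∞ (uncurry g)) :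
    ContDiff ℝ ∞ (uncurry (dt g)) := by
  rw [uncurry_dt hg]; exact (hg.fderiv_right (m := ∞) (by simp)).clm_apply contDiff_const

theorem contDiff_dx (hg : ContDiff ℝ ∞ (uncurry g)) :
    ContDiff ℝ ∞ (uncurry (dx g)) := by
  rw [uncurry_dx hg]; exact (hg.fderiv_right (m := ∞) (by simp)).clm_apply contDiff_const

theorem hasCompactSupport_dt (hg : ContDiff ℝ ∞ (uncurry g))
    (hs : HasCompactSupport (uncurry g)) : HasCompactSupport (uncurry (dt g)) := by
  rw [uncurry_dt hg]; exact hs.fderiv_apply (𝕜 := ℝ) (1, 0)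

theorem hasCompactSupport_dx (hg : ContDiff ℝ ∞ (uncurry g))
    (hs : HasCompactSupport (uncurry g)) : HasCompactSupport (uncurry (dx g)) := by
  rw [uncurry_dx hg]; exact hs.fderiv_apply (𝕜 := ℝ) (0, 1)

theorem exists_c11_of_smooth (hg : ContDiff ℝ ∞ (uncurry g))
    (hs : HasCompactSupport (uncurry g)) : ∃ K, ∀ t, C11On univ K (g t) (dx g t) := by
  have h1 := contDiff_dx hg
  have h2 := contDiff_dx h1
  have s1 := hasCompactSupport_dx hg hs
  have s2 := hasCompactSupport_dx h1 s1
  obtain ⟨K0, hK0⟩ := hs.exists_bound_of_continuous hg.continuous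
  obtain ⟨K1, hK1⟩ := s1.exists_bound_of_continuous h1.continuous
  obtain ⟨K2, hK2⟩ := s2.exists_bound_of_continuous h2.continuous
  exact ⟨_, fun t => C11On.of_hasDeriv_max convex_univ
    (fun x _ => (hasDerivAt_dx hg t x).hasDerivWithinAt) (fun x _ => hK0 (t, x))
    (fun x _ => hK1 (t, x)) fun x hx y hy => convex_univ.abs_image_sub_le
    (fun z _ => (hasDerivAt_dx h1 t z).hasDerivWithinAt) (fun z _ => hK2 (t, z)) hx hy⟩

theorem exists_c11_of_smooth_one {φ : ℝ → ℝ} (hg : ContDiff ℝ ∞ φ) (hs : HasCompactSupport φ) :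
    ∃ K, C11On univ K φ (deriv φ) := by
  have h1 : ContDiff ℝ ∞ (deriv φ) := (contDiff_infty_iff_deriv.1 hg).2
  have h2 : ContDiff ℝ ∞ (deriv (deriv φ)) := (contDiff_infty_iff_deriv.1 h1).2
  obtain ⟨K0, hK0⟩ := hs.exists_bound_of_continuous hg.continuous
  obtain ⟨K1, hK1⟩ := hs.deriv.exists_bound_of_continuous h1.continuous
  obtain ⟨K2, hK2⟩ := hs.deriv.deriv.exists_bound_of_continuous h2.continuous
  exact ⟨_, C11On.of_hasDeriv_max convex_univ
    (fun x _ => ((hg.differentiable (by simp)) x).hasDerivAt.hasDerivWithinAt) (fun x _ => hK0 x)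
    (fun x _ => hK1 x) fun x hx y hy => convex_univ.abs_image_sub_le (fun z _ =>
    ((h1.differentiable (by simp)) z).hasDerivAt.hasDerivWithinAt) (fun z _ => hK2 z) hx hy⟩

end SmoothCompact

/-! ### Diagonal quasilinear transport systems with causal coefficients -/

/-- Hypotheses for the existence theorem: the coefficients `C`, `S` of the system
`∂_t u_i + C_i[u] ∂_x u_i = S_i[u]` on `[0, T] × [x0, ∞)`, initial data `u0`, and a smooth solution
`b` on the initial strip `x0 ≤ x ≤ x1`. -/
structure TransportSystem {ι : Type*} (T x0 x1 D K' : ℝ) (C S : ι → ℝ → (ι → ℝ → ℝ) → ℝ → ℝ)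
    (b : ι → ℝ → ℝ → ℝ) (u0 u0' : ι → ℝ → ℝ) : Prop where
  pos_T : 0 < T
  lt_x : x0 < x1
  nonneg_D : 0 ≤ D
  small : T * (K' * (1 + (8 * D + 2))) ≤ 1 / 8
  smooth_b : ∀ i, ContDiff ℝ ∞ (uncurry (b i))
  supp_b : ∀ i, HasCompactSupport (uncurry (b i))
  c11_b : ∀ i, ∀ t ∈ Icc 0 T, C11On (Icc x0 x1) D (b i t) (dx (b i) t)
  c11_u0 : ∀ i, C11On (Ici x0) D (u0 i) (u0' i)
  eq_u0 : ∀ i, ∀ x ∈ Icc x0 x1, u0 i x = b i 0 x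
  reg_C : ∀ i, ∀ t ∈ Icc 0 T, ∀ v v' : ι → ℝ → ℝ, (∀ j, C11On (Ici x0) (8 * D + 2) (v j) (v' j)) →
    ∃ c', C11On (Ici x0) K' (C i t v) c'
  pos_C : ∀ i, ∀ t ∈ Icc 0 T, ∀ v : ι → ℝ → ℝ, ∀ x ∈ Ici x0, 0 ≤ C i t v x
  reg_S : ∀ i, ∀ t ∈ Icc 0 T, ∀ v v' : ι → ℝ → ℝ, (∀ j, C11On (Ici x0) (8 * D + 2) (v j) (v' j)) →
    ∃ s', C11On (Ici x0) K' (S i t v) s'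
  cont_C : ∀ i, ∀ u u' : ι → ℝ → ℝ → ℝ,
    (∀ j, ContinuousOn (uncurry (u j)) (Icc 0 T ×ˢ Ici x0)) →
    (∀ j, ∀ t ∈ Icc 0 T, C11On (Ici x0) (8 * D + 2) (u j t) (u' j t)) →
    ContinuousOn (uncurry fun t x => C i t (fun j => u j t) x) (Icc 0 T ×ˢ Ici x0)
  cont_S : ∀ i, ∀ u u' : ι → ℝ → ℝ → ℝ,
    (∀ j, ContinuousOn (uncurry (u j)) (Icc 0 T ×ˢ Ici x0)) →
    (∀ j, ∀ t ∈ Icc 0 T, C11On (Ici x0) (8 * D + 2) (u j t) (u' j t)) →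
    ContinuousOn (uncurry fun t x => S i t (fun j => u j t) x) (Icc 0 T ×ˢ Ici x0)
  lip : ∀ i, ∀ t ∈ Icc 0 T, ∀ v v' w w' : ι → ℝ → ℝ,
    (∀ j, C11On (Ici x0) (8 * D + 2) (v j) (v' j)) → (∀ j, C11On (Ici x0) (8 * D + 2) (w j) (w' j)) →
    ∀ X ∈ Ici x0, ∀ e, 0 ≤ e → (∀ j, ∀ y ∈ Icc x0 X, |v j y - w j y| ≤ e) →
      |C i t v X - C i t w X| ≤ K' * e ∧ |S i t v X - S i t w X| ≤ K' * e
  compat : ∀ i, ∀ t ∈ Icc 0 T, ∀ v v' : ι → ℝ → ℝ, (∀ j, C11On (Ici x0) (8 * D + 2) (v j) (v' j)) →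
    (∀ j, ∀ x ∈ Icc x0 x1, v j x = b j t x) → ∀ x ∈ Icc x0 x1,
      dt (b i) t x + C i t v x * dx (b i) t x = S i t v x

namespace TransportSystem

variable {ι : Type*} {T x0 x1 D K' : ℝ} {C S : ι → ℝ → (ι → ℝ → ℝ) → ℝ → ℝ} {b : ι → ℝ → ℝ → ℝ}
  {u0 u0' : ι → ℝ → ℝ}

/-- Admissible iterates. -/
structure Adm (T x0 x1 K : ℝ) (b : ι → ℝ → ℝ → ℝ) (u u' : ι → ℝ → ℝ → ℝ) : Prop where
  cont : ∀ i, ContinuousOn (uncurry (u i)) (Icc 0 T ×ˢ Ici x0)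
  c11 : ∀ i, ∀ t ∈ Icc 0 T, C11On (Ici x0) K (u i t) (u' i t)
  eq_b : ∀ i, ∀ t ∈ Icc 0 T, ∀ x ∈ Icc x0 x1, u i t x = b i t x

/-- Extension by zero to the left of `x0` of the product with a function vanishing near `x0`. -/
theorem c11_cutoff {χ χ' f f' : ℝ → ℝ} {Kc K x0 xa : ℝ} (hχ : C11On (Ici x0) Kc χ χ')
    (hxa : x0 < xa) (hχ0 : ∀ x ∈ Icc x0 xa, χ x = 0) (hf : C11On (Ici x0) K f f') :
    ∃ h', C11On univ (6 * Kc * K) (fun x => χ (max x x0) * f (max x x0)) h' := by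
  have hp := hχ.mul hf
  have hm : x0 ∈ Icc x0 xa := ⟨le_rfl, hxa.le⟩
  have h0 := hχ0 x0 hm
  have hd : χ' x0 = 0 := (uniqueDiffOn_Icc hxa x0 hm).eq_deriv _
    ((hχ.hasDerivWithinAt self_mem_Ici).mono Icc_subset_Ici_self)
    ((hasDerivWithinAt_const x0 _ (0 : ℝ)).congr hχ0 h0)
  have hz : C11On (univ ∩ Iic x0) (6 * Kc * K) (fun _ => 0) (fun _ => 0) :=
    (C11On.const 0).mono (by rw [abs_zero]; exact hp.nonneg self_mem_Ici)
  refine ⟨_, (hz.glue (hp.mono_set inter_subset_right) (mem_univ x0) (by simp [h0])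
    (by simp [h0, hd])).congr (fun x _ => ?_) (fun x _ => rfl)⟩
  split_ifs with h
  · rw [max_eq_right h, h0, zero_mul]
  · rw [max_eq_left (not_le.1 h).le]

theorem continuousOn_cutoff {χ : ℝ → ℝ} {f : ℝ → ℝ → ℝ} {T x0 : ℝ} (hχ : Continuous χ)
    (hf : ContinuousOn (uncurry f) (Icc 0 T ×ˢ Ici x0)) :
    ContinuousOn (uncurry fun t x => χ (max x x0) * f t (max x x0))
      (Icc 0 T ×ˢ univ) := by
  refine ContinuousOn.mul (by fun_prop) ?_
  exact hf.comp (by fun_prop : Continuous fun z : ℝ × ℝ => (z.1, max z.2 x0)).continuousOn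
    fun z hz => ⟨hz.1, mem_Ici.2 (le_max_right _ _)⟩

/-- One step of the iteration: the linear problem with the coefficients of an admissible `u`. -/
theorem exists_step (H : TransportSystem T x0 x1 D K' C S b u0 u0') {u u' : ι → ℝ → ℝ → ℝ}
    (hu : Adm T x0 x1 (8 * D + 2) b u u') :
    ∃ v v' : ι → ℝ → ℝ → ℝ, Adm T x0 x1 (8 * D + 2) b v v' ∧
      (∀ i, ∀ x ∈ Ici x0, v i 0 x = u0 i x) ∧
      ∀ i, ∀ t ∈ Ioo 0 T, ∀ x ∈ Ioi x0, HasDerivAt (fun τ => v i τ x)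
        (S i t (fun j => u j t) x - C i t (fun j => u j t) x * v' i t x) t := by
  have hT := H.pos_T
  have hx := H.lt_x
  have h0T : (0 : ℝ) ∈ Icc 0 T := ⟨le_rfl, hT.le⟩
  have hI : Ioo 0 T ⊆ Icc 0 T := Ioo_subset_Icc_self
  have hx0 : x0 ∈ Icc x0 x1 := ⟨le_rfl, hx.le⟩
  have hμ : 0 < x1 - x0 := sub_pos.2 hx
  let φ : ContDiffBump x0 := ⟨(x1 - x0) / 2, x1 - x0, by positivity, half_lt_self hμ⟩
  obtain ⟨Kφ, hKφ⟩ := exists_c11_of_smooth_one (φ := φ) φ.contDiff φ.hasCompactSupport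
  set χ : ℝ → ℝ := fun x => 1 - φ x with hχ
  have hχc : Continuous χ := continuous_const.sub φ.continuous
  have hχ11 : C11On (Ici x0) (|1| + Kφ) χ (fun x => 0 - deriv φ x) :=
    ((C11On.const 1).sub hKφ).mono_set (subset_univ _)
  have hχ0 : ∀ x ∈ Icc x0 (x0 + (x1 - x0) / 2), χ x = 0 := fun x hx => by
    refine sub_eq_zero.2 (φ.one_of_mem_closedBall ?_).symm
    rw [Metric.mem_closedBall, Real.dist_eq, abs_of_nonneg (sub_nonneg.2 hx.1)]
    exact sub_le_iff_le_add'.2 hx.2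
  have hχ1 : ∀ x, x1 ≤ x → χ x = 1 := fun x hx1 => by
    have : φ x = 0 := φ.zero_of_le_dist (by
      rw [Real.dist_eq, abs_of_nonneg (by linarith)]; exact sub_le_sub_right hx1 x0)
    simp [hχ, this]
  suffices hsuff : ∀ i, ∃ v v' : ℝ → ℝ → ℝ,
      ContinuousOn (uncurry v) (Icc 0 T ×ˢ Ici x0) ∧
      (∀ t ∈ Icc 0 T, C11On (Ici x0) (8 * D + 2) (v t) (v' t)) ∧
      (∀ t ∈ Icc 0 T, ∀ x ∈ Icc x0 x1, v t x = b i t x) ∧ (∀ x ∈ Ici x0, v 0 x = u0 i x) ∧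
      ∀ t ∈ Ioo 0 T, ∀ x ∈ Ioi x0, HasDerivAt (fun τ => v τ x)
        (S i t (fun j => u j t) x - C i t (fun j => u j t) x * v' t x) t by
    choose v v' h1 h2 h3 h4 h5 using hsuff
    exact ⟨v, v', ⟨h1, h2, h3⟩, h4, h5⟩
  intro i
  set c : ℝ → ℝ → ℝ := fun t x => C i t (fun j => u j t) x
  set s : ℝ → ℝ → ℝ := fun t x => S i t (fun j => u j t) x
  have hc11 : ∀ t ∈ Icc 0 T, ∃ c', C11On (Ici x0) K' (c t) c' := fun t ht =>
    H.reg_C i t ht _ _ fun j => hu.c11 j t ht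
  have hs11 : ∀ t ∈ Icc 0 T, ∃ s', C11On (Ici x0) K' (s t) s' := fun t ht =>
    H.reg_S i t ht _ _ fun j => hu.c11 j t ht
  choose! c' hc' using hc11
  choose! s' hs' using hs11
  have hcc : ContinuousOn (uncurry c) (Icc 0 T ×ˢ Ici x0) := H.cont_C i u u' hu.cont hu.c11
  have hcpos : ∀ t ∈ Icc 0 T, ∀ x ∈ Ici x0, 0 ≤ c t x := fun t ht => H.pos_C i t ht _
  -- the remainder after subtraction of the boundary solution
  set β := b i
  have hβs := H.smooth_b i
  have hβc := H.supp_b i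
  set r : ℝ → ℝ → ℝ := fun t x => s t x - dt β t x - c t x * dx β t x with hr
  have hr0 : ∀ t ∈ Icc 0 T, ∀ x ∈ Icc x0 x1, r t x = 0 := fun t ht x hx => by
    simp only [hr, s, ← H.compat i t ht _ _ (fun j => hu.c11 j t ht) (fun j => hu.eq_b j t ht) x hx]
    ring
  obtain ⟨K1, hK1⟩ := exists_c11_of_smooth hβs hβc
  obtain ⟨K2, hK2⟩ := exists_c11_of_smooth (contDiff_dt hβs) (hasCompactSupport_dt hβs hβc)
  obtain ⟨K3, hK3⟩ := exists_c11_of_smooth (contDiff_dx hβs) (hasCompactSupport_dx hβs hβc)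
  have hsub : ∀ {K f f'}, C11On univ K f f' → C11On (Ici x0) K f f' := fun h =>
    h.mono_set (subset_univ _)
  have hrc : ContinuousOn (uncurry r) (Icc 0 T ×ˢ Ici x0) :=
    ((H.cont_S i u u' hu.cont hu.c11).sub (contDiff_dt hβs).continuous.continuousOn).sub
      (hcc.mul (contDiff_dx hβs).continuous.continuousOn)
  have hx0a : x0 < x0 + (x1 - x0) / 2 := by linarith
  choose! C1' hC1' using fun t (ht : t ∈ Icc 0 T) => c11_cutoff hχ11 hx0a hχ0 (hc' t ht)
  choose! S1' hS1' using fun t (ht : t ∈ Icc 0 T) => c11_cutoff hχ11 hx0a hχ0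
    (((hs' t ht).sub (hsub (hK2 t))).sub ((hc' t ht).mul (hsub (hK3 t))))
  obtain ⟨W0', hW0'⟩ := c11_cutoff hχ11 hx0a hχ0 ((H.c11_u0 i).sub (hsub (hK1 0)))
  obtain ⟨w, w', L, hw11, hwc, hw0, hwd⟩ := exists_linear_transport hT.le
    (c := fun t x => χ (max x x0) * c t (max x x0))
    (s := fun t x => χ (max x x0) * r t (max x x0))
    (fun t ht => (hC1' t ht).mono (le_max_left _ _)) (continuousOn_cutoff hχc hcc)
    (fun t ht => (hS1' t ht).mono ((le_max_left _ _).trans (le_max_right _ _)))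
    (continuousOn_cutoff hχc hrc)
    (hW0'.mono ((le_max_right _ _).trans (le_max_right _ _)))
  have hw00 : ∀ x ∈ Icc x0 x1, w 0 x = 0 := fun x hx => by
    rw [hw0, max_eq_left hx.1, H.eq_u0 i x hx, sub_self, mul_zero]
  have hwd' := fun t (ht : t ∈ Ioo 0 T) x => (hwd t (hI ht) x).hasDerivAt (Icc_mem_nhds ht.1 ht.2)
  have hwx0 : ∀ t ∈ Icc 0 T, w t x0 = 0 := fun t ht => by
    have h2 := (convex_Icc 0 T).abs_image_sub_le (f := fun τ => w τ x0) (fun τ hτ => hwd τ hτ x0)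
      (C := 0) (fun _ _ => by simp [hχ0 x0 ⟨le_rfl, hx0a.le⟩]) h0T ht
    rwa [zero_mul, hw00 x0 hx0, sub_zero, abs_nonpos_iff] at h2
  have hwdx : ∀ t ∈ Icc 0 T, ∀ x, HasDerivAt (w t) (w' t x) x := fun t ht x =>
    (hw11 t ht).hasDerivAt univ_mem
  have hwz : ∀ t ∈ Icc 0 T, ∀ x ∈ Icc x0 x1, w t x = 0 := fun t ht x hx1 => by
    have := transport_abs_le (D := 0) (S := 0) (c := fun t x => χ (max x x0) * c t (max x x0))
      hT hx (hwc.mono (prod_mono le_rfl (subset_univ _)))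
      (fun t ht x hx => hwd' t ht x) (fun t ht x hx => hwdx t (hI ht) x)
      (fun t ht x hx => mul_nonneg (sub_nonneg.2 φ.le_one) (hcpos t (hI ht) _ (mem_Ici.2 (le_max_right _ _))))
      le_rfl (fun t ht x hx => ?_) (fun x hx => by rw [hw00 x hx, abs_zero])
      (fun t ht => by rw [hwx0 t ht, abs_zero]) t ht x hx1
    · rwa [zero_mul, add_zero, abs_nonpos_iff] at this
    · rw [sub_add_cancel, max_eq_left hx.1.le, hr0 t (hI ht) x ⟨hx.1.le, hx.2.le⟩]
      simp
  set v : ℝ → ℝ → ℝ := fun t x => w t x + β t x with hv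
  set v' : ℝ → ℝ → ℝ := fun t x => w' t x + dx β t x with hv'
  have hv11 : ∀ t ∈ Icc 0 T, C11On (Ici x0) (L + K1) (v t) (v' t) := fun t ht =>
    (hsub (hw11 t ht)).add (hsub (hK1 t))
  have hvc : ContinuousOn (uncurry v) (Icc 0 T ×ˢ Ici x0) :=
    (hwc.mono (prod_mono le_rfl (subset_univ _))).add hβs.continuous.continuousOn
  have hvd : ∀ t ∈ Ioo 0 T, ∀ x ∈ Ioi x0, HasDerivAt (fun τ => v τ x)
      (s t x - c t x * v' t x) t := by
    intro t ht x hx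
    refine ((hwd' t ht x).add (hasDerivAt_dt hβs t x)).congr_deriv ?_
    rw [max_eq_left (le_of_lt hx)]
    rcases lt_or_ge x x1 with hxm | hxm
    · have hw'0 : w' t x = 0 := (hwdx t (hI ht) x).unique
        ((hasDerivAt_const x (0 : ℝ)).congr_of_eventuallyEq (by
          filter_upwards [Ioo_mem_nhds hx hxm] with y hy
            using hwz t (hI ht) y ⟨hy.1.le, hy.2.le⟩))
      have := hr0 t (hI ht) x ⟨le_of_lt hx, hxm.le⟩
      simp only [hv', hw'0, this]
      simp only [hr] at this
      linarith
    · rw [hχ1 x hxm]; simp only [hv', hr]; ring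
  have hvb : ∀ t ∈ Icc 0 T, ∀ x ∈ Icc x0 x1, v t x = β t x := fun t ht x hx => by
    simp only [hv, hwz t ht x hx, zero_add]
  have hv0 : ∀ x ∈ Ici x0, v 0 x = u0 i x := fun x hx => by
    rcases le_total x x1 with hxm | hxm
    · rw [hvb 0 h0T x ⟨hx, hxm⟩, H.eq_u0 i x ⟨hx, hxm⟩]
    · simp only [hv]; rw [hw0, max_eq_left hx, hχ1 x hxm]; ring
  -- the derivative is determined by the function on the initial slice and near the boundary
  have huniq : ∀ {J K1 K2 f g f1 g1}, UniqueDiffOn ℝ J → C11On J K1 f f1 → C11On J K2 g g1 →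
      (∀ x ∈ J, f x = g x) → C11On J K2 f f1 := fun hJ h1 h2 h =>
    h2.congr h fun x hx => (hJ x hx).eq_deriv _ (h1.hasDerivWithinAt hx)
      ((h2.hasDerivWithinAt hx).congr h (h x hx))
  have hK'0 : 0 ≤ K' := (hc' 0 h0T).nonneg (x := x0) self_mem_Ici
  refine ⟨v, v', hvc, transport_c11_bound hT hx H.nonneg_D hv11 hvc hc' hcpos hs' hvd
    (huniq (uniqueDiffOn_Ici x0) (hv11 0 h0T) (H.c11_u0 i) hv0) (fun t ht =>
    huniq (uniqueDiffOn_Icc hx) ((hv11 t ht).mono_set Icc_subset_Ici_self) (H.c11_b i t ht)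
    (hvb t ht)) ?_, hvb, hv0, hvd⟩
  nlinarith [H.small, mul_nonneg hT.le (mul_nonneg hK'0
    (by linarith [H.nonneg_D] : 0 ≤ 8 * D + 2))]

end TransportSystem

/-! ### Convergence of the iteration -/

namespace TransportSystem

variable {ι : Type*} {T x0 x1 D K' : ℝ} {C S : ι → ℝ → (ι → ℝ → ℝ) → ℝ → ℝ} {b : ι → ℝ → ℝ → ℝ}
  {u0 u0' : ι → ℝ → ℝ}

theorem exists_adm (H : TransportSystem T x0 x1 D K' C S b u0 u0') :
    ∃ u u' : ι → ℝ → ℝ → ℝ, Adm T x0 x1 (8 * D + 2) b u u' := by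
  have hx := H.lt_x
  have hD := H.nonneg_D
  have h0T : (0 : ℝ) ∈ Icc 0 T := ⟨le_rfl, H.pos_T.le⟩
  have h1 : x1 ∈ Icc x0 x1 := ⟨hx.le, le_rfl⟩
  suffices h : ∀ i, ∃ v v' : ℝ → ℝ → ℝ, ContinuousOn (uncurry v) (Icc 0 T ×ˢ Ici x0) ∧
      (∀ t ∈ Icc 0 T, C11On (Ici x0) (8 * D + 2) (v t) (v' t)) ∧
      (∀ t ∈ Icc 0 T, ∀ x ∈ Icc x0 x1, v t x = b i t x) by
    choose v v' h1 h2 h3 using h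
    exact ⟨v, v', h1, h2, h3⟩
  intro i
  have hbc : Continuous (uncurry (b i)) := (H.smooth_b i).continuous
  have hdc : Continuous (uncurry (dx (b i))) := (contDiff_dx (H.smooth_b i)).continuous
  set α : ℝ → ℝ := fun t => b i t x1 - b i 0 x1 with hα
  set β : ℝ → ℝ := fun t => dx (b i) t x1 - dx (b i) 0 x1 with hβ
  have hsub : ∀ {p q : ℝ}, |p| ≤ D → |q| ≤ D → |p - q| ≤ 2 * D := fun hp hq =>
    (abs_sub _ _).trans (by linarith)
  have hα' : ∀ t ∈ Icc 0 T, |α t| ≤ 2 * D := fun t ht =>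
    hsub ((H.c11_b i t ht).bound x1 h1) ((H.c11_b i 0 h0T).bound x1 h1)
  have hβ' : ∀ t ∈ Icc 0 T, |β t| ≤ 2 * D := fun t ht =>
    hsub ((H.c11_b i t ht).bound' x1 h1) ((H.c11_b i 0 h0T).bound' x1 h1)
  set g : ℝ → ℝ → ℝ := fun t x => if x ≤ x1 then b i t x - b i 0 x
    else α t + β t * Real.sin (x - x1) with hg
  have hg11 : ∀ t ∈ Icc 0 T, ∃ g', C11On (Ici x0) (4 * D) (g t) g' := fun t ht => by
    refine ⟨_, C11On.glue (c := x1) (f := fun x => b i t x - b i 0 x)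
      (f' := fun x => dx (b i) t x - dx (b i) 0 x) (g := fun x => α t + β t * Real.sin (x - x1))
      (g' := fun x => β t * Real.cos (x - x1))
      ((((H.c11_b i t ht).sub (H.c11_b i 0 h0T)).mono (by linarith)).mono_set Ici_inter_Iic.subset)
      (C11On.of_hasDeriv ((convex_Ici x0).inter (convex_Ici x1)) (fun x _ => ?_) (fun x _ =>
        (abs_le_add rfl (hα' t ht) (abs_mul_le (hβ' t ht) (Real.abs_sin_le_one _))).trans ?_)
        (fun x _ => (abs_mul_le (hβ' t ht) (Real.abs_cos_le_one _)).trans ?_) fun x _ y _ => ?_)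
      hx.le (by simp [hα]) (by simp [hβ])⟩
    · simpa using (((hasDerivAt_id x).sub_const x1).sin.const_mul (β t)).const_add (α t)
        |>.hasDerivWithinAt
    · linarith
    · linarith
    · have := Real.abs_cos_sub_cos_le (y - x1) (x - x1)
      rw [sub_sub_sub_cancel_right] at this
      rw [← mul_sub]
      refine (abs_mul_le (hβ' t ht) this).trans ?_
      gcongr; norm_num
  have hgc : Continuous (uncurry g) := by
    refine Continuous.if_le (f := fun z : ℝ × ℝ => z.2) (g := fun _ => x1) (hbc.sub (hbc.comp
      (by fun_prop : Continuous fun z : ℝ × ℝ => ((0 : ℝ), z.2)))) ?_ continuous_snd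
      continuous_const ?_
    · have h3 (t : ℝ × ℝ → ℝ) (h : Continuous t) : Continuous fun z => (t z, x1) := by fun_prop
      exact ((hbc.comp (h3 _ continuous_fst)).sub continuous_const).add
        (((hdc.comp (h3 _ continuous_fst)).sub continuous_const).mul
        (Real.continuous_sin.comp (by fun_prop)))
    · rintro ⟨t, x⟩ (rfl : x = x1)
      simp [hα]
  choose! g' hg' using hg11
  refine ⟨fun t x => u0 i x + g t x, fun t x => u0' i x + g' t x, ?_, fun t ht =>
    ((H.c11_u0 i).add (hg' t ht)).mono (by linarith), fun t ht x hx => ?_⟩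
  · exact ((H.c11_u0 i).continuousOn.comp continuous_snd.continuousOn fun z hz => hz.2).add
      hgc.continuousOn
  · simp only [hg, if_pos hx.2, H.eq_u0 i x hx]; ring

theorem step_dist_le (H : TransportSystem T x0 x1 D K' C S b u0 u0')
    {u u' w w' v v' z z' : ι → ℝ → ℝ → ℝ} (hu : Adm T x0 x1 (8 * D + 2) b u u')
    (hw : Adm T x0 x1 (8 * D + 2) b w w') (hv : Adm T x0 x1 (8 * D + 2) b v v')
    (hz : Adm T x0 x1 (8 * D + 2) b z z')
    (hv0 : ∀ i, ∀ x ∈ Ici x0, v i 0 x = u0 i x) (hz0 : ∀ i, ∀ x ∈ Ici x0, z i 0 x = u0 i x)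
    (hvd : ∀ i, ∀ t ∈ Ioo 0 T, ∀ x ∈ Ioi x0, HasDerivAt (fun τ => v i τ x)
        (S i t (fun j => u j t) x - C i t (fun j => u j t) x * v' i t x) t)
    (hzd : ∀ i, ∀ t ∈ Ioo 0 T, ∀ x ∈ Ioi x0, HasDerivAt (fun τ => z i τ x)
        (S i t (fun j => w j t) x - C i t (fun j => w j t) x * z' i t x) t)
    {e : ℝ} (he : 0 ≤ e) (huw : ∀ i, ∀ t ∈ Icc 0 T, ∀ x ∈ Ici x0, |u i t x - w i t x| ≤ e) :
    ∀ i, ∀ t ∈ Icc 0 T, ∀ x ∈ Ici x0, |v i t x - z i t x| ≤ e / 8 := by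
  intro i t ht x hx
  have hT := H.pos_T
  have hD := H.nonneg_D
  have hI : Ioo 0 T ⊆ Icc 0 T := Ioo_subset_Icc_self
  have h0T : (0 : ℝ) ∈ Icc 0 T := ⟨le_rfl, hT.le⟩
  have hK' : 0 ≤ K' := by
    obtain ⟨c', hc⟩ := H.reg_C i 0 h0T _ _ fun j => hu.c11 j 0 h0T
    exact hc.nonneg self_mem_Ici
  refine (transport_abs_le (X := x + 1) (D := 0)
    (S := K' * e + K' * e * (8 * D + 2)) (w := fun t x => v i t x - z i t x)
    (c := fun t x => C i t (fun j => u j t) x) hT (lt_add_of_le_of_pos hx one_pos)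
    (((hv.cont i).sub (hz.cont i)).mono (prod_mono_right Icc_subset_Ici_self))
    (fun t ht x hx => (hvd i t ht x hx.1).sub (hzd i t ht x hx.1))
    (fun t ht x hx => ((hv.c11 i t (hI ht)).hasDerivAt (Ici_mem_nhds hx.1)).sub
      ((hz.c11 i t (hI ht)).hasDerivAt (Ici_mem_nhds hx.1)))
    (fun t ht x hx => H.pos_C i t (hI ht) _ x hx.1.le)
    (by positivity) (fun t ht x hx => ?_) (fun x hx => ?_) (fun t ht => ?_) t ht x
    ⟨hx, by linarith⟩).trans ?_
  · obtain ⟨hC, hS⟩ := H.lip i t (hI ht) _ _ _ _ (fun j => hu.c11 j t (hI ht))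
      (fun j => hw.c11 j t (hI ht)) x hx.1.le e he fun j y hy => huw j t (hI ht) y hy.1
    exact abs_le_add (by ring) hS ((abs_neg _).trans_le
      (abs_mul_le hC ((hz.c11 i t (hI ht)).bound' x hx.1.le)))
  · rw [hv0 i x hx.1, hz0 i x hx.1, sub_self, abs_zero]
  · have h1 : x0 ∈ Icc x0 x1 := ⟨le_rfl, H.lt_x.le⟩
    rw [hv.eq_b i t ht x0 h1, hz.eq_b i t ht x0 h1, sub_self, abs_zero]
  · have : (K' * e + K' * e * (8 * D + 2)) * t ≤ (K' * e + K' * e * (8 * D + 2)) * T := by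
      gcongr; exact ht.2
    nlinarith [H.small]

/-- Existence for diagonal quasilinear transport systems with causal coefficients. -/
theorem exists_solution (H : TransportSystem T x0 x1 D K' C S b u0 u0') :
    ∃ u u' : ι → ℝ → ℝ → ℝ, Adm T x0 x1 (8 * D + 2) b u u' ∧
      (∀ i, ∀ x ∈ Ici x0, u i 0 x = u0 i x) ∧
      ∀ i, ∀ t ∈ Ioo 0 T, ∀ x ∈ Ioi x0, HasDerivAt (fun τ => u i τ x)
        (S i t (fun j => u j t) x - C i t (fun j => u j t) x * u' i t x) t := by
  have h0T : (0 : ℝ) ∈ Icc 0 T := ⟨le_rfl, H.pos_T.le⟩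
  have hI : Ioo 0 T ⊆ Icc 0 T := Ioo_subset_Icc_self
  set K := 8 * D + 2 with hK
  have hK0 : 0 < K := by linarith [H.nonneg_D]
  choose Φ hΦ0 hΦd using show
      ∀ p : {p : (ι → ℝ → ℝ → ℝ) × (ι → ℝ → ℝ → ℝ) // Adm T x0 x1 K b p.1 p.2},
      ∃ q : {p : (ι → ℝ → ℝ → ℝ) × (ι → ℝ → ℝ → ℝ) // Adm T x0 x1 K b p.1 p.2},
      (∀ i, ∀ x ∈ Ici x0, q.1.1 i 0 x = u0 i x) ∧
      ∀ i, ∀ t ∈ Ioo 0 T, ∀ x ∈ Ioi x0, HasDerivAt (fun τ => q.1.1 i τ x)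
        (S i t (fun j => p.1.1 j t) x - C i t (fun j => p.1.1 j t) x * q.1.2 i t x) t from fun p => by
    obtain ⟨v, v', h1, h2, h3⟩ := H.exists_step p.2
    exact ⟨⟨(v, v'), h1⟩, h2, h3⟩
  obtain ⟨a, a', ha⟩ := H.exists_adm
  set U : ℕ → ι → ℝ → ℝ → ℝ := fun n => (Φ^[n] ⟨(a, a'), ha⟩).1.1 with hU
  set U' : ℕ → ι → ℝ → ℝ → ℝ := fun n => (Φ^[n] ⟨(a, a'), ha⟩).1.2 with hU'
  have hadm : ∀ n, Adm T x0 x1 K b (U n) (U' n) := fun n => (Φ^[n] ⟨(a, a'), ha⟩).2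
  have hini : ∀ n i, ∀ x ∈ Ici x0, U (n + 1) i 0 x = u0 i x := fun n => by
    simp only [hU, Function.iterate_succ_apply']; exact hΦ0 _
  have hder : ∀ n i, ∀ t ∈ Ioo 0 T, ∀ x ∈ Ioi x0, HasDerivAt (fun τ => U (n + 1) i τ x)
        (S i t (fun j => U n j t) x - C i t (fun j => U n j t) x * U' (n + 1) i t x) t := fun n => by
    simp only [hU, hU', Function.iterate_succ_apply']; exact hΦd _
  have hdist : ∀ n i, ∀ t ∈ Icc 0 T, ∀ x ∈ Ici x0,
      |U n i t x - U (n + 1) i t x| ≤ 2 * K * (1 / 8) ^ n := by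
    intro n
    induction n with
    | zero =>
      intro i t ht x hx
      refine (abs_sub _ _).trans ?_
      linarith [((hadm 1).c11 i t ht).bound x hx, ((hadm 0).c11 i t ht).bound x hx]
    | succ n ih =>
      intro i t ht x hx
      refine (H.step_dist_le (hadm n) (hadm (n + 1)) (hadm (n + 1)) (hadm (n + 2)) (hini _) (hini _)
        (hder _) (hder _) (by positivity) ih i t ht x hx).trans_eq ?_
      rw [pow_succ]; ring
  set E := 4 * K + (4 + 4 * K) * √(2 * K) with hE
  have hd0 : ∀ n i, ∀ t ∈ Icc 0 T, ∀ x ∈ Ici x0,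
      dist (U n i t x) (U (n + 1) i t x) ≤ E / 2 / 2 ^ n := fun n i t ht x hx =>
    (hdist n i t ht x hx).trans (by
      rw [one_div, inv_pow, ← div_eq_mul_inv]
      have : 0 ≤ (4 + 4 * K) * √(2 * K) := by positivity
      gcongr
      · linarith
      · norm_num)
  have hd1 : ∀ n i, ∀ t ∈ Icc 0 T, ∀ x ∈ Ici x0,
      dist (U' n i t x) (U' (n + 1) i t x) ≤ E / 2 / 2 ^ n := by
    intro n i t ht x hx
    refine ((((hadm n).c11 i t ht).sub ((hadm (n + 1)).c11 i t ht)).abs_deriv_le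
      (e := √(2 * K) * (1 / 2) ^ n) (by positivity) (fun y hy => ?_) hx).trans ?_
    · refine (hdist n i t ht y hy).trans ?_
      rw [mul_pow, Real.sq_sqrt (by positivity), ← pow_mul, mul_comm n, pow_mul]
      gcongr; norm_num
    · rw [one_div, inv_pow, ← mul_assoc, ← div_eq_mul_inv]
      gcongr; linarith
  choose! u u' huu using show ∀ i, ∀ t ∈ Icc 0 T, ∀ x ∈ Ici x0, ∃ l l' : ℝ,
      Tendsto (fun n => U n i t x) atTop (𝓝 l) ∧ Tendsto (fun n => U' n i t x) atTop (𝓝 l') from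
    fun i t ht x hx => by
      obtain ⟨l, hl⟩ := cauchySeq_tendsto_of_complete
        (cauchySeq_of_le_geometric_two fun n => hd0 n i t ht x hx)
      obtain ⟨l', hl'⟩ := cauchySeq_tendsto_of_complete
        (cauchySeq_of_le_geometric_two fun n => hd1 n i t ht x hx)
      exact ⟨l, l', hl, hl'⟩
  have hu1 : ∀ n i, ∀ t ∈ Icc 0 T, ∀ x ∈ Ici x0, |U n i t x - u i t x| ≤ E / 2 ^ n :=
    fun n i t ht x hx =>
      dist_le_of_le_geometric_two_of_tendsto (fun n => hd0 n i t ht x hx) (huu i t ht x hx).1 n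
  have hunif : ∀ {α : Type} {f : ℕ → α → ℝ} {g : α → ℝ} {s : Set α} {c : ℝ},
      (∀ n, ∀ z ∈ s, |f n z - g z| ≤ c * (E / 2 ^ n)) → TendstoUniformlyOn f g atTop s := by
    intro α f g s c h
    have h0 := (tendsto_const_nhds (x := E)).div_atTop (tendsto_pow_atTop_atTop_of_one_lt
      (one_lt_two (α := ℝ))) |>.const_mul c
    rw [mul_zero] at h0
    rw [Metric.tendstoUniformlyOn_iff]
    intro δ hδ
    filter_upwards [h0.eventually (gt_mem_nhds hδ)] with n hn z hz
    rw [dist_comm]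
    exact (h n z hz).trans_lt hn
  have hAdm : Adm T x0 x1 K b u u' := by
    refine ⟨fun i => ?_, fun i t ht => C11On.of_tendsto (fun n => (hadm n).c11 i t ht)
      (fun x hx => (huu i t ht x hx).1) fun x hx => (huu i t ht x hx).2, fun i t ht x hx => ?_⟩
    · exact (hunif (c := 1) (f := fun n => uncurry (U n i)) fun n z hz => by
        rw [one_mul]; exact hu1 n i z.1 hz.1 z.2 hz.2).continuousOn
        (Eventually.of_forall fun n => (hadm n).cont i).frequently
    · refine tendsto_nhds_unique (huu i t ht x hx.1).1 ?_
      simp only [fun n => (hadm n).eq_b i t ht x hx, tendsto_const_nhds]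
  refine ⟨u, u', hAdm, fun i x hx => ?_, fun i t ht x hx => ?_⟩
  · refine tendsto_nhds_unique ((tendsto_add_atTop_iff_nat 1).2 (huu i 0 h0T x hx).1) ?_
    simp only [fun n => hini n i x hx, tendsto_const_nhds]
  · have hx' : x ∈ Ici x0 := Ioi_subset_Ici_self hx
    refine hasDerivAt_of_tendstoUniformlyOn (s := Ioo 0 T) (l := atTop)
      (f := fun n τ => U (n + 1) i τ x) (f' := fun n t => S i t (fun j => U n j t) x -
        C i t (fun j => U n j t) x * U' (n + 1) i t x)
      (g' := fun t => S i t (fun j => u j t) x - C i t (fun j => u j t) x * u' i t x)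
      isOpen_Ioo (hunif (c := K' * (2 + K)) fun n τ hτ => ?_)
      (Eventually.of_forall fun n τ hτ => hder n i τ hτ x hx)
      (fun τ hτ => (tendsto_add_atTop_iff_nat (f := fun n => U n i τ x) 1).2
        (huu i τ (hI hτ) x hx').1) ht
    obtain ⟨hC, hS⟩ := H.lip i τ (hI hτ) _ _ _ _ (fun j => (hadm n).c11 j τ (hI hτ))
      (fun j => hAdm.c11 j τ (hI hτ)) x hx' (E / 2 ^ n) (by positivity)
      fun j y hy => hu1 n j τ (hI hτ) y hy.1
    obtain ⟨c', hc'⟩ := H.reg_C i τ (hI hτ) _ _ fun j => hAdm.c11 j τ (hI hτ)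
    have hb : |U' (n + 1) i τ x - u' i τ x| ≤ E / 2 ^ n :=
      (dist_le_of_le_geometric_two_of_tendsto (fun n => hd1 n i τ (hI hτ) x hx')
        (huu i τ (hI hτ) x hx').2 (n + 1)).trans (by gcongr <;> simp)
    exact (abs_le_add (by ring) hS ((abs_neg _).trans_le (abs_le_add rfl (abs_mul_le hC
      (((hadm (n + 1)).c11 i τ (hI hτ)).bound' x hx')) (abs_mul_le (hc'.bound x hx')
      hb)))).trans_eq (by ring)

end TransportSystem

/-! ### Bounded functions with bounded Lipschitz partial derivatives on a closed half-strip -/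

/-- `f` is bounded and Lipschitz in each variable on `[a, b] × [c, ∞)`. -/
def BddLip (a b c : ℝ) (f : ℝ → ℝ → ℝ) : Prop :=
  ∃ L, 0 ≤ L ∧ (∀ t ∈ Icc a b, ∀ x ∈ Ici c, |f t x| ≤ L) ∧
      (∀ t ∈ Icc a b, ∀ s ∈ Icc a b, ∀ x ∈ Ici c, |f s x - f t x| ≤ L * |s - t|) ∧
      ∀ t ∈ Icc a b, ∀ x ∈ Ici c, ∀ y ∈ Ici c, |f t y - f t x| ≤ L * |y - x|

/-- `f` and its partial derivatives of order at most `k` are bounded and Lipschitz on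
`[a, b] × [c, ∞)`. -/
def CB (a b c : ℝ) : ℕ → (ℝ → ℝ → ℝ) → Prop
  | 0, f => BddLip a b c f
  | k + 1, f => BddLip a b c f ∧ ∃ ft fx : ℝ → ℝ → ℝ, CB a b c k ft ∧ CB a b c k fx ∧
      (∀ t ∈ Icc a b, ∀ x ∈ Ici c, HasDerivWithinAt (fun s => f s x) (ft t x) (Icc a b) t) ∧
      ∀ t ∈ Icc a b, ∀ x ∈ Ici c, HasDerivWithinAt (f t) (fx t x) (Ici c) x

namespace CB

variable {a b c : ℝ} {k : ℕ} {f g : ℝ → ℝ → ℝ}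

theorem zero (h : CB a b c k f) : CB a b c 0 f := by
  cases k with
  | zero => exact h
  | succ k => exact h.1

theorem pred (h : CB a b c (k + 1) f) : CB a b c k f := by
  induction k generalizing f with
  | zero => exact h.1
  | succ k ih =>
    obtain ⟨h0, ft, fx, h1, h2, h3⟩ := h
    exact ⟨h0, ft, fx, ih h1, ih h2, h3⟩

theorem congr (h : CB a b c k f) (hfg : ∀ t ∈ Icc a b, ∀ x ∈ Ici c, g t x = f t x) :
    CB a b c k g := by
  have h0 : ∀ {f : ℝ → ℝ → ℝ}, CB a b c 0 f → (∀ t ∈ Icc a b, ∀ x ∈ Ici c, g t x = f t x) →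
      CB a b c 0 g := by
    rintro f ⟨L, hL, h1, h2, h3⟩ hfg
    refine ⟨L, hL, fun t ht x hx => ?_, fun t ht s hs x hx => ?_, fun t ht x hx y hy => ?_⟩
    · rw [hfg t ht x hx]; exact h1 t ht x hx
    · rw [hfg t ht x hx, hfg s hs x hx]; exact h2 t ht s hs x hx
    · rw [hfg t ht x hx, hfg t ht y hy]; exact h3 t ht x hx y hy
  cases k with
  | zero => exact h0 h hfg
  | succ k =>
    obtain ⟨h1, ft, fx, h2, h3, h4, h5⟩ := h
    exact ⟨h0 h1 hfg, ft, fx, h2, h3,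
      fun t ht x hx => (h4 t ht x hx).congr (fun s hs => hfg s hs x hx) (hfg t ht x hx),
      fun t ht x hx => (h5 t ht x hx).congr (fun y hy => hfg t ht y hy) (hfg t ht x hx)⟩

theorem const (r : ℝ) : CB a b c k (fun _ _ => r) := by
  induction k generalizing r with
  | zero =>
    exact ⟨|r|, abs_nonneg _, fun _ _ _ _ => le_rfl,
      fun _ _ _ _ _ _ => by rw [sub_self, abs_zero]; positivity,
      fun _ _ _ _ _ _ => by rw [sub_self, abs_zero]; positivity⟩
  | succ k ih =>
    refine ⟨(ih r).zero, fun _ _ => 0, fun _ _ => 0, ih 0, ih 0,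
      fun _ _ _ _ => hasDerivWithinAt_const _ _ _, fun _ _ _ _ => hasDerivWithinAt_const _ _ _⟩

/-- Composition with a function of class `C¹`. -/
theorem comp₂ {φ : ℝ × ℝ → ℝ} (hφ : ContDiff ℝ 1 φ) (hf : CB a b c 0 f) (hg : CB a b c 0 g) :
    CB a b c 0 (fun t x => φ (f t x, g t x)) := by
  obtain ⟨L, hL, h1, h2, h3⟩ := hf
  obtain ⟨L', hL', h1', h2', h3'⟩ := hg
  obtain ⟨N, hN⟩ := (isCompact_closedBall (0 : ℝ × ℝ) (L + L')).exists_bound_of_continuousOn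
    hφ.continuous.continuousOn
  obtain ⟨M, hM⟩ := (isCompact_closedBall (0 : ℝ × ℝ) (L + L')).exists_bound_of_continuousOn
    (hφ.continuous_fderiv one_ne_zero).continuousOn
  have hn : ∀ {p q r : ℝ}, |p| ≤ L * r → |q| ≤ L' * r → ‖(p, q)‖ ≤ (L + L') * r := fun hp hq =>
    (norm_prod_le_iff.2 ⟨hp.trans (le_add_of_nonneg_right ((abs_nonneg _).trans hq)),
      hq.trans (le_add_of_nonneg_left ((abs_nonneg _).trans hp))⟩).trans_eq (add_mul _ _ _).symm
  have hb : ∀ t ∈ Icc a b, ∀ x ∈ Ici c, (f t x, g t x) ∈ Metric.closedBall (0 : ℝ × ℝ) (L + L') :=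
    fun t ht x hx => mem_closedBall_zero_iff.2 (by
      simpa using hn (r := 1) (by simpa using h1 t ht x hx) (by simpa using h1' t ht x hx))
  have hl : ∀ {z w r}, z ∈ Metric.closedBall (0 : ℝ × ℝ) (L + L') →
      w ∈ Metric.closedBall (0 : ℝ × ℝ) (L + L') → 0 ≤ r → ‖w - z‖ ≤ (L + L') * r →
      |φ w - φ z| ≤ (|N| + |M| * (L + L')) * r := fun hz hw hr h =>
    ((convex_closedBall _ _).norm_image_sub_le_of_norm_fderiv_le
      (fun z _ => (hφ.differentiable one_ne_zero) z) hM hz hw).trans ((mul_le_mul (le_abs_self M) h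
      (norm_nonneg _) (abs_nonneg _)).trans (by nlinarith [mul_nonneg (abs_nonneg N) hr]))
  refine ⟨|N| + |M| * (L + L'), by positivity, fun t ht x hx => ((hN _ (hb t ht x hx)).trans
    (le_abs_self N)).trans (le_add_of_nonneg_right (by positivity)), fun t ht s hs x hx =>
    hl (hb t ht x hx) (hb s hs x hx) (abs_nonneg _) (hn (h2 t ht s hs x hx) (h2' t ht s hs x hx)),
    fun t ht x hx y hy => hl (hb t ht x hx) (hb t ht y hy) (abs_nonneg _) (hn (h3 t ht x hx y hy)
    (h3' t ht x hx y hy))⟩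

theorem add (hf : CB a b c k f) (hg : CB a b c k g) : CB a b c k (fun t x => f t x + g t x) := by
  induction k generalizing f g with
  | zero => exact hf.comp₂ (contDiff_fst.add contDiff_snd) hg
  | succ k ih =>
    obtain ⟨h1, ft, fx, h2, h3, h4, h5⟩ := hf
    obtain ⟨h1', gt, gx, h2', h3', h4', h5'⟩ := hg
    exact ⟨comp₂ (contDiff_fst.add contDiff_snd) h1 h1', _, _, ih h2 h2', ih h3 h3',
      fun t ht x hx => (h4 t ht x hx).add (h4' t ht x hx),
      fun t ht x hx => (h5 t ht x hx).add (h5' t ht x hx)⟩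

theorem mul (hf : CB a b c k f) (hg : CB a b c k g) : CB a b c k (fun t x => f t x * g t x) := by
  induction k generalizing f g with
  | zero => exact hf.comp₂ (contDiff_fst.mul contDiff_snd) hg
  | succ k ih =>
    have hf0 := hf.pred
    have hg0 := hg.pred
    obtain ⟨h1, ft, fx, h2, h3, h4, h5⟩ := hf
    obtain ⟨h1', gt, gx, h2', h3', h4', h5'⟩ := hg
    exact ⟨comp₂ (contDiff_fst.mul contDiff_snd) h1 h1', _, _, (ih h2 hg0).add (ih hf0 h2'), (ih h3 hg0).add (ih hf0 h3'),
      fun t ht x hx => (h4 t ht x hx).mul (h4' t ht x hx),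
      fun t ht x hx => (h5 t ht x hx).mul (h5' t ht x hx)⟩

theorem const_mul (r : ℝ) (hf : CB a b c k f) : CB a b c k (fun t x => r * f t x) :=
  (const r).mul hf

theorem neg (hf : CB a b c k f) : CB a b c k (fun t x => -f t x) :=
  (hf.const_mul (-1)).congr fun _ _ _ _ => by ring

theorem sub (hf : CB a b c k f) (hg : CB a b c k g) : CB a b c k (fun t x => f t x - g t x) :=
  (hf.add hg.neg).congr fun _ _ _ _ => sub_eq_add_neg _ _

protected theorem exp (hf : CB a b c k f) : CB a b c k (fun t x => exp (f t x)) := by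
  induction k generalizing f with
  | zero => exact hf.comp₂ contDiff_fst.exp hf
  | succ k ih =>
    have he := ih hf.pred
    obtain ⟨h1, ft, fx, h2, h3, h4, h5⟩ := hf
    exact ⟨comp₂ contDiff_fst.exp h1 h1, _, _, he.mul h2, he.mul h3,
      fun t ht x hx => (h4 t ht x hx).exp, fun t ht x hx => (h5 t ht x hx).exp⟩

protected theorem exp_neg {r : ℝ} (hr : 0 ≤ r) : CB a b c k (fun _ x => exp (-(r * x))) := by
  have h := C11On.exp_neg hr c
  have hn := h.nonneg self_mem_Ici
  have h0 : CB a b c 0 (fun _ x => exp (-(r * x))) :=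
    ⟨_, mul_nonneg zero_le_two hn, fun t _ x hx => (h.bound x hx).trans (by linarith),
      fun t _ s _ x _ => by rw [sub_self, abs_zero]; positivity, fun t _ x hx y hy => h.lip hx hy⟩
  induction k with
  | zero => exact h0
  | succ k ih =>
    exact ⟨h0, fun _ _ => 0, _, const 0, ih.const_mul (-r), fun t _ x _ =>
      hasDerivWithinAt_const _ _ _, fun t _ x hx => h.hasDerivWithinAt hx⟩

/-- Functions of the first variable. -/
theorem of_smooth {p : ℝ → ℝ} (hp : ContDiff ℝ ∞ p) : CB a b c k (fun t _ => p t) := by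
  have h0 : ∀ {p : ℝ → ℝ}, ContDiff ℝ ∞ p → CB a b c 0 (fun t _ => p t) := by
    intro p hp
    obtain ⟨L, hL⟩ := isCompact_Icc.exists_bound_of_continuousOn (s := Icc a b)
      hp.continuous.continuousOn
    obtain ⟨L', hL'⟩ := isCompact_Icc.exists_bound_of_continuousOn (s := Icc a b)
      (hp.continuous_deriv (by simp)).continuousOn
    refine ⟨max |L| |L'|, by positivity, fun t ht x _ => (hL t ht).trans
      ((le_abs_self _).trans (le_max_left _ _)), fun t ht s hs x _ => ?_, fun t _ x _ y _ => ?_⟩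
    · refine (convex_Icc a b).norm_image_sub_le_of_norm_deriv_le (f := p)
        (fun y _ => (hp.differentiable (by simp)) y) (fun y hy => (hL' y hy).trans
        ((le_abs_self _).trans (le_max_right _ _))) ht hs
    · rw [sub_self, abs_zero]; positivity
  induction k generalizing p with
  | zero => exact h0 hp
  | succ k ih =>
    have hd : ContDiff ℝ ∞ (deriv p) := (contDiff_infty_iff_deriv.1 hp).2
    exact ⟨h0 hp, _, fun _ _ => 0, ih hd, const 0,
      fun t _ x _ => ((hp.differentiable (by simp)) t).hasDerivAt.hasDerivWithinAt,
      fun t _ x _ => hasDerivWithinAt_const _ _ _⟩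

/-- Quadratic Taylor estimate in the first variable. -/
theorem taylor_fst {ft : ℝ → ℝ → ℝ} (hf : CB a b c 0 f) (hft : CB a b c 0 ft)
    (hd : ∀ t ∈ Icc a b, ∀ x ∈ Ici c, HasDerivWithinAt (fun s => f s x) (ft t x) (Icc a b) t) :
    ∃ K, ∀ x ∈ Ici c, C11On (Icc a b) K (fun t => f t x) (fun t => ft t x) := by
  obtain ⟨L, hL, h1, h2, -⟩ := hf
  obtain ⟨L', hL', h1', h2', -⟩ := hft
  exact ⟨max L L', fun x hx => C11On.of_hasDeriv (convex_Icc a b) (fun t ht => hd t ht x hx)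
    (fun t ht => (h1 t ht x hx).trans (le_max_left _ _))
    (fun t ht => (h1' t ht x hx).trans (le_max_right _ _))
    fun t ht s hs => (h2' t ht s hs x hx).trans (by gcongr; exact le_max_right _ _)⟩

theorem taylor_snd {fx : ℝ → ℝ → ℝ} (hf : CB a b c 0 f) (hfx : CB a b c 0 fx)
    (hd : ∀ t ∈ Icc a b, ∀ x ∈ Ici c, HasDerivWithinAt (f t) (fx t x) (Ici c) x) :
    ∃ K, ∀ t ∈ Icc a b, C11On (Ici c) K (f t) (fx t) := by
  obtain ⟨L, hL, h1, -, h2⟩ := hf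
  obtain ⟨L', hL', h1', -, h2'⟩ := hfx
  exact ⟨max L L', fun t ht => C11On.of_hasDeriv (convex_Ici c) (fun x hx => hd t ht x hx)
    (fun x hx => (h1 t ht x hx).trans (le_max_left _ _))
    (fun x hx => (h1' t ht x hx).trans (le_max_right _ _))
    fun x hx y hy => (h2' t ht x hx y hy).trans (by gcongr; exact le_max_right _ _)⟩

theorem continuousOn (hf : CB a b c k f) :
    ContinuousOn (uncurry f) (Icc a b ×ˢ Ici c) := by
  obtain ⟨L, hL, -, h2, h3⟩ := hf.zero
  exact continuousOn_prod_of_continuousOn_lipschitzOnWith _ L.toNNReal (fun t ht =>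
    (LipschitzOnWith.of_dist_le_mul (K := L.toNNReal) fun x hx y hy => by
      rw [Real.coe_toNNReal L hL]; exact h3 t ht y hy x hx).continuousOn) fun x hx =>
    LipschitzOnWith.of_dist_le_mul fun s hs t ht => by
      rw [Real.coe_toNNReal L hL]; exact h2 t ht s hs x hx

theorem hasFDerivWithinAt {ft fx : ℝ → ℝ → ℝ} (hf : CB a b c 0 f) (hft : CB a b c 0 ft) (hfx : CB a b c 0 fx)
    (hdt : ∀ t ∈ Icc a b, ∀ x ∈ Ici c, HasDerivWithinAt (fun s => f s x) (ft t x) (Icc a b) t)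
    (hdx : ∀ t ∈ Icc a b, ∀ x ∈ Ici c, HasDerivWithinAt (f t) (fx t x) (Ici c) x) :
    ∀ z ∈ Icc a b ×ˢ Ici c, HasFDerivWithinAt (uncurry f)
      (ft z.1 z.2 • ContinuousLinearMap.fst ℝ ℝ ℝ + fx z.1 z.2 • ContinuousLinearMap.snd ℝ ℝ ℝ)
      (Icc a b ×ˢ Ici c) z := by
  obtain ⟨K, hK⟩ := hf.taylor_fst hft hdt
  obtain ⟨K', hK'⟩ := hf.taylor_snd hfx hdx
  obtain ⟨L, hL, -, -, h3⟩ := hft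
  rintro ⟨t, x⟩ ⟨ht, hx⟩
  rw [hasFDerivWithinAt_iff_isLittleO]
  refine (Asymptotics.IsBigO.of_bound (K + K' + L) (g := fun z => ‖z - (t, x)‖ ^ 2) ?_).trans_isLittleO
    ((Asymptotics.isLittleO_pow_sub_sub _ one_lt_two).mono nhdsWithin_le_nhds)
  filter_upwards [self_mem_nhdsWithin]
  rintro ⟨s, y⟩ ⟨hs, hy⟩
  set n := ‖((s, y) : ℝ × ℝ) - (t, x)‖
  have n1 : |s - t| ≤ n := norm_fst_le ((s, y) - (t, x))
  have n2 : |y - x| ≤ n := norm_snd_le ((s, y) - (t, x))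
  rw [norm_eq_abs, norm_eq_abs, abs_of_nonneg (sq_nonneg n), add_mul, add_mul]
  refine abs_le_add (b := (f s y - f t y - ft t y * (s - t)) + (f t y - f t x - fx t x * (y - x)))
    (c := (ft t y - ft t x) * (s - t)) (by simp [uncurry]; ring) (abs_le_add rfl
    (((hK y hy).taylor t ht s hs).trans (mul_le_mul_of_nonneg_left ?_ ((hK x hx).nonneg ht)))
    (((hK' t ht).taylor x hx y hy).trans (mul_le_mul_of_nonneg_left ?_ ((hK' t ht).nonneg hx))))
    ((abs_mul_le ((h3 t ht x hx y hy).trans (mul_le_mul_of_nonneg_left n2 hL)) n1).trans_eq (by ring))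
  · rw [← sq_abs]; gcongr
  · rw [← sq_abs]; gcongr

theorem contDiffOn (hab : a < b) (hf : CB a b c k f) :
    ContDiffOn ℝ k (uncurry f) (Icc a b ×ˢ Ici c) := by
  induction k generalizing f with
  | zero =>
    rw [Nat.cast_zero, contDiffOn_zero]; exact hf.continuousOn
  | succ k ih =>
    have hu : UniqueDiffOn ℝ (Icc a b ×ˢ Ici c) :=
      (uniqueDiffOn_Icc hab).prod (uniqueDiffOn_Ici c)
    obtain ⟨h1, ft, fx, h2, h3, h4, h5⟩ := hf
    rw [Nat.cast_succ, contDiffOn_succ_iff_hasFDerivWithinAt_of_uniqueDiffOn hu]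
    refine ⟨fun h => absurd h (by simp), fun z => ft z.1 z.2 • ContinuousLinearMap.fst ℝ ℝ ℝ +
      fx z.1 z.2 • ContinuousLinearMap.snd ℝ ℝ ℝ, ?_, CB.hasFDerivWithinAt h1 h2.zero h3.zero h4 h5⟩
    exact ((ih h2).smul contDiffOn_const).add ((ih h3).smul contDiffOn_const)

theorem comp_log {p q T : ℝ} (hq : 0 < q) (hf : CB 0 T (log q) k f) :
    CB p (p + T) q k (fun t x => f (t - p) (log x)) := by
  have hm : ∀ {t}, t ∈ Icc p (p + T) → t - p ∈ Icc 0 T := fun h => ⟨by linarith [h.1], by linarith [h.2]⟩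
  have hl : ∀ {x}, x ∈ Ici q → log x ∈ Ici (log q) := fun h => log_le_log hq h
  have hpos : ∀ {x}, x ∈ Ici q → 0 < x := fun h => hq.trans_le h
  have hd : ∀ {x}, x ∈ Ici q → HasDerivWithinAt log x⁻¹ (Ici q) x := fun h =>
    (hasDerivAt_log (hpos h).ne').hasDerivWithinAt
  have h0 : ∀ {f : ℝ → ℝ → ℝ}, CB 0 T (log q) 0 f →
      CB p (p + T) q 0 (fun t x => f (t - p) (log x)) := by
    rintro f ⟨L, hL, h1, h2, h3⟩
    have hq' := mul_nonneg hL (inv_pos.2 hq).le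
    refine ⟨L + L * q⁻¹, by positivity, fun t ht x hx => (h1 _ (hm ht) _ (hl hx)).trans
      (by linarith), fun t ht s hs x hx => (h2 _ (hm ht) _ (hm hs) _ (hl hx)).trans ?_,
      fun t ht x hx y hy => (h3 _ (hm ht) _ (hl hx) _ (hl hy)).trans ((mul_le_mul_of_nonneg_left
        ((convex_Ici q).abs_image_sub_le (C := q⁻¹) (fun y hy => hd hy) (fun y hy => ?_) hx hy)
        hL).trans ?_)⟩
    · rw [sub_sub_sub_cancel_right]; gcongr; linarith
    · rw [abs_of_pos (inv_pos.2 (hpos hy))]; exact inv_anti₀ hq hy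
    · rw [← mul_assoc]; gcongr; linarith
  induction k generalizing f with
  | zero => exact h0 hf
  | succ k ih =>
    obtain ⟨h1, ft, fx, h2, h3, h4, h5⟩ := hf
    refine ⟨h0 h1, _, _, ih h2, (ih h3).mul ((ih (CB.exp_neg zero_le_one)).congr (g := fun _ x => x⁻¹)
      fun t _ x hx => by rw [one_mul, exp_neg, exp_log (hpos hx)]), fun t ht x hx => ?_,
      fun t ht x hx => (h5 _ (hm ht) _ (hl hx)).comp x (hd hx) fun y hy => hl hy⟩
    have := (h4 _ (hm ht) _ (hl hx)).scomp t (((hasDerivAt_id t).sub_const p).hasDerivWithinAt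
      (s := Icc p (p + T))) fun s hs => hm hs
    rwa [one_smul] at this

end CB

/-! ### Weighted integrals from the left end point, with a parameter -/

namespace CB

variable {a b c : ℝ} {k : ℕ} {f g : ℝ → ℝ → ℝ}

theorem continuousOn_slice (hf : CB a b c k f) {t : ℝ} (ht : t ∈ Icc a b) :
    ContinuousOn (f t) (Ici c) :=
  hf.continuousOn.comp (f := fun x => (t, x)) (by fun_prop) fun _ hx => ⟨ht, hx⟩

theorem intervalIntegrable (hf : CB a b c k f) (r : ℝ) {t x : ℝ} (ht : t ∈ Icc a b) (hx : x ∈ Ici c) :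
    IntervalIntegrable (fun y => exp (r * y) * f t y) volume c x :=
  ContinuousOn.intervalIntegrable (ContinuousOn.mul (by fun_prop) (by
    rw [uIcc_of_le hx]; exact (hf.continuousOn_slice ht).mono Icc_subset_Ici_self))

theorem hasDerivWithinAt_integral_param {ft : ℝ → ℝ → ℝ} {r r' C : ℝ}
    (hC : ∀ x, c ≤ x → exp (-(r * x)) * ∫ y in c..x, exp (r' * y) ≤ C)
    (hf : CB a b c 0 f) (hft : CB a b c 0 ft)
    (hd : ∀ t ∈ Icc a b, ∀ x ∈ Ici c, HasDerivWithinAt (fun s => f s x) (ft t x) (Icc a b) t)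
    {t x : ℝ} (ht : t ∈ Icc a b) (hx : x ∈ Ici c) :
    HasDerivWithinAt (fun t => exp (-(r * x)) * ∫ y in c..x, exp (r' * y) * f t y)
      (exp (-(r * x)) * ∫ y in c..x, exp (r' * y) * ft t y) (Icc a b) t := by
  obtain ⟨K, hK⟩ := taylor_fst hf hft hd
  refine hasDerivWithinAt_of_quadratic (K := C * K) fun s hs => ?_
  have e1 := hf.intervalIntegrable r' hs hx
  have e2 := hf.intervalIntegrable r' ht hx
  have e4 : exp (-(r * x)) * (∫ y in c..x, exp (r' * y) * f s y)
      - exp (-(r * x)) * (∫ y in c..x, exp (r' * y) * f t y)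
      - (exp (-(r * x)) * ∫ y in c..x, exp (r' * y) * ft t y) * (s - t)
      = exp (-(r * x)) * ∫ y in c..x, exp (r' * y) * (f s y - f t y - ft t y * (s - t)) := by
    rw [← mul_sub, ← intervalIntegral.integral_sub e1 e2, mul_assoc,
      ← intervalIntegral.integral_mul_const, ← mul_sub, ← intervalIntegral.integral_sub
      (e1.sub e2) ((hft.intervalIntegrable r' ht hx).mul_const _)]
    congr 2
    ext y; ring
  rw [e4, mul_assoc]
  exact weightedIntegral_abs_le hC hx (mul_nonneg ((hK c self_mem_Ici).nonneg ht) (sq_nonneg _))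
    fun y hy => (hK y hy.1).taylor t ht s hs

theorem integral {r r' C : ℝ} (hr : 0 ≤ r) (hrr : r' ≤ r)
    (hC : ∀ x, c ≤ x → exp (-(r * x)) * ∫ y in c..x, exp (r' * y) ≤ C) (hf : CB a b c k f) :
    CB a b c k (fun t x => exp (-(r * x)) * ∫ y in c..x, exp (r' * y) * f t y) := by
  have hC0 : 0 ≤ C := by simpa using hC c le_rfl
  have hE : ∀ {k}, CB a b c k fun _ x => exp (-((r - r') * x)) := CB.exp_neg (sub_nonneg.2 hrr)
  have h0 : ∀ {f : ℝ → ℝ → ℝ}, CB a b c 0 f →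
      CB a b c 0 (fun t x => exp (-(r * x)) * ∫ y in c..x, exp (r' * y) * f t y) := by
    intro f hf
    obtain ⟨L, hL, h1, h2, -⟩ := id hf
    obtain ⟨L', hL', h1', -, -⟩ := hE.mul hf
    have hb : ∀ t ∈ Icc a b, ∀ x ∈ Ici c,
        |exp (-(r * x)) * ∫ y in c..x, exp (r' * y) * f t y| ≤ C * L :=
      fun t ht x hx => weightedIntegral_abs_le hC hx hL fun y hy => h1 t ht y hy.1
    have p1 : 0 ≤ C * L := by positivity
    have p2 : 0 ≤ r * (C * L) + L' := by positivity
    refine ⟨C * L + (r * (C * L) + L'), by positivity, fun t ht x hx => (hb t ht x hx).trans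
      (by linarith), fun t ht s hs x hx => ?_, fun t ht x hx y hy =>
      ((convex_Ici c).abs_image_sub_le (fun x hx =>
      hasDerivWithinAt_weightedIntegral r r' (hf.continuousOn_slice ht) hx) (fun x hx =>
      abs_le_add rfl (abs_mul_le (by rw [abs_neg, abs_of_nonneg hr]) (hb t ht x hx)) (h1' t ht x hx))
      hx hy).trans (mul_le_mul_of_nonneg_right (by linarith) (abs_nonneg _))⟩
    rw [← mul_sub, ← intervalIntegral.integral_sub (hf.intervalIntegrable r' hs hx)
      (hf.intervalIntegrable r' ht hx)]
    simp only [← mul_sub]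
    refine (weightedIntegral_abs_le hC hx (k := L * |s - t|) (by positivity)
      fun y hy => h2 t ht s hs y hy.1).trans ?_
    rw [← mul_assoc]
    gcongr; linarith
  induction k generalizing f with
  | zero => exact h0 hf
  | succ k ih =>
    have hf0 := hf.pred
    obtain ⟨h1, ft, fx, h2, h3, h4, h5⟩ := hf
    exact ⟨h0 h1, _, _, ih h2, ((ih hf0).const_mul (-r)).add (hE.mul hf0),
      fun t ht x hx => hasDerivWithinAt_integral_param hC h1 h2.zero h4 ht hx,
      fun t ht x hx => hasDerivWithinAt_weightedIntegral r r' (continuousOn_slice (k := k) hf0 ht) hx⟩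

end CB

/-! ### Causal expressions -/

/-- Operators built from the unknowns, constants and decaying exponentials by sums, products,
exponentials and weighted integrals from the left end point. -/
inductive Causal {ι : Type*} (x0 : ℝ) : ((ι → ℝ → ℝ) → ℝ → ℝ) → Prop
  | proj (i : ι) : Causal x0 (fun v => v i)
  | const (r : ℝ) : Causal x0 (fun _ _ => r)
  | expNeg {r : ℝ} (hr : 0 ≤ r) : Causal x0 (fun _ x => exp (-(r * x)))
  | add {F G} : Causal x0 F → Causal x0 G → Causal x0 (fun v x => F v x + G v x)
  | mul {F G} : Causal x0 F → Causal x0 G → Causal x0 (fun v x => F v x * G v x)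
  | protected exp {F} : Causal x0 F → Causal x0 (fun v x => exp (F v x))
  | integral {F} {a b C : ℝ} (ha : 0 ≤ a) (hba : b ≤ a)
    (hC : ∀ x, x0 ≤ x → exp (-(a * x)) * ∫ y in x0..x, exp (b * y) ≤ C) : Causal x0 F →
    Causal x0 (fun v x => exp (-(a * x)) * ∫ y in x0..x, exp (b * y) * F v y)

namespace Causal

variable {ι : Type*} {x0 : ℝ} {F G : (ι → ℝ → ℝ) → ℝ → ℝ}

theorem const_mul (r : ℝ) (hF : Causal x0 F) : Causal x0 (fun v x => r * F v x) := (const r).mul hF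

theorem neg (hF : Causal x0 F) : Causal x0 (fun v x => -F v x) := by
  have := hF.const_mul (-1)
  simpa only [neg_one_mul] using this

theorem sub (hF : Causal x0 F) (hG : Causal x0 G) : Causal x0 (fun v x => F v x - G v x) := by
  have := hF.add hG.neg
  simpa only [← sub_eq_add_neg] using this

theorem good (hF : Causal x0 F) : Good x0 F := by
  induction hF with
  | proj i => exact Good.proj i
  | const r => exact Good.const r
  | expNeg hr => exact Good.of_fun (C11On.exp_neg hr x0)
  | add _ _ h1 h2 => exact h1.add h2
  | mul _ _ h1 h2 => exact h1.mul h2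
  | exp _ h => exact h.exp
  | integral ha hba hC _ h => exact h.integral ha hba hC

theorem cb {a b : ℝ} {k : ℕ} (hF : Causal x0 F) {u : ι → ℝ → ℝ → ℝ} (hu : ∀ i, CB a b x0 k (u i)) :
    CB a b x0 k (fun t x => F (fun i => u i t) x) := by
  induction hF with
  | proj i => exact hu i
  | const r => exact CB.const r
  | expNeg hr => exact CB.exp_neg hr
  | add _ _ h1 h2 => exact h1.add h2
  | mul _ _ h1 h2 => exact h1.mul h2
  | exp _ h => exact h.exp
  | integral ha hba hC _ h => exact h.integral ha hba hC

theorem continuousOn {a b : ℝ} (hab : a ≤ b) (hF : Causal x0 F) {u : ι → ℝ → ℝ → ℝ}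
    (hu : ∀ i, ContinuousOn (uncurry (u i)) (Icc a b ×ˢ Ici x0)) :
    ContinuousOn (uncurry fun t x => F (fun i => u i t) x) (Icc a b ×ˢ Ici x0) := by
  induction hF with
  | proj i => exact hu i
  | const r => exact continuousOn_const
  | expNeg hr => exact (by fun_prop : Continuous fun z : ℝ × ℝ => exp (-(_ * z.2))).continuousOn
  | add _ _ h1 h2 => exact h1.add h2
  | mul _ _ h1 h2 => exact h1.mul h2
  | exp _ h => exact h.rexp
  | @integral F r r' C ha hba hC _ h =>
    refine ContinuousOn.mul
      (by fun_prop : Continuous fun z : ℝ × ℝ => exp (-(r * z.2))).continuousOn ?_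
    set f : ℝ → ℝ → ℝ := fun t x => F (fun i => u i t) x
    have hc : Continuous fun z : ℝ × ℝ => f (projIcc a b hab z.1) (max z.2 x0) := by
      refine h.comp_continuous (f := fun z : ℝ × ℝ => ((projIcc a b hab z.1 : ℝ), max z.2 x0)) ?_
        fun z => ⟨(projIcc a b hab z.1).2, mem_Ici.2 (le_max_right _ _)⟩
      exact (continuous_subtype_val.comp (continuous_projIcc.comp continuous_fst)).prodMk (by fun_prop)
    have hc2 : Continuous fun z : ℝ × ℝ => ∫ y in x0..z.2,
        exp (r' * y) * f (projIcc a b hab z.1) (max y x0) := by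
      refine intervalIntegral.continuous_parametric_intervalIntegral_of_continuous
        (f := fun (z : ℝ × ℝ) y => exp (r' * y) * f (projIcc a b hab z.1) (max y x0)) ?_ continuous_snd
      exact Continuous.mul (by fun_prop) (hc.comp
        (by fun_prop : Continuous fun w : (ℝ × ℝ) × ℝ => (w.1.1, w.2)))
    refine hc2.continuousOn.congr ?_
    rintro ⟨t, x⟩ ⟨ht, hx⟩
    refine intervalIntegral.integral_congr fun y hy => ?_
    rw [uIcc_of_le hx] at hy
    simp only [projIcc_of_mem hab ht, max_eq_left hy.1, f]

end Causal

/-! ### Weak derivatives of continuously differentiable and of Lipschitz functions -/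

section Weak

variable {E : Type*} [NormedAddCommGroup E] [NormedSpace ℝ E] [MeasureSpace E]

theorem isWeakDeriv_zero {U : Set E} {v : E} {u : E → ℝ} (hu : LocallyIntegrableOn u U volume) :
    IsWeakDeriv U v 0 u u :=
  ⟨hu, hu, fun φ _ _ _ => by simp⟩

theorem IsWeakDeriv.succ_iff {U : Set E} {v : E} {j : ℕ} {u g h : E → ℝ}
    (h1 : IsWeakDeriv U v 1 u g) : IsWeakDeriv U v (j + 1) u h ↔ IsWeakDeriv U v j g h := by
  refine (and_iff_right h1.1).trans (Iff.trans ?_ (and_iff_right h1.2.1).symm)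
  refine and_congr_right fun _ => forall_congr' fun φ => forall_congr' fun hφ => forall_congr' fun hφc =>
    forall_congr' fun hφU => ?_
  set ψ : E → ℝ := fun y => iteratedFDeriv ℝ j φ y (fun _ => v) with hψ
  have hs : ContDiff ℝ ∞ (iteratedFDeriv ℝ j φ) :=
    hφ.iteratedFDeriv_right (m := ∞) (i := j) (by exact_mod_cast le_top)
  have hψs : ContDiff ℝ ∞ ψ :=
    (ContinuousMultilinearMap.apply ℝ (fun _ : Fin j => E) ℝ (fun _ => v)).contDiff.comp hs
  have hsub : tsupport ψ ⊆ tsupport φ := by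
    refine (closure_mono fun y hy => ?_).trans (tsupport_iteratedFDeriv_subset (𝕜 := ℝ) (f := φ) j)
    rw [Function.mem_support] at hy ⊢
    intro h0; apply hy; simp [hψ, h0]
  have e1 : ∀ y, iteratedFDeriv ℝ (j + 1) φ y (fun _ => v) = iteratedFDeriv ℝ 1 ψ y (fun _ => v) := by
    intro y
    have h2 : fderiv ℝ ψ y = _ := ((ContinuousMultilinearMap.apply ℝ (fun _ : Fin j => E) ℝ
      (fun _ => v)).hasFDerivAt.comp y ((hs.differentiable (by simp)) y).hasFDerivAt).fderiv
    rw [iteratedFDeriv_one_apply, iteratedFDeriv_succ_apply_left, h2]; rfl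
  simp only [e1]
  rw [h1.2.2 ψ hψs (hφc.of_isClosed_subset (isClosed_tsupport _) hsub) (hsub.trans hφU), pow_one, neg_one_mul, pow_succ, mul_neg_one, neg_mul, neg_inj]

theorem IsWeakDeriv.comp {U : Set E} {v : E} {j : ℕ} {u g h : E → ℝ} (h1 : IsWeakDeriv U v 1 u g)
    (hj : IsWeakDeriv U v j g h) : IsWeakDeriv U v (j + 1) u h := h1.succ_iff.2 hj

theorem weakSup_lt_top {U : Set E} (hU : MeasurableSet U) {v : E} {w : E → ℝ} {j : ℕ} {u g : E → ℝ}
    (h : IsWeakDeriv U v j u g) {C : ℝ} (hb : ∀ z ∈ U, |w z * g z| ≤ C) : weakSup U v w j u < ⊤ := by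
  refine (iInf₂_le g h).trans_lt
    ((eLpNormEssSup_le_of_ae_bound (C := C) ?_).trans_lt ENNReal.ofReal_lt_top)
  filter_upwards [ae_restrict_mem hU] with z hz using hb z hz

variable [BorelSpace E] [FiniteDimensional ℝ E] [(volume : Measure E).IsAddHaarMeasure]

theorem isWeakDeriv_of_hasLineDerivAt {U : Set E} (hU : IsOpen U) {v : E} {u u' : E → ℝ}
    (hu : ContinuousOn u U) (hu' : ContinuousOn u' U)
    (hd : ∀ z ∈ U, HasLineDerivAt ℝ u (u' z) z v) : IsWeakDeriv U v 1 u u' := by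
  refine ⟨hu.locallyIntegrableOn hU.measurableSet, hu'.locallyIntegrableOn hU.measurableSet,
    fun φ hφ hφc hφU => ?_⟩
  have hint : ∀ {w χ : E → ℝ}, ContinuousOn w U → Continuous χ → tsupport χ ⊆ tsupport φ →
      Integrable fun x => w x * χ x := fun {w χ} hw hχ hs =>
    have h := tsupport_mul_subset_right.trans hs
    ((hw.mul hχ.continuousOn).continuous_of_tsupport_subset hU (h.trans hφU)).integrable_of_hasCompactSupport
      (hφc.of_isClosed_subset (isClosed_tsupport _) h)
  have hset : ∀ {w χ : E → ℝ}, tsupport χ ⊆ tsupport φ →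
      ∫ x in U, w x * χ x = ∫ x, w x * χ x := fun {w χ} hs =>
    setIntegral_eq_integral_of_forall_compl_eq_zero fun x hx => by
      rw [image_eq_zero_of_notMem_tsupport (f := χ) fun h => hx (hφU (hs h)), mul_zero]
  set φ' : E → ℝ := fun x => fderiv ℝ φ x v with hφ'
  have hφ'c : Continuous φ' := (hφ.continuous_fderiv (by simp)).clm_apply continuous_const
  have hφ's : tsupport φ' ⊆ tsupport φ := tsupport_fderiv_apply_subset ℝ v
  have e1 : ∀ x, iteratedFDeriv ℝ 1 φ x (fun _ => v) = φ' x := fun x => iteratedFDeriv_one_apply _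
  simp only [e1]
  rw [hset hφ's, hset subset_rfl, pow_one, neg_one_mul]
  exact integral_bilinear_hasLineDerivAt_right_eq_neg_left_of_integrable
    (B := ContinuousLinearMap.mul ℝ ℝ) (hint hu' hφ.continuous subset_rfl) (hint hu hφ'c hφ's)
    (hint hu hφ.continuous subset_rfl) (fun x hx => hd x (hφU hx))
    fun x _ => ((hφ.differentiable (by simp)) x).hasFDerivAt.hasLineDerivAt v

theorem isWeakDeriv_of_lipschitzOnWith {U : Set E} (hU : IsOpen U) (v : E) {u : E → ℝ} {C : ℝ≥0}
    (hu : LipschitzOnWith C u U) :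
    ∃ F : E → ℝ, LipschitzWith C F ∧ EqOn u F U ∧ IsWeakDeriv U v 1 u (fun z => lineDeriv ℝ F z v) := by
  obtain ⟨F, hF, hE⟩ := hu.extend_real
  refine ⟨F, hF, hE, hu.continuousOn.locallyIntegrableOn hU.measurableSet,
    (hF.locallyIntegrable_lineDeriv v).locallyIntegrableOn U, fun φ hφ hφc hφU => ?_⟩
  obtain ⟨L, hL⟩ := hφ.lipschitzWith_of_hasCompactSupport hφc (by simp)
  have h1 := hF.integral_lineDeriv_mul_eq (μ := volume) hL hφc v
  have e1 : ∀ x, iteratedFDeriv ℝ 1 φ x (fun _ => v) = fderiv ℝ φ x v := fun x =>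
    iteratedFDeriv_one_apply _
  have e2 : ∀ x, lineDeriv ℝ φ x (-v) = -fderiv ℝ φ x v := fun x => by
    rw [((hφ.differentiable (by simp)) x).lineDeriv_eq_fderiv, map_neg]
  simp only [e1, pow_one, neg_one_mul]
  have e3 : ∫ x in U, u x * fderiv ℝ φ x v = ∫ x, F x * fderiv ℝ φ x v := by
    rw [setIntegral_congr_fun hU.measurableSet (g := fun x => F x * fderiv ℝ φ x v)
      fun x hx => by simp only [hE hx]]
    refine setIntegral_eq_integral_of_forall_compl_eq_zero fun x hx => ?_
    rw [image_eq_zero_of_notMem_tsupport (f := fun x => fderiv ℝ φ x v)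
      fun h => hx (hφU (tsupport_fderiv_apply_subset ℝ v h)), mul_zero]
  have e4 : ∫ x in U, lineDeriv ℝ F x v * φ x = ∫ x, lineDeriv ℝ F x v * φ x :=
    setIntegral_eq_integral_of_forall_compl_eq_zero fun x hx => by
      rw [image_eq_zero_of_notMem_tsupport fun h => hx (hφU h), mul_zero]
  rw [e3, e4, h1, ← integral_neg]
  exact integral_congr_ae (Eventually.of_forall fun x => by simp only [e2]; ring)

end Weak

theorem abs_lineDeriv_le_of_right {E : Type*} [NormedAddCommGroup E] [NormedSpace ℝ E]
    {F : E → ℝ} {z v : E} {B : ℝ} (hB : 0 ≤ B)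
    (h : ∀ᶠ s in 𝓝[>] (0 : ℝ), |F (z + s • v) - F z| ≤ B * s) : |lineDeriv ℝ F z v| ≤ B := by
  by_cases hd : LineDifferentiableAt ℝ F z v
  · have h1 : HasDerivAt (fun s : ℝ => F (z + s • v)) (lineDeriv ℝ F z v) 0 := hd.hasLineDerivAt
    have h2 := (hasDerivWithinAt_iff_tendsto_slope' (by simp)).1 (h1.hasDerivWithinAt (s := Ioi 0))
    refine le_of_tendsto h2.abs ?_
    filter_upwards [h, self_mem_nhdsWithin] with s hs hs0
    rw [slope_def_field, abs_div, sub_zero, abs_of_pos (mem_Ioi.1 hs0), div_le_iff₀ (mem_Ioi.1 hs0)]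
    simpa using hs
  · rw [lineDeriv_zero_of_not_lineDifferentiableAt hd, abs_zero]; exact hB

namespace CB

variable {a b c : ℝ} {k : ℕ} {f : ℝ → ℝ → ℝ}

theorem exists_lipschitzOnWith (hf : CB a b c k f) :
    ∃ L, LipschitzOnWith L (uncurry f) (Icc a b ×ˢ Ici c) := by
  obtain ⟨L, hL, -, h2, h3⟩ := hf.zero
  refine ⟨2 * L.toNNReal, LipschitzOnWith.of_dist_le_mul ?_⟩
  rintro ⟨t, x⟩ ⟨ht, hx⟩ ⟨s, y⟩ ⟨hs, hy⟩
  rw [Real.dist_eq, Prod.dist_eq, Real.dist_eq, Real.dist_eq]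
  push_cast
  rw [Real.coe_toNNReal L hL]
  have e4 : L * |t - s| ≤ L * max |t - s| |x - y| := by gcongr; exact le_max_left _ _
  have e5 : L * |x - y| ≤ L * max |t - s| |x - y| := by gcongr; exact le_max_right _ _
  simp only [uncurry]
  linarith [h2 s hs t ht x hx, h3 s hs y hy x hx, abs_sub_le (f t x) (f s x) (f s y)]

theorem subset_closed : Ioo a b ×ˢ Ioi c ⊆ Icc a b ×ˢ Ici c :=
  prod_mono Ioo_subset_Icc_self Ioi_subset_Ici_self

theorem isOpen_strip : IsOpen (Ioo a b ×ˢ Ioi c) := isOpen_Ioo.prod isOpen_Ioi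

theorem memLp (hf : CB a b c k f) :
    MemLp (uncurry f) ⊤ (volume.restrict (Ioo a b ×ˢ Ioi c)) := by
  have hc := hf.continuousOn.mono subset_closed
  obtain ⟨L, hL, h1, -⟩ := hf.zero
  refine memLp_top_of_bound (hc.aestronglyMeasurable isOpen_strip.measurableSet) L ?_
  filter_upwards [ae_restrict_mem isOpen_strip.measurableSet] with z hz
  exact h1 z.1 (Ioo_subset_Icc_self hz.1) z.2 (Ioi_subset_Ici_self hz.2)

theorem memW (hf : CB a b c k f) : MemW (Ioo a b ×ˢ Ioi c) (k + 1) (uncurry f) := by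
  induction k generalizing f with
  | zero =>
    refine ⟨hf.memLp, fun v => ?_⟩
    obtain ⟨L, hL⟩ := hf.exists_lipschitzOnWith
    obtain ⟨F, hF, -, hw⟩ := isWeakDeriv_of_lipschitzOnWith isOpen_strip v (hL.mono subset_closed)
    exact ⟨_, hw, (hF.memLp_lineDeriv v).restrict _⟩
  | succ k ih =>
    refine ⟨hf.memLp, fun v => ?_⟩
    obtain ⟨h1, ft, fx, h2, h3, h4, h5⟩ := hf
    have hg := (h2.const_mul v.1).add (h3.const_mul v.2)
    refine ⟨_, isWeakDeriv_of_hasLineDerivAt isOpen_strip ?_ ?_ fun z hz => ?_, ih hg⟩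
    · exact (CB.continuousOn (k := 0) h1).mono subset_closed
    · exact hg.continuousOn.mono subset_closed
    · have := (CB.hasFDerivWithinAt h1 h2.zero h3.zero h4 h5 z (subset_closed hz)).hasFDerivAt
        (mem_of_superset (isOpen_strip.mem_nhds hz) subset_closed)
      have h6 := this.hasLineDerivAt v
      have e : (ft z.1 z.2 • ContinuousLinearMap.fst ℝ ℝ ℝ + fx z.1 z.2 • ContinuousLinearMap.snd ℝ ℝ ℝ) v
        = uncurry (fun t x => v.1 * ft t x + v.2 * fx t x) z := by
        simp [uncurry]; ring
      rwa [e] at h6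

/-- The last weak `q`-derivative of a weighted norm. -/
theorem exists_isWeakDeriv_weighted {p T q r : ℝ} (hq : 0 < q) (hr : 0 ≤ r)
    {G : ℝ → ℝ → ℝ} (hG : CB 0 T (log q) 0 G) :
    ∃ g C, IsWeakDeriv (Ioo p (p + T) ×ˢ Ioi q) ((0, 1) : ℝ × ℝ) 1
      (fun z : ℝ × ℝ => z.2 ^ (-r) * G (z.1 - p) (log z.2)) g ∧
      ∀ z ∈ Ioo p (p + T) ×ˢ Ioi q, |z.2 ^ (r + 1) * g z| ≤ C := by
  have hY : CB 0 T (log q) 0 fun t x => exp (-(r * x)) * G t x := (CB.exp_neg hr).mul hG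
  obtain ⟨L, hL⟩ := (hY.comp_log (p := p) hq).exists_lipschitzOnWith
  have hpos : ∀ {x}, x ∈ Ioi q → 0 < x := fun h => hq.trans h
  have hrw : ∀ x ∈ Ioi q, x ^ (-r) = exp (-(r * log x)) := fun x hx => by
    rw [rpow_def_of_pos (hpos hx)]; ring_nf
  have hL' : LipschitzOnWith L (fun z : ℝ × ℝ => z.2 ^ (-r) * G (z.1 - p) (log z.2))
      (Ioo p (p + T) ×ˢ Ioi q) := by
    intro z hz w hw
    have := (hL.mono subset_closed) hz hw
    simp only [uncurry, ← hrw _ hz.2, ← hrw _ hw.2] at this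
    exact this
  obtain ⟨F, -, hE, hw⟩ := isWeakDeriv_of_lipschitzOnWith isOpen_strip (0, 1) hL'
  obtain ⟨K, hK, h1, -, h3⟩ := hG
  refine ⟨_, K * (1 + r), hw, fun z hz => ?_⟩
  obtain ⟨y, x⟩ := z
  have hx0 : 0 < x := hpos hz.2
  have hyT : y - p ∈ Icc 0 T := ⟨by linarith [hz.1.1], by linarith [hz.1.2]⟩
  have hlx : log q ≤ log x := log_le_log hq (le_of_lt hz.2)
  have hwt : 0 < x ^ (-r) := rpow_pos_of_pos hx0 _
  have key := abs_lineDeriv_le_of_right (F := F) (z := (y, x)) (v := ((0, 1) : ℝ × ℝ))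
    (B := x ^ (-(r + 1)) * (K * (1 + r))) (by positivity) ?_
  · rw [abs_mul, abs_of_pos (rpow_pos_of_pos hx0 _)]
    calc _ ≤ x ^ (r + 1) * (x ^ (-(r + 1)) * (K * (1 + r))) := by gcongr
      _ = x ^ (r + 1) * x ^ (-(r + 1)) * (K * (1 + r)) := by ring
      _ = _ := by rw [← rpow_add hx0]; simp
  · filter_upwards [self_mem_nhdsWithin] with s hs
    have hs0 : 0 < s := hs
    have hz' : ((y, x + s) : ℝ × ℝ) ∈ Ioo p (p + T) ×ˢ Ioi q :=
      ⟨hz.1, by have : q < x := hz.2; simp only [mem_Ioi]; linarith⟩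
    have e : ((y, x) : ℝ × ℝ) + s • ((0, 1) : ℝ × ℝ) = (y, x + s) := by simp
    rw [e, ← hE hz, ← hE hz']
    simp only
    set d := log (x + s) - log x with hd'
    have hl : d ≤ s / x := by
      rw [hd', ← Real.log_div (by positivity) hx0.ne']
      refine (Real.log_le_sub_one_of_pos (by positivity)).trans_eq ?_
      field_simp; ring
    have hd : 0 ≤ d := sub_nonneg.2 (log_le_log hx0 (by linarith))
    have hlx' : log q ≤ log (x + s) := hlx.trans (sub_nonneg.1 hd)
    have e1 : (x + s) ^ (-r) = x ^ (-r) * exp (-(r * d)) := by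
      rw [hrw _ hz.2, hrw _ hz'.2, ← exp_add, hd']; ring_nf
    have e2 : 0 ≤ r * d := mul_nonneg hr hd
    have e3 : |exp (-(r * d)) - 1| ≤ r * d := abs_le.2
      ⟨by linarith [add_one_le_exp (-(r * d))], by linarith [Real.exp_le_one_iff.2 (neg_nonpos.2 e2)]⟩
    have e4 := abs_mul_le (abs_of_pos hwt).le (abs_le_add rfl
      (abs_mul_le e3 (h1 _ hyT _ hlx')) (h3 _ hyT _ hlx _ hlx'))
    calc _ = _ := by congr 1; rw [e1]; ring
      _ ≤ _ := e4
      _ = x ^ (-r) * (K * (1 + r) * d) := by rw [abs_of_nonneg hd]; ring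
      _ ≤ x ^ (-r) * (K * (1 + r) * (s / x)) := by gcongr
      _ = _ := by rw [neg_add', Real.rpow_sub_one hx0.ne']; ring

end CB

/-! ### Existence and regularity for systems with causal coefficients -/

variable {ι κ : Type*}

/-- The unknowns together with parameters depending on time only. -/
def withParam (v : ι → ℝ → ℝ) (π : κ → ℝ) : ι ⊕ κ → ℝ → ℝ := Sum.elim v fun k _ => π k

notation "join[" u ", " π ", " t "]" => withParam (fun j => u j t) fun k => π k t

theorem c11_withParam {x0 K P : ℝ} {v v' : ι → ℝ → ℝ} {π : κ → ℝ} (hv : ∀ j, C11On (Ici x0) K (v j) (v' j))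
    (hπ : ∀ k, |π k| ≤ P) (j : ι ⊕ κ) :
    C11On (Ici x0) (max K P) (withParam v π j) (Sum.elim v' (fun _ _ => 0) j) := by
  cases j with
  | inl j => exact (hv j).mono (le_max_left _ _)
  | inr k => exact (C11On.const (π k)).mono ((hπ k).trans (le_max_right _ _))

theorem exists_bounds [Finite ι] {x0 : ℝ} {C S : ι → ((ι ⊕ κ → ℝ → ℝ) → ℝ → ℝ)}
    (hC : ∀ i, Causal x0 (C i)) (hS : ∀ i, Causal x0 (S i)) (K P : ℝ) :
    ∃ K' > 0, ∀ i, ∀ π : κ → ℝ, (∀ k, |π k| ≤ P) →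
      ∀ v v' : ι → ℝ → ℝ, (∀ j, C11On (Ici x0) K (v j) (v' j)) →
      (∃ c', C11On (Ici x0) K' (C i (withParam v π)) c') ∧
      (∃ s', C11On (Ici x0) K' (S i (withParam v π)) s') ∧
      ∀ w w' : ι → ℝ → ℝ, (∀ j, C11On (Ici x0) K (w j) (w' j)) →
      ∀ X ∈ Ici x0, ∀ e, 0 ≤ e → (∀ j, ∀ y ∈ Icc x0 X, |v j y - w j y| ≤ e) →
        |C i (withParam v π) X - C i (withParam w π) X| ≤ K' * e ∧
        |S i (withParam v π) X - S i (withParam w π) X| ≤ K' * e := by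
  have hF : ∀ j, Causal x0 (Sum.elim C S j) := by rintro (i | i); exacts [hC i, hS i]
  choose K1 h1 using fun j => (hF j).good.reg (max K P)
  choose K2 _ h2 using fun j => (hF j).good.est (max K P)
  obtain ⟨B, hB⟩ := Finite.bddAbove_range fun j => max (K1 j) (K2 j)
  have hle : ∀ j, K1 j ≤ max B 1 ∧ K2 j ≤ max B 1 := fun j =>
    max_le_iff.1 ((hB ⟨j, rfl⟩).trans (le_max_left _ _))
  have key : ∀ j (π : κ → ℝ), (∀ k, |π k| ≤ P) → ∀ v v' : ι → ℝ → ℝ,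
      (∀ j, C11On (Ici x0) K (v j) (v' j)) →
      (∃ c', C11On (Ici x0) (max B 1) (Sum.elim C S j (withParam v π)) c') ∧
      ∀ w w' : ι → ℝ → ℝ, (∀ j, C11On (Ici x0) K (w j) (w' j)) → ∀ X ∈ Ici x0, ∀ e, 0 ≤ e →
        (∀ j, ∀ y ∈ Icc x0 X, |v j y - w j y| ≤ e) →
        |Sum.elim C S j (withParam v π) X - Sum.elim C S j (withParam w π) X| ≤ max B 1 * e := by
    refine fun j π hπ v v' hv => ⟨?_, fun w w' hw X hX e he h => ?_⟩
    · obtain ⟨c', hc⟩ := h1 j _ _ (c11_withParam hv hπ)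
      exact ⟨c', hc.mono (hle j).1⟩
    · refine ((h2 j X hX (withParam v π) (withParam w π)
        (fun j => (c11_withParam hv hπ j).continuousOn.mono Icc_subset_Ici_self)
        (fun j => (c11_withParam hw hπ j).continuousOn.mono Icc_subset_Ici_self)
        (fun j y hy => (c11_withParam hv hπ j).bound y hy.1)
        (fun j y hy => (c11_withParam hw hπ j).bound y hy.1)).2 e he ?_).trans
        (mul_le_mul_of_nonneg_right (hle j).2 he)
      rintro (j | k) y hy
      · exact h j y hy
      · simpa [withParam] using he
  refine ⟨max B 1, by positivity, fun i π hπ v v' hv => ⟨(key (.inl i) π hπ v v' hv).1,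
    (key (.inr i) π hπ v v' hv).1, fun w w' hw X hX e he h => ⟨?_, ?_⟩⟩⟩
  exacts [(key (.inl i) π hπ v v' hv).2 w w' hw X hX e he h,
    (key (.inr i) π hπ v v' hv).2 w w' hw X hX e he h]

theorem abs_le_of_hasDerivWithinAt_right {f : ℝ → ℝ} {f' x B : ℝ}
    (hf : HasDerivWithinAt f f' (Ici x) x) (h : ∀ y > x, |f y - f x| ≤ B * (y - x)) : |f'| ≤ B := by
  have h2 := (hasDerivWithinAt_iff_tendsto_slope' (by simp)).1 (hf.mono Ioi_subset_Ici_self)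
  refine le_of_tendsto h2.abs ?_
  filter_upwards [self_mem_nhdsWithin] with y hy
  have hy0 : 0 < y - x := sub_pos.2 hy
  rw [slope_def_field, abs_div, abs_of_pos hy0, div_le_iff₀ hy0]
  exact h y hy

/-- A uniformly `C^{1,1}` family in `x` which solves a transport equation with bounded Lipschitz
coefficients has bounded Lipschitz first derivatives in both variables. -/
theorem CB.of_transport {T c K : ℝ} {u u' C S : ℝ → ℝ → ℝ}
    (hu : ∀ t ∈ Icc 0 T, C11On (Ici c) K (u t) (u' t))
    (hd : ∀ t ∈ Icc 0 T, ∀ x ∈ Ici c,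
      HasDerivWithinAt (fun τ => u τ x) (S t x - C t x * u' t x) (Icc 0 T) t)
    (hC : CB 0 T c 0 C) (hS : CB 0 T c 0 S) (hT : 0 ≤ T) : CB 0 T c 0 u' := by
  have hK : 0 ≤ K := (hu 0 ⟨le_rfl, hT⟩).nonneg self_mem_Ici
  obtain ⟨L, hL, h1, -, h3⟩ := hC
  obtain ⟨L', hL', -, -, h3'⟩ := hS
  set B := L' + (L * (2 * K) + L * K) with hB
  have hB0 : 0 ≤ B := by positivity
  have hG : ∀ t ∈ Icc 0 T, ∀ x ∈ Ici c, ∀ y ∈ Ici c,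
      |S t y - C t y * u' t y - (S t x - C t x * u' t x)| ≤ B * |y - x| := fun t ht x hx y hy =>
    (abs_le_add (c := -(C t y * (u' t y - u' t x) + (C t y - C t x) * u' t x)) (by ring)
      (h3' t ht x hx y hy) ((abs_neg _).trans_le (abs_le_add rfl
        (abs_mul_le (h1 t ht y hy) ((hu t ht).lip_deriv hx hy))
        (abs_mul_le (h3 t ht x hx y hy) ((hu t ht).bound' x hx))))).trans_eq (by rw [hB]; ring)
  refine ⟨2 * K + B, by positivity, fun t ht x hx => ((hu t ht).bound' x hx).trans (by linarith),
    fun t ht s hs x hx => ?_, fun t ht x hx y hy => ((hu t ht).lip_deriv hx hy).trans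
      (by gcongr; linarith)⟩
  have hcx : Ici x ⊆ Ici c := Ici_subset_Ici.2 hx
  have key := abs_le_of_hasDerivWithinAt_right (f := fun y => u s y - u t y) (x := x)
    (B := B * |s - t|) ((((hu s hs).hasDerivWithinAt hx).sub ((hu t ht).hasDerivWithinAt hx)).mono hcx)
    fun y hy => ?_
  · exact key.trans (by gcongr; linarith)
  · have hy' : y ∈ Ici c := hcx hy.le
    have := (convex_Icc 0 T).abs_image_sub_le (f := fun τ => u τ y - u τ x)
      (fun τ hτ => (hd τ hτ y hy').sub (hd τ hτ x hx)) (fun τ hτ => hG τ hτ x hx y hy') ht hs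
    rwa [abs_of_pos (sub_pos.2 hy), mul_right_comm, sub_sub_sub_comm] at this

theorem CB.of_slices {T c K K' : ℝ} {u u' ut : ℝ → ℝ → ℝ} (hT : 0 ≤ T)
    (hu : ∀ t ∈ Icc 0 T, C11On (Ici c) K (u t) (u' t))
    (hd : ∀ t ∈ Icc 0 T, ∀ x ∈ Ici c, HasDerivWithinAt (fun τ => u τ x) (ut t x) (Icc 0 T) t)
    (hb : ∀ t ∈ Icc 0 T, ∀ x ∈ Ici c, |ut t x| ≤ K') : CB 0 T c 0 u := by
  have hK : 0 ≤ K := (hu 0 ⟨le_rfl, hT⟩).nonneg self_mem_Ici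
  have hK' : 0 ≤ K' := (abs_nonneg _).trans (hb 0 ⟨le_rfl, hT⟩ c self_mem_Ici)
  refine ⟨2 * K + K', by positivity, fun t ht x hx => ((hu t ht).bound x hx).trans (by linarith),
    fun t ht s hs x hx => ((convex_Icc 0 T).abs_image_sub_le (fun τ hτ => hd τ hτ x hx)
      (fun τ hτ => hb τ hτ x hx) ht hs).trans (by gcongr; linarith),
    fun t ht x hx y hy => ((hu t ht).lip hx hy).trans (by gcongr; linarith)⟩

/-- Local existence with regularity for diagonal quasilinear transport systems whose coefficients
are causal expressions; the existence time depends only on the size of the data. -/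
theorem exists_causal_solution [Finite ι] {x0 : ℝ} {C S : ι → ((ι ⊕ κ → ℝ → ℝ) → ℝ → ℝ)}
    (hC : ∀ i, Causal x0 (C i)) (hS : ∀ i, Causal x0 (S i)) (hpos : ∀ i v x, 0 ≤ C i v x)
    {D P : ℝ} (hD : 0 ≤ D) :
    ∃ K' > 0, ∃ T0 > 0, ∀ T, 0 < T → T < T0 → ∀ x1 > x0, ∀ (π : κ → ℝ → ℝ),
      (∀ k, ContDiff ℝ ∞ (π k)) → (∀ k, ∀ t ∈ Icc 0 T, |π k t| ≤ P) →
      ∀ (b : ι → ℝ → ℝ → ℝ) (u0 u0' : ι → ℝ → ℝ),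
      (∀ i, ContDiff ℝ ∞ (uncurry (b i))) → (∀ i, HasCompactSupport (uncurry (b i))) →
      (∀ i, ∀ t ∈ Icc 0 T, C11On (Icc x0 x1) D (b i t) (dx (b i) t)) →
      (∀ i, C11On (Ici x0) D (u0 i) (u0' i)) → (∀ i, ∀ x ∈ Icc x0 x1, u0 i x = b i 0 x) →
      (∀ i, ∀ t ∈ Icc 0 T, ∀ v v' : ι → ℝ → ℝ, (∀ j, C11On (Ici x0) (8 * D + 2) (v j) (v' j)) →
        (∀ j, ∀ x ∈ Icc x0 x1, v j x = b j t x) → ∀ x ∈ Icc x0 x1,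
        dt (b i) t x + C i (withParam v fun k => π k t) x * dx (b i) t x =
          S i (withParam v fun k => π k t) x) →
      ∃ u u' : ι → ℝ → ℝ → ℝ, (∀ i, CB 0 T x0 1 (u i)) ∧ (∀ i, CB 0 T x0 0 (u' i)) ∧
        (∀ i, ∀ x ∈ Ici x0, u i 0 x = u0 i x) ∧
        (∀ i, ∀ t ∈ Icc 0 T, ∀ x ∈ Icc x0 x1, u i t x = b i t x) ∧
        (∀ i, ∀ t ∈ Icc 0 T, ∀ x ∈ Ici x0, HasDerivWithinAt (fun τ => u i τ x)
          (S i join[u, π, t] x - C i join[u, π, t] x * u' i t x) (Icc 0 T) t) ∧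
        (∀ i, ∀ t ∈ Icc 0 T, ∀ x ∈ Ici x0, HasDerivWithinAt (u i t) (u' i t x) (Ici x0) x) ∧
        ∀ i, ∀ t ∈ Icc 0 T, ∀ x ∈ Ici x0, |S i join[u, π, t] x| ≤ K' := by
  obtain ⟨K', hK', hb⟩ := exists_bounds hC hS (8 * D + 2) P
  refine ⟨K', hK', 1 / 8 / (K' * (1 + (8 * D + 2))), by positivity,
    fun T hT0 hT x1 hx1 π hπs hπ b u0 u0' hbs hbc hb11 hu0 hb0 hcompat => ?_⟩
  have hparc : ∀ {u : ι → ℝ → ℝ → ℝ}, (∀ j, ContinuousOn (uncurry (u j)) (Icc 0 T ×ˢ Ici x0)) →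
      ∀ j, ContinuousOn (uncurry fun t => join[u, π, t] j) (Icc 0 T ×ˢ Ici x0) := by
    rintro u hu (j | k)
    · exact hu j
    · exact ((hπs k).continuous.comp continuous_fst).continuousOn
  have hπ' : ∀ t ∈ Icc 0 T, ∀ k, |π k t| ≤ P := fun t ht k => hπ k t ht
  have H : TransportSystem T x0 x1 D K' (fun i t v => C i (withParam v fun k => π k t))
      (fun i t v => S i (withParam v fun k => π k t)) b u0 u0' :=
    { pos_T := hT0
      lt_x := hx1
      nonneg_D := hD
      small := by rw [lt_div_iff₀ (by positivity)] at hT; exact hT.le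
      smooth_b := hbs
      supp_b := hbc
      c11_b := hb11
      c11_u0 := hu0
      eq_u0 := hb0
      reg_C := fun i t ht v v' hv => (hb i _ (hπ' t ht) v v' hv).1
      pos_C := fun i t _ v x _ => hpos i _ x
      reg_S := fun i t ht v v' hv => (hb i _ (hπ' t ht) v v' hv).2.1
      cont_C := fun i u _ hu _ => (hC i).continuousOn hT0.le (u := fun j t => join[u, π, t] j) (hparc hu)
      cont_S := fun i u _ hu _ => (hS i).continuousOn hT0.le (u := fun j t => join[u, π, t] j) (hparc hu)
      lip := fun i t ht v v' w w' hv hw => (hb i _ (hπ' t ht) v v' hv).2.2 w w' hw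
      compat := hcompat }
  obtain ⟨u, u', hadm, hini, hder⟩ := H.exists_solution
  have hcC := fun i => H.cont_C i u u' hadm.cont hadm.c11
  have hcS := fun i => H.cont_S i u u' hadm.cont hadm.c11
  have hcu' : ∀ i, ContinuousOn (uncurry (u' i)) (Icc 0 T ×ˢ Ici x0) := fun i =>
    continuousOn_deriv_of_c11 (isUpperSet_Ici x0) (hadm.c11 i) (hadm.cont i)
  have hdt : ∀ i, ∀ t ∈ Icc 0 T, ∀ x ∈ Ici x0, HasDerivWithinAt (fun τ => u i τ x)
      (S i join[u, π, t] x - C i join[u, π, t] x * u' i t x) (Icc 0 T) t := by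
    intro i t ht x hx
    rcases le_or_gt x x1 with hxx | hxx
    · have hxI : x ∈ Icc x0 x1 := ⟨hx, hxx⟩
      have h1 : u' i t x = dx (b i) t x := by
        refine (uniqueDiffOn_Icc hx1 x hxI).eq_deriv _
          (((hadm.c11 i t ht).hasDerivWithinAt hx).mono Icc_subset_Ici_self) ?_
        exact (hasDerivAt_dx (hbs i) t x).hasDerivWithinAt.congr (fun y hy => hadm.eq_b i t ht y hy)
          (hadm.eq_b i t ht x hxI)
      have h2 := hcompat i t ht _ _ (fun j => hadm.c11 j t ht) (fun j => hadm.eq_b j t ht) x hxI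
      refine ((hasDerivAt_dt (hbs i) t x).hasDerivWithinAt.congr
        (fun τ hτ => hadm.eq_b i τ hτ x hxI) (hadm.eq_b i t ht x hxI)).congr_deriv ?_
      rw [h1]; linarith
    · have hx' : x ∈ Ioi x0 := hx1.trans hxx
      set G : ℝ → ℝ := fun t => S i join[u, π, t] x - C i join[u, π, t] x * u' i t x
      have hs : ∀ {f : ℝ → ℝ → ℝ}, ContinuousOn (uncurry f) (Icc 0 T ×ˢ Ici x0) →
          ContinuousOn (fun t => f t x) (Icc 0 T) := fun h =>
        h.comp (f := fun t => (t, x)) (by fun_prop) fun t ht => ⟨ht, hx⟩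
      have hGc : ContinuousOn G (Icc 0 T) := (hs (hcS i)).sub ((hs (hcC i)).mul (hs (hcu' i)))
      have hI : ∀ t ∈ Icc 0 T, u i t x = u i 0 x + ∫ τ in (0:ℝ)..t, G τ := by
        intro t ht
        rw [intervalIntegral.integral_eq_sub_of_hasDerivAt_of_le ht.1
          ((hs (hadm.cont i)).mono (Icc_subset_Icc_right ht.2))
          (fun τ hτ => hder i τ ⟨hτ.1, hτ.2.trans_le ht.2⟩ x hx')]
        · ring
        · exact (hGc.mono (by rw [uIcc_of_le ht.1]; exact Icc_subset_Icc_right ht.2)).intervalIntegrable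
      exact ((hasDerivWithinAt_integral_Icc hGc (t := 0) ⟨le_rfl, hT0.le⟩ ht).const_add
        (u i 0 x)).congr hI (hI t ht)
  have hSb : ∀ i, ∀ t ∈ Icc 0 T, ∀ x ∈ Ici x0, |S i join[u, π, t] x| ≤ K' := fun i t ht x hx => by
    obtain ⟨s', hs'⟩ := H.reg_S i t ht _ _ fun j => hadm.c11 j t ht
    exact hs'.bound x hx
  have hu0' : ∀ i, CB 0 T x0 0 (u i) := fun i => by
    refine CB.of_slices hT0.le (hadm.c11 i) (hdt i) (K' := K' + K' * (8 * D + 2)) fun t ht x hx => ?_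
    obtain ⟨c', hc'⟩ := H.reg_C i t ht _ _ fun j => hadm.c11 j t ht
    exact (abs_sub _ _).trans (add_le_add (hSb i t ht x hx)
      (abs_mul_le (hc'.bound x hx) ((hadm.c11 i t ht).bound' x hx)))
  have hpar : ∀ j, CB 0 T x0 0 (fun t => join[u, π, t] j) := by
    rintro (j | k)
    · exact hu0' j
    · exact CB.of_smooth (hπs k)
  have hC0 := fun i => (hC i).cb (u := fun j t => join[u, π, t] j) hpar
  have hS0 := fun i => (hS i).cb (u := fun j t => join[u, π, t] j) hpar
  have hu'0 := fun i => CB.of_transport (hadm.c11 i) (hdt i) (hC0 i) (hS0 i) hT0.le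
  have hdx := fun i t ht x hx => (hadm.c11 i t ht).hasDerivWithinAt (x := x) hx
  exact ⟨u, u', fun i => ⟨hu0' i, _, _, (hS0 i).sub ((hC0 i).mul (hu'0 i)), hu'0 i, hdt i, hdx i⟩,
    hu'0, hini, hadm.eq_b, hdt, hdx, hSb⟩

/-! ### Constants -/

/-- `k₊ - 1 = 1 - k₋`. -/
def kap (ε : ℝ) : ℝ := √(2 * eta ε + eta ε ^ 2) / (1 + eta ε)

theorem kPlus_eq (ε : ℝ) : kPlus ε = 1 + kap ε := rfl

theorem kMinus_eq (ε : ℝ) : kMinus ε = 1 - kap ε := rfl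

theorem kPlus_sub_kMinus (ε : ℝ) : kPlus ε - kMinus ε = 2 * kap ε := by
  rw [kPlus_eq, kMinus_eq]; ring

section Constants

variable {ε : ℝ}

theorem eta_pos (h0 : 0 < ε) (h1 : ε < 1) : 0 < eta ε := div_pos (by grind) (by grind)

theorem one_add_eta (h1 : ε < 1) : (1 + ε) = (1 + eta ε) * (1 - ε) := by
  have : 1 - ε ≠ 0 := by grind
  rw [eta]; field_simp; ring

theorem kap_pos (h0 : 0 < ε) (h1 : ε < 1) : 0 < kap ε := by
  have := eta_pos h0 h1
  rw [kap]; positivity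

theorem kap_sq (h0 : 0 < ε) (h1 : ε < 1) : (1 + eta ε) ^ 2 * (1 - kap ε ^ 2) = 1 := by
  have := eta_pos h0 h1
  have h2 : 1 + eta ε ≠ 0 := by grind
  rw [kap, div_pow, Real.sq_sqrt (by bound)]
  field_simp; ring

theorem kap_lt_one (h0 : 0 < ε) (h1 : ε < 1) : kap ε < 1 := by
  have h := kap_sq h0 h1
  have h2 := eta_pos h0 h1
  have h3 := kap_pos h0 h1
  by_contra! h4
  nlinarith [sq_nonneg (1 + eta ε), mul_nonneg (sq_nonneg (1 + eta ε)) (by nlinarith : 0 ≤ kap ε ^ 2 - 1)]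

end Constants

/-! ### The fluid variables in logarithmic form -/

section LogForm

variable {ε : ℝ}

theorem uQOf_sq (h0 : 0 < ε) (h1 : ε < 1) (α β l : ℝ) :
    uQOf ε (exp α) (exp β) (exp l) ^ 2 =
      (1 + eta ε) * exp (-(2 * eta ε) * l + (α - β) / 2) := by
  have := eta_pos h0 h1
  rw [uQOf, Real.sq_sqrt (by bound), ← exp_sub, ← Real.exp_half, ← exp_mul, mul_assoc,
    ← exp_add]
  ring_nf

theorem uQOf_pos (h0 : 0 < ε) (h1 : ε < 1) {a b r : ℝ} (ha : 0 < a) (hb : 0 < b) (hr : 0 < r) :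
    0 < uQOf ε a b r := by
  have := eta_pos h0 h1
  rw [uQOf]; positivity

theorem rhoOf_exp (h1 : ε < 1) (α β l : ℝ) :
    (1 - ε) * rhoOf ε (exp α) (exp β) (exp l) =
      exp ((α + β) / (2 * kap ε) - (2 + 2 * eta ε) * l) := by
  have : 1 - ε ≠ 0 := by grind
  rw [rhoOf, kPlus_sub_kMinus, ← exp_add, ← exp_mul, ← exp_mul, ← mul_div_assoc,
    ← mul_assoc, mul_one_div_cancel this, one_mul, ← exp_sub]
  ring_nf

variable {F : Fields} {z : ℝ × ℝ} {α β om l : ℝ}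

theorem speed_exp (h0 : 0 < ε) (h1 : ε < 1) (hα : F.fP z = exp α) (hβ : F.fM z = exp β)
    (hom : F.Om z = exp om) (hl : F.r z = exp l) :
    F.speed ε z = (1 + eta ε) ^ 2 * exp (2 * om - 2 * eta ε * l + (α - β) / 2) := by
  rw [Fields.speed, hα, hβ, hom, hl, uQOf_sq h0 h1, ← exp_nat_mul]
  have e : exp (2 * om - 2 * eta ε * l + (α - β) / 2) =
      exp ((2 : ℕ) * om) * exp (-(2 * eta ε) * l + (α - β) / 2) := by
    rw [← exp_add]; push_cast; ring_nf
  rw [e]; ring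

theorem Tpq_exp (h1 : ε < 1) (hα : F.fP z = exp α) (hβ : F.fM z = exp β)
    (hom : F.Om z = exp om) (hl : F.r z = exp l) :
    (F.toFluidMetric ε).Tpq ε z =
      exp ((α + β) / (2 * kap ε) - (2 + 2 * eta ε) * l - 2 * om) := by
  have h := rhoOf_exp h1 α β l
  simp only [FluidMetric.Tpq, Fields.toFluidMetric, hα, hβ, hom, hl, h]
  rw [← exp_nat_mul, ← exp_sub]
  push_cast; ring_nf

theorem Tpp_exp (h0 : 0 < ε) (h1 : ε < 1) (hα : F.fP z = exp α) (hβ : F.fM z = exp β)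
    (hom : F.Om z = exp om) (hl : F.r z = exp l) :
    (F.toFluidMetric ε).Tpp ε z =
      exp ((α + β) / (2 * kap ε) - (α - β) / 2 - 2 * l - 4 * om) := by
  have h := rhoOf_exp h1 α β l
  have hη : 1 + eta ε ≠ 0 := by have := eta_pos h0 h1; positivity
  simp only [FluidMetric.Tpp, Fields.toFluidMetric, hα, hβ, hom, hl, uPOf, div_pow, mul_pow, one_pow]
  rw [uQOf_sq h0 h1, one_add_eta h1, mul_assoc (1 + eta ε), h, ← exp_nat_mul, ← exp_nat_mul]
  have e : exp ((α + β) / (2 * kap ε) - (2 + 2 * eta ε) * l) =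
      exp ((α + β) / (2 * kap ε) - (α - β) / 2 - 2 * l - 4 * om) *
        (exp ((2 : ℕ) * ((2 : ℕ) * om)) * exp (-(2 * eta ε) * l + (α - β) / 2)) := by
    rw [← exp_add, ← exp_add]; push_cast; ring_nf
  rw [e]
  field_simp

theorem Tqq_exp (h0 : 0 < ε) (h1 : ε < 1) (hα : F.fP z = exp α) (hβ : F.fM z = exp β)
    (hl : F.r z = exp l) :
    (F.toFluidMetric ε).Tqq ε z =
      (1 + eta ε) ^ 2 * exp ((α + β) / (2 * kap ε) + (α - β) / 2 - (2 + 4 * eta ε) * l) := by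
  have h := rhoOf_exp h1 α β l
  simp only [FluidMetric.Tqq, Fields.toFluidMetric, hα, hβ, hl]
  rw [uQOf_sq h0 h1, one_add_eta h1, mul_assoc (1 + eta ε), h]
  rw [show (α + β) / (2 * kap ε) + (α - β) / 2 - (2 + 4 * eta ε) * l =
    ((α + β) / (2 * kap ε) - (2 + 2 * eta ε) * l) + (-(2 * eta ε) * l + (α - β) / 2) by ring,
    exp_add ((α + β) / (2 * kap ε) - (2 + 2 * eta ε) * l)]
  ring

/-- The passage to `[f^±, Ω, r]` is invertible. -/
theorem roundtrip (h0 : 0 < ε) (h1 : ε < 1) {r ρ u : ℝ} (hr : 0 < r) (hρ : 0 < ρ) (hu : 0 < u) :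
    rhoOf ε (fPlusOf ε r ρ u) (fMinusOf ε r ρ u) r = ρ ∧
      uQOf ε (fPlusOf ε r ρ u) (fMinusOf ε r ρ u) r = u := by
  have hη := eta_pos h0 h1
  have hk := kap_pos h0 h1
  have h1' : 0 < 1 - ε := by linarith
  have h2' : 0 < 1 + ε := by linarith
  obtain ⟨l, rfl⟩ : ∃ l, r = exp l := ⟨_, (exp_log hr).symm⟩
  obtain ⟨m, rfl⟩ : ∃ l, ρ = exp l := ⟨_, (exp_log hρ).symm⟩
  obtain ⟨w, rfl⟩ : ∃ l, u = exp l := ⟨_, (exp_log hu).symm⟩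
  set c := log (1 - ε) with hc
  set d := log (1 + eta ε) with hd
  have ec : 1 - ε = exp c := (exp_log h1').symm
  have ed : 1 + eta ε = exp d := (exp_log (by positivity)).symm
  have e2 : 1 + ε = exp (c + d) := by rw [one_add_eta h1, ec, ed, ← exp_add, add_comm]
  have eP : fPlusOf ε (exp l) (exp m) (exp w) =
      exp (c * (1 + kap ε) - (c + d) + l * ((2 + 2 * eta ε) * (1 + kap ε) - 2) + m * kap ε + 2 * w) := by
    rw [fPlusOf, e2, ec, kPlus_eq, ← exp_mul, ← exp_mul, ← exp_mul, ← exp_nat_mul,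
      ← exp_sub, ← exp_add, ← exp_add, ← exp_add]
    push_cast; ring_nf
  have eM : fMinusOf ε (exp l) (exp m) (exp w) =
      exp ((c + d) - c * (1 - kap ε) + l * (2 - (2 + 2 * eta ε) * (1 - kap ε)) + m * kap ε - 2 * w) := by
    rw [fMinusOf, e2, ec, kMinus_eq, ← exp_mul, ← exp_mul, ← exp_mul, ← exp_nat_mul,
      ← exp_sub, ← exp_add, ← exp_sub, ← exp_add]
    push_cast; ring_nf
  rw [eP, eM]
  constructor
  · have := rhoOf_exp h1 (c * (1 + kap ε) - (c + d) + l * ((2 + 2 * eta ε) * (1 + kap ε) - 2) + m * kap ε + 2 * w)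
      ((c + d) - c * (1 - kap ε) + l * (2 - (2 + 2 * eta ε) * (1 - kap ε)) + m * kap ε - 2 * w) l
    have e3 : exp ((c * (1 + kap ε) - (c + d) + l * ((2 + 2 * eta ε) * (1 + kap ε) - 2) + m * kap ε + 2 * w
      + ((c + d) - c * (1 - kap ε) + l * (2 - (2 + 2 * eta ε) * (1 - kap ε)) + m * kap ε - 2 * w)) / (2 * kap ε)
      - (2 + 2 * eta ε) * l) = (1 - ε) * exp m := by
      rw [ec, ← exp_add]; congr 1; field_simp; ring
    rw [e3] at this
    exact mul_left_cancel₀ h1'.ne' this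
  · rw [← sq_eq_sq₀ (uQOf_pos h0 h1 (exp_pos _) (exp_pos _) (exp_pos _)).le (exp_pos _).le,
      uQOf_sq h0 h1, ed, ← exp_add, ← exp_nat_mul]
    congr 1; push_cast; ring

end LogForm

/-! ### Locality of the equations -/

section Local

variable {ε : ℝ} {N : Set (ℝ × ℝ)} {z : ℝ × ℝ}

theorem eq_iff_of_sub {a b a' b' c : ℝ} (hc : c ≠ 0) (h : a - b = c * (a' - b')) :
    a = b ↔ a' = b' := by
  rw [← sub_eq_zero, h, mul_eq_zero, or_iff_right hc, sub_eq_zero]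

theorem eventually_fst {P : ℝ × ℝ → Prop} (hN : IsOpen N) (hz : z ∈ N) (h : ∀ w ∈ N, P w) :
    ∀ᶠ s in 𝓝 z.1, P (s, z.2) := by
  have : Tendsto (fun s : ℝ => (s, z.2)) (𝓝 z.1) (𝓝 z) :=
    (by fun_prop : Continuous fun s : ℝ => (s, z.2)).tendsto' _ _ rfl
  exact this.eventually (eventually_of_mem (hN.mem_nhds hz) h)

theorem eventually_snd {P : ℝ × ℝ → Prop} (hN : IsOpen N) (hz : z ∈ N) (h : ∀ w ∈ N, P w) :
    ∀ᶠ s in 𝓝 z.2, P (z.1, s) := by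
  have : Tendsto (fun s : ℝ => (z.1, s)) (𝓝 z.2) (𝓝 z) :=
    (by fun_prop : Continuous fun s : ℝ => (z.1, s)).tendsto' _ _ rfl
  exact this.eventually (eventually_of_mem (hN.mem_nhds hz) h)

theorem dp_congr {u v : ℝ × ℝ → ℝ} (hN : IsOpen N) (hz : z ∈ N) (h : ∀ w ∈ N, u w = v w) :
    dp u z = dp v z :=
  Filter.EventuallyEq.deriv_eq (eventually_fst hN hz h)

theorem dq_congr {u v : ℝ × ℝ → ℝ} (hN : IsOpen N) (hz : z ∈ N) (h : ∀ w ∈ N, u w = v w) :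
    dq u z = dq v z :=
  Filter.EventuallyEq.deriv_eq (eventually_snd hN hz h)

theorem dp_eq {u v : ℝ × ℝ → ℝ} {d : ℝ} (hN : IsOpen N) (hz : z ∈ N) (h : ∀ w ∈ N, u w = v w)
    (hv : HasDerivAt (fun s => v (s, z.2)) d z.1) : dp u z = d :=
  (dp_congr hN hz h).trans hv.deriv

theorem dq_eq {u v : ℝ × ℝ → ℝ} {d : ℝ} (hN : IsOpen N) (hz : z ∈ N) (h : ∀ w ∈ N, u w = v w)
    (hv : HasDerivAt (fun s => v (z.1, s)) d z.2) : dq u z = d :=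
  (dq_congr hN hz h).trans hv.deriv

/-- Equality of two sets of unknowns on an open set. -/
structure FluidMetric.EqOn (N : Set (ℝ × ℝ)) (S S' : FluidMetric) : Prop where
  rho : ∀ w ∈ N, S.rho w = S'.rho w
  uP : ∀ w ∈ N, S.uP w = S'.uP w
  uQ : ∀ w ∈ N, S.uQ w = S'.uQ w
  Om : ∀ w ∈ N, S.Om w = S'.Om w
  r : ∀ w ∈ N, S.r w = S'.r w

namespace FluidMetric.EqOn

variable {S S' : FluidMetric}

theorem Tpp (h : EqOn N S S') : ∀ w ∈ N, S.Tpp ε w = S'.Tpp ε w := fun w hw => by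
  rw [FluidMetric.Tpp, FluidMetric.Tpp, h.rho w hw, h.uP w hw]

theorem Tqq (h : EqOn N S S') : ∀ w ∈ N, S.Tqq ε w = S'.Tqq ε w := fun w hw => by
  rw [FluidMetric.Tqq, FluidMetric.Tqq, h.rho w hw, h.uQ w hw]

theorem Tpq (h : EqOn N S S') : ∀ w ∈ N, S.Tpq ε w = S'.Tpq ε w := fun w hw => by
  rw [FluidMetric.Tpq, FluidMetric.Tpq, h.rho w hw, h.Om w hw]

theorem rWave (hN : IsOpen N) (hz : z ∈ N) (h : EqOn N S S') (hw : RWaveAt ε S z) :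
    RWaveAt ε S' z := by
  have h1 : ∀ w ∈ N, dq S.r w = dq S'.r w := fun w hw => dq_congr hN hw h.r
  rwa [RWaveAt, dp_congr hN hz h1, dp_congr hN hz h.r, h1 z hz, h.Om z hz, h.r z hz, h.Tpq z hz] at hw

theorem omegaWave (hN : IsOpen N) (hz : z ∈ N) (h : EqOn N S S') (hw : OmegaWaveAt ε S z) :
    OmegaWaveAt ε S' z := by
  have h1 : ∀ w ∈ N, dq (fun x => log (S.Om x)) w = dq (fun x => log (S'.Om x)) w :=
    fun w hw => dq_congr hN hw fun y hy => by rw [h.Om y hy]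
  rwa [OmegaWaveAt, dp_congr hN hz h1, dp_congr hN hz h.r, dq_congr hN hz h.r, h.Om z hz, h.r z hz,
    h.Tpq z hz] at hw

theorem constraintP (hN : IsOpen N) (hz : z ∈ N) (h : EqOn N S S') (hw : ConstraintPAt ε S z) :
    ConstraintPAt ε S' z := by
  have h1 : ∀ w ∈ N, dp S.r w / S.Om w ^ 2 = dp S'.r w / S'.Om w ^ 2 := fun w hw => by
    rw [dp_congr hN hw h.r, h.Om w hw]
  rwa [ConstraintPAt, dp_congr hN hz h1, h.Om z hz, h.r z hz, h.Tqq z hz] at hw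

theorem flux (h : EqOn N S S') : ∀ w ∈ N, S.Om w ^ 2 * S.r w ^ (2 + 2 * eta ε) * S.Tpq ε w =
    S'.Om w ^ 2 * S'.r w ^ (2 + 2 * eta ε) * S'.Tpq ε w :=
  fun w hw => by rw [h.Om w hw, h.r w hw, h.Tpq w hw]

theorem continuity (hN : IsOpen N) (hz : z ∈ N) (h : EqOn N S S') (hw : ContinuityAt ε S z) :
    ContinuityAt ε S' z := by
  have h1 : ∀ w ∈ N, S.Om w ^ 4 * S.r w ^ 2 * S.Tpp ε w = S'.Om w ^ 4 * S'.r w ^ 2 * S'.Tpp ε w :=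
    fun w hw => by rw [h.Om w hw, h.r w hw, h.Tpp w hw]
  rwa [ContinuityAt, dp_congr hN hz h1, dq_congr hN hz h.flux, h.Om z hz, h.r z hz] at hw

theorem momentum (hN : IsOpen N) (hz : z ∈ N) (h : EqOn N S S') (hw : MomentumAt ε S z) :
    MomentumAt ε S' z := by
  have h1 : ∀ w ∈ N, S.Om w ^ 4 * S.r w ^ 2 * S.Tqq ε w = S'.Om w ^ 4 * S'.r w ^ 2 * S'.Tqq ε w :=
    fun w hw => by rw [h.Om w hw, h.r w hw, h.Tqq w hw]
  rwa [MomentumAt, dq_congr hN hz h1, dp_congr hN hz h.flux, h.Om z hz, h.r z hz] at hw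

end FluidMetric.EqOn

end Local

/-! ### The fluid equations in logarithmic form -/

/-- Logarithms `α, β, om, l` of `f⁺, f⁻, Ω, r` on `N`, with first order partial derivatives
at `z`. -/
structure LogJet (F : Fields) (N : Set (ℝ × ℝ)) (z : ℝ × ℝ) (α β om l : ℝ × ℝ → ℝ)
    (αp αq βp βq omq lq : ℝ) : Prop where
  isOpen : IsOpen N
  mem : z ∈ N
  fP : ∀ w ∈ N, F.fP w = exp (α w)
  fM : ∀ w ∈ N, F.fM w = exp (β w)
  Om : ∀ w ∈ N, F.Om w = exp (om w)
  r : ∀ w ∈ N, F.r w = exp (l w)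
  hαp : HasDerivAt (fun s => α (s, z.2)) αp z.1
  hαq : HasDerivAt (fun s => α (z.1, s)) αq z.2
  hβp : HasDerivAt (fun s => β (s, z.2)) βp z.1
  hβq : HasDerivAt (fun s => β (z.1, s)) βq z.2
  homq : HasDerivAt (fun s => om (z.1, s)) omq z.2
  hlq : HasDerivAt (fun s => l (z.1, s)) lq z.2

namespace LogJet

variable {ε : ℝ} {F : Fields} {N : Set (ℝ × ℝ)} {z : ℝ × ℝ} {α β om l : ℝ × ℝ → ℝ}
    {αp αq βp βq omq lq : ℝ}

theorem dq_Om (H : LogJet F N z α β om l αp αq βp βq omq lq) : dq F.Om z / F.Om z = omq := by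
  rw [dq_eq (v := fun w => exp (om w)) H.isOpen H.mem H.Om H.homq.exp, H.Om z H.mem]
  exact mul_div_cancel_left₀ _ (exp_pos _).ne'

theorem dq_r (H : LogJet F N z α β om l αp αq βp βq omq lq) : dq F.r z / F.r z = lq := by
  rw [dq_eq (v := fun w => exp (l w)) H.isOpen H.mem H.r H.hlq.exp, H.r z H.mem]
  exact mul_div_cancel_left₀ _ (exp_pos _).ne'

theorem fPlus_iff (H : LogJet F N z α β om l αp αq βp βq omq lq) :
    FPlusTransportAt ε F z ↔
      αp + kPlus ε * F.speed ε z * (αq + 2 * (2 * omq - 2 * eta ε * lq)) = 0 := by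
  rw [FPlusTransportAt, dp_eq (v := fun w => exp (α w)) H.isOpen H.mem H.fP H.hαp.exp,
    dq_eq (v := fun w => exp (α w)) H.isOpen H.mem H.fP H.hαq.exp, H.dq_Om, H.dq_r, H.fP z H.mem]
  exact eq_iff_of_sub (exp_pos (α z)).ne' (by ring)

theorem fMinus_iff (H : LogJet F N z α β om l αp αq βp βq omq lq) :
    FMinusTransportAt ε F z ↔
      βp + kMinus ε * F.speed ε z * (βq - 2 * (2 * omq - 2 * eta ε * lq)) = 0 := by
  rw [FMinusTransportAt, dp_eq (v := fun w => exp (β w)) H.isOpen H.mem H.fM H.hβp.exp,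
    dq_eq (v := fun w => exp (β w)) H.isOpen H.mem H.fM H.hβq.exp, H.dq_Om, H.dq_r, H.fM z H.mem]
  exact eq_iff_of_sub (exp_pos (β z)).ne' (by ring)

theorem flux_eq (h1 : ε < 1) (H : LogJet F N z α β om l αp αq βp βq omq lq) : ∀ w ∈ N,
    (F.toFluidMetric ε).Om w ^ 2 * (F.toFluidMetric ε).r w ^ (2 + 2 * eta ε) *
      (F.toFluidMetric ε).Tpq ε w = exp ((α w + β w) / (2 * kap ε)) := by
  intro w hw
  rw [Tpq_exp h1 (H.fP w hw) (H.fM w hw) (H.Om w hw) (H.r w hw)]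
  change F.Om w ^ 2 * F.r w ^ (2 + 2 * eta ε) * _ = _
  rw [H.Om w hw, H.r w hw, ← exp_nat_mul, ← exp_mul, ← exp_add, ← exp_add]
  push_cast; ring_nf

theorem continuity_iff (h0 : 0 < ε) (h1 : ε < 1)
    (H : LogJet F N z α β om l αp αq βp βq omq lq) :
    ContinuityAt ε (F.toFluidMetric ε) z ↔
      (1 + eta ε) ^ 2 * ((αp + βp) / (2 * kap ε) - (αp - βp) / 2) +
        F.speed ε z * ((αq + βq) / (2 * kap ε)) = 0 := by
  have hη := eta_pos h0 h1
  have e1 : ∀ w ∈ N, (F.toFluidMetric ε).Om w ^ 4 * (F.toFluidMetric ε).r w ^ 2 *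
      (F.toFluidMetric ε).Tpp ε w = exp ((α w + β w) / (2 * kap ε) - (α w - β w) / 2) := by
    intro w hw
    rw [Tpp_exp h0 h1 (H.fP w hw) (H.fM w hw) (H.Om w hw) (H.r w hw)]
    change F.Om w ^ 4 * F.r w ^ 2 * _ = _
    rw [H.Om w hw, H.r w hw, ← exp_nat_mul, ← exp_nat_mul, ← exp_add, ← exp_add]
    push_cast; ring_nf
  have d1 := dp_eq (v := fun w => exp ((α w + β w) / (2 * kap ε) - (α w - β w) / 2)) H.isOpen
    H.mem e1 ((((H.hαp.add H.hβp).div_const _).sub ((H.hαp.sub H.hβp).div_const _)).exp)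
  have d2 := dq_eq (v := fun w => exp ((α w + β w) / (2 * kap ε))) H.isOpen
    H.mem (H.flux_eq h1) ((H.hαq.add H.hβq).div_const _).exp
  rw [ContinuityAt, d1, d2, speed_exp h0 h1 (H.fP z H.mem) (H.fM z H.mem) (H.Om z H.mem) (H.r z H.mem)]
  change _ + F.Om z ^ 2 / F.r z ^ (2 * eta ε) * _ = 0 ↔ _
  rw [H.Om z H.mem, H.r z H.mem, ← exp_nat_mul, ← exp_mul, ← exp_sub]
  simp only [Prod.mk.eta, Pi.add_apply, Pi.sub_apply]
  set σ := (α z + β z) / (2 * kap ε)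
  have e3 : exp ((2 : ℕ) * om z - l z * (2 * eta ε)) * exp σ =
      exp (σ - (α z - β z) / 2) * exp (2 * om z - 2 * eta ε * l z + (α z - β z) / 2) := by
    rw [← exp_add, ← exp_add]; push_cast; ring_nf
  refine eq_iff_of_sub (c := exp (σ - (α z - β z) / 2) / (1 + eta ε) ^ 2) (by positivity) ?_
  rw [div_mul_eq_mul_div, eq_div_iff (by positivity)]
  linear_combination (1 + eta ε) ^ 2 * ((αq + βq) / (2 * kap ε)) * e3

theorem momentum_iff (h0 : 0 < ε) (h1 : ε < 1)
    (H : LogJet F N z α β om l αp αq βp βq omq lq) :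
    MomentumAt ε (F.toFluidMetric ε) z ↔
      (αp + βp) / (2 * kap ε) + F.speed ε z *
        ((αq + βq) / (2 * kap ε) + (αq - βq) / 2 + 2 * (2 * omq - 2 * eta ε * lq)) = 0 := by
  have hη := eta_pos h0 h1
  have e1 : ∀ w ∈ N, (F.toFluidMetric ε).Om w ^ 4 * (F.toFluidMetric ε).r w ^ 2 *
      (F.toFluidMetric ε).Tqq ε w = (1 + eta ε) ^ 2 * exp ((α w + β w) / (2 * kap ε) +
        (α w - β w) / 2 + (4 * om w - 4 * eta ε * l w)) := by
    intro w hw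
    rw [Tqq_exp h0 h1 (H.fP w hw) (H.fM w hw) (H.r w hw)]
    change F.Om w ^ 4 * F.r w ^ 2 * _ = _
    rw [H.Om w hw, H.r w hw, ← exp_nat_mul, ← exp_nat_mul, mul_left_comm, ← exp_add,
      ← exp_add]
    push_cast; ring_nf
  have d1 := dq_eq (v := fun w => (1 + eta ε) ^ 2 * exp ((α w + β w) / (2 * kap ε) +
        (α w - β w) / 2 + (4 * om w - 4 * eta ε * l w))) H.isOpen
    H.mem e1 (((((H.hαq.add H.hβq).div_const _).add ((H.hαq.sub H.hβq).div_const _)).add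
      ((H.homq.const_mul 4).sub (H.hlq.const_mul (4 * eta ε)))).exp.const_mul _)
  have d2 := dp_eq (v := fun w => exp ((α w + β w) / (2 * kap ε))) H.isOpen
    H.mem (H.flux_eq h1) ((H.hαp.add H.hβp).div_const _).exp
  rw [MomentumAt, d1, d2, speed_exp h0 h1 (H.fP z H.mem) (H.fM z H.mem) (H.Om z H.mem) (H.r z H.mem)]
  change _ + F.r z ^ (2 * eta ε) / F.Om z ^ 2 * _ = 0 ↔ _
  rw [H.Om z H.mem, H.r z H.mem, ← exp_nat_mul, ← exp_mul, ← exp_sub]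
  simp only [Prod.mk.eta, Pi.add_apply, Pi.sub_apply]
  set σ := (α z + β z) / (2 * kap ε)
  have e3 : exp (l z * (2 * eta ε) - (2 : ℕ) * om z) *
        exp (σ + (α z - β z) / 2 + (4 * om z - 4 * eta ε * l z)) =
      exp σ * exp (2 * om z - 2 * eta ε * l z + (α z - β z) / 2) := by
    rw [← exp_add, ← exp_add]; push_cast; ring_nf
  exact eq_iff_of_sub (exp_pos σ).ne' (by linear_combination (1 + eta ε) ^ 2 *
    ((αq + βq) / (2 * kap ε) + (αq - βq) / 2 + (4 * omq - 4 * eta ε * lq)) * e3)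

/-- The Euler equations are equivalent to the transport equations for `f^±`. -/
theorem euler_iff (h0 : 0 < ε) (h1 : ε < 1)
    (H : LogJet F N z α β om l αp αq βp βq omq lq) :
    ContinuityAt ε (F.toFluidMetric ε) z ∧ MomentumAt ε (F.toFluidMetric ε) z ↔
      FPlusTransportAt ε F z ∧ FMinusTransportAt ε F z := by
  have hη := eta_pos h0 h1
  have hk := kap_pos h0 h1
  have hs := kap_sq h0 h1
  rw [H.continuity_iff h0 h1, H.momentum_iff h0 h1, H.fPlus_iff, H.fMinus_iff, kPlus_eq, kMinus_eq]
  set U := F.speed ε z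
  set G := 2 * omq - 2 * eta ε * lq
  obtain ⟨σp, hσp⟩ : ∃ x, x = (αp + βp) / (2 * kap ε) := ⟨_, rfl⟩
  obtain ⟨σq, hσq⟩ : ∃ x, x = (αq + βq) / (2 * kap ε) := ⟨_, rfl⟩
  rw [← hσp, ← hσq]
  have eσp : αp + βp = 2 * kap ε * σp := by rw [hσp]; field_simp
  have eσq : αq + βq = 2 * kap ε * σq := by rw [hσq]; field_simp
  have hη2 : (1 + eta ε) ^ 2 ≠ 0 := by positivity
  obtain ⟨rfl⟩ : βp = 2 * kap ε * σp - αp := by linarith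
  obtain ⟨rfl⟩ : βq = 2 * kap ε * σq - αq := by linarith
  constructor
  · rintro ⟨c1, c2⟩
    have c3 : (2 * kap ε * σp - 2 * αp) / 2 + σp + U * σq * (1 - kap ε ^ 2) = 0 := by
      apply mul_left_cancel₀ hη2
      linear_combination c1 + U * σq * hs
    constructor
    · linear_combination (1 + kap ε) * c2 - c3
    · linear_combination (kap ε - 1) * c2 + c3
  · rintro ⟨c1, c2⟩
    have c2' : σp + U * (σq + (αq - (2 * kap ε * σq - αq)) / 2 + 2 * G) = 0 := by
      apply mul_left_cancel₀ hk.ne'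
      linear_combination (c1 + c2) / 2
    refine ⟨?_, c2'⟩
    have c3 : (2 * kap ε * σp - 2 * αp) / 2 + σp + U * σq * (1 - kap ε ^ 2) = 0 := by
      linear_combination (1 + kap ε) * c2' - c1
    linear_combination (1 + eta ε) ^ 2 * c3 - U * σq * hs

end LogJet

/-! ### Differentiation under the integral and exchange of partial derivatives -/

namespace CB

variable {a b c : ℝ} {k : ℕ} {f ft : ℝ → ℝ → ℝ}

/-- The derivative in time of `∂_x f`, when `∂_t f` has a Lipschitz derivative in `x`. -/
theorem hasDerivWithinAt_mixed {fx h hx : ℝ → ℝ → ℝ} (hh : CB a b c 0 hx)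
    (hdx : ∀ t ∈ Icc a b, ∀ x ∈ Ici c, HasDerivWithinAt (f t) (fx t x) (Ici c) x)
    (hdt : ∀ t ∈ Icc a b, ∀ x ∈ Ici c, HasDerivWithinAt (fun s => f s x) (h t x) (Icc a b) t)
    (hhx : ∀ t ∈ Icc a b, ∀ x ∈ Ici c, HasDerivWithinAt (h t) (hx t x) (Ici c) x)
    {t x : ℝ} (ht : t ∈ Icc a b) (hxc : x ∈ Ici c) :
    HasDerivWithinAt (fun s => fx s x) (hx t x) (Icc a b) t := by
  obtain ⟨L, hL, -, h2, h3⟩ := hh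
  have hcx : Ici x ⊆ Ici c := Ici_subset_Ici.2 hxc
  refine hasDerivWithinAt_of_quadratic (K := L) fun s hs => ?_
  rw [← sq_abs]
  refine le_of_forall_pos_le_add fun δ hδ => ?_
  set δ' := δ / (L * |s - t| + 1) with hδ'
  have hδ'0 : 0 < δ' := by positivity
  have hts := uIcc_subset_Icc ht hs
  have key : ∀ y ∈ Icc x (x + δ'), |(f s y - f s x - (f t y - f t x)) - hx t x * (s - t) * (y - x)| ≤
      L * (|s - t| + δ') * |s - t| * (y - x) := by
    intro y hy
    have hb : ∀ τ ∈ uIcc t s, |h τ y - h τ x - hx t x * (y - x) * 1| ≤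
        L * (|s - t| + δ') * (y - x) := by
      intro τ hτ
      have := (convex_Icc x y).abs_image_sub_le
        (f := fun ξ => h τ ξ - hx t x * ξ) (f' := fun ξ => hx τ ξ - hx t x * 1)
        (C := L * (|s - t| + δ')) (x := x) (y := y)
        (fun ξ hξ => ((hhx τ (hts hτ) ξ (hcx hξ.1)).mono fun w hw => hcx hw.1).sub
          ((hasDerivWithinAt_id ξ _).const_mul (hx t x))) (fun ξ hξ => ?_)
        ⟨le_rfl, hy.1⟩ ⟨hy.1, le_rfl⟩
      · rw [abs_of_nonneg (sub_nonneg.2 hy.1)] at this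
        convert this using 2; ring
      · rw [mul_add]
        refine abs_le_add (b := hx τ ξ - hx t ξ) (by ring) ((h2 t ht τ (hts hτ) ξ (hcx hξ.1)).trans
          (mul_le_mul_of_nonneg_left (abs_sub_left_of_mem_uIcc hτ) hL))
          ((h3 t ht x hxc ξ (hcx hξ.1)).trans (mul_le_mul_of_nonneg_left ?_ hL))
        rw [abs_of_nonneg (sub_nonneg.2 hξ.1)]; linarith [hξ.2, hy.2]
    have := (convex_uIcc t s).abs_image_sub_le (f := fun τ => f τ y - f τ x - hx t x * (y - x) * τ)
      (fun τ hτ => (((hdt τ (hts hτ) y (hcx hy.1)).sub (hdt τ (hts hτ) x hxc)).mono hts).sub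
      ((hasDerivWithinAt_id τ _).const_mul _)) hb left_mem_uIcc right_mem_uIcc
    convert this using 1 <;> ring_nf
  have hlim := (((hdx s hs x hxc).sub (hdx t ht x hxc)).mono hcx).sub
    ((hasDerivWithinAt_id x (Ici x)).const_mul (hx t x * (s - t)))
  have h5 := (hasDerivWithinAt_iff_tendsto_slope' (by simp)).1 (hlim.mono Ioi_subset_Ici_self)
  have h6 : |fx s x - fx t x - hx t x * (s - t) * 1| ≤ L * (|s - t| + δ') * |s - t| := by
    refine le_of_tendsto h5.abs ?_
    filter_upwards [Ioc_mem_nhdsGT (show x < x + δ' by linarith)] with y hy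
    have hy0 : 0 < y - x := sub_pos.2 hy.1
    rw [slope_def_field, abs_div, abs_of_pos hy0, div_le_iff₀ hy0]
    refine le_trans (le_of_eq ?_) (key y ⟨hy.1.le, hy.2⟩)
    simp only [Pi.sub_apply, id]
    ring_nf
  rw [mul_one] at h6
  refine h6.trans ?_
  have h7 : δ' * (L * |s - t| + 1) = δ := by rw [hδ']; field_simp
  nlinarith [abs_nonneg (s - t)]

end CB

/-! ### The first order system in the variables `t = p - p₀`, `x = log q` -/

/-- Decay exponent of the density variables. -/
def nu (ε Np Nm : ℝ) : ℝ := (Np + Nm) / (2 * kap ε)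

/-- Characteristic speed in `x`, divided by `k_±`. -/
def velF (ε A B om s x : ℝ) : ℝ :=
  (1 + eta ε) ^ 2 * (exp (2 * om - eta ε * s + 1 / 2 * (A - B)) * exp (-(1 * x)))

/-- `r² Ω⁴ T^{pq}`. -/
def densF (ε ν A B om s x : ℝ) : ℝ :=
  exp (1 / (2 * kap ε) * (A + B) + (2 * om - eta ε * s)) * exp (-((2 * eta ε + ν) * x))

/-- `∂_p ∂_q r²`, in terms of `r² Ω⁴ T^{pq}` and `log Ω`. -/
def waveRF (Y om : ℝ) : ℝ := 2 * Real.pi * Y - 1 / 2 * exp (2 * om)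

/-- `q² ∂_p ∂_q log Ω`. -/
def waveOmF (ε Y om s W T : ℝ) : ℝ :=
  1 / 4 * exp (2 * om - s) + 1 / 4 * (W * T * exp (-(2 * s)))
    - (1 + eta ε) * Real.pi * (Y * exp (-s))

section Operators

variable (ε θ Np Nm x0 : ℝ)

/-- `log Ω`, recovered from `q^{1+θ} ∂_q log Ω`. -/
def omOp (v : Fin 5 ⊕ Fin 2 → ℝ → ℝ) (x : ℝ) : ℝ :=
  v (Sum.inr 0) x + exp (-(0 * x)) * ∫ y in x0..x, exp (-θ * y) * v (Sum.inl 2) y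

def muOp (v : Fin 5 ⊕ Fin 2 → ℝ → ℝ) (x : ℝ) : ℝ := exp (-(θ * x)) * v (Sum.inl 2) x

def velOp (v : Fin 5 ⊕ Fin 2 → ℝ → ℝ) (x : ℝ) : ℝ :=
  velF ε (v (Sum.inl 0) x) (v (Sum.inl 1) x) (omOp θ x0 v x) (v (Sum.inl 3) x) x

def densOp (v : Fin 5 ⊕ Fin 2 → ℝ → ℝ) (x : ℝ) : ℝ :=
  densF ε (nu ε Np Nm) (v (Sum.inl 0) x) (v (Sum.inl 1) x) (omOp θ x0 v x) (v (Sum.inl 3) x) x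

def waveROp (v : Fin 5 ⊕ Fin 2 → ℝ → ℝ) (x : ℝ) : ℝ :=
  waveRF (densOp ε θ Np Nm x0 v x) (omOp θ x0 v x)

/-- `∂_p r² / q`, by integration of the wave equation. -/
def rpOp (v : Fin 5 ⊕ Fin 2 → ℝ → ℝ) (x : ℝ) : ℝ :=
  exp (-(1 * x)) * v (Sum.inr 1) x
    + exp (-(1 * x)) * ∫ y in x0..x, exp (1 * y) * waveROp ε θ Np Nm x0 v y

def waveOmOp (v : Fin 5 ⊕ Fin 2 → ℝ → ℝ) (x : ℝ) : ℝ :=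
  waveOmF ε (densOp ε θ Np Nm x0 v x) (omOp θ x0 v x) (v (Sum.inl 3) x) (rpOp ε θ Np Nm x0 v x)
    (v (Sum.inl 4) x)

/-- Characteristic speeds of the system. -/
def speedOp : Fin 5 → (Fin 5 ⊕ Fin 2 → ℝ → ℝ) → ℝ → ℝ
  | 0 => fun v x => kPlus ε * velOp ε θ x0 v x
  | 1 => fun v x => kMinus ε * velOp ε θ x0 v x
  | _ => fun _ _ => 0

/-- Source terms of the system. -/
def sourceOp : Fin 5 → (Fin 5 ⊕ Fin 2 → ℝ → ℝ) → ℝ → ℝ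
  | 0 => fun v x => kPlus ε * velOp ε θ x0 v x *
      (Np - 4 * muOp θ v x + 2 * eta ε * (exp (-v (Sum.inl 3) x) * v (Sum.inl 4) x))
  | 1 => fun v x => kMinus ε * velOp ε θ x0 v x *
      (Nm + 4 * muOp θ v x - 2 * eta ε * (exp (-v (Sum.inl 3) x) * v (Sum.inl 4) x))
  | 2 => fun v x => exp (-((1 - θ) * x)) * waveOmOp ε θ Np Nm x0 v x
  | 3 => fun v x => exp (-(1 * x)) * (exp (-v (Sum.inl 3) x) * rpOp ε θ Np Nm x0 v x)
  | 4 => fun v x => exp (-(1 * x)) * waveROp ε θ Np Nm x0 v x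

end Operators

section Causality

variable {ε θ Np Nm x0 : ℝ}

theorem exp_integral_bound_neg (hθ : 0 < θ) (x : ℝ) (_ : x0 ≤ x) :
    exp (-(0 * x)) * ∫ y in x0..x, exp (-θ * y) ≤ exp (-θ * x0) / θ := by
  rw [intervalIntegral.integral_comp_mul_left (fun y => exp y) (neg_ne_zero.2 hθ.ne'), integral_exp, zero_mul,
    neg_zero, exp_zero, one_mul, smul_eq_mul, inv_neg, neg_mul, ← mul_neg, neg_sub,
    ← div_eq_inv_mul]
  gcongr
  have := exp_pos (-θ * x)
  linarith

theorem exp_integral_bound_pos {r : ℝ} (hr : 0 < r) (x : ℝ) (_ : x0 ≤ x) :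
    exp (-(r * x)) * ∫ y in x0..x, exp (r * y) ≤ 1 / r := by
  rw [intervalIntegral.integral_comp_mul_left (fun y => exp y) hr.ne', integral_exp, smul_eq_mul,
    mul_left_comm, mul_sub, ← exp_add, neg_add_cancel, exp_zero, ← div_eq_inv_mul]
  gcongr
  have := mul_pos (exp_pos (-(r * x))) (exp_pos (r * x0))
  linarith

theorem causal_proj (i : Fin 5) : Causal x0 fun (v : Fin 5 ⊕ Fin 2 → ℝ → ℝ) => v (Sum.inl i) :=
  Causal.proj (Sum.inl i)

theorem causal_om (hθ : 0 < θ) : Causal x0 (omOp θ x0) :=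
  (Causal.proj (Sum.inr 0)).add (Causal.integral le_rfl (by linarith) (exp_integral_bound_neg hθ)
    (Causal.proj (Sum.inl 2)))

theorem causal_mu (hθ : 0 < θ) : Causal x0 (muOp θ) := (Causal.expNeg hθ.le).mul (Causal.proj _)

theorem causal_vel (hθ : 0 < θ) : Causal x0 (velOp ε θ x0) := by
  have h1 := ((causal_om (x0 := x0) hθ).const_mul 2).sub
    ((causal_proj 3).const_mul (eta ε))
  have h2 := ((causal_proj (x0 := x0) 0).sub
    (causal_proj 1)).const_mul (1 / 2)
  exact ((h1.add h2).exp.mul (Causal.expNeg zero_le_one)).const_mul _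

theorem causal_dens (hθ : 0 < θ) (hν : 0 ≤ 2 * eta ε + nu ε Np Nm) :
    Causal x0 (densOp ε θ Np Nm x0) := by
  have h1 := ((causal_om (x0 := x0) hθ).const_mul 2).sub
    ((causal_proj 3).const_mul (eta ε))
  have h2 := ((causal_proj (x0 := x0) 0).add
    (causal_proj 1)).const_mul (1 / (2 * kap ε))
  exact (h2.add h1).exp.mul (Causal.expNeg hν)

theorem causal_waveR (hθ : 0 < θ) (hν : 0 ≤ 2 * eta ε + nu ε Np Nm) :
    Causal x0 (waveROp ε θ Np Nm x0) :=
  ((causal_dens hθ hν).const_mul _).sub (((causal_om hθ).const_mul 2).exp.const_mul _)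

theorem causal_rp (hθ : 0 < θ) (hν : 0 ≤ 2 * eta ε + nu ε Np Nm) :
    Causal x0 (rpOp ε θ Np Nm x0) :=
  ((Causal.expNeg zero_le_one).mul (Causal.proj _)).add (Causal.integral zero_le_one le_rfl
    (exp_integral_bound_pos zero_lt_one) (causal_waveR hθ hν))

theorem causal_waveOm (hθ : 0 < θ) (hν : 0 ≤ 2 * eta ε + nu ε Np Nm) :
    Causal x0 (waveOmOp ε θ Np Nm x0) := by
  have hs := causal_proj (x0 := x0) 3
  have h1 := ((((causal_om (x0 := x0) hθ).const_mul 2).sub hs).exp).const_mul (1 / 4)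
  have h2 := ((((causal_rp (x0 := x0) hθ hν).mul (causal_proj 4)).mul
    (hs.const_mul 2).neg.exp)).const_mul (1 / 4)
  have h3 := (((causal_dens (x0 := x0) hθ hν).mul hs.neg.exp)).const_mul ((1 + eta ε) * Real.pi)
  exact (h1.add h2).sub h3

theorem causal_speed (hθ : 0 < θ) (i : Fin 5) : Causal x0 (speedOp ε θ x0 i) := by
  match i with
  | 0 | 1 => exact (causal_vel hθ).const_mul _
  | 2 | 3 | 4 => exact Causal.const 0

theorem causal_source (hθ : 0 < θ) (hθ1 : θ < 1) (hν : 0 ≤ 2 * eta ε + nu ε Np Nm) (i : Fin 5) :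
    Causal x0 (sourceOp ε θ Np Nm x0 i) := by
  have hs := causal_proj (x0 := x0) 3
  have hT := causal_proj (x0 := x0) 4
  have h1 := (hs.neg.exp.mul hT).const_mul (2 * eta ε)
  have h2 := (causal_mu (x0 := x0) hθ).const_mul 4
  match i with
  | 0 => exact ((causal_vel hθ).const_mul _).mul (((Causal.const Np).sub h2).add h1)
  | 1 => exact ((causal_vel hθ).const_mul _).mul (((Causal.const Nm).add h2).sub h1)
  | 2 => exact (Causal.expNeg (by linarith)).mul (causal_waveOm hθ hν)
  | 3 => exact (Causal.expNeg zero_le_one).mul (hs.neg.exp.mul (causal_rp hθ hν))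
  | 4 => exact (Causal.expNeg zero_le_one).mul (causal_waveR hθ hν)

theorem speedOp_nonneg (h0 : 0 < ε) (h1 : ε < 1) (i : Fin 5) (v : Fin 5 ⊕ Fin 2 → ℝ → ℝ) (x : ℝ) :
    0 ≤ speedOp ε θ x0 i v x := by
  have hk := kap_pos h0 h1
  have hk1 := kap_lt_one h0 h1
  have hv : 0 ≤ velOp ε θ x0 v x := by rw [velOp, velF]; positivity
  match i with
  | 0 => exact mul_nonneg (by rw [kPlus_eq]; linarith) hv
  | 1 => exact mul_nonneg (by rw [kMinus_eq]; linarith) hv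
  | 2 | 3 | 4 => exact le_rfl

end Causality

/-! ### Solutions on the strip and their derivatives -/

/-- Logarithmic derivative of `densF`, without the explicit dependence on `x`. -/
def densD (ε a b o s : ℝ) : ℝ := 1 / (2 * kap ε) * (a + b) + (2 * o - eta ε * s)

/-- Derivative of `waveRF (densF ..) om` from the logarithmic derivative `d` of the density. -/
def waveRD (Y om d o : ℝ) : ℝ := 2 * Real.pi * (Y * d) - exp (2 * om) * o

/-- A regular solution of the first order system on `[0, T] × [x0, ∞)`, together with the relations
between its components. -/
structure StripSol (ε θ Np Nm T x0 : ℝ) (A B om m s R W A' B' m' R' omt Wt : ℝ → ℝ → ℝ)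
    (V Y μ : ℝ → ℝ → ℝ) : Prop where
  V_eq : ∀ t x, V t x = velF ε (A t x) (B t x) (om t x) (s t x) x
  Y_eq : ∀ t x, Y t x = densF ε (nu ε Np Nm) (A t x) (B t x) (om t x) (s t x) x
  μ_eq : ∀ t x, μ t x = exp (-(θ * x)) * m t x
  cbA : CB 0 T x0 1 A
  cbB : CB 0 T x0 1 B
  cbom : CB 0 T x0 2 om
  cbm : CB 0 T x0 1 m
  cbs : CB 0 T x0 2 s
  cbR : CB 0 T x0 1 R
  cbW : CB 0 T x0 1 W
  cbA' : CB 0 T x0 0 A'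
  cbB' : CB 0 T x0 0 B'
  cbm' : CB 0 T x0 0 m'
  cbR' : CB 0 T x0 0 R'
  A_t : ∀ t ∈ Icc 0 T, ∀ x ∈ Ici x0, HasDerivWithinAt (fun t => A t x) (kPlus ε * V t x *
    (Np - 4 * μ t x + 2 * eta ε * (exp (-s t x) * R t x) - A' t x)) (Icc 0 T) t
  B_t : ∀ t ∈ Icc 0 T, ∀ x ∈ Ici x0, HasDerivWithinAt (fun t => B t x) (kMinus ε * V t x *
    (Nm + 4 * μ t x - 2 * eta ε * (exp (-s t x) * R t x) - B' t x)) (Icc 0 T) t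
  A_x : ∀ t ∈ Icc 0 T, ∀ x ∈ Ici x0, HasDerivWithinAt (A t) (A' t x) (Ici x0) x
  B_x : ∀ t ∈ Icc 0 T, ∀ x ∈ Ici x0, HasDerivWithinAt (B t) (B' t x) (Ici x0) x
  om_t : ∀ t ∈ Icc 0 T, ∀ x ∈ Ici x0, HasDerivWithinAt (fun t => om t x) (omt t x) (Icc 0 T) t
  om_x : ∀ t ∈ Icc 0 T, ∀ x ∈ Ici x0, HasDerivWithinAt (om t) (μ t x) (Ici x0) x
  omt_x : ∀ t ∈ Icc 0 T, ∀ x ∈ Ici x0, HasDerivWithinAt (omt t)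
    (exp (-x) * waveOmF ε (Y t x) (om t x) (s t x) (W t x) (R t x)) (Ici x0) x
  μ_t : ∀ t ∈ Icc 0 T, ∀ x ∈ Ici x0, HasDerivWithinAt (fun t => μ t x)
    (exp (-x) * waveOmF ε (Y t x) (om t x) (s t x) (W t x) (R t x)) (Icc 0 T) t
  m_x : ∀ t ∈ Icc 0 T, ∀ x ∈ Ici x0, HasDerivWithinAt (m t) (m' t x) (Ici x0) x
  s_t : ∀ t ∈ Icc 0 T, ∀ x ∈ Ici x0, HasDerivWithinAt (fun t => s t x)
    (exp (-x) * (exp (-s t x) * W t x)) (Icc 0 T) t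
  s_x : ∀ t ∈ Icc 0 T, ∀ x ∈ Ici x0,
    HasDerivWithinAt (s t) (exp (-s t x) * R t x - 2) (Ici x0) x
  R_t : ∀ t ∈ Icc 0 T, ∀ x ∈ Ici x0, HasDerivWithinAt (fun t => R t x)
    (exp (-x) * waveRF (Y t x) (om t x)) (Icc 0 T) t
  R_x : ∀ t ∈ Icc 0 T, ∀ x ∈ Ici x0, HasDerivWithinAt (R t) (R' t x) (Ici x0) x
  R'_t : ∀ t ∈ Icc 0 T, ∀ x ∈ Ici x0, HasDerivWithinAt (fun t => R' t x)
    (exp (-x) * (waveRD (Y t x) (om t x) (densD ε (A' t x) (B' t x) (μ t x)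
      (exp (-s t x) * R t x - 2) - (2 * eta ε + nu ε Np Nm)) (μ t x)
      - waveRF (Y t x) (om t x))) (Icc 0 T) t
  W_t : ∀ t ∈ Icc 0 T, ∀ x ∈ Ici x0, HasDerivWithinAt (fun t => W t x) (Wt t x) (Icc 0 T) t
  W_x : ∀ t ∈ Icc 0 T, ∀ x ∈ Ici x0,
    HasDerivWithinAt (W t) (waveRF (Y t x) (om t x) - W t x) (Ici x0) x
  Wt_x : ∀ t ∈ Icc 0 T, ∀ x ∈ Ici x0, HasDerivWithinAt (Wt t)
    (waveRD (Y t x) (om t x) (densD ε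
      (kPlus ε * V t x * (Np - 4 * μ t x + 2 * eta ε * (exp (-s t x) * R t x) - A' t x))
      (kMinus ε * V t x * (Nm + 4 * μ t x - 2 * eta ε * (exp (-s t x) * R t x) - B' t x))
      (omt t x) (exp (-x) * (exp (-s t x) * W t x))) (omt t x) - Wt t x) (Ici x0) x

section

variable {ε θ Np Nm T x0 : ℝ}

theorem hasDerivWithinAt_dens_t {A B om s : ℝ → ℝ} {a b o σ x : ℝ} {J : Set ℝ} {t : ℝ} (ν : ℝ)
    (hA : HasDerivWithinAt A a J t) (hB : HasDerivWithinAt B b J t) (ho : HasDerivWithinAt om o J t)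
    (hs : HasDerivWithinAt s σ J t) :
    HasDerivWithinAt (fun t => densF ε ν (A t) (B t) (om t) (s t) x)
      (densF ε ν (A t) (B t) (om t) (s t) x * densD ε a b o σ) J t := by
  have h1 := (((hA.add hB).const_mul (1 / (2 * kap ε))).add
    ((ho.const_mul 2).sub (hs.const_mul (eta ε)))).exp.mul_const (exp (-((2 * eta ε + ν) * x)))
  refine h1.congr_deriv ?_
  simp only [densF, densD, Pi.add_apply, Pi.sub_apply]
  ring

theorem hasDerivWithinAt_dens_x {A B om s : ℝ → ℝ} {a b o σ x : ℝ} {J : Set ℝ} (ν : ℝ)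
    (hA : HasDerivWithinAt A a J x) (hB : HasDerivWithinAt B b J x) (ho : HasDerivWithinAt om o J x)
    (hs : HasDerivWithinAt s σ J x) :
    HasDerivWithinAt (fun x => densF ε ν (A x) (B x) (om x) (s x) x)
      (densF ε ν (A x) (B x) (om x) (s x) x * (densD ε a b o σ - (2 * eta ε + ν))) J x := by
  have h0 : HasDerivAt (fun x => exp (-((2 * eta ε + ν) * x)))
      (exp (-((2 * eta ε + ν) * x)) * -((2 * eta ε + ν) * 1)) x :=
    ((hasDerivAt_id x).const_mul (2 * eta ε + ν)).neg.exp
  have h1 := (((hA.add hB).const_mul (1 / (2 * kap ε))).add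
    ((ho.const_mul 2).sub (hs.const_mul (eta ε)))).exp.mul h0.hasDerivWithinAt
  refine h1.congr_deriv ?_
  simp only [densF, densD, Pi.add_apply, Pi.sub_apply]
  ring

theorem hasDerivWithinAt_waveR {Y om : ℝ → ℝ} {d o x : ℝ} {J : Set ℝ}
    (hY : HasDerivWithinAt Y (Y x * d) J x) (ho : HasDerivWithinAt om o J x) :
    HasDerivWithinAt (fun x => waveRF (Y x) (om x)) (waveRD (Y x) (om x) d o) J x := by
  have := (hY.const_mul (2 * Real.pi)).sub ((ho.const_mul 2).exp.const_mul (1 / 2))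
  refine this.congr_deriv ?_
  simp only [waveRD]; ring

theorem eq_of_hasDerivWithinAt_zero {f : ℝ → ℝ} {J : Set ℝ} (hJ : Convex ℝ J)
    (h : ∀ x ∈ J, HasDerivWithinAt f 0 J x) {x y : ℝ} (hx : x ∈ J) (hy : y ∈ J) : f y = f x := by
  have := hJ.abs_image_sub_le (C := 0) h (fun x _ => by simp) hx hy
  rw [zero_mul] at this
  exact sub_eq_zero.1 (norm_le_zero_iff.1 this)

/-- A regular solution of the causal system gives a solution on the strip. -/
theorem stripSol_of_system (hθ : 0 < θ) (hθ1 : θ < 1) (hν : 0 ≤ 2 * eta ε + nu ε Np Nm) (hT : 0 < T)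
    {π : Fin 2 → ℝ → ℝ} (hπ : ∀ k, ContDiff ℝ ∞ (π k)) {u u' : Fin 5 → ℝ → ℝ → ℝ}
    (hu : ∀ i, CB 0 T x0 1 (u i)) (hu' : ∀ i, CB 0 T x0 0 (u' i))
    (hdt : ∀ i, ∀ t ∈ Icc 0 T, ∀ x ∈ Ici x0, HasDerivWithinAt (fun τ => u i τ x)
      (sourceOp ε θ Np Nm x0 i join[u, π, t] x - speedOp ε θ x0 i join[u, π, t] x * u' i t x)
      (Icc 0 T) t)
    (hdx : ∀ i, ∀ t ∈ Icc 0 T, ∀ x ∈ Ici x0, HasDerivWithinAt (u i t) (u' i t x) (Ici x0) x)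
    (hdata : ∀ x ∈ Ici x0, u' 3 0 x = exp (-u 3 0 x) * u 4 0 x - 2) :
    ∃ omt Wt, StripSol ε θ Np Nm T x0 (u 0) (u 1) (fun t => omOp θ x0 join[u, π, t]) (u 2) (u 3) (u 4)
      (fun t => rpOp ε θ Np Nm x0 join[u, π, t]) (u' 0) (u' 1) (u' 2) (u' 4) omt Wt
      (fun t => velOp ε θ x0 join[u, π, t]) (fun t => densOp ε θ Np Nm x0 join[u, π, t])
      (fun t => muOp θ join[u, π, t]) := by
  set w : ℝ → Fin 5 ⊕ Fin 2 → ℝ → ℝ := fun t => join[u, π, t]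
  have hcb : ∀ {F : (Fin 5 ⊕ Fin 2 → ℝ → ℝ) → ℝ → ℝ}, Causal x0 F → CB 0 T x0 1 fun t x => F (w t) x :=
    fun hF => hF.cb (u := fun j t => w t j) (by
      rintro (j | k)
      exacts [hu j, CB.of_smooth (hπ k)])
  have hdp : ∀ k t, HasDerivWithinAt (π k) (deriv (π k) t) (Icc 0 T) t := fun k t =>
    ((hπ k).differentiable (by simp) t).hasDerivAt.hasDerivWithinAt
  set om : ℝ → ℝ → ℝ := fun t => omOp θ x0 (w t)
  set μ : ℝ → ℝ → ℝ := fun t => muOp θ (w t)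
  set V : ℝ → ℝ → ℝ := fun t => velOp ε θ x0 (w t)
  set Y : ℝ → ℝ → ℝ := fun t => densOp ε θ Np Nm x0 (w t)
  set W : ℝ → ℝ → ℝ := fun t => rpOp ε θ Np Nm x0 (w t)
  set g : ℝ → ℝ → ℝ := fun t => waveOmOp ε θ Np Nm x0 (w t)
  set jj : ℝ → ℝ → ℝ := fun t => waveROp ε θ Np Nm x0 (w t)
  have cbj : CB 0 T x0 1 jj := hcb (causal_waveR hθ hν)
  have cbW : CB 0 T x0 1 W := hcb (causal_rp hθ hν)
  have hes : CB 0 T x0 1 fun t x => exp (-u 3 t x) := (hu 3).neg.exp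
  have hex : ∀ {k}, CB 0 T x0 k fun _ x => exp (-x) :=
    (CB.exp_neg zero_le_one).congr fun _ _ _ _ => by rw [one_mul]
  have hexp : ∀ x, HasDerivWithinAt (fun x => exp (-x)) (-exp (-x)) (Ici x0) x := fun x => by
    simpa using (hasDerivAt_id x).neg.exp.hasDerivWithinAt
  have m_t : ∀ t ∈ Icc 0 T, ∀ x ∈ Ici x0, HasDerivWithinAt (fun t => u 2 t x)
      (exp (-((1 - θ) * x)) * g t x) (Icc 0 T) t := fun t ht x hx =>
    (hdt 2 t ht x hx).congr_deriv (by simp only [speedOp, sourceOp, g]; ring)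
  have s_t : ∀ t ∈ Icc 0 T, ∀ x ∈ Ici x0, HasDerivWithinAt (fun t => u 3 t x)
      (exp (-x) * (exp (-u 3 t x) * W t x)) (Icc 0 T) t := fun t ht x hx =>
    (hdt 3 t ht x hx).congr_deriv (by
      simp only [speedOp, sourceOp, W, w, withParam, Sum.elim_inl, one_mul]; ring)
  have R_t : ∀ t ∈ Icc 0 T, ∀ x ∈ Ici x0, HasDerivWithinAt (fun t => u 4 t x)
      (exp (-x) * jj t x) (Icc 0 T) t := fun t ht x hx =>
    (hdt 4 t ht x hx).congr_deriv (by simp only [speedOp, sourceOp, jj, one_mul]; ring)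
  have cbmt : CB 0 T x0 1 fun t x => exp (-((1 - θ) * x)) * g t x :=
    (CB.exp_neg (by linarith)).mul (hcb (causal_waveOm hθ hν))
  set omt : ℝ → ℝ → ℝ := fun t x => deriv (π 0) t +
    exp (-(0 * x)) * ∫ y in x0..x, exp (-θ * y) * (exp (-((1 - θ) * y)) * g t y)
  have hint0 := exp_integral_bound_neg (x0 := x0) hθ
  have om_t : ∀ t ∈ Icc 0 T, ∀ x ∈ Ici x0, HasDerivWithinAt (fun t => om t x) (omt t x) (Icc 0 T) t :=
    fun t ht x hx => (hdp 0 t).add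
      (CB.hasDerivWithinAt_integral_param hint0 (hu 2).zero cbmt.zero m_t ht hx)
  have om_x : ∀ t ∈ Icc 0 T, ∀ x ∈ Ici x0, HasDerivWithinAt (om t) (μ t x) (Ici x0) x :=
    fun t ht x hx => ((hasDerivWithinAt_weightedIntegral 0 (-θ) ((hu 2).continuousOn_slice ht)
      hx).const_add (π 0 t)).congr_deriv (by simp [μ, muOp, w, withParam])
  have omt_x : ∀ t ∈ Icc 0 T, ∀ x ∈ Ici x0,
      HasDerivWithinAt (omt t) (exp (-x) * g t x) (Ici x0) x := fun t ht x hx => by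
    refine ((hasDerivWithinAt_weightedIntegral 0 (-θ) (cbmt.continuousOn_slice ht) hx).const_add
      (deriv (π 0) t)).congr_deriv ?_
    rw [← mul_assoc (exp _) (exp _), ← exp_add]; ring_nf
  have W_x : ∀ t ∈ Icc 0 T, ∀ x ∈ Ici x0, HasDerivWithinAt (W t) (jj t x - W t x) (Ici x0) x := by
    intro t ht x hx
    refine (((hexp x).mul_const (π 1 t)).add (hasDerivWithinAt_weightedIntegral 1 1
      (cbj.continuousOn_slice ht) hx)).congr_of_eventuallyEq_of_mem
      (.of_forall fun y => ?_) hx |>.congr_deriv ?_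
    · simp [W, rpOp, w, withParam, jj]
    · simp [W, rpOp, w, withParam, jj]; ring
  have A_t : ∀ t ∈ Icc 0 T, ∀ x ∈ Ici x0, HasDerivWithinAt (fun t => u 0 t x) (kPlus ε * V t x *
      (Np - 4 * μ t x + 2 * eta ε * (exp (-u 3 t x) * u 4 t x) - u' 0 t x)) (Icc 0 T) t :=
    fun t ht x hx => (hdt 0 t ht x hx).congr_deriv (by
      simp only [speedOp, sourceOp, V, μ, w, withParam, Sum.elim_inl]; ring)
  have B_t : ∀ t ∈ Icc 0 T, ∀ x ∈ Ici x0, HasDerivWithinAt (fun t => u 1 t x) (kMinus ε * V t x *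
      (Nm + 4 * μ t x - 2 * eta ε * (exp (-u 3 t x) * u 4 t x) - u' 1 t x)) (Icc 0 T) t :=
    fun t ht x hx => (hdt 1 t ht x hx).congr_deriv (by
      simp only [speedOp, sourceOp, V, μ, w, withParam, Sum.elim_inl]; ring)
  obtain ⟨-, jt, jx, cbjt, cbjx, hjt, hjx⟩ := id cbj
  set Wt : ℝ → ℝ → ℝ := fun t x => exp (-(1 * x)) * deriv (π 1) t +
    exp (-(1 * x)) * ∫ y in x0..x, exp (1 * y) * jt t y
  have Wt_x : ∀ t ∈ Icc 0 T, ∀ x ∈ Ici x0, HasDerivWithinAt (Wt t) (jt t x - Wt t x) (Ici x0) x := by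
    intro t ht x hx
    refine (((hexp x).mul_const (deriv (π 1) t)).add (hasDerivWithinAt_weightedIntegral 1 1
      (cbjt.continuousOn_slice ht) hx)).congr_of_eventuallyEq_of_mem
      (.of_forall fun y => ?_) hx |>.congr_deriv ?_
    · simp [Wt]
    · simp [Wt]; ring
  have s'_t : ∀ t ∈ Icc 0 T, ∀ x ∈ Ici x0, HasDerivWithinAt (fun t => u' 3 t x)
      (exp (-x) * (exp (-u 3 t x) * (jj t x - 2 * W t x - u' 3 t x * W t x))) (Icc 0 T) t :=
    fun t ht x hx => CB.hasDerivWithinAt_mixed (hx := fun t x => exp (-x) * (exp (-u 3 t x) *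
        (jj t x - 2 * W t x - u' 3 t x * W t x)))
      (hex.mul (hes.zero.mul ((cbj.zero.sub (cbW.zero.const_mul 2)).sub ((hu' 3).mul cbW.zero))))
      (hdx 3) s_t (fun t ht x hx => ((hexp x).mul ((hdx 3 t ht x hx).neg.exp.mul
        (W_x t ht x hx))).congr_deriv (by simp only [Pi.mul_apply, Pi.neg_apply]; ring)) ht hx
  have s_x : ∀ t ∈ Icc 0 T, ∀ x ∈ Ici x0,
      HasDerivWithinAt (u 3 t) (exp (-u 3 t x) * u 4 t x - 2) (Ici x0) x := fun t ht x hx => by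
    refine (hdx 3 t ht x hx).congr_deriv ?_
    have q : ∀ t, exp (u 3 t x) * exp (-u 3 t x) = 1 := fun t => by rw [← exp_add]; simp
    have h := eq_of_hasDerivWithinAt_zero (convex_Icc 0 T)
      (f := fun t => exp (u 3 t x) * (u' 3 t x + 2) - u 4 t x) (fun t ht =>
        (((s_t t ht x hx).exp.mul ((s'_t t ht x hx).add_const 2)).sub (R_t t ht x hx)).congr_deriv
        (by linear_combination exp (-x) * jj t x * q t)) ⟨le_rfl, hT.le⟩ ht
    simp only [hdata x hx] at h
    linear_combination exp (-u 3 t x) * (h + u 4 0 x * q 0) - (u' 3 t x + 2) * q t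
  refine ⟨omt, Wt,
    { V_eq := fun _ _ => rfl
      Y_eq := fun _ _ => rfl
      μ_eq := fun _ _ => rfl
      cbA := hu 0
      cbB := hu 1
      cbom := ⟨(hcb (causal_om hθ)).zero, omt, μ, (CB.of_smooth (contDiff_infty_iff_deriv.1 (hπ 0)).2).add
        (CB.integral le_rfl (by linarith) hint0 cbmt), hcb (causal_mu hθ), om_t, om_x⟩
      cbm := hu 2
      cbs := ⟨(hu 3).zero, _, _, hex.mul (hes.mul cbW), (hes.mul (hu 4)).sub (CB.const 2), s_t, s_x⟩
      cbR := hu 4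
      cbW := cbW
      cbA' := hu' 0
      cbB' := hu' 1
      cbm' := hu' 2
      cbR' := hu' 4
      A_t := A_t
      B_t := B_t
      A_x := hdx 0
      B_x := hdx 1
      om_t := om_t
      om_x := om_x
      omt_x := omt_x
      μ_t := fun t ht x hx => ((m_t t ht x hx).const_mul (exp (-(θ * x)))).congr_deriv (by
        rw [← mul_assoc, ← exp_add]; ring_nf; rfl)
      m_x := hdx 2
      s_t := s_t
      s_x := s_x
      R_t := R_t
      R_x := hdx 4
      R'_t := fun t ht x hx => (CB.hasDerivWithinAt_mixed (hx := fun t x => exp (-x) * (jx t x - jj t x))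
        (hex.mul (cbjx.sub cbj.zero)) (hdx 4) R_t (fun t ht x hx =>
        ((hexp x).mul (hjx t ht x hx)).congr_deriv (by ring)) ht hx).congr_deriv (by
        rw [(uniqueDiffOn_Ici x0 x hx).eq_deriv _ (hjx t ht x hx)
          (hasDerivWithinAt_waveR (Y := fun x => Y t x) (om := fun x => om t x)
          (hasDerivWithinAt_dens_x (nu ε Np Nm) (hdx 0 t ht x hx) (hdx 1 t ht x hx)
          (om_x t ht x hx) (s_x t ht x hx)) (om_x t ht x hx))]; rfl)
      W_t := fun t ht x hx => ((hdp 1 t).const_mul _).add (CB.hasDerivWithinAt_integral_param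
        (exp_integral_bound_pos zero_lt_one) cbj.zero cbjt hjt ht hx)
      W_x := W_x
      Wt_x := fun t ht x hx => (Wt_x t ht x hx).congr_deriv (by
        rw [(uniqueDiffOn_Icc hT t ht).eq_deriv _ (hjt t ht x hx)
          (hasDerivWithinAt_waveR (Y := fun t => Y t x) (om := fun t => om t x)
          (hasDerivWithinAt_dens_t (nu ε Np Nm) (A_t t ht x hx) (B_t t ht x hx) (om_t t ht x hx)
          (s_t t ht x hx)) (om_t t ht x hx))]) }⟩

end

/-! ### The field equations in the variables `t = p - p₀`, `x = log q` -/

theorem HasDerivAt.comp_log {g : ℝ → ℝ} {d q : ℝ} (hq : 0 < q) (h : HasDerivAt g d (log q)) :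
    HasDerivAt (fun s => g (log s)) (exp (-log q) * d) q := by
  refine (h.comp q (hasDerivAt_log hq.ne')).congr_deriv ?_
  rw [exp_neg, exp_log hq, mul_comm]

theorem waveOmF_eq (ε Y om s W T : ℝ) : waveOmF ε Y om s W T = exp (-s) *
    (1 / 4 * exp (2 * om) + 1 / 4 * (W * T * exp (-s)) - (1 + eta ε) * Real.pi * Y) := by
  rw [waveOmF, sub_eq_add_neg (2 * om), two_mul s, neg_add, exp_add, exp_add]; ring

/-- `Ω⁴ r² T^{pp}`. -/
def ppF (ε ν A B x : ℝ) : ℝ :=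
  exp (1 / (2 * kap ε) * (A + B) - 1 / 2 * (A - B)) * exp (-((2 * eta ε + ν) * x))

/-- The outgoing constraint. -/
def outgoingF (ε ν A B s μ R Rx x : ℝ) : ℝ :=
  (R + Rx) / 2 - exp (-s) * R ^ 2 / 4 - μ * R + Real.pi * ppF ε ν A B x

/-- `Ω⁴ r² T^{qq}`. -/
def qqF (ε ν A B om s x : ℝ) : ℝ :=
  (1 + eta ε) ^ 2 * (exp (1 / (2 * kap ε) * (A + B) + 1 / 2 * (A - B) +
    (4 * om - 2 * eta ε * s)) * exp (-((2 * eta ε + ν) * x)))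

/-- The fields `F` are given on `N` by `A = log (q^{N₊} f⁺)`, `B = log (q^{N₋} f⁻)`, `om = log Ω`,
`s = log (r²/q²)`, with `R = ∂_q r² / q`, `W = ∂_p r² / q` and `μ = q ∂_q log Ω`. -/
structure Polar (Np Nm p0 : ℝ) (F : Fields) (N : Set (ℝ × ℝ)) (A B om s R μ W : ℝ → ℝ → ℝ) :
    Prop where
  isOpen : IsOpen N
  pos : ∀ w ∈ N, 0 < w.2
  fP : ∀ w ∈ N, F.fP w = exp (A (w.1 - p0) (log w.2) - Np * log w.2)
  fM : ∀ w ∈ N, F.fM w = exp (B (w.1 - p0) (log w.2) - Nm * log w.2)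
  Om : ∀ w ∈ N, F.Om w = exp (om (w.1 - p0) (log w.2))
  r : ∀ w ∈ N, F.r w = exp (log w.2 + s (w.1 - p0) (log w.2) / 2)
  om_x : ∀ w ∈ N, HasDerivAt (om (w.1 - p0)) (μ (w.1 - p0) (log w.2)) (log w.2)
  s_t : ∀ w ∈ N, HasDerivAt (fun t => s t (log w.2)) (exp (-log w.2) *
    (exp (-s (w.1 - p0) (log w.2)) * W (w.1 - p0) (log w.2))) (w.1 - p0)
  s_x : ∀ w ∈ N, HasDerivAt (s (w.1 - p0)) (exp (-s (w.1 - p0) (log w.2)) *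
    R (w.1 - p0) (log w.2) - 2) (log w.2)

theorem exp_neg_half (x s : ℝ) : exp (-s / 2) = exp (-x) * exp (x + s / 2) * exp (-s) := by
  rw [← exp_add, ← exp_add]; ring_nf

namespace Polar

variable {ε Np Nm p0 : ℝ} {F : Fields} {N : Set (ℝ × ℝ)} {A B om s R μ W : ℝ → ℝ → ℝ}
  {z : ℝ × ℝ} {t x At Ax Bt Bx omt μt Rt Rx Wt : ℝ}

theorem logJet (H : Polar Np Nm p0 F N A B om s R μ W) (hz : z ∈ N) (ht : t = z.1 - p0)
    (hx : x = log z.2)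
    (hAt : HasDerivAt (fun t => A t x) At t) (hAx : HasDerivAt (A t) Ax x)
    (hBt : HasDerivAt (fun t => B t x) Bt t) (hBx : HasDerivAt (B t) Bx x) :
    LogJet F N z (fun w => A (w.1 - p0) (log w.2) - Np * log w.2)
      (fun w => B (w.1 - p0) (log w.2) - Nm * log w.2)
      (fun w => om (w.1 - p0) (log w.2))
      (fun w => log w.2 + s (w.1 - p0) (log w.2) / 2)
      At (exp (-x) * (Ax - Np)) Bt (exp (-x) * (Bx - Nm)) (exp (-x) * μ t x)
      (exp (-x) * (exp (-s t x) * R t x) / 2) := by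
  subst ht hx
  have hq := H.pos z hz
  have hid : ∀ c : ℝ, HasDerivAt (fun y : ℝ => c * y) c (log z.2) := fun c => by
    simpa using (hasDerivAt_id (log z.2)).const_mul c
  refine ⟨H.isOpen, hz, H.fP, H.fM, H.Om, H.r, ?_, ?_, ?_, ?_, ?_, ?_⟩
  · exact (HasDerivAt.comp_sub_const z.1 p0 hAt).sub_const (Np * log z.2)
  · exact HasDerivAt.comp_log hq (hAx.sub (hid Np))
  · exact (HasDerivAt.comp_sub_const z.1 p0 hBt).sub_const (Nm * log z.2)
  · exact HasDerivAt.comp_log hq (hBx.sub (hid Nm))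
  · exact HasDerivAt.comp_log hq (H.om_x z hz)
  · refine (HasDerivAt.comp_log hq ((hasDerivAt_id' (log z.2)).add
      ((H.s_x z hz).div_const 2))).congr_deriv ?_
    ring

theorem dq_r (H : Polar Np Nm p0 F N A B om s R μ W) : ∀ w ∈ N, dq F.r w =
    exp (-s (w.1 - p0) (log w.2) / 2) * R (w.1 - p0) (log w.2) / 2 := by
  intro w hw
  have h := HasDerivAt.comp_log (H.pos w hw) (((hasDerivAt_id' (log w.2)).add
      ((H.s_x w hw).div_const 2)).exp)
  rw [dq_eq (v := fun w => exp (log w.2 + s (w.1 - p0) (log w.2) / 2)) H.isOpen hw H.r h]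
  rw [Pi.add_apply, exp_neg_half (log w.2)]; ring

theorem dp_r (H : Polar Np Nm p0 F N A B om s R μ W) : ∀ w ∈ N, dp F.r w =
    exp (-s (w.1 - p0) (log w.2) / 2) * W (w.1 - p0) (log w.2) / 2 := by
  intro w hw
  have h := (((HasDerivAt.comp_sub_const w.1 p0 (H.s_t w hw)).div_const 2).const_add (log w.2)).exp
  rw [dp_eq (v := fun w => exp (log w.2 + s (w.1 - p0) (log w.2) / 2)) H.isOpen hw H.r h]
  rw [exp_neg_half (log w.2)]; ring

theorem dq_logOm (H : Polar Np Nm p0 F N A B om s R μ W) : ∀ w ∈ N,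
    dq (fun w => log (F.Om w)) w =
      exp (-log w.2) * μ (w.1 - p0) (log w.2) := fun w hw =>
  dq_eq (v := fun w => om (w.1 - p0) (log w.2)) H.isOpen hw
    (fun w hw => by rw [H.Om w hw, log_exp]) (HasDerivAt.comp_log (H.pos w hw) (H.om_x w hw))

theorem values (H : Polar Np Nm p0 F N A B om s R μ W) (hz : z ∈ N) (ht : t = z.1 - p0)
    (hx : x = log z.2) : F.r z = exp (x + s t x / 2) ∧ F.Om z = exp (om t x) ∧
    dq F.r z = exp (-s t x / 2) * R t x / 2 ∧ dp F.r z = exp (-s t x / 2) * W t x / 2 := by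
  subst ht hx
  exact ⟨H.r z hz, H.Om z hz, H.dq_r z hz, H.dp_r z hz⟩

theorem speed_eq (h0 : 0 < ε) (h1 : ε < 1) (hN : Np = Nm - 4 * eta ε)
    (H : Polar Np Nm p0 F N A B om s R μ W) (hz : z ∈ N)
    (ht : t = z.1 - p0) (hx : x = log z.2) :
    F.speed ε z = exp x * velF ε (A t x) (B t x) (om t x) (s t x) x := by
  subst ht hx
  rw [speed_exp h0 h1 (H.fP z hz) (H.fM z hz) (H.Om z hz) (H.r z hz), velF, hN, ← exp_add,
    mul_left_comm, ← exp_add]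
  ring_nf

theorem dens_eq (h1 : ε < 1) (H : Polar Np Nm p0 F N A B om s R μ W) (hz : z ∈ N)
    (ht : t = z.1 - p0) (hx : x = log z.2) :
    F.r z * F.Om z ^ 4 * (F.toFluidMetric ε).Tpq ε z = exp (-x - s t x / 2) *
      densF ε (nu ε Np Nm) (A t x) (B t x) (om t x) (s t x) x := by
  subst ht hx
  rw [Tpq_exp h1 (H.fP z hz) (H.fM z hz) (H.Om z hz) (H.r z hz), H.r z hz, H.Om z hz, densF, nu,
    ← exp_nat_mul, ← exp_add, ← exp_add, ← exp_add, ← exp_add]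
  push_cast
  ring_nf

/-- The wave equation for `r`. -/
theorem rWave_iff (h1 : ε < 1) (H : Polar Np Nm p0 F N A B om s R μ W) (hz : z ∈ N)
    (ht : t = z.1 - p0) (hx : x = log z.2) (hRt : HasDerivAt (fun t => R t x) Rt t) :
    RWaveAt ε (F.toFluidMetric ε) z ↔ Rt = exp (-x) *
      waveRF (densF ε (nu ε Np Nm) (A t x) (B t x) (om t x) (s t x) x) (om t x) := by
  have hd := H.dens_eq h1 hz ht hx
  obtain ⟨e0, e3, e1, e2⟩ := H.values hz ht hx
  have hst := H.s_t z hz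
  rw [← ht, ← hx] at hst
  have hdd : dp (dq F.r) z = exp (-s t x / 2) * (Rt - exp (-x) *
      (exp (-s t x) * W t x) * R t x / 2) / 2 := by
    have h2 := ((hst.neg.div_const 2).exp.mul hRt).div_const 2
    rw [hx, ht] at h2
    rw [dp_eq H.isOpen hz H.dq_r (HasDerivAt.comp_sub_const z.1 p0 h2)]
    rw [← hx, ← ht]
    simp only [Pi.neg_apply]; ring
  rw [RWaveAt]
  change dp (dq F.r) z = -(F.Om z ^ 2 / (4 * F.r z)) - 1 / F.r z * dp F.r z * dq F.r z
    + Real.pi * F.r z * F.Om z ^ 4 * _ ↔ _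
  have hd' : Real.pi * F.r z * F.Om z ^ 4 * (F.toFluidMetric ε).Tpq ε z = Real.pi * (exp (-x - s t x / 2) *
      densF ε (nu ε Np Nm) (A t x) (B t x) (om t x) (s t x) x) := by rw [← hd]; ring
  rw [hd', hdd, e1, e2, e0, e3, waveRF, ← exp_nat_mul]
  set Y := densF ε (nu ε Np Nm) (A t x) (B t x) (om t x) (s t x) x
  have q1 : 1 / exp (x + s t x / 2) = exp (-x) * exp (-s t x / 2) := by
    rw [one_div, ← exp_neg, ← exp_add]; ring_nf
  have q2 : exp ((2 : ℕ) * om t x) / (4 * exp (x + s t x / 2)) =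
      exp (2 * om t x) / 4 * (exp (-x) * exp (-s t x / 2)) := by
    rw [← q1]; push_cast; ring
  have q3 : exp (-x - s t x / 2) = exp (-x) * exp (-s t x / 2) := by
    rw [← exp_add]; ring_nf
  have q4 : exp (-s t x) = exp (-s t x / 2) * exp (-s t x / 2) := by
    rw [← exp_add]; ring_nf
  rw [q1, q2, q3, q4]
  exact eq_iff_of_sub (c := exp (-s t x / 2) / 2) (by positivity) (by ring)

/-- The wave equation for `log Ω`. -/
theorem omegaWave_iff (h1 : ε < 1) (H : Polar Np Nm p0 F N A B om s R μ W) (hz : z ∈ N)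
    (ht : t = z.1 - p0) (hx : x = log z.2) (hμt : HasDerivAt (fun t => μ t x) μt t) :
    OmegaWaveAt ε (F.toFluidMetric ε) z ↔ μt = exp (-x) *
      waveOmF ε (densF ε (nu ε Np Nm) (A t x) (B t x) (om t x) (s t x) x) (om t x) (s t x) (W t x)
        (R t x) := by
  have hd := H.dens_eq h1 hz ht hx
  obtain ⟨e0, e3, e1, e2⟩ := H.values hz ht hx
  have hdd : dp (dq fun w => log (F.Om w)) z = exp (-x) * μt := by
    have h2 := hμt.const_mul (exp (-x))
    rw [hx, ht] at h2
    rw [dp_eq H.isOpen hz H.dq_logOm (HasDerivAt.comp_sub_const z.1 p0 h2), hx]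
  rw [OmegaWaveAt]
  change dp (dq fun w => log (F.Om w)) z = -((1 + eta ε) * Real.pi * F.Om z ^ 4 *
    (F.toFluidMetric ε).Tpq ε z) + F.Om z ^ 2 / (4 * F.r z ^ 2)
    + 1 / F.r z ^ 2 * dp F.r z * dq F.r z ↔ _
  set Y := densF ε (nu ε Np Nm) (A t x) (B t x) (om t x) (s t x) x
  have hr : F.r z ≠ 0 := by rw [e0]; exact (exp_pos _).ne'
  have q1 : 1 / F.r z = exp (-x) * exp (-s t x / 2) := by
    rw [e0, one_div, ← exp_neg, ← exp_add]; ring_nf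
  have q3 : exp (-x - s t x / 2) = exp (-x) * exp (-s t x / 2) := by
    rw [← exp_add]; ring_nf
  have q4 : exp (-s t x) = exp (-s t x / 2) * exp (-s t x / 2) := by
    rw [← exp_add]; ring_nf
  have q5 : exp (2 * om t x) = exp (om t x) ^ 2 := by rw [← exp_nat_mul]; push_cast; rfl
  rw [hdd, e1, e2, e3, waveOmF_eq, q5, q4]
  have hd' : (1 + eta ε) * Real.pi * exp (om t x) ^ 4 * (F.toFluidMetric ε).Tpq ε z =
      (1 + eta ε) * Real.pi * (exp (-x) * exp (-s t x / 2) *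
        (exp (-x) * exp (-s t x / 2) * Y)) := by
    rw [← q3, ← hd, q3, ← q1, e3]; field_simp
  rw [hd', div_mul_eq_div_mul_one_div, ← one_div_pow, q1]
  exact eq_iff_of_sub (exp_pos (-x)).ne' (by ring)

theorem fPlus_iff (h0 : 0 < ε) (h1 : ε < 1) (hN : Np = Nm - 4 * eta ε)
    (H : Polar Np Nm p0 F N A B om s R μ W) (hz : z ∈ N) (ht : t = z.1 - p0)
    (hx : x = log z.2)
    (hAt : HasDerivAt (fun t => A t x) At t) (hAx : HasDerivAt (A t) Ax x)
    (hBt : HasDerivAt (fun t => B t x) Bt t) (hBx : HasDerivAt (B t) Bx x) :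
    FPlusTransportAt ε F z ↔ At = kPlus ε * velF ε (A t x) (B t x) (om t x) (s t x) x *
      (Np - 4 * μ t x + 2 * eta ε * (exp (-s t x) * R t x) - Ax) := by
  rw [(H.logJet hz ht hx hAt hAx hBt hBx).fPlus_iff, H.speed_eq h0 h1 hN hz ht hx]
  have e : exp x * exp (-x) = 1 := by rw [← exp_add]; simp
  refine eq_iff_of_sub one_ne_zero ?_
  linear_combination kPlus ε * velF ε (A t x) (B t x) (om t x) (s t x) x *
    (Ax - Np + 2 * (2 * μ t x - 2 * eta ε * (exp (-s t x) * R t x) / 2)) * e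

theorem fMinus_iff (h0 : 0 < ε) (h1 : ε < 1) (hN : Np = Nm - 4 * eta ε)
    (H : Polar Np Nm p0 F N A B om s R μ W) (hz : z ∈ N) (ht : t = z.1 - p0)
    (hx : x = log z.2)
    (hAt : HasDerivAt (fun t => A t x) At t) (hAx : HasDerivAt (A t) Ax x)
    (hBt : HasDerivAt (fun t => B t x) Bt t) (hBx : HasDerivAt (B t) Bx x) :
    FMinusTransportAt ε F z ↔ Bt = kMinus ε * velF ε (A t x) (B t x) (om t x) (s t x) x *
      (Nm + 4 * μ t x - 2 * eta ε * (exp (-s t x) * R t x) - Bx) := by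
  rw [(H.logJet hz ht hx hAt hAx hBt hBx).fMinus_iff, H.speed_eq h0 h1 hN hz ht hx]
  have e : exp x * exp (-x) = 1 := by rw [← exp_add]; simp
  refine eq_iff_of_sub one_ne_zero ?_
  linear_combination kMinus ε * velF ε (A t x) (B t x) (om t x) (s t x) x *
    (Bx - Nm - 2 * (2 * μ t x - 2 * eta ε * (exp (-s t x) * R t x) / 2)) * e

/-- The outgoing constraint. -/
theorem constraintQ_iff (h0 : 0 < ε) (h1 : ε < 1) (hN : Np = Nm - 4 * eta ε)
    (H : Polar Np Nm p0 F N A B om s R μ W) (hz : z ∈ N) (ht : t = z.1 - p0)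
    (hx : x = log z.2) (hRx : HasDerivAt (R t) Rx x) :
    ConstraintQAt ε (F.toFluidMetric ε) z ↔
      outgoingF ε (nu ε Np Nm) (A t x) (B t x) (s t x) (μ t x) (R t x) Rx x = 0 := by
  have e1 : ∀ w ∈ N, dq F.r w / F.Om w ^ 2 = exp (-s (w.1 - p0) (log w.2) / 2 -
      2 * om (w.1 - p0) (log w.2)) * R (w.1 - p0) (log w.2) / 2 := fun w hw => by
    rw [H.dq_r w hw, H.Om w hw, ← exp_nat_mul, exp_sub]; push_cast; ring
  have hsx := H.s_x z hz
  have homx := H.om_x z hz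
  rw [← ht, ← hx] at hsx homx
  have h2 := ((((hsx.neg.div_const 2).sub (homx.const_mul 2)).exp.mul hRx).div_const 2)
  rw [hx] at h2
  have hdd := dq_eq H.isOpen hz e1 (by dsimp only; rw [← ht]; exact HasDerivAt.comp_log (H.pos z hz) h2)
  have hr : F.r z * F.Om z ^ 2 * (F.toFluidMetric ε).Tpp ε z =
      exp (-x) * exp (-s t x / 2 - 2 * om t x) * ppF ε (nu ε Np Nm) (A t x) (B t x) x := by
    subst ht hx
    rw [Tpp_exp h0 h1 (H.fP z hz) (H.fM z hz) (H.Om z hz) (H.r z hz), H.r z hz, H.Om z hz, ppF, nu, hN,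
      ← exp_nat_mul, ← exp_add, ← exp_add, ← exp_add, ← exp_add, ← exp_add]
    push_cast
    ring_nf
  rw [ConstraintQAt]
  change dq (fun w => dq F.r w / F.Om w ^ 2) z = -(Real.pi * F.r z * F.Om z ^ 2 * _) ↔ _
  rw [hdd, show Real.pi * F.r z * F.Om z ^ 2 * (F.toFluidMetric ε).Tpp ε z =
    Real.pi * (F.r z * F.Om z ^ 2 * (F.toFluidMetric ε).Tpp ε z) by ring, hr]
  simp only [← hx, Pi.sub_apply, Pi.neg_apply]
  exact eq_iff_of_sub (mul_pos (exp_pos (-x)) (exp_pos (-s t x / 2 - 2 * om t x))).ne' (by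
    rw [outgoingF]; ring)

/-- The ingoing constraint. -/
theorem constraintP_iff (h0 : 0 < ε) (h1 : ε < 1) (hN : Np = Nm - 4 * eta ε)
    (H : Polar Np Nm p0 F N A B om s R μ W) (hz : z ∈ N) (ht : t = z.1 - p0)
    (hx : x = log z.2) (homt : HasDerivAt (fun t => om t x) omt t)
    (hWt : HasDerivAt (fun t => W t x) Wt t) :
    ConstraintPAt ε (F.toFluidMetric ε) z ↔ exp x * (Wt / 2 - omt * W t x) -
      exp (-s t x) * W t x ^ 2 / 4
      + Real.pi * qqF ε (nu ε Np Nm) (A t x) (B t x) (om t x) (s t x) x = 0 := by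
  have e1 : ∀ w ∈ N, dp F.r w / F.Om w ^ 2 = exp (-s (w.1 - p0) (log w.2) / 2 -
      2 * om (w.1 - p0) (log w.2)) * W (w.1 - p0) (log w.2) / 2 := fun w hw => by
    rw [H.dp_r w hw, H.Om w hw, ← exp_nat_mul, exp_sub]; push_cast; ring
  have hst := H.s_t z hz
  rw [← ht, ← hx] at hst
  have h2 := ((((hst.neg.div_const 2).sub (homt.const_mul 2)).exp.mul hWt).div_const 2)
  rw [ht] at h2
  have hdd := dp_eq H.isOpen hz e1 (by dsimp only; rw [← hx]; exact HasDerivAt.comp_sub_const z.1 p0 h2)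
  have hr : F.r z * F.Om z ^ 2 * (F.toFluidMetric ε).Tqq ε z = exp (-x) *
      exp (-s t x / 2 - 2 * om t x) * qqF ε (nu ε Np Nm) (A t x) (B t x) (om t x) (s t x) x := by
    subst ht hx
    rw [Tqq_exp h0 h1 (H.fP z hz) (H.fM z hz) (H.r z hz), H.r z hz, H.Om z hz, qqF, nu, hN,
      ← exp_nat_mul, ← exp_add, mul_left_comm, mul_left_comm _ ((1 + eta ε) ^ 2),
      ← exp_add, ← exp_add, ← exp_add, ← exp_add]
    push_cast
    ring_nf
  rw [ConstraintPAt]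
  change dp (fun w => dp F.r w / F.Om w ^ 2) z = -(Real.pi * F.r z * F.Om z ^ 2 * _) ↔ _
  rw [hdd, show Real.pi * F.r z * F.Om z ^ 2 * (F.toFluidMetric ε).Tqq ε z =
    Real.pi * (F.r z * F.Om z ^ 2 * (F.toFluidMetric ε).Tqq ε z) by ring, hr]
  simp only [← ht, Pi.sub_apply, Pi.neg_apply]
  have e : exp (-x) * exp x = 1 := by rw [← exp_add]; simp
  refine eq_iff_of_sub (mul_pos (exp_pos (-x)) (exp_pos (-s t x / 2 - 2 * om t x))).ne' ?_
  linear_combination -exp (-s t x / 2 - 2 * om t x) * (Wt / 2 - omt * W t x) * e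

end Polar

/-! ### Propagation of the constraints and the mass at infinity -/

section Algebra

variable {ε Np Nm : ℝ}

theorem vel_mul_pp (ν A B om s x : ℝ) : velF ε A B om s x * ppF ε ν A B x =
    (1 + eta ε) ^ 2 * (exp (-x) * densF ε ν A B om s x) := by
  rw [velF, ppF, densF, mul_assoc, ← exp_add, ← exp_add, ← exp_add, ← exp_add,
    ← exp_add]
  ring_nf

theorem vel_mul_dens (ν A B om s x : ℝ) : velF ε A B om s x * densF ε ν A B om s x =
    exp (-x) * qqF ε ν A B om s x := by
  rw [velF, qqF, densF, mul_assoc, mul_left_comm (exp (-x)), ← exp_add, ← exp_add,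
    ← exp_add, ← exp_add, ← exp_add]
  ring_nf

theorem two_kap_inv (h0 : 0 < ε) (h1 : ε < 1) : 1 / (2 * kap ε) * kap ε = 1 / 2 := by
  have := kap_pos h0 h1
  field_simp

theorem nu_eq (Np Nm : ℝ) : nu ε Np Nm = 1 / (2 * kap ε) * (Np + Nm) := by rw [nu]; ring

end Algebra

namespace StripSol

variable {ε θ Np Nm T x0 : ℝ} {A B om m s R W A' B' m' R' omt Wt : ℝ → ℝ → ℝ}
    {V Y μ : ℝ → ℝ → ℝ}

/-- The outgoing constraint propagates. -/
theorem constraintQ (H : StripSol ε θ Np Nm T x0 A B om m s R W A' B' m' R' omt Wt V Y μ)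
    (h0 : 0 < ε) (h1 : ε < 1)
    (hdata : ∀ x ∈ Ici x0, outgoingF ε (nu ε Np Nm) (A 0 x) (B 0 x) (s 0 x) (μ 0 x) (R 0 x) (R' 0 x) x = 0)
    {t x : ℝ} (ht : t ∈ Icc 0 T) (hx : x ∈ Ici x0) :
    outgoingF ε (nu ε Np Nm) (A t x) (B t x) (s t x) (μ t x) (R t x) (R' t x) x = 0 := by
  have hd : ∀ t ∈ Icc 0 T, HasDerivWithinAt (fun t =>
      outgoingF ε (nu ε Np Nm) (A t x) (B t x) (s t x) (μ t x) (R t x) (R' t x) x) 0 (Icc 0 T) t := by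
    intro t ht
    have hpp := ((((H.A_t t ht x hx).add (H.B_t t ht x hx)).const_mul (1 / (2 * kap ε))).sub
      (((H.A_t t ht x hx).sub (H.B_t t ht x hx)).const_mul (1 / 2))).exp.mul_const
      (exp (-((2 * eta ε + nu ε Np Nm) * x)))
    refine ((((((H.R_t t ht x hx).add (H.R'_t t ht x hx)).div_const 2).sub
      (((H.s_t t ht x hx).neg.exp.mul ((H.R_t t ht x hx).pow 2)).div_const 4)).sub
      ((H.μ_t t ht x hx).mul (H.R_t t ht x hx))).add (hpp.const_mul Real.pi)).congr_deriv ?_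
    have hVP := vel_mul_pp (ε := ε) (nu ε Np Nm) (A t x) (B t x) (om t x) (s t x) x
    rw [← H.V_eq, ← H.Y_eq] at hVP
    have hk := kap_sq h0 h1
    have hc := two_kap_inv h0 h1
    have hν := nu_eq (ε := ε) Np Nm
    have hP : ppF ε (nu ε Np Nm) (A t x) (B t x) x =
      exp (1 / (2 * kap ε) * (A t x + B t x) - 1 / 2 * (A t x - B t x)) *
        exp (-((2 * eta ε + nu ε Np Nm) * x)) := rfl
    simp only [Pi.add_apply, Pi.sub_apply, Pi.neg_apply, Pi.pow_apply, waveOmF_eq, waveRF, waveRD, densD,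
      kPlus_eq, kMinus_eq]
    push_cast
    rw [hP] at hVP
    rw [hν] at hVP ⊢
    set e1 := exp (1 / (2 * kap ε) * (A t x + B t x) - 1 / 2 * (A t x - B t x))
    set e2 := exp (-((2 * eta ε + 1 / (2 * kap ε) * (Np + Nm)) * x))
    set c := 1 / (2 * kap ε)
    set κ := kap ε
    set es := exp (-s t x)
    set E := exp (-x)
    set P := Np - 4 * μ t x + 2 * eta ε * (es * R t x) - A' t x with hPd
    set Q := Nm + 4 * μ t x - 2 * eta ε * (es * R t x) - B' t x with hQd
    have hPQ : e1 * e2 * (c * ((1 + κ) * V t x * P + (1 - κ) * V t x * Q) -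
        1 / 2 * ((1 + κ) * V t x * P - (1 - κ) * V t x * Q)) = E * Y t x * c * (P + Q) := by
      linear_combination ((1 - κ ^ 2) * c * (P + Q)) * hVP + (E * Y t x * c * (P + Q)) * hk +
        e1 * e2 * V t x * (P * (1 + κ) - Q * (1 - κ)) * hc
    rw [hPd, hQd] at hPQ
    linear_combination Real.pi * hPQ
  have := eq_of_hasDerivWithinAt_zero (convex_Icc 0 T) hd (left_mem_Icc.2 (ht.1.trans ht.2)) ht
  rw [this]
  exact hdata x hx

/-- The ingoing constraint propagates. -/
theorem constraintP (H : StripSol ε θ Np Nm T x0 A B om m s R W A' B' m' R' omt Wt V Y μ)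
    (hN : Np = Nm - 4 * eta ε) (h0 : 0 < ε) (h1 : ε < 1) {t x y : ℝ}
    (ht : t ∈ Icc 0 T) (hx : x ∈ Ici x0) (hy : y ∈ Ici x0)
    (hdata : exp y * (Wt t y / 2 - omt t y * W t y) - exp (-s t y) * W t y ^ 2 / 4
      + Real.pi * qqF ε (nu ε Np Nm) (A t y) (B t y) (om t y) (s t y) y = 0) :
    exp x * (Wt t x / 2 - omt t x * W t x) - exp (-s t x) * W t x ^ 2 / 4
      + Real.pi * qqF ε (nu ε Np Nm) (A t x) (B t x) (om t x) (s t x) x = 0 := by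
  have hd : ∀ x ∈ Ici x0, HasDerivWithinAt (fun x => exp x * (Wt t x / 2 - omt t x * W t x) -
      exp (-s t x) * W t x ^ 2 / 4 + Real.pi *
      qqF ε (nu ε Np Nm) (A t x) (B t x) (om t x) (s t x) x) 0 (Ici x0) x := by
    intro x hx
    have he : HasDerivWithinAt (fun x => exp (-((2 * eta ε + nu ε Np Nm) * x)))
        (exp (-((2 * eta ε + nu ε Np Nm) * x)) * -((2 * eta ε + nu ε Np Nm) * 1)) (Ici x0) x :=
      ((hasDerivAt_id x).const_mul (2 * eta ε + nu ε Np Nm)).neg.exp.hasDerivWithinAt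
    have hA := H.A_x t ht x hx
    have hB := H.B_x t ht x hx
    have hW := H.W_x t ht x hx
    have hs := H.s_x t ht x hx
    have hqq := (((((hA.add hB).const_mul (1 / (2 * kap ε))).add ((hA.sub hB).const_mul (1 / 2))).add
      (((H.om_x t ht x hx).const_mul 4).sub (hs.const_mul (2 * eta ε)))).exp.mul he).const_mul
      ((1 + eta ε) ^ 2)
    refine ((((hasDerivAt_exp x).hasDerivWithinAt.mul (((H.Wt_x t ht x hx).div_const 2).sub
      ((H.omt_x t ht x hx).mul hW))).sub ((hs.neg.exp.mul (hW.pow 2)).div_const 4)).add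
      (hqq.const_mul Real.pi)).congr_deriv ?_
    have hVY := vel_mul_dens (ε := ε) (nu ε Np Nm) (A t x) (B t x) (om t x) (s t x) x
    rw [← H.V_eq, ← H.Y_eq] at hVY
    have hc := two_kap_inv h0 h1
    have hν := nu_eq (ε := ε) Np Nm
    have q3 : exp x * exp (-x) = 1 := by rw [← exp_add]; simp
    rw [qqF] at hVY
    simp only [Pi.add_apply, Pi.sub_apply, Pi.neg_apply, Pi.mul_apply, Pi.pow_apply, waveOmF_eq, waveRF, waveRD, densD,
      kPlus_eq, kMinus_eq]
    push_cast
    rw [hν] at hVY ⊢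
    set e1 := exp (1 / (2 * kap ε) * (A t x + B t x) + 1 / 2 * (A t x - B t x) +
      (4 * om t x - 2 * eta ε * s t x))
    set e2 := exp (-((2 * eta ε + 1 / (2 * kap ε) * (Np + Nm)) * x))
    set c := 1 / (2 * kap ε)
    set κ := kap ε
    set es := exp (-s t x)
    set E := exp (-x)
    set X := exp x
    set G := 4 * μ t x - 2 * eta ε * (es * R t x) with hG
    have hPQ : X * (Y t x * (c * ((1 + κ) * V t x * (Np - G - A' t x) + (1 - κ) * V t x * (Nm + G - B' t x)))) =
        (1 + eta ε) ^ 2 * (e1 * e2) * (c * ((Np - A' t x) + (Nm - B' t x)) +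
          1 / 2 * ((Np - A' t x) - (Nm - B' t x)) - G) := by
      linear_combination X * (c * ((1 + κ) * (Np - G - A' t x) + (1 - κ) * (Nm + G - B' t x))) * hVY +
        X * E * ((1 + eta ε) ^ 2 * (e1 * e2)) * (Np - G - A' t x - (Nm + G - B' t x)) * hc +
        (1 + eta ε) ^ 2 * (e1 * e2) * (c * ((Np - A' t x) + (Nm - B' t x)) +
          1 / 2 * ((Np - A' t x) - (Nm - B' t x)) - G) * q3
    rw [hG] at hPQ
    subst hN
    linear_combination Real.pi * hPQ - (W t x * ((1 / 4 * (exp (2 * om t x) * es) + 1 / 4 * (W t x * R t x * (es * es)) -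
      (1 + eta ε) * Real.pi * (Y t x * es))) + Real.pi * eta ε * Y t x * es * W t x) * q3
  rw [eq_of_hasDerivWithinAt_zero (convex_Ici x0) hd hy hx]
  exact hdata

/-- The mass has a limit at infinity. -/
theorem exists_tendsto_mass
    (H : StripSol ε θ Np Nm T x0 A B om m s R W A' B' m' R' omt Wt V Y μ)
    (hν : 1 < 2 * eta ε + nu ε Np Nm) {t : ℝ} (ht : t ∈ Icc 0 T)
    (hK : ∀ x ∈ Ici x0,
      outgoingF ε (nu ε Np Nm) (A t x) (B t x) (s t x) (μ t x) (R t x) (R' t x) x = 0) :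
    ∃ L, Tendsto (fun x => exp (x + s t x / 2) / 2 *
      (1 + exp (-s t x - 2 * om t x) * (W t x * R t x))) atTop (𝓝 L) := by
  set c := 2 * eta ε + nu ε Np Nm with hc
  set G : ℝ → ℝ → ℝ := fun t x => exp (-1 / 2 * s t x + -2 * om t x) *
    (R t x * exp (1 / (2 * kap ε) * (A t x + B t x) + (2 * om t x - eta ε * s t x)) -
      W t x * exp (1 / (2 * kap ε) * (A t x + B t x) - 1 / 2 * (A t x - B t x))) with hGd
  have hom := H.cbom.pred
  have hs := H.cbs.pred
  have hG : CB 0 T x0 1 G :=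
    ((hs.const_mul (-1 / 2)).add (hom.const_mul (-2))).exp.mul
      ((H.cbR.mul (((H.cbA.add H.cbB).const_mul _).add ((hom.const_mul 2).sub
        (hs.const_mul (eta ε)))).exp).sub
      (H.cbW.mul (((H.cbA.add H.cbB).const_mul _).sub ((H.cbA.sub H.cbB).const_mul (1 / 2))).exp))
  have hd : ∀ x ∈ Ioi x0, HasDerivAt (fun x => exp (x + s t x / 2) / 2 *
      (1 + exp (-s t x - 2 * om t x) * (W t x * R t x)))
      (Real.pi * (exp (-(c - 1) * x) * G t x)) x := by
    intro x hx
    have hxc : x ∈ Ici x0 := Ioi_subset_Ici_self hx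
    have hn : Ici x0 ∈ 𝓝 x := Ici_mem_nhds hx
    have hsx := (H.s_x t ht x hxc).hasDerivAt hn
    have hox := (H.om_x t ht x hxc).hasDerivAt hn
    have hWx := (H.W_x t ht x hxc).hasDerivAt hn
    have hRx := (H.R_x t ht x hxc).hasDerivAt hn
    refine ((((hasDerivAt_id' x).add (hsx.div_const 2)).exp.div_const 2).mul
      (((hsx.neg.sub (hox.const_mul 2)).exp.mul (hWx.mul hRx)).const_add 1)).congr_deriv ?_
    have k := hK x hxc
    rw [outgoingF] at k
    have q1 : exp (-s t x) = exp (-s t x - 2 * om t x) * exp (2 * om t x) := by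
      rw [← exp_add]; ring_nf
    have q2 : Real.pi * (exp (-(c - 1) * x) * G t x) = Real.pi *
        (exp (x + s t x / 2) * exp (-s t x - 2 * om t x) *
          (R t x * Y t x - W t x * ppF ε (nu ε Np Nm) (A t x) (B t x) x)) := by
      rw [H.Y_eq, densF, ppF, ← hc]
      have e : exp (x + s t x / 2) * exp (-s t x - 2 * om t x) * exp (-(c * x)) =
        exp (-(c - 1) * x) * exp (-1 / 2 * s t x + -2 * om t x) := by
        rw [← exp_add, ← exp_add, ← exp_add]; ring_nf
      rw [hGd]
      linear_combination -Real.pi * (R t x * exp (1 / (2 * kap ε) * (A t x + B t x) +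
        (2 * om t x - eta ε * s t x)) - W t x * exp (1 / (2 * kap ε) * (A t x + B t x) -
          1 / 2 * (A t x - B t x))) * e
    rw [q2]
    simp only [Pi.add_apply, Pi.sub_apply, Pi.neg_apply, Pi.mul_apply, waveRF]
    rw [q1] at k ⊢
    set e1 := exp (x + s t x / 2)
    set e2 := exp (-s t x - 2 * om t x)
    linear_combination e1 * e2 * W t x * k
  have hcont : ContinuousOn (fun x => Real.pi * (exp (-(c - 1) * x) * G t x)) (Ici x0) :=
    continuousOn_const.mul (ContinuousOn.mul (by fun_prop) (hG.zero.continuousOn_slice ht))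
  have hint : IntegrableOn (fun x => Real.pi * (exp (-(c - 1) * x) * G t x)) (Ioi x0) := by
    refine integrable_of_isBigO_exp_neg (b := c - 1) (by linarith) hcont ?_
    obtain ⟨L, hL, h, -⟩ := hG.zero
    refine Asymptotics.IsBigO.of_bound (Real.pi * L) ?_
    filter_upwards [eventually_ge_atTop x0] with x hx
    rw [norm_eq_abs, norm_eq_abs, abs_mul, abs_mul, abs_of_pos Real.pi_pos,
      mul_comm |exp _|, ← mul_assoc]
    gcongr
    exact h t ht x hx
  exact ⟨_, tendsto_limUnder_of_hasDerivAt_of_integrableOn_Ioi hd hint⟩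

end StripSol

/-! ### The fields of a solution on the strip -/

section WeightedDerivatives

variable {p T q r : ℝ}

theorem mem_strip_log (hq : 0 < q) {z : ℝ × ℝ} (hz : z ∈ Icc p (p + T) ×ˢ Ici q) :
    z.1 - p ∈ Icc 0 T ∧ log z.2 ∈ Ici (log q) :=
  ⟨⟨by linarith [hz.1.1], by linarith [hz.1.2]⟩, log_le_log hq hz.2⟩

theorem continuousOn_comp_log (hq : 0 < q) {G : ℝ → ℝ → ℝ}
    (hG : ContinuousOn (uncurry G) (Icc 0 T ×ˢ Ici (log q))) :
    ContinuousOn (fun z : ℝ × ℝ => G (z.1 - p) (log z.2)) (Icc p (p + T) ×ˢ Ici q) := by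
  have h : ContinuousOn (fun z : ℝ × ℝ => (z.1 - p, log z.2)) (Icc p (p + T) ×ˢ Ici q) :=
    (by fun_prop : ContinuousOn (fun z : ℝ × ℝ => z.1 - p) _).prodMk
      (ContinuousOn.log (by fun_prop) fun z hz => (hq.trans_le hz.2).ne')
  exact hG.comp h fun z hz => mem_strip_log hq hz

/-- A weak `q`-derivative of a weighted function which is differentiable in `log q`. -/
theorem isWeakDeriv_weighted (hq : 0 < q) {u : ℝ × ℝ → ℝ} {G Gx : ℝ → ℝ → ℝ}
    (hG : ContinuousOn (uncurry G) (Icc 0 T ×ˢ Ici (log q)))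
    (hGx : ContinuousOn (uncurry Gx) (Icc 0 T ×ˢ Ici (log q)))
    (hd : ∀ t ∈ Icc 0 T, ∀ x ∈ Ici (log q), HasDerivWithinAt (G t) (Gx t x) (Ici (log q)) x)
    (hu : ∀ z ∈ Ioo p (p + T) ×ˢ Ioi q, u z = z.2 ^ (-r) * G (z.1 - p) (log z.2)) :
    IsWeakDeriv (Ioo p (p + T) ×ˢ Ioi q) ((0, 1) : ℝ × ℝ) 1 u fun z =>
      z.2 ^ (-(r + 1)) * (Gx (z.1 - p) (log z.2) - r * G (z.1 - p) (log z.2)) := by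
  have hcG := (continuousOn_comp_log (p := p) hq hG).mono CB.subset_closed
  have hcGx := (continuousOn_comp_log (p := p) hq hGx).mono CB.subset_closed
  have hw : ∀ a : ℝ, ContinuousOn (fun z : ℝ × ℝ => z.2 ^ a) (Ioo p (p + T) ×ˢ Ioi q) := fun a =>
    ContinuousOn.rpow_const (by fun_prop) fun z hz => Or.inl (hq.trans hz.2).ne'
  refine isWeakDeriv_of_hasLineDerivAt CB.isOpen_strip (((hw _).mul hcG).congr hu)
    ((hw _).mul (hcGx.sub (continuousOn_const.mul hcG))) fun z hz => ?_
  obtain ⟨y, x⟩ := z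
  have hx : 0 < x := hq.trans hz.2
  obtain ⟨h1, h2⟩ := mem_strip_log hq (CB.subset_closed hz)
  have h3 : HasDerivAt (G (y - p)) (Gx (y - p) (log x)) (log x) :=
    (hd _ h1 _ h2).hasDerivAt (Ici_mem_nhds (log_lt_log hq hz.2))
  have h4 := (Real.hasDerivAt_rpow_const (x := x) (p := -r) (Or.inl hx.ne')).mul
    (h3.comp x (hasDerivAt_log hx.ne'))
  have h5 : HasDerivAt (fun s => u (y, s)) (x ^ (-(r + 1)) * (Gx (y - p) (log x) -
      r * G (y - p) (log x))) x := by
    refine (h4.congr_of_eventuallyEq ?_).congr_deriv ?_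
    · exact eventually_snd CB.isOpen_strip hz hu
    · have e1 : x ^ (-r - 1) = x ^ (-(r + 1)) := by ring_nf
      have e2 : x ^ (-r) * x⁻¹ = x ^ (-(r + 1)) := by
        rw [← Real.rpow_neg_one, ← rpow_add hx]; ring_nf
      simp only [Function.comp_apply]
      rw [e1, ← e2]; ring
  have h6 : HasDerivAt (fun s : ℝ => x + s) 1 0 := (hasDerivAt_id' (0 : ℝ)).const_add x
  have h7 := HasDerivAt.comp (h₂ := fun s => u (y, s)) 0 (by rw [add_zero]; exact h5) h6
  rw [mul_one] at h7
  rw [HasLineDerivAt]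
  refine HasDerivAt.congr_of_eventuallyEq h7 (Eventually.of_forall fun s => ?_)
  simp [Function.comp]

theorem CB.weakSup_lt_top_of_eq (hq : 0 < q) {j : ℕ} {u w g : ℝ × ℝ → ℝ} {G : ℝ → ℝ → ℝ}
    (hG : CB 0 T (log q) 0 G) (hu : IsWeakDeriv (Ioo p (p + T) ×ˢ Ioi q) ((0, 1) : ℝ × ℝ) j u g)
    (h : ∀ z ∈ Ioo p (p + T) ×ˢ Ioi q, w z * g z = G (z.1 - p) (log z.2)) :
    weakSup (Ioo p (p + T) ×ˢ Ioi q) ((0, 1) : ℝ × ℝ) w j u < ⊤ := by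
  obtain ⟨L, -, hL, -⟩ := hG
  refine weakSup_lt_top CB.isOpen_strip.measurableSet hu (C := L) fun z hz => ?_
  obtain ⟨h1, h2⟩ := mem_strip_log hq (CB.subset_closed hz)
  rw [h z hz]; exact hL _ h1 _ h2

theorem CB.weakSup_zero_lt_top (hq : 0 < q) {u w : ℝ × ℝ → ℝ} {G : ℝ → ℝ → ℝ}
    (hG : CB 0 T (log q) 0 G) (hu : ContinuousOn u (Ioo p (p + T) ×ˢ Ioi q))
    (h : ∀ z ∈ Ioo p (p + T) ×ˢ Ioi q, w z * u z = G (z.1 - p) (log z.2)) :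
    weakSup (Ioo p (p + T) ×ˢ Ioi q) ((0, 1) : ℝ × ℝ) w 0 u < ⊤ :=
  hG.weakSup_lt_top_of_eq hq (isWeakDeriv_zero (hu.locallyIntegrableOn CB.isOpen_strip.measurableSet)) h

/-- Weak derivatives of `log f` when `log f + N log q` is regular. -/
theorem CB.weakSup_log_lt_top (hq : 0 < q) {f : ℝ × ℝ → ℝ} {G Gx : ℝ → ℝ → ℝ} {N : ℝ}
    (hG : CB 0 T (log q) 0 G) (hGx : CB 0 T (log q) 0 Gx)
    (hd : ∀ t ∈ Icc 0 T, ∀ x ∈ Ici (log q), HasDerivWithinAt (G t) (Gx t x) (Ici (log q)) x)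
    (hf : ∀ z ∈ Ioo p (p + T) ×ˢ Ioi q, f z = exp (G (z.1 - p) (log z.2) - N * log z.2)) :
    weakSup (Ioo p (p + T) ×ˢ Ioi q) ((0, 1) : ℝ × ℝ) (fun z => z.2 ^ (0 : ℝ)) 0
      (fun z => log (z.2 ^ N * f z)) < ⊤ ∧ ∀ j ∈ Finset.Icc (1 : ℕ) 2,
    weakSup (Ioo p (p + T) ×ˢ Ioi q) ((0, 1) : ℝ × ℝ) (fun z => z.2 ^ (j : ℝ)) j
      (fun z => log (f z)) < ⊤ := by
  have hpos : ∀ z ∈ Ioo p (p + T) ×ˢ Ioi q, 0 < z.2 := fun z hz => hq.trans hz.2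
  have hlog : ∀ z ∈ Ioo p (p + T) ×ˢ Ioi q,
      log (z.2 ^ N * f z) = G (z.1 - p) (log z.2) := fun z hz => by
    rw [hf z hz, rpow_def_of_pos (hpos z hz), ← exp_add, log_exp]; ring
  have h1 := isWeakDeriv_weighted (p := p) (T := T) (r := 0) (u := fun z => log (f z)) hq
    (G := fun t x => G t x - N * x) (Gx := fun t x => Gx t x - N * 1)
    (hG.continuousOn.sub (by fun_prop)) (hGx.continuousOn.sub continuousOn_const)
    (fun t ht x hx => (hd t ht x hx).sub ((hasDerivWithinAt_id x _).const_mul N))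
    (fun z hz => by rw [hf z hz, log_exp]; simp)
  have e1 : (fun z : ℝ × ℝ => z.2 ^ (-((0 : ℝ) + 1)) * (Gx (z.1 - p) (log z.2) - N * 1 -
      0 * (G (z.1 - p) (log z.2) - N * log z.2))) =
      fun z => z.2 ^ (-(1 : ℝ)) * (Gx (z.1 - p) (log z.2) - N) := by
    ext z; ring_nf
  rw [e1] at h1
  have hcb := hGx.sub (CB.const N)
  refine ⟨hG.weakSup_zero_lt_top hq (((continuousOn_comp_log (p := p) hq hG.continuousOn).mono
    CB.subset_closed).congr hlog) fun z hz => ?_, fun j hj => ?_⟩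
  · rw [rpow_zero, one_mul]; exact hlog z hz
  · obtain rfl | rfl : j = 1 ∨ j = 2 := by have := Finset.mem_Icc.1 hj; omega
    · refine hcb.weakSup_lt_top_of_eq hq h1 fun z hz => ?_
      rw [← mul_assoc, ← rpow_add (hpos z hz)]; simp
    · obtain ⟨g, C, hg, hC⟩ := CB.exists_isWeakDeriv_weighted (p := p) hq zero_le_one hcb
      refine weakSup_lt_top CB.isOpen_strip.measurableSet (h1.comp hg) (C := C) fun z hz => ?_
      have := hC z hz
      norm_num at this ⊢
      exact this

theorem CB.weakSup_logOm_lt_top {θ : ℝ} (hθ : 0 < θ) (hq : 0 < q) {Om : ℝ × ℝ → ℝ} {om m m' : ℝ → ℝ → ℝ}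
    (hom : CB 0 T (log q) 0 om) (hm : CB 0 T (log q) 0 m) (hm' : CB 0 T (log q) 0 m')
    (hox : ∀ t ∈ Icc 0 T, ∀ x ∈ Ici (log q),
      HasDerivWithinAt (om t) (exp (-(θ * x)) * m t x) (Ici (log q)) x)
    (hmx : ∀ t ∈ Icc 0 T, ∀ x ∈ Ici (log q), HasDerivWithinAt (m t) (m' t x) (Ici (log q)) x)
    (hO : ∀ z ∈ Ioo p (p + T) ×ˢ Ioi q, Om z = exp (om (z.1 - p) (log z.2))) :
    weakSup (Ioo p (p + T) ×ˢ Ioi q) ((0, 1) : ℝ × ℝ) (fun z => z.2 ^ (0 : ℝ)) 0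
      (fun z => log (Om z)) < ⊤ ∧ ∀ j ∈ Finset.Icc (1 : ℕ) 3,
    weakSup (Ioo p (p + T) ×ˢ Ioi q) ((0, 1) : ℝ × ℝ) (fun z => z.2 ^ (j + θ)) j
      (fun z => log (Om z)) < ⊤ := by
  have hpos : ∀ z ∈ Ioo p (p + T) ×ˢ Ioi q, 0 < z.2 := fun z hz => hq.trans hz.2
  have hlog : ∀ z ∈ Ioo p (p + T) ×ˢ Ioi q,
      log (Om z) = om (z.1 - p) (log z.2) := fun z hz => by rw [hO z hz, log_exp]
  have hμ : CB 0 T (log q) 0 fun t x => exp (-(θ * x)) * m t x := (CB.exp_neg hθ.le).mul hm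
  have h1 := isWeakDeriv_weighted (p := p) (T := T) (r := 0) (u := fun z => log (Om z)) hq
    hom.continuousOn hμ.continuousOn hox (fun z hz => by rw [hlog z hz]; simp)
  have e1 : ∀ z ∈ Ioo p (p + T) ×ˢ Ioi q, z.2 ^ (-((0 : ℝ) + 1)) * (exp (-(θ * log z.2)) *
      m (z.1 - p) (log z.2) - 0 * om (z.1 - p) (log z.2)) =
      z.2 ^ (-(1 + θ)) * m (z.1 - p) (log z.2) := fun z hz => by
    rw [rpow_def_of_pos (hpos z hz), rpow_def_of_pos (hpos z hz), zero_mul, sub_zero,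
      ← mul_assoc, ← exp_add]
    ring_nf
  have h2 := isWeakDeriv_weighted (p := p) (T := T) (r := 1 + θ) hq hm.continuousOn hm'.continuousOn hmx e1
  have hcb : CB 0 T (log q) 0 fun t x => m' t x - (1 + θ) * m t x := hm'.sub (hm.const_mul _)
  refine ⟨hom.weakSup_zero_lt_top hq (((continuousOn_comp_log (p := p) hq hom.continuousOn).mono
    CB.subset_closed).congr hlog) fun z hz => ?_, fun j hj => ?_⟩
  · rw [rpow_zero, one_mul]; exact hlog z hz
  · obtain rfl | rfl | rfl : j = 1 ∨ j = 2 ∨ j = 3 := by have := Finset.mem_Icc.1 hj; omega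
    · refine hm.weakSup_lt_top_of_eq hq h1 fun z hz => ?_
      rw [e1 z hz, ← mul_assoc, ← rpow_add (hpos z hz)]; simp
    · refine hcb.weakSup_lt_top_of_eq hq (h1.comp h2) fun z hz => ?_
      rw [← mul_assoc, ← rpow_add (hpos z hz), show ((2 : ℕ) : ℝ) + θ + -(1 + θ + 1) = 0 by
        push_cast; ring, rpow_zero, one_mul]
    · obtain ⟨g, C, hg, hC⟩ := CB.exists_isWeakDeriv_weighted (p := p) (r := 1 + θ + 1) hq (by linarith) hcb
      refine weakSup_lt_top CB.isOpen_strip.measurableSet (h1.comp (h2.comp hg)) (C := C) fun z hz => ?_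
      have := hC z hz
      rwa [show 1 + θ + 1 + 1 = ((3 : ℕ) : ℝ) + θ by push_cast; ring] at this

theorem CB.weakSup_rsq_lt_top (hq : 0 < q) {r : ℝ × ℝ → ℝ} {s R R' : ℝ → ℝ → ℝ}
    (hs : CB 0 T (log q) 1 s) (hR : CB 0 T (log q) 0 R) (hR' : CB 0 T (log q) 0 R')
    (hsx : ∀ t ∈ Icc 0 T, ∀ x ∈ Ici (log q),
      HasDerivWithinAt (s t) (exp (-s t x) * R t x - 2) (Ici (log q)) x)
    (hRx : ∀ t ∈ Icc 0 T, ∀ x ∈ Ici (log q), HasDerivWithinAt (R t) (R' t x) (Ici (log q)) x)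
    (hr : ∀ z ∈ Ioo p (p + T) ×ˢ Ioi q, r z = exp (log z.2 + s (z.1 - p) (log z.2) / 2)) :
    ∀ j ∈ Finset.range 4, weakSup (Ioo p (p + T) ×ˢ Ioi q) ((0, 1) : ℝ × ℝ)
      (fun z => z.2 ^ ((j : ℝ) - 2)) j (fun z => r z ^ 2) < ⊤ := by
  have hpos : ∀ z ∈ Ioo p (p + T) ×ˢ Ioi q, 0 < z.2 := fun z hz => hq.trans hz.2
  have hes : CB 0 T (log q) 1 fun t x => exp (s t x) := hs.exp
  have hsq : ∀ z ∈ Ioo p (p + T) ×ˢ Ioi q,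
      r z ^ 2 = z.2 ^ (-(-2 : ℝ)) * exp (s (z.1 - p) (log z.2)) := fun z hz => by
    rw [hr z hz, rpow_def_of_pos (hpos z hz), ← exp_nat_mul, ← exp_add]
    push_cast; ring_nf
  have h1 := isWeakDeriv_weighted (p := p) (T := T) (r := -2) (u := fun z => r z ^ 2) hq
    hes.continuousOn (hR.sub (hes.zero.const_mul 2)).continuousOn (fun t ht x hx =>
      (hsx t ht x hx).exp.congr_deriv (by
        rw [exp_neg]; field_simp)) hsq
  have e1 : ∀ z ∈ Ioo p (p + T) ×ˢ Ioi q, z.2 ^ (-((-2 : ℝ) + 1)) * (R (z.1 - p) (log z.2) -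
      2 * exp (s (z.1 - p) (log z.2)) - -2 * exp (s (z.1 - p) (log z.2))) =
      z.2 ^ (-(-1 : ℝ)) * R (z.1 - p) (log z.2) := fun z hz => by
    norm_num
  have h2 := isWeakDeriv_weighted (p := p) (T := T) (r := -1) hq hR.continuousOn hR'.continuousOn hRx e1
  have e2 : ∀ z : ℝ × ℝ, z.2 ^ (-((-1 : ℝ) + 1)) * (R' (z.1 - p) (log z.2) -
      -1 * R (z.1 - p) (log z.2)) = z.2 ^ (-(0 : ℝ)) *
        (R' (z.1 - p) (log z.2) + R (z.1 - p) (log z.2)) := fun z => by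
    norm_num
  simp only [e2] at h2
  have hcb : CB 0 T (log q) 0 fun t x => R' t x + R t x := hR'.add hR
  have hcu : ContinuousOn (fun z => r z ^ 2) (Ioo p (p + T) ×ˢ Ioi q) := by
    refine ContinuousOn.congr (ContinuousOn.mul ?_ ((continuousOn_comp_log (p := p) hq
      hes.continuousOn).mono CB.subset_closed)) hsq
    exact ContinuousOn.rpow_const (by fun_prop) fun z hz => Or.inl (hpos z hz).ne'
  intro j hj
  obtain rfl | rfl | rfl | rfl : j = 0 ∨ j = 1 ∨ j = 2 ∨ j = 3 := by have := Finset.mem_range.1 hj; omega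
  · refine hes.zero.weakSup_zero_lt_top hq hcu fun z hz => ?_
    rw [hsq z hz, ← mul_assoc, ← rpow_add (hpos z hz)]; norm_num
  · refine hR.weakSup_lt_top_of_eq hq h1 fun z hz => ?_
    rw [e1 z hz, ← mul_assoc, ← rpow_add (hpos z hz)]; norm_num
  · refine hcb.weakSup_lt_top_of_eq hq (h1.comp h2) fun z hz => ?_
    norm_num
  · obtain ⟨g, C, hg, hC⟩ := CB.exists_isWeakDeriv_weighted (p := p) (r := 0) hq le_rfl hcb
    refine weakSup_lt_top CB.isOpen_strip.measurableSet (h1.comp (h2.comp hg)) (C := C) fun z hz => ?_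
    have := hC z hz
    norm_num at this ⊢
    exact this

end WeightedDerivatives

/-- The fields given by `log (q^{N₊} f⁺)`, `log (q^{N₋} f⁻)`, `log Ω` and `log (r²/q²)`. -/
def stripFields (Np Nm p0 : ℝ) (A B om s : ℝ → ℝ → ℝ) : Fields where
  fP z := exp (A (z.1 - p0) (log z.2) - Np * log z.2)
  fM z := exp (B (z.1 - p0) (log z.2) - Nm * log z.2)
  Om z := exp (om (z.1 - p0) (log z.2))
  r z := z.2 * exp (1 / 2 * s (z.1 - p0) (log z.2))

theorem stripFields_r {Np Nm p0 : ℝ} {A B om s : ℝ → ℝ → ℝ} {z : ℝ × ℝ} (hz : 0 < z.2) :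
    (stripFields Np Nm p0 A B om s).r z = exp (log z.2 + s (z.1 - p0) (log z.2) / 2) := by
  rw [exp_add, exp_log hz, stripFields]; ring_nf

namespace StripSol

variable {ε θ Np Nm T p0 q0 : ℝ} {A B om m s R W A' B' m' R' omt Wt : ℝ → ℝ → ℝ}
    {V Y μ : ℝ → ℝ → ℝ} {F : Fields}

theorem polar (H : StripSol ε θ Np Nm T (log q0) A B om m s R W A' B' m' R' omt Wt V Y μ)
    (hF : F = stripFields Np Nm p0 A B om s) (hq : 0 < q0) (hT : p0 + T = 0) :
    Polar Np Nm p0 F (domD p0 q0) A B om s R μ W := by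
  subst hF
  have hm : ∀ w ∈ domD p0 q0, w.1 - p0 ∈ Icc 0 T ∧ log w.2 ∈ Ici (log q0) ∧
      Icc 0 T ∈ 𝓝 (w.1 - p0) ∧ Ici (log q0) ∈ 𝓝 (log w.2) := by
    intro w hw
    have h1 : log q0 < log w.2 := log_lt_log hq hw.2
    have h2 : 0 < w.1 - p0 := by linarith [hw.1.1]
    have h3 : w.1 - p0 < T := by linarith [hw.1.2]
    exact ⟨⟨h2.le, h3.le⟩, h1.le, Icc_mem_nhds h2 h3, Ici_mem_nhds h1⟩
  exact
    { isOpen := isOpen_Ioo.prod isOpen_Ioi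
      pos := fun w hw => hq.trans hw.2
      fP := fun _ _ => rfl
      fM := fun _ _ => rfl
      Om := fun _ _ => rfl
      r := fun w hw => stripFields_r (hq.trans hw.2)
      om_x := fun w hw => (H.om_x _ (hm w hw).1 _ (hm w hw).2.1).hasDerivAt (hm w hw).2.2.2
      s_t := fun w hw => (H.s_t _ (hm w hw).1 _ (hm w hw).2.1).hasDerivAt (hm w hw).2.2.1
      s_x := fun w hw => (H.s_x _ (hm w hw).1 _ (hm w hw).2.1).hasDerivAt (hm w hw).2.2.2 }

theorem evolutionAt (h0 : 0 < ε) (h1 : ε < 1) (hN : Np = Nm - 4 * eta ε)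
    (H : StripSol ε θ Np Nm T (log q0) A B om m s R W A' B' m' R' omt Wt V Y μ)
    (hF : F = stripFields Np Nm p0 A B om s) (hq : 0 < q0) (hT : p0 + T = 0) {z : ℝ × ℝ} (hz : z ∈ domD p0 q0) :
    EvolutionAt ε F z ∧
      ContinuityAt ε (F.toFluidMetric ε) z ∧
      MomentumAt ε (F.toFluidMetric ε) z := by
  have P := H.polar hF hq hT
  have hx : log q0 < log z.2 := log_lt_log hq hz.2
  have ht0 : 0 < z.1 - p0 := by linarith [hz.1.1]
  have htT : z.1 - p0 < T := by linarith [hz.1.2]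
  have ht : z.1 - p0 ∈ Icc 0 T := ⟨ht0.le, htT.le⟩
  have nt := Icc_mem_nhds ht0 htT
  have nx := Ici_mem_nhds hx
  have hAt := (H.A_t _ ht _ hx.le).hasDerivAt nt
  have hAx := (H.A_x _ ht _ hx.le).hasDerivAt nx
  have hBt := (H.B_t _ ht _ hx.le).hasDerivAt nt
  have hBx := (H.B_x _ ht _ hx.le).hasDerivAt nx
  have hP : FPlusTransportAt ε F z :=
    (P.fPlus_iff h0 h1 hN hz rfl rfl hAt hAx hBt hBx).2 (by rw [H.V_eq])
  have hM : FMinusTransportAt ε F z :=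
    (P.fMinus_iff h0 h1 hN hz rfl rfl hAt hAx hBt hBx).2 (by rw [H.V_eq])
  refine ⟨⟨?_, ?_, hP, hM⟩, ((P.logJet hz rfl rfl hAt hAx hBt hBx).euler_iff h0 h1).2 ⟨hP, hM⟩⟩
  · exact (P.rWave_iff h1 hz rfl rfl ((H.R_t _ ht _ hx.le).hasDerivAt nt)).2 (by rw [H.Y_eq])
  · exact (P.omegaWave_iff h1 hz rfl rfl ((H.μ_t _ ht _ hx.le).hasDerivAt nt)).2 (by rw [H.Y_eq])

theorem asymptoticallyFlat (hν : 1 < 2 * eta ε + nu ε Np Nm)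
    (H : StripSol ε θ Np Nm T (log q0) A B om m s R W A' B' m' R' omt Wt V Y μ)
    (hF : F = stripFields Np Nm p0 A B om s) (hq : 0 < q0) (hT : p0 + T = 0) (hp : p0 < 0)
    (hK : ∀ t ∈ Icc 0 T, ∀ x ∈ Ici (log q0),
      outgoingF ε (nu ε Np Nm) (A t x) (B t x) (s t x) (μ t x) (R t x) (R' t x) x = 0) :
    AsymptoticallyFlat p0 F := by
  subst hF
  set F := stripFields Np Nm p0 A B om s
  intro p hp0
  have ht : p - p0 ∈ Icc 0 T := ⟨by linarith [hp0.1], by linarith [hp0.2]⟩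
  set t := p - p0 with htd
  obtain ⟨L, hL⟩ := H.exists_tendsto_mass hν ht (hK _ ht)
  refine ⟨L, (hL.comp Real.tendsto_log_atTop).congr' ?_⟩
  filter_upwards [eventually_gt_atTop q0] with q hqq
  have hq' : 0 < q := hq.trans hqq
  have hx : log q0 < log q := log_lt_log hq hqq
  set x := log q with hxd
  have hqx : q = exp x := (exp_log hq').symm
  have e0 : F.r (p, q) = exp (x + s t x / 2) :=
    stripFields_r (z := (p, q)) hq'
  have e3 : F.Om (p, q) = exp (om t x) := rfl
  have hmaps : MapsTo (fun y : ℝ => y - p0) (Icc p0 0) (Icc 0 T) := fun y hy =>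
    ⟨by linarith [hy.1], by linarith [hy.2]⟩
  have d1 : derivWithin (fun y => F.r (y, q)) (Icc p0 0) p =
      exp (-s t x / 2) * W t x / 2 := by
    have h1 := (H.s_t _ ht _ hx.le).scomp p
      ((hasDerivWithinAt_id p (Icc p0 0)).sub_const p0) hmaps
    have h2 := ((h1.const_mul (1 / 2)).exp.const_mul q)
    have h3 : HasDerivWithinAt (fun y => F.r (y, q)) _ (Icc p0 0) p := h2
    rw [h3.derivWithin (uniqueDiffOn_Icc hp p hp0)]
    simp only [Function.comp_apply, smul_eq_mul, one_mul, id]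
    have e : q * exp (1 / 2 * s t x) * (exp (-x) * exp (-s t x)) =
        exp (-s t x / 2) := by
      rw [hqx, ← exp_add, ← exp_add, ← exp_add]; ring_nf
    linear_combination W t x / 2 * e
  have d2 : dq F.r (p, q) =
      exp (-s t x / 2) * R t x / 2 := by
    have h1 := HasDerivAt.comp_log hq' (((H.s_x _ ht _ hx.le).hasDerivAt (Ici_mem_nhds hx)).const_mul
      (1 / 2)).exp
    have h2 := (hasDerivAt_id' q).mul h1
    have h3 : HasDerivAt (fun y => F.r (p, y)) _ q := h2
    rw [dq, h3.deriv]
    have e : exp (1 / 2 * s t x) * exp (-s t x) =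
        exp (-s t x / 2) := by
      rw [← exp_add]; ring_nf
    have e' : q * exp (-x) = 1 := by rw [hqx, ← exp_add]; simp
    rw [← hxd]
    linear_combination R t x / 2 * e + exp (1 / 2 * s t x) * (1 / 2) *
      (exp (-s t x) * R t x - 2) * e'
  rw [d1, d2, e0, e3, massOf]
  simp only [Function.comp_apply]
  have e : 4 * (exp (-s t x / 2) * W t x / 2) *
      (exp (-s t x / 2) * R t x / 2) / exp (om t x) ^ 2 =
      exp (-s t x - 2 * om t x) * (W t x * R t x) := by
    have q1 : exp (-s t x - 2 * om t x) = exp (-s t x / 2) *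
        exp (-s t x / 2) / exp (om t x) ^ 2 := by
      rw [← exp_nat_mul, ← exp_add, ← exp_sub]; push_cast; ring_nf
    rw [q1]; ring
  rw [e]

theorem totalNorm_lt_top (hθ : 0 < θ)
    (H : StripSol ε θ Np Nm T (log q0) A B om m s R W A' B' m' R' omt Wt V Y μ)
    (hF : F = stripFields Np Nm p0 A B om s) (hq : 0 < q0) (hT : p0 + T = 0) {c : ℝ} (hc : 0 < c)
    (hR : ∀ t ∈ Icc 0 T, ∀ x ∈ Ici (log q0), c ≤ |R t x|) :
    totalNorm θ Np Nm p0 q0 F < ⊤ := by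
  subst hF
  set F := stripFields Np Nm p0 A B om s
  have hD : domD p0 q0 = Ioo p0 (p0 + T) ×ˢ Ioi q0 := by rw [hT]; rfl
  have hμ : ∀ t ∈ Icc 0 T, ∀ x ∈ Ici (log q0), HasDerivWithinAt (om t)
      (exp (-(θ * x)) * m t x) (Ici (log q0)) x := fun t ht x hx => by
    rw [← H.μ_eq]; exact H.om_x t ht x hx
  obtain ⟨a0, a1⟩ := CB.weakSup_log_lt_top (p := p0) (T := T) hq (N := Np)
    (f := F.fP) H.cbA.zero H.cbA' H.A_x fun _ _ => rfl
  obtain ⟨b0, b1⟩ := CB.weakSup_log_lt_top (p := p0) (T := T) hq (N := Nm)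
    (f := F.fM) H.cbB.zero H.cbB' H.B_x fun _ _ => rfl
  obtain ⟨o0, o1⟩ := CB.weakSup_logOm_lt_top (p := p0) (T := T) hθ hq
    (Om := F.Om) H.cbom.zero H.cbm.zero H.cbm' hμ H.m_x fun _ _ => rfl
  have r0 := CB.weakSup_rsq_lt_top (p := p0) (T := T) hq (r := F.r)
    H.cbs.pred H.cbR.zero H.cbR' H.s_x H.R_x fun z hz => stripFields_r (hq.trans hz.2)
  have hmem : ∀ z ∈ domD p0 q0, z.1 - p0 ∈ Icc 0 T ∧ log q0 < log z.2 := fun z hz =>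
    ⟨⟨by linarith [hz.1.1], by linarith [hz.1.2]⟩, log_lt_log hq hz.2⟩
  have hmeas : MeasurableSet (domD p0 q0) := (isOpen_Ioo.prod isOpen_Ioi).measurableSet
  have hP := H.polar (F := F) rfl hq hT
  have k1 : essSup (fun z : ℝ × ℝ => ‖z.2 ^ 2‖ₑ / ‖F.r z ^ 2‖ₑ)
      (volume.restrict (domD p0 q0)) < ⊤ := by
    obtain ⟨L, -, hL, -⟩ := H.cbs.zero
    refine (essSup_le_of_ae_le (ENNReal.ofReal (exp L)) ?_).trans_lt ENNReal.ofReal_lt_top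
    filter_upwards [ae_restrict_mem hmeas] with z hz
    have hz0 : 0 < z.2 := hq.trans hz.2
    obtain ⟨h1, h2⟩ := hmem z hz
    rw [Real.enorm_eq_ofReal_abs, Real.enorm_eq_ofReal_abs, ← ENNReal.ofReal_div_of_pos
      (abs_pos.2 (by rw [stripFields_r hz0]; positivity)), ← abs_div]
    refine ENNReal.ofReal_le_ofReal ?_
    have e : z.2 ^ 2 / F.r z ^ 2 =
        exp (-s (z.1 - p0) (log z.2)) := by
      change z.2 ^ 2 / (z.2 * exp (1 / 2 * s (z.1 - p0) (log z.2))) ^ 2 = _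
      rw [mul_pow, ← exp_nat_mul, exp_neg]
      push_cast
      rw [show 2 * (1 / 2 * s (z.1 - p0) (log z.2)) = s (z.1 - p0) (log z.2) by ring]
      field_simp
    rw [e, abs_exp, exp_le_exp]
    exact (neg_le_abs _).trans (hL _ h1 _ h2.le)
  have k2 : essSup (fun z : ℝ × ℝ => ‖z.2‖ₑ / ‖dq (fun x => F.r x ^ 2) z‖ₑ)
      (volume.restrict (domD p0 q0)) < ⊤ := by
    refine (essSup_le_of_ae_le (ENNReal.ofReal (1 / c)) ?_).trans_lt ENNReal.ofReal_lt_top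
    filter_upwards [ae_restrict_mem hmeas] with z hz
    have hz0 : 0 < z.2 := hq.trans hz.2
    obtain ⟨h1, h2⟩ := hmem z hz
    have hRz := hR _ h1 _ h2.le
    have e : dq (fun x => F.r x ^ 2) z =
        z.2 * R (z.1 - p0) (log z.2) := by
      have hd := HasDerivAt.comp_log hz0
        (((hasDerivAt_id' (log z.2)).add ((hP.s_x z hz).div_const 2)).exp.pow 2)
      rw [dq_eq (v := fun w => exp (log w.2 + s (w.1 - p0) (log w.2) / 2) ^ 2)
        hP.isOpen hz (fun w hw => by rw [hP.r w hw]) hd]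
      have e1 : exp (-log z.2) * (exp (log z.2 + s (z.1 - p0) (log z.2) / 2) *
          exp (log z.2 + s (z.1 - p0) (log z.2) / 2)) *
          exp (-s (z.1 - p0) (log z.2)) = z.2 := by
        rw [← exp_add, ← exp_add, ← exp_add]
        conv_rhs => rw [← exp_log hz0]
        ring_nf
      simp only [Pi.add_apply]
      push_cast
      linear_combination R (z.1 - p0) (log z.2) * e1
    rw [e, Real.enorm_eq_ofReal_abs, Real.enorm_eq_ofReal_abs, ← ENNReal.ofReal_div_of_pos
      (abs_pos.2 (mul_ne_zero hz0.ne' (abs_pos.1 (hc.trans_le hRz)))), abs_mul, div_mul_eq_div_div,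
      div_self (abs_pos.2 hz0.ne').ne']
    exact ENNReal.ofReal_le_ofReal (one_div_le_one_div_of_le hc hRz)
  rw [← hD] at a0 a1 b0 b1 o0 o1 r0
  dsimp only [totalNorm]
  refine ENNReal.add_lt_top.2 ⟨ENNReal.add_lt_top.2 ⟨ENNReal.add_lt_top.2 ⟨ENNReal.add_lt_top.2
    ⟨ENNReal.add_lt_top.2 ⟨ENNReal.add_lt_top.2 ⟨ENNReal.add_lt_top.2 ⟨ENNReal.add_lt_top.2 ⟨a0,
    ENNReal.sum_lt_top.2 a1⟩, b0⟩, ENNReal.sum_lt_top.2 b1⟩, o0⟩, ENNReal.sum_lt_top.2 o1⟩,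
    ENNReal.sum_lt_top.2 r0⟩, k1⟩, k2⟩

/-- The fields of a solution on the strip solve the characteristic problem, provided that they
attain the data. -/
theorem isCharacteristicSolution (h0 : 0 < ε) (h1 : ε < 1) (hNp : 0 < Np) (hNm : 0 < Nm)
    (hN : Np = Nm - 4 * eta ε) (hθ : 0 < θ)
    (H : StripSol ε θ Np Nm T (log q0) A B om m s R W A' B' m' R' omt Wt V Y μ)
    (hF : F = stripFields Np Nm p0 A B om s) (hq : 0 < q0) (hT : p0 + T = 0) (hp : p0 < 0) {c : ℝ} (hc : 0 < c)
    (hR : ∀ t ∈ Icc 0 T, ∀ x ∈ Ici (log q0), c ≤ |R t x|) {b : FluidMetric} {d : OutgoingData}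
    (hin : ∀ p ∈ Icc p0 0,
      F.fP (p, q0) = (b.toFields ε).fP (p, q0) ∧
      F.fM (p, q0) = (b.toFields ε).fM (p, q0) ∧
      F.Om (p, q0) = b.Om (p, q0) ∧
      F.r (p, q0) = b.r (p, q0))
    (hout : ∀ q ∈ Ici q0, F.fP (p0, q) = d.fP q ∧
      F.fM (p0, q) = d.fM q ∧
      F.Om (p0, q) = d.Om q ∧
      F.r (p0, q) = d.r q) :
    IsCharacteristicSolution ε θ Np Nm p0 q0 b d F := by
  have hD : domD p0 q0 = Ioo p0 (p0 + T) ×ˢ Ioi q0 := by rw [hT]; rfl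
  have hDb : domDbar p0 q0 = Icc p0 (p0 + T) ×ˢ Ici q0 := by rw [hT]; rfl
  subst hF
  have hlog : ∀ {f : ℝ → ℝ → ℝ} {N : ℝ}, 0 < N → CB 0 T (log q0) 1 f →
      CB p0 (p0 + T) q0 1 fun t x => exp (f (t - p0) (log x) - N * log x) := by
    intro f N hN hf
    refine CB.congr ((hf.exp.mul (CB.exp_neg hN.le)).comp_log hq) fun t _ x _ => ?_
    rw [← exp_add]; ring_nf
  have cP := hlog hNp H.cbA
  have cM := hlog hNm H.cbB
  have cO := (H.cbom.exp).comp_log (p := p0) hq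
  have cr := ((H.cbs.const_mul (1 / 2)).exp).comp_log (p := p0) hq
  have hab : p0 < p0 + T := by rw [hT]; exact hp
  refine ⟨fun z hz => ⟨exp_pos _, exp_pos _, exp_pos _,
    mul_pos (hq.trans_le hz.2) (exp_pos _)⟩, ?_, ?_, ?_, ?_, ?_, ?_, ?_, ?_,
    H.totalNorm_lt_top hθ rfl hq hT hc hR, fun z hz => (H.evolutionAt h0 h1 hN rfl hq hT hz).1, hin, hout⟩
  · rw [hDb]; exact mod_cast cP.contDiffOn hab
  · rw [hDb]; exact mod_cast cM.contDiffOn hab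
  · rw [hDb]; exact mod_cast cO.contDiffOn hab
  · rw [hDb]; exact contDiff_snd.contDiffOn.mul (mod_cast cr.contDiffOn hab)
  · rw [hD]; exact cP.memW
  · rw [hD]; exact cM.memW
  · rw [hD]; exact cO.memW
  · rw [hD]
    refine (cr.congr (g := fun t x => x * exp (1 / 2 * s (t - p0) (log x)) / x)
      fun t _ x hx => ?_).memW
    have : x ≠ 0 := (hq.trans_le hx).ne'
    field_simp

end StripSol

/-! ### Uniqueness for systems with causal coefficients -/

section Uniqueness

variable {ι κ : Type*}

theorem causal_unique [Finite ι] {T x0 X K : ℝ} (hT : 0 < T) (hX : x0 < X)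
    {C S : ι → ((ι ⊕ κ → ℝ → ℝ) → ℝ → ℝ)} (hC : ∀ i, Causal x0 (C i)) (hS : ∀ i, Causal x0 (S i))
    (hpos : ∀ i v x, 0 ≤ C i v x) {π : κ → ℝ → ℝ} (hπ : ∀ k, ∀ t ∈ Icc 0 T, |π k t| ≤ K)
    {u v : ι → ℝ → ℝ → ℝ}
    (hu : ∀ i, ContinuousOn (uncurry (u i)) (Icc 0 T ×ˢ Icc x0 X))
    (hv : ∀ i, ContinuousOn (uncurry (v i)) (Icc 0 T ×ˢ Icc x0 X))
    (h0 : ∀ i, ∀ x ∈ Icc x0 X, u i 0 x = v i 0 x)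
    (heq : ∀ i, ((∀ t ∈ Icc 0 T, u i t x0 = v i t x0) ∧ ∀ t ∈ Ioo 0 T, ∀ x ∈ Ioo x0 X, ∃ ut ux vt vx,
        HasDerivAt (fun t => u i t x) ut t ∧ HasDerivAt (u i t) ux x ∧
        HasDerivAt (fun t => v i t x) vt t ∧ HasDerivAt (v i t) vx x ∧ |vx| ≤ K ∧
        ut + C i join[u, π, t] x * ux = S i join[u, π, t] x ∧
        vt + C i join[v, π, t] x * vx = S i join[v, π, t] x) ∨
      ∀ t ∈ Ioo 0 T, ∀ x ∈ Ioo x0 X,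
        HasDerivAt (fun t => u i t x) (S i join[u, π, t] x) t ∧
        HasDerivAt (fun t => v i t x) (S i join[v, π, t] x) t) :
    ∀ i, ∀ t ∈ Icc 0 T, ∀ x ∈ Icc x0 X, u i t x = v i t x := by
  have hbd : ∀ w : ι → ℝ → ℝ → ℝ,
      (∀ i, ContinuousOn (uncurry (w i)) (Icc 0 T ×ˢ Icc x0 X)) →
      ∃ L, ∀ i, ∀ t ∈ Icc 0 T, ∀ x ∈ Icc x0 X, |w i t x| ≤ L := by
    intro w hw
    choose L hL using fun i => (isCompact_Icc.prod isCompact_Icc).exists_bound_of_continuousOn (hw i)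
    obtain ⟨B, hB⟩ := Finite.bddAbove_range L
    exact ⟨B, fun i t ht x hx => (hL i (t, x) ⟨ht, hx⟩).trans (hB ⟨i, rfl⟩)⟩
  obtain ⟨L1, hL1⟩ := hbd u hu
  obtain ⟨L2, hL2⟩ := hbd v hv
  choose KC hKC0 hKC using fun i => (hC i).good.est (max K (max L1 L2))
  choose KS hKS0 hKS using fun i => (hS i).good.est (max K (max L1 L2))
  obtain ⟨M', hM'⟩ := Finite.bddAbove_range fun i => KS i + KC i * |K|
  set M := |M'|
  have hM : ∀ i, KS i + KC i * |K| ≤ M := fun i => (hM' ⟨i, rfl⟩).trans (le_abs_self _)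
  have hslice : ∀ w : ι → ℝ → ℝ → ℝ,
      (∀ i, ContinuousOn (uncurry (w i)) (Icc 0 T ×ˢ Icc x0 X)) →
      (∀ i, ∀ t ∈ Icc 0 T, ∀ x ∈ Icc x0 X, |w i t x| ≤ max L1 L2) → ∀ t ∈ Icc 0 T, ∀ x ≤ X,
      (∀ j, ContinuousOn (join[w, π, t] j) (Icc x0 x)) ∧
        ∀ j, ∀ y ∈ Icc x0 x, |join[w, π, t] j y| ≤ max K (max L1 L2) := by
    refine fun w hw hL t ht x hx => ⟨?_, ?_⟩ <;> rintro (j | k)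
    · exact (hw j).comp (by fun_prop : ContinuousOn (fun y => (t, y)) (Icc x0 x))
        fun y hy => ⟨ht, hy.1, hy.2.trans hx⟩
    · exact continuousOn_const
    · exact fun y hy => (hL j t ht y ⟨hy.1, hy.2.trans hx⟩).trans (le_max_right _ _)
    · exact fun _ _ => (hπ k t ht).trans (le_max_left _ _)
  set lam := 2 * M + 1 with hlam
  have hlam0 : 0 ≤ lam := by positivity
  set w : ι → ℝ → ℝ → ℝ := fun i t x => exp (-lam * t) * (u i t x - v i t x) with hw
  have hwc : ∀ i, ContinuousOn (uncurry (w i)) (Icc 0 T ×ˢ Icc x0 X) := fun i =>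
    ContinuousOn.mul (by fun_prop) ((hu i).sub (hv i))
  have hexp : ∀ t : ℝ, HasDerivAt (fun t => exp (-lam * t)) (exp (-lam * t) * -lam) t :=
    fun t => by simpa using ((hasDerivAt_id t).const_mul (-lam)).exp
  have hinv : ∀ t, exp (-lam * t) * exp (lam * t) = 1 := fun t => by rw [← exp_add]; simp
  have hI : ∀ {a b : ℝ}, Ioo a b ⊆ Icc a b := fun h => Ioo_subset_Icc_self h
  have hstep : ∀ D, 0 ≤ D → (∀ i, ∀ t ∈ Icc 0 T, ∀ x ∈ Icc x0 X, |w i t x| ≤ D) →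
      ∀ i, ∀ t ∈ Icc 0 T, ∀ x ∈ Icc x0 X, |w i t x| ≤ D / 2 := by
    intro D hD h i
    have hD2 : 0 ≤ D / 2 := by positivity
    have hw0 : ∀ x ∈ Icc x0 X, |w i 0 x| ≤ D / 2 := fun x hx => by simpa [hw, h0 i x hx]
    have hres : ∀ t ∈ Ioo 0 T, ∀ x ∈ Ioo x0 X, ∀ r vx, |vx| ≤ |K| →
        r = S i join[u, π, t] x - S i join[v, π, t] x -
          (C i join[u, π, t] x - C i join[v, π, t] x) * vx →
        |exp (-lam * t) * r| ≤ 0 + lam * (D / 2) := by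
      intro t ht x hx r vx hvx hr
      have hh : ∀ j, ∀ y ∈ Icc x0 x, |join[u, π, t] j y - join[v, π, t] j y| ≤
          exp (lam * t) * D := by
        rintro (j | k) y hy
        · have h1 := h j t (hI ht) y ⟨hy.1, hy.2.trans hx.2.le⟩
          simp only [hw, abs_mul, abs_exp] at h1
          calc |u j t y - v j t y| = exp (lam * t) * (exp (-lam * t) * |u j t y - v j t y|) := by
                linear_combination -|u j t y - v j t y| * hinv t
            _ ≤ _ := by gcongr
        · simpa [withParam] using mul_nonneg (exp_pos _).le hD
      obtain ⟨cu, bu⟩ := hslice u hu (fun i t ht x hx => (hL1 i t ht x hx).trans (le_max_left _ _))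
        t (hI ht) x hx.2.le
      obtain ⟨cv, bv⟩ := hslice v hv (fun i t ht x hx => (hL2 i t ht x hx).trans (le_max_right _ _))
        t (hI ht) x hx.2.le
      have h2 := abs_le_add (hr.trans (sub_eq_add_neg _ _))
        ((hKS i x hx.1.le _ _ cu cv bu bv).2 _ (by positivity) hh)
        ((abs_neg _).trans_le
          (abs_mul_le ((hKC i x hx.1.le _ _ cu cv bu bv).2 _ (by positivity) hh) hvx))
      rw [abs_mul, abs_exp]
      refine (mul_le_mul_of_nonneg_left h2 (exp_pos _).le).trans ?_
      calc _ = (KS i + KC i * |K|) * D := by linear_combination (KS i + KC i * |K|) * D * hinv t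
        _ ≤ M * D := by gcongr; exact hM i
        _ ≤ _ := by rw [hlam]; linarith
    rcases heq i with ⟨hb, hd⟩ | hd
    · choose! ut ux vt vx d1 d2 d3 d4 d5 d6 d7 using hd
      have := transport_abs_le_of_damping (c := fun t x => C i join[u, π, t] x) hT hX (hwc i)
        (fun t ht x hx => (hexp t).mul ((d1 t ht x hx).sub (d3 t ht x hx)))
        (fun t ht x hx => ((d2 t ht x hx).sub (d4 t ht x hx)).const_mul _)
        (fun _ _ _ _ => hpos _ _ _) hlam0 le_rfl (fun t ht x hx => le_of_eq_of_le ?_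
          (hres t ht x hx (ut t x - vt t x + C i join[u, π, t] x * (ux t x - vx t x)) (vx t x)
            ((d5 t ht x hx).trans (le_abs_self K))
            (by linear_combination d6 t ht x hx - d7 t ht x hx))) hw0
        (fun t ht => by simpa [hw, hb t ht])
      · simpa using this
      · congr 1; simp only [hw]; ring
    · intro t ht
      rw [← closure_Ioo hX.ne]
      intro x hx
      refine le_on_closure (f := fun x => |w i t x|) (g := fun _ => D / 2)
        (fun x hx => ?_) ?_ continuousOn_const hx
      · have hc1 : ContinuousOn (fun t => w i t x) (Icc 0 T) :=
          (hwc i).comp (by fun_prop : ContinuousOn (fun t => (t, x)) (Icc 0 T))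
            fun t ht => ⟨ht, hI hx⟩
        have := transport_abs_le_of_damping (w := fun t ξ => w i t x * ξ) (c := fun _ _ => 0) hT
          one_pos (ContinuousOn.mul (hc1.comp continuousOn_fst fun z hz => hz.1) continuousOn_snd)
          (fun t ht ξ hξ => ((hexp t).mul ((hd t ht x hx).1.sub (hd t ht x hx).2)).mul_const ξ)
          (fun t ht ξ hξ => (hasDerivAt_id ξ).const_mul _) (fun _ _ _ _ => le_rfl) hlam0 le_rfl
          (fun t ht ξ hξ => ?_)
          (fun ξ hξ => ((abs_mul_le (hw0 x (hI hx)) (abs_le.2 ⟨by linarith [hξ.1], hξ.2⟩)).trans_eq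
            (mul_one _))) (fun t _ => by simpa) t ht 1 ⟨zero_le_one, le_rfl⟩
        · simpa using this
        · refine le_of_eq_of_le ?_ ((abs_mul_le (hres t ht x hx _ 0 (by simp) rfl)
            (abs_le.2 ⟨by linarith [hξ.1], hξ.2.le⟩)).trans_eq (mul_one _))
          congr 1; simp only [hw, Pi.sub_apply]; ring
      · rw [closure_Ioo hX.ne]
        exact ((hwc i).comp (by fun_prop : ContinuousOn (fun y => (t, y)) (Icc x0 X))
          fun y hy => ⟨ht, hy⟩).abs
  obtain ⟨D, hD⟩ := hbd w hwc
  have hpow : ∀ n : ℕ, ∀ i, ∀ t ∈ Icc 0 T, ∀ x ∈ Icc x0 X, |w i t x| ≤ |D| * (1 / 2) ^ n := by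
    intro n
    induction n with
    | zero => simpa using fun i t ht ht' x hx hx' =>
        (hD i t ⟨ht, ht'⟩ x ⟨hx, hx'⟩).trans (le_abs_self D)
    | succ n ih =>
      refine fun i t ht x hx => (hstep _ (by positivity) ih i t ht x hx).trans_eq ?_
      rw [pow_succ]; ring
  intro i t ht x hx
  have hlim := (tendsto_pow_atTop_nhds_zero_of_lt_one (r := (1 / 2 : ℝ)) (by norm_num)
    (by norm_num)).const_mul |D|
  rw [mul_zero] at hlim
  have h2 := abs_nonpos_iff.1 (ge_of_tendsto' hlim fun n => hpow n i t ht x hx)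
  exact sub_eq_zero.1 ((mul_eq_zero.1 h2).resolve_left (exp_pos _).ne')

end Uniqueness

/-! ### The first order system for given fields -/

section Slices

/-- At a fixed time, the arguments `v` of the operators come from functions on `[x0, X]`. -/
structure SliceData (ε θ Np Nm x0 X : ℝ) (v : Fin 5 ⊕ Fin 2 → ℝ → ℝ) (a b o s R μ W : ℝ → ℝ) :
    Prop where
  hv0 : ∀ x ∈ Icc x0 X, v (Sum.inl 0) x = a x
  hv1 : ∀ x ∈ Icc x0 X, v (Sum.inl 1) x = b x
  hv2 : ∀ x ∈ Icc x0 X, v (Sum.inl 2) x = exp (θ * x) * μ x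
  hv3 : ∀ x ∈ Icc x0 X, v (Sum.inl 3) x = s x
  hv4 : ∀ x ∈ Icc x0 X, v (Sum.inl 4) x = R x
  hv5 : ∀ x ∈ Icc x0 X, v (Sum.inr 0) x = o x0
  hv6 : ∀ x ∈ Icc x0 X, v (Sum.inr 1) x = exp x0 * W x0
  ca : ContinuousOn a (Icc x0 X)
  cb : ContinuousOn b (Icc x0 X)
  co : ContinuousOn o (Icc x0 X)
  cs : ContinuousOn s (Icc x0 X)
  cμ : ContinuousOn μ (Icc x0 X)
  cW : ContinuousOn W (Icc x0 X)
  o_x : ∀ x ∈ Ioo x0 X, HasDerivAt o (μ x) x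
  W_x : ∀ x ∈ Ioo x0 X, HasDerivAt (fun x => exp x * W x) (exp x *
    waveRF (densF ε (nu ε Np Nm) (a x) (b x) (o x) (s x) x) (o x)) x

namespace SliceData

variable {ε θ Np Nm x0 X x : ℝ} {v : Fin 5 ⊕ Fin 2 → ℝ → ℝ} {a b o s R μ W : ℝ → ℝ}

theorem muOp_eq (H : SliceData ε θ Np Nm x0 X v a b o s R μ W) (hx : x ∈ Icc x0 X) :
    muOp θ v x = μ x := by
  rw [muOp, H.hv2 x hx, ← mul_assoc, ← exp_add]; simp

theorem omOp_eq (H : SliceData ε θ Np Nm x0 X v a b o s R μ W) (hx : x ∈ Icc x0 X) :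
    omOp θ x0 v x = o x := by
  have hsub : Icc x0 x ⊆ Icc x0 X := Icc_subset_Icc_right hx.2
  have h1 : ∫ y in x0..x, exp (-θ * y) * v (Sum.inl 2) y = ∫ y in x0..x, μ y := by
    refine intervalIntegral.integral_congr fun y hy => ?_
    rw [uIcc_of_le hx.1] at hy
    rw [H.hv2 y (hsub hy), ← mul_assoc, ← exp_add]; simp
  have h2 := intervalIntegral.integral_eq_sub_of_hasDerivAt_of_le hx.1 (H.co.mono hsub)
    (fun y hy => H.o_x y ⟨hy.1, hy.2.trans_le hx.2⟩)
    ((H.cμ.mono hsub).intervalIntegrable_of_Icc hx.1)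
  rw [omOp, h1, h2, H.hv5 x hx]; simp

theorem velOp_eq (H : SliceData ε θ Np Nm x0 X v a b o s R μ W) (hx : x ∈ Icc x0 X) :
    velOp ε θ x0 v x = velF ε (a x) (b x) (o x) (s x) x := by
  rw [velOp, H.omOp_eq hx, H.hv0 x hx, H.hv1 x hx, H.hv3 x hx]

theorem densOp_eq (H : SliceData ε θ Np Nm x0 X v a b o s R μ W) (hx : x ∈ Icc x0 X) :
    densOp ε θ Np Nm x0 v x = densF ε (nu ε Np Nm) (a x) (b x) (o x) (s x) x := by
  rw [densOp, H.omOp_eq hx, H.hv0 x hx, H.hv1 x hx, H.hv3 x hx]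

theorem waveROp_eq (H : SliceData ε θ Np Nm x0 X v a b o s R μ W) (hx : x ∈ Icc x0 X) :
    waveROp ε θ Np Nm x0 v x =
      waveRF (densF ε (nu ε Np Nm) (a x) (b x) (o x) (s x) x) (o x) := by
  rw [waveROp, H.omOp_eq hx, H.densOp_eq hx]

theorem rpOp_eq (H : SliceData ε θ Np Nm x0 X v a b o s R μ W) (hx : x ∈ Icc x0 X) :
    rpOp ε θ Np Nm x0 v x = W x := by
  have hsub : Icc x0 x ⊆ Icc x0 X := Icc_subset_Icc_right hx.2
  have h1 : ∫ y in x0..x, exp (1 * y) * waveROp ε θ Np Nm x0 v y =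
      ∫ y in x0..x, exp y *
        waveRF (densF ε (nu ε Np Nm) (a y) (b y) (o y) (s y) y) (o y) := by
    refine intervalIntegral.integral_congr fun y hy => ?_
    rw [uIcc_of_le hx.1] at hy
    rw [H.waveROp_eq (hsub hy), one_mul]
  have hci : ContinuousOn (fun y => exp y *
        waveRF (densF ε (nu ε Np Nm) (a y) (b y) (o y) (s y) y) (o y)) (Icc x0 x) := by
    have := H.ca.mono hsub
    have := H.cb.mono hsub
    have := H.co.mono hsub
    have := H.cs.mono hsub
    unfold waveRF densF
    fun_prop
  have h2 := intervalIntegral.integral_eq_sub_of_hasDerivAt_of_le hx.1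
    (f := fun x => exp x * W x) (Real.continuous_exp.continuousOn.mul (H.cW.mono hsub))
    (fun y hy => H.W_x y ⟨hy.1, hy.2.trans_le hx.2⟩) (hci.intervalIntegrable_of_Icc hx.1)
  rw [rpOp, h1, h2, H.hv6 x hx, one_mul]
  have e : exp (-x) * exp x = 1 := by rw [← exp_add]; simp
  linear_combination W x * e

theorem waveOmOp_eq (H : SliceData ε θ Np Nm x0 X v a b o s R μ W) (hx : x ∈ Icc x0 X) :
    waveOmOp ε θ Np Nm x0 v x = waveOmF ε (densF ε (nu ε Np Nm) (a x) (b x) (o x) (s x) x) (o x) (s x)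
      (W x) (R x) := by
  rw [waveOmOp, H.densOp_eq hx, H.omOp_eq hx, H.rpOp_eq hx, H.hv3 x hx, H.hv4 x hx]

end SliceData

end Slices

/-! ### Partial derivatives up to the boundary -/

section Partials

/-- `∂_p` on a set, possibly up to its boundary. -/
def pD (S : Set (ℝ × ℝ)) (u : ℝ × ℝ → ℝ) (z : ℝ × ℝ) : ℝ := fderivWithin ℝ u S z (1, 0)

/-- `∂_q` on a set, possibly up to its boundary. -/
def qD (S : Set (ℝ × ℝ)) (u : ℝ × ℝ → ℝ) (z : ℝ × ℝ) : ℝ := fderivWithin ℝ u S z (0, 1)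

variable {S N : Set (ℝ × ℝ)} {u : ℝ × ℝ → ℝ} {z : ℝ × ℝ} {n m : ℕ∞ω}

theorem contDiffOn_pD (hS : UniqueDiffOn ℝ S) (hu : ContDiffOn ℝ n u S) (h : m + 1 ≤ n) :
    ContDiffOn ℝ m (pD S u) S := (hu.fderivWithin hS h).clm_apply contDiffOn_const

theorem contDiffOn_qD (hS : UniqueDiffOn ℝ S) (hu : ContDiffOn ℝ n u S) (h : m + 1 ≤ n) :
    ContDiffOn ℝ m (qD S u) S := (hu.fderivWithin hS h).clm_apply contDiffOn_const

theorem hasDerivWithinAt_pD (hu : ContDiffOn ℝ n u S) (hn : 1 ≤ n) (hz : z ∈ S) :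
    HasDerivWithinAt (fun s => u (s, z.2)) (pD S u z) {s | (s, z.2) ∈ S} z.1 := by
  have h1 := (hu.differentiableOn (by rintro rfl; simp at hn) z hz).hasFDerivWithinAt
  have h2 : HasDerivWithinAt (fun s : ℝ => (s, z.2)) ((1 : ℝ), (0 : ℝ)) {s | (s, z.2) ∈ S} z.1 :=
    ((hasDerivAt_id z.1).prodMk (hasDerivAt_const z.1 z.2)).hasDerivWithinAt
  exact HasFDerivWithinAt.comp_hasDerivWithinAt z.1 (f := fun s : ℝ => (s, z.2)) h1 h2 fun s hs => hs

theorem hasDerivWithinAt_qD (hu : ContDiffOn ℝ n u S) (hn : 1 ≤ n) (hz : z ∈ S) :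
    HasDerivWithinAt (fun s => u (z.1, s)) (qD S u z) {s | (z.1, s) ∈ S} z.2 := by
  have h1 := (hu.differentiableOn (by rintro rfl; simp at hn) z hz).hasFDerivWithinAt
  have h2 : HasDerivWithinAt (fun s : ℝ => (z.1, s)) ((0 : ℝ), (1 : ℝ)) {s | (z.1, s) ∈ S} z.2 :=
    ((hasDerivAt_const z.2 z.1).prodMk (hasDerivAt_id z.2)).hasDerivWithinAt
  exact HasFDerivWithinAt.comp_hasDerivWithinAt z.2 (f := fun s : ℝ => (z.1, s)) h1 h2 fun s hs => hs

theorem hasDerivAt_pD (hN : IsOpen N) (hNS : N ⊆ S) (hu : ContDiffOn ℝ n u S) (hn : 1 ≤ n)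
    (hz : z ∈ N) : HasDerivAt (fun s => u (s, z.2)) (pD S u z) z.1 :=
  (hasDerivWithinAt_pD hu hn (hNS hz)).hasDerivAt (eventually_fst hN hz hNS)

theorem hasDerivAt_qD (hN : IsOpen N) (hNS : N ⊆ S) (hu : ContDiffOn ℝ n u S) (hn : 1 ≤ n)
    (hz : z ∈ N) : HasDerivAt (fun s => u (z.1, s)) (qD S u z) z.2 :=
  (hasDerivWithinAt_qD hu hn (hNS hz)).hasDerivAt (eventually_snd hN hz hNS)

theorem qD_pD (hN : IsOpen N) (hNS : N ⊆ S) (hu : ContDiffOn ℝ 2 u S) (hz : z ∈ N) :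
    qD S (pD S u) z = pD S (qD S u) z := by
  have hmem : ∀ w ∈ N, S ∈ 𝓝 w := fun w hw => mem_of_superset (hN.mem_nhds hw) hNS
  have hC : ContDiffAt ℝ 2 u z := (hu z (hNS hz)).contDiffAt (hmem z hz)
  have hsym : IsSymmSndFDerivAt ℝ u z := hC.isSymmSndFDerivAt (by simp)
  have hd : DifferentiableAt ℝ (fderiv ℝ u) z :=
    ((hC.fderiv_right (m := 1) (by norm_num)).differentiableAt (by simp))
  have key : ∀ v w : ℝ × ℝ, fderivWithin ℝ (fun z => fderivWithin ℝ u S z v) S z w =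
      fderiv ℝ (fderiv ℝ u) z w v := by
    intro v w
    rw [fderivWithin_of_mem_nhds (hmem z hz)]
    have e : (fun z => fderivWithin ℝ u S z v) =ᶠ[𝓝 z] fun z => fderiv ℝ u z v := by
      filter_upwards [hN.mem_nhds hz] with w hw
      rw [fderivWithin_of_mem_nhds (hmem w hw)]
    rw [e.fderiv_eq, (hd.hasFDerivAt.clm_apply (hasFDerivAt_const v z)).fderiv]
    simp
  exact (key _ _).trans ((hsym _ _).trans (key _ _).symm)

end Partials

/-! ### The unknowns of the first order system for given fields -/

/-- Change of variables from `(t, x)` to `(p, q)`. -/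
def polarMap (p0 : ℝ) (y : ℝ × ℝ) : ℝ × ℝ := (p0 + y.1, exp y.2)

theorem polarMap_log {p0 : ℝ} {w : ℝ × ℝ} (hw : 0 < w.2) :
    polarMap p0 (w.1 - p0, log w.2) = w := by
  rw [polarMap, exp_log hw, add_sub_cancel]

theorem contDiff_polarMap (p0 : ℝ) {n : ℕ∞ω} : ContDiff ℝ n (polarMap p0) :=
  (contDiff_const.add contDiff_fst).prodMk (Real.contDiff_exp.comp contDiff_snd)

namespace Fields

variable (S : Set (ℝ × ℝ)) (p0 N : ℝ) (F : Fields)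

/-- `log (q^N f⁺)` -/
def logP (t x : ℝ) : ℝ := log (F.fP (polarMap p0 (t, x))) + N * x

/-- `log (q^N f⁻)` -/
def logM (t x : ℝ) : ℝ := log (F.fM (polarMap p0 (t, x))) + N * x

/-- `log Ω` -/
def logOm (t x : ℝ) : ℝ := log (F.Om (polarMap p0 (t, x)))

/-- `log (r²/q²)` -/
def logR (t x : ℝ) : ℝ := 2 * (log (F.r (polarMap p0 (t, x))) - x)

/-- `∂_q r² / q` -/
def rsqQ (t x : ℝ) : ℝ := 2 * exp (-x) * F.r (polarMap p0 (t, x)) * qD S F.r (polarMap p0 (t, x))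

/-- `∂_p r² / q` -/
def rsqP (t x : ℝ) : ℝ := 2 * exp (-x) * F.r (polarMap p0 (t, x)) * pD S F.r (polarMap p0 (t, x))

/-- `q ∂_q log Ω` -/
def logOmQ (t x : ℝ) : ℝ := exp x * qD S F.Om (polarMap p0 (t, x)) / F.Om (polarMap p0 (t, x))

/-- The derivative in `x` of `log (q^N f)`. -/
def logX (f : ℝ × ℝ → ℝ) (t x : ℝ) : ℝ :=
  exp x * qD S f (polarMap p0 (t, x)) / f (polarMap p0 (t, x)) + N

/-- Fields with the regularity of characteristic solutions, on a set `S` with open part `O`. -/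
structure Regular (S O : Set (ℝ × ℝ)) (F : Fields) : Prop where
  isOpen : IsOpen O
  subset : O ⊆ S
  unique : UniqueDiffOn ℝ S
  pos_q : ∀ z ∈ S, 0 < z.2
  pos : ∀ z ∈ S, 0 < F.fP z ∧ 0 < F.fM z ∧ 0 < F.Om z ∧ 0 < F.r z
  fP_C1 : ContDiffOn ℝ 1 F.fP S
  fM_C1 : ContDiffOn ℝ 1 F.fM S
  Om_C2 : ContDiffOn ℝ 2 F.Om S
  r_C2 : ContDiffOn ℝ 2 F.r S

/-- The first order system at a point. -/
structure SystemAt (ε Np Nm : ℝ) (A B om s R μ W : ℝ → ℝ → ℝ) (At Ax Bt Bx t x : ℝ) : Prop where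
  A_t : HasDerivAt (fun t => A t x) At t
  A_x : HasDerivAt (A t) Ax x
  A_eq : At + kPlus ε * velF ε (A t x) (B t x) (om t x) (s t x) x * Ax =
    kPlus ε * velF ε (A t x) (B t x) (om t x) (s t x) x *
      (Np - 4 * μ t x + 2 * eta ε * (exp (-s t x) * R t x))
  B_t : HasDerivAt (fun t => B t x) Bt t
  B_x : HasDerivAt (B t) Bx x
  B_eq : Bt + kMinus ε * velF ε (A t x) (B t x) (om t x) (s t x) x * Bx =
    kMinus ε * velF ε (A t x) (B t x) (om t x) (s t x) x *
      (Nm + 4 * μ t x - 2 * eta ε * (exp (-s t x) * R t x))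
  μ_t : HasDerivAt (fun t => μ t x) (exp (-x) *
    waveOmF ε (densF ε (nu ε Np Nm) (A t x) (B t x) (om t x) (s t x) x) (om t x) (s t x) (W t x)
        (R t x)) t
  s_t : HasDerivAt (fun t => s t x) (exp (-x) * (exp (-s t x) * W t x)) t
  R_t : HasDerivAt (fun t => R t x) (exp (-x) *
    waveRF (densF ε (nu ε Np Nm) (A t x) (B t x) (om t x) (s t x) x) (om t x)) t
  W_x : HasDerivAt (fun x => exp x * W t x) (exp x *
    waveRF (densF ε (nu ε Np Nm) (A t x) (B t x) (om t x) (s t x) x) (om t x)) x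

variable {S p0 N F} {ε Np Nm t x : ℝ} {O : Set (ℝ × ℝ)} {n m : ℕ∞ω}

theorem hasDerivWithinAt_comp_exp {u : ℝ × ℝ → ℝ} (hu : ContDiffOn ℝ n u S) (hn : 1 ≤ n)
    (hz : polarMap p0 (t, x) ∈ S) : HasDerivWithinAt (fun x => u (polarMap p0 (t, x)))
      (exp x * qD S u (polarMap p0 (t, x))) {y | polarMap p0 (t, y) ∈ S} x := by
  have h := hasDerivWithinAt_qD (z := polarMap p0 (t, x)) hu hn hz
  rw [mul_comm]
  exact HasDerivWithinAt.comp (h₂ := fun s => u ((polarMap p0 (t, x)).1, s)) (h := exp)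
    (s' := {s | ((polarMap p0 (t, x)).1, s) ∈ S}) x h (hasDerivAt_exp x).hasDerivWithinAt
    fun y hy => hy

namespace Regular

theorem isOpen_preimage (H : Regular S O F) : IsOpen (polarMap p0 ⁻¹' O) :=
  H.isOpen.preimage (contDiff_polarMap p0 (n := 0)).continuous

theorem exp_logR (H : Regular S O F) (hz : polarMap p0 (t, x) ∈ S) :
    F.r (polarMap p0 (t, x)) = exp (x + F.logR p0 t x / 2) := by
  rw [logR, mul_div_cancel_left₀ _ two_ne_zero, add_sub_cancel, exp_log (H.pos _ hz).2.2.2]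

theorem mem_nhds (H : Regular S O F) (hz : polarMap p0 (t, x) ∈ O) :
    {y | polarMap p0 (t, y) ∈ S} ∈ 𝓝 x :=
  ((contDiff_polarMap p0 (n := 0)).continuous.comp (by fun_prop : Continuous fun y => (t, y))).continuousAt
    |>.preimage_mem_nhds (mem_of_superset (H.isOpen.mem_nhds hz) H.subset)

theorem comp_t {u : ℝ × ℝ → ℝ} (H : Regular S O F) (hu : ContDiffOn ℝ n u S) (hn : 1 ≤ n)
    (hz : polarMap p0 (t, x) ∈ O) :
    HasDerivAt (fun t => u (polarMap p0 (t, x))) (pD S u (polarMap p0 (t, x))) t :=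
  HasDerivAt.comp_const_add p0 t (hasDerivAt_pD H.isOpen H.subset hu hn hz)

theorem comp_x {u : ℝ × ℝ → ℝ} (H : Regular S O F) (hu : ContDiffOn ℝ n u S) (hn : 1 ≤ n)
    (hz : polarMap p0 (t, x) ∈ O) :
    HasDerivAt (fun x => u (polarMap p0 (t, x))) (exp x * qD S u (polarMap p0 (t, x))) x :=
  (hasDerivWithinAt_comp_exp hu hn (H.subset hz)).hasDerivAt (H.mem_nhds hz)

theorem hasDerivWithinAt_logOm (H : Regular S O F) (hz : polarMap p0 (t, x) ∈ S) :
    HasDerivWithinAt (F.logOm p0 t) (F.logOmQ S p0 t x) {y | polarMap p0 (t, y) ∈ S} x :=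
  (hasDerivWithinAt_comp_exp H.Om_C2 one_le_two hz).log (H.pos _ hz).2.2.1.ne'

theorem hasDerivWithinAt_logR (H : Regular S O F) (hz : polarMap p0 (t, x) ∈ S) :
    HasDerivWithinAt (F.logR p0 t) (exp (-F.logR p0 t x) * F.rsqQ S p0 t x - 2)
      {y | polarMap p0 (t, y) ∈ S} x := by
  have hr := (H.pos _ hz).2.2.2.ne'
  have h1 := hasDerivWithinAt_comp_exp H.r_C2 one_le_two hz
  refine (((h1.log hr).sub (hasDerivWithinAt_id x _)).const_mul 2).congr_deriv ?_
  have e := H.exp_logR hz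
  have e2 : exp (-F.logR p0 t x) * exp (-x) *
      (F.r (polarMap p0 (t, x)) * F.r (polarMap p0 (t, x))) = exp x := by
    rw [e, ← exp_add, ← exp_add, ← exp_add]
    ring_nf
  rw [rsqQ]
  field_simp
  linear_combination -(qD S F.r (polarMap p0 (t, x))) * e2

theorem om_x (H : Regular S O F) (hz : polarMap p0 (t, x) ∈ O) :
    HasDerivAt (F.logOm p0 t) (F.logOmQ S p0 t x) x :=
  (H.hasDerivWithinAt_logOm (H.subset hz)).hasDerivAt (H.mem_nhds hz)

theorem s_t (H : Regular S O F) (hz : polarMap p0 (t, x) ∈ O) :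
    HasDerivAt (fun t => F.logR p0 t x) (exp (-x) * (exp (-F.logR p0 t x) * F.rsqP S p0 t x)) t := by
  have hr := (H.pos _ (H.subset hz)).2.2.2.ne'
  refine ((((H.comp_t H.r_C2 one_le_two hz).log hr).sub_const x).const_mul 2).congr_deriv ?_
  have e := H.exp_logR (H.subset hz)
  have e2 : exp (-x) * (exp (-F.logR p0 t x) * exp (-x)) *
      (F.r (polarMap p0 (t, x)) * F.r (polarMap p0 (t, x))) = 1 := by
    rw [e, ← exp_add, ← exp_add, ← exp_add, ← exp_add]
    ring_nf; simp
  rw [rsqP]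
  field_simp
  linear_combination -(pD S F.r (polarMap p0 (t, x))) * e2

theorem s_x (H : Regular S O F) (hz : polarMap p0 (t, x) ∈ O) :
    HasDerivAt (F.logR p0 t) (exp (-F.logR p0 t x) * F.rsqQ S p0 t x - 2) x :=
  (H.hasDerivWithinAt_logR (H.subset hz)).hasDerivAt (H.mem_nhds hz)

theorem polar (H : Regular S O F) (Np Nm p0 : ℝ) :
    Polar Np Nm p0 F O (F.logP p0 Np) (F.logM p0 Nm) (F.logOm p0) (F.logR p0) (F.rsqQ S p0)
      (F.logOmQ S p0) (F.rsqP S p0) := by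
  have hq : ∀ w ∈ O, 0 < w.2 := fun w hw => H.pos_q w (H.subset hw)
  have hp := fun w hw => H.pos w (H.subset hw)
  have hz : ∀ w ∈ O, polarMap p0 (w.1 - p0, log w.2) ∈ O := fun w hw => by
    rwa [polarMap_log (hq w hw)]
  exact
    { isOpen := H.isOpen
      pos := hq
      fP := fun w hw => by
        rw [logP, polarMap_log (hq w hw), add_sub_cancel_right, exp_log (hp w hw).1]
      fM := fun w hw => by
        rw [logM, polarMap_log (hq w hw), add_sub_cancel_right, exp_log (hp w hw).2.1]
      Om := fun w hw => by rw [logOm, polarMap_log (hq w hw), exp_log (hp w hw).2.2.1]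
      r := fun w hw => by
        rw [← H.exp_logR (H.subset (hz w hw)), polarMap_log (hq w hw)]
      om_x := fun w hw => H.om_x (hz w hw)
      s_t := fun w hw => H.s_t (hz w hw)
      s_x := fun w hw => H.s_x (hz w hw) }

/-- The evolution equations as a first order system. -/
theorem systemAt (h0 : 0 < ε) (h1 : ε < 1) (hN : Np = Nm - 4 * eta ε) (H : Regular S O F)
    (hz : polarMap p0 (t, x) ∈ O) (hE : EvolutionAt ε F (polarMap p0 (t, x))) :
    SystemAt ε Np Nm (F.logP p0 Np) (F.logM p0 Nm) (F.logOm p0) (F.logR p0) (F.rsqQ S p0)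
      (F.logOmQ S p0) (F.rsqP S p0)
      (pD S F.fP (polarMap p0 (t, x)) / F.fP (polarMap p0 (t, x))) (logX S p0 Np F.fP t x)
      (pD S F.fM (polarMap p0 (t, x)) / F.fM (polarMap p0 (t, x))) (logX S p0 Nm F.fM t x) t x := by
  have hp := H.pos _ (H.subset hz)
  have P := H.polar Np Nm p0
  set w := polarMap p0 (t, x) with hw
  have et : t = w.1 - p0 := by rw [hw, polarMap, add_sub_cancel_left]
  have ex : x = log w.2 := by rw [hw, polarMap, log_exp]
  have hid : ∀ c : ℝ, HasDerivAt (fun y : ℝ => c * y) c x := fun c => by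
    simpa using (hasDerivAt_id x).const_mul c
  have At := ((H.comp_t H.fP_C1 le_rfl hz).log hp.1.ne').add_const (Np * x)
  have Ax := ((H.comp_x H.fP_C1 le_rfl hz).log hp.1.ne').add (hid Np)
  have Bt := ((H.comp_t H.fM_C1 le_rfl hz).log hp.2.1.ne').add_const (Nm * x)
  have Bx := ((H.comp_x H.fM_C1 le_rfl hz).log hp.2.1.ne').add (hid Nm)
  have O_t := H.comp_t H.Om_C2 one_le_two hz
  have C1 : (1 : ℕ∞ω) + 1 ≤ 2 := by norm_num
  have rp_x := H.comp_x (contDiffOn_pD H.unique H.r_C2 C1) le_rfl hz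
  have μt := ((H.comp_t (contDiffOn_qD H.unique H.Om_C2 C1) le_rfl hz).const_mul (exp x)).div O_t
    hp.2.2.1.ne'
  have Rt := ((H.comp_t H.r_C2 one_le_two hz).const_mul (2 * exp (-x))).mul
    (H.comp_t (contDiffOn_qD H.unique H.r_C2 C1) le_rfl hz)
  have eP := (P.fPlus_iff h0 h1 hN hz et ex At Ax Bt Bx).1 hE.2.2.1
  have eM := (P.fMinus_iff h0 h1 hN hz et ex At Ax Bt Bx).1 hE.2.2.2
  have eR := (P.rWave_iff h1 hz et ex Rt).1 hE.1
  have eO := (P.omegaWave_iff h1 hz et ex μt).1 hE.2.1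
  refine
    { A_t := At
      A_x := Ax
      A_eq := by rw [logX]; linear_combination eP
      B_t := Bt
      B_x := Bx
      B_eq := by rw [logX]; linear_combination eM
      μ_t := HasDerivAt.congr_deriv μt eO
      s_t := H.s_t hz
      R_t := HasDerivAt.congr_deriv Rt eR
      W_x := ?_ }
  have e1 : ∀ y : ℝ, exp y * F.rsqP S p0 t y =
      2 * (F.r (polarMap p0 (t, y)) * pD S F.r (polarMap p0 (t, y))) := fun y => by
    have : exp y * exp (-y) = 1 := by rw [← exp_add]; simp
    rw [rsqP]
    linear_combination 2 * (F.r (polarMap p0 (t, y)) * pD S F.r (polarMap p0 (t, y))) * this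
  refine (((H.comp_x H.r_C2 one_le_two hz).mul rp_x).const_mul 2).congr_of_eventuallyEq
    (Eventually.of_forall e1) |>.congr_deriv ?_
  apply mul_left_cancel₀ (exp_pos (-x)).ne'
  rw [← hw] at *
  rw [qD_pD H.isOpen H.subset H.r_C2 hz]
  linear_combination exp x * eR

end Regular

end Fields

/-! ### Uniqueness of characteristic solutions -/

namespace Fields

/-- The unknowns of the first order system, for given fields. -/
def unknowns (θ Np Nm : ℝ) (S : Set (ℝ × ℝ)) (p0 : ℝ) (F : Fields) : Fin 5 → ℝ → ℝ → ℝ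
  | 0 => F.logP p0 Np
  | 1 => F.logM p0 Nm
  | 2 => fun t x => exp (θ * x) * F.logOmQ S p0 t x
  | 3 => F.logR p0
  | 4 => F.rsqQ S p0

/-- The derivatives of the first two unknowns in `x`. -/
def unknownsX (Np Nm : ℝ) (S : Set (ℝ × ℝ)) (p0 : ℝ) (F : Fields) (i : Fin 5) : ℝ → ℝ → ℝ :=
  if i = 0 then logX S p0 Np F.fP else logX S p0 Nm F.fM

/-- The arguments `w` of the operators are the unknowns of the given fields at time `t`. -/
abbrev IsSlice (ε θ Np Nm x0 X : ℝ) (S : Set (ℝ × ℝ)) (p0 : ℝ) (F : Fields) (t : ℝ)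
    (w : Fin 5 ⊕ Fin 2 → ℝ → ℝ) : Prop :=
  SliceData ε θ Np Nm x0 X w (F.logP p0 Np t) (F.logM p0 Nm t) (F.logOm p0 t) (F.logR p0 t)
    (F.rsqQ S p0 t) (F.logOmQ S p0 t) (F.rsqP S p0 t)

namespace Regular

variable {S O : Set (ℝ × ℝ)} {F : Fields} {ε θ Np Nm p0 t x x0 X : ℝ}

section Continuity

variable {n : ℕ∞ω}

theorem contDiffOn_comp_polarMap {u : ℝ × ℝ → ℝ} (hu : ContDiffOn ℝ n u S) :
    ContDiffOn ℝ n (fun y => u (polarMap p0 y)) (polarMap p0 ⁻¹' S) :=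
  hu.comp (contDiff_polarMap p0).contDiffOn fun _ h => h

theorem contDiffOn_logP (H : Regular S O F) (h : ContDiffOn ℝ n F.fP S) :
    ContDiffOn ℝ n (uncurry (F.logP p0 Np)) (polarMap p0 ⁻¹' S) :=
  ((contDiffOn_comp_polarMap h).log fun y hy => (H.pos _ hy).1.ne').add (by fun_prop)

theorem contDiffOn_logM (H : Regular S O F) (h : ContDiffOn ℝ n F.fM S) :
    ContDiffOn ℝ n (uncurry (F.logM p0 Nm)) (polarMap p0 ⁻¹' S) :=
  ((contDiffOn_comp_polarMap h).log fun y hy => (H.pos _ hy).2.1.ne').add (by fun_prop)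

theorem contDiffOn_logOm (H : Regular S O F) (h : ContDiffOn ℝ n F.Om S) :
    ContDiffOn ℝ n (uncurry (F.logOm p0)) (polarMap p0 ⁻¹' S) :=
  (contDiffOn_comp_polarMap h).log fun _ hy => (H.pos _ hy).2.2.1.ne'

theorem contDiffOn_logR (H : Regular S O F) (h : ContDiffOn ℝ n F.r S) :
    ContDiffOn ℝ n (uncurry (F.logR p0)) (polarMap p0 ⁻¹' S) :=
  contDiffOn_const.mul (((contDiffOn_comp_polarMap h).log fun y hy =>
    (H.pos _ hy).2.2.2.ne').sub (by fun_prop))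

theorem contDiffOn_rsqQ (H : Regular S O F) (h : ContDiffOn ℝ (n + 1) F.r S) :
    ContDiffOn ℝ n (uncurry (F.rsqQ S p0)) (polarMap p0 ⁻¹' S) := by
  have h1 : ContDiffOn ℝ n (fun y : ℝ × ℝ => 2 * exp (-y.2)) (polarMap p0 ⁻¹' S) := by fun_prop
  exact (h1.mul (contDiffOn_comp_polarMap (h.of_le le_self_add))).mul
    (contDiffOn_comp_polarMap (contDiffOn_qD H.unique h le_rfl))

theorem contDiffOn_rsqP (H : Regular S O F) (h : ContDiffOn ℝ (n + 1) F.r S) :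
    ContDiffOn ℝ n (uncurry (F.rsqP S p0)) (polarMap p0 ⁻¹' S) := by
  have h1 : ContDiffOn ℝ n (fun y : ℝ × ℝ => 2 * exp (-y.2)) (polarMap p0 ⁻¹' S) := by fun_prop
  exact (h1.mul (contDiffOn_comp_polarMap (h.of_le le_self_add))).mul
    (contDiffOn_comp_polarMap (contDiffOn_pD H.unique h le_rfl))

theorem contDiffOn_logOmQ (H : Regular S O F) (h : ContDiffOn ℝ (n + 1) F.Om S) :
    ContDiffOn ℝ n (uncurry (F.logOmQ S p0)) (polarMap p0 ⁻¹' S) := by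
  have h1 : ContDiffOn ℝ n (fun y : ℝ × ℝ => exp y.2) (polarMap p0 ⁻¹' S) := by fun_prop
  exact (h1.mul (contDiffOn_comp_polarMap (contDiffOn_qD H.unique h le_rfl))).div
    (contDiffOn_comp_polarMap (h.of_le le_self_add)) fun y hy => (H.pos _ hy).2.2.1.ne'

theorem contDiffOn_unknowns (H : Regular S O F) (hP : ContDiffOn ℝ n F.fP S) (hM : ContDiffOn ℝ n F.fM S)
    (hO : ContDiffOn ℝ (n + 1) F.Om S) (hr : ContDiffOn ℝ (n + 1) F.r S) (i : Fin 5) :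
    ContDiffOn ℝ n (uncurry (F.unknowns θ Np Nm S p0 i)) (polarMap p0 ⁻¹' S) := by
  match i with
  | 0 => exact H.contDiffOn_logP hP
  | 1 => exact H.contDiffOn_logM hM
  | 2 =>
    have h1 : ContDiffOn ℝ n (fun y : ℝ × ℝ => exp (θ * y.2)) (polarMap p0 ⁻¹' S) := by fun_prop
    exact h1.mul (H.contDiffOn_logOmQ hO)
  | 3 => exact H.contDiffOn_logR (hr.of_le le_self_add)
  | 4 => exact H.contDiffOn_rsqQ hr

end Continuity

/-- The slices of the unknowns, extended by `v`, as arguments of the operators. -/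
theorem sliceData (h0 : 0 < ε) (h1 : ε < 1) (hN : Np = Nm - 4 * eta ε) (H : Regular S O F)
    (hS : ∀ y ∈ Icc x0 X, polarMap p0 (t, y) ∈ S)
    (hO : ∀ y ∈ Ioo x0 X, polarMap p0 (t, y) ∈ O ∧ EvolutionAt ε F (polarMap p0 (t, y)))
    {π : Fin 2 → ℝ} (hπ0 : π 0 = F.logOm p0 t x0) (hπ1 : π 1 = exp x0 * F.rsqP S p0 t x0)
    {v : Fin 5 → ℝ → ℝ} (hv : ∀ j, ∀ y ∈ Icc x0 X, v j y = F.unknowns θ Np Nm S p0 j t y) :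
    F.IsSlice ε θ Np Nm x0 X S p0 t (withParam v π) := by
  have hsl : ∀ {g : ℝ → ℝ → ℝ}, ContDiffOn ℝ 0 (uncurry g) (polarMap p0 ⁻¹' S) →
      ContinuousOn (g t) (Icc x0 X) := fun hg =>
    hg.continuousOn.comp (by fun_prop : ContinuousOn (fun y => (t, y)) (Icc x0 X)) hS
  have hr1 : ContDiffOn ℝ (0 + 1) F.r S := H.r_C2.of_le (by norm_num)
  have hO1 : ContDiffOn ℝ (0 + 1) F.Om S := H.Om_C2.of_le (by norm_num)
  exact
    { hv0 := hv 0
      hv1 := hv 1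
      hv2 := hv 2
      hv3 := hv 3
      hv4 := hv 4
      hv5 := fun _ _ => hπ0
      hv6 := fun _ _ => hπ1
      ca := hsl (H.contDiffOn_logP (H.fP_C1.of_le zero_le_one))
      cb := hsl (H.contDiffOn_logM (H.fM_C1.of_le zero_le_one))
      co := hsl (H.contDiffOn_logOm (H.Om_C2.of_le zero_le_two))
      cs := hsl (H.contDiffOn_logR (H.r_C2.of_le zero_le_two))
      cμ := hsl (H.contDiffOn_logOmQ hO1)
      cW := hsl (H.contDiffOn_rsqP hr1)
      o_x := fun y hy => H.om_x (hO y hy).1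
      W_x := fun y hy => (H.systemAt h0 h1 hN (hO y hy).1 (hO y hy).2).W_x }

/-- The unknowns solve the system with operator coefficients. -/
theorem unknowns_system (h0 : 0 < ε) (h1 : ε < 1) (hN : Np = Nm - 4 * eta ε) (H : Regular S O F)
    {w : Fin 5 ⊕ Fin 2 → ℝ → ℝ}
    (hw : F.IsSlice ε θ Np Nm x0 X S p0 t w) (hx : x ∈ Icc x0 X)
    (hz : polarMap p0 (t, x) ∈ O) (hE : EvolutionAt ε F (polarMap p0 (t, x))) (i : Fin 5) :
    ((i = 0 ∨ i = 1) ∧ ∃ ut, HasDerivAt (fun t => F.unknowns θ Np Nm S p0 i t x) ut t ∧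
      HasDerivAt (F.unknowns θ Np Nm S p0 i t) (F.unknownsX Np Nm S p0 i t x) x ∧
      ut + speedOp ε θ x0 i w x * F.unknownsX Np Nm S p0 i t x = sourceOp ε θ Np Nm x0 i w x) ∨
    ¬(i = 0 ∨ i = 1) ∧ speedOp ε θ x0 i w x = 0 ∧
      HasDerivAt (fun t => F.unknowns θ Np Nm S p0 i t x) (sourceOp ε θ Np Nm x0 i w x) t := by
  have hs := H.systemAt h0 h1 hN hz hE
  match i with
  | 0 =>
    refine .inl ⟨.inl rfl, _, hs.A_t, hs.A_x, ?_⟩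
    simp only [speedOp, sourceOp, hw.velOp_eq hx, hw.muOp_eq hx, hw.hv3 x hx, hw.hv4 x hx]
    exact hs.A_eq
  | 1 =>
    refine .inl ⟨.inr rfl, _, hs.B_t, hs.B_x, ?_⟩
    simp only [speedOp, sourceOp, hw.velOp_eq hx, hw.muOp_eq hx, hw.hv3 x hx, hw.hv4 x hx]
    exact hs.B_eq
  | 2 =>
    refine .inr ⟨by decide, rfl, (hs.μ_t.const_mul (exp (θ * x))).congr_deriv ?_⟩
    simp only [sourceOp, hw.waveOmOp_eq hx]
    rw [← mul_assoc, ← exp_add]; ring_nf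
  | 3 =>
    refine .inr ⟨by decide, rfl, hs.s_t.congr_deriv ?_⟩
    simp only [sourceOp, hw.rpOp_eq hx, hw.hv3 x hx, one_mul]
  | 4 =>
    refine .inr ⟨by decide, rfl, hs.R_t.congr_deriv ?_⟩
    simp only [sourceOp, hw.waveROp_eq hx, one_mul]

end Regular

end Fields

section

variable {ε θ Np Nm p0 q0 : ℝ} {B : FluidMetric} {d : OutgoingData} {F G : Fields}

theorem uniqueDiffOn_domDbar (hp : p0 < 0) : UniqueDiffOn ℝ (domDbar p0 q0) :=
  (uniqueDiffOn_Icc hp).prod (uniqueDiffOn_Ici q0)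

theorem IsCharacteristicSolution.regular (hp : p0 < 0) (hq : 0 < q0)
    (H : IsCharacteristicSolution ε θ Np Nm p0 q0 B d F) :
    F.Regular (domDbar p0 q0) (domD p0 q0) :=
  { isOpen := isOpen_Ioo.prod isOpen_Ioi
    subset := prod_mono Ioo_subset_Icc_self Ioi_subset_Ici_self
    unique := uniqueDiffOn_domDbar hp
    pos_q := fun _ hz => hq.trans_le hz.2
    pos := H.pos
    fP_C1 := H.fP_C1
    fM_C1 := H.fM_C1
    Om_C2 := H.Om_C2
    r_C2 := H.r_C2 }

theorem qD_domDbar_congr {u v : ℝ × ℝ → ℝ} {z : ℝ × ℝ} (hz : z ∈ domDbar p0 q0)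
    (hu : ContDiffOn ℝ 2 u (domDbar p0 q0)) (hv : ContDiffOn ℝ 2 v (domDbar p0 q0))
    (h : ∀ q ∈ Ici q0, u (z.1, q) = v (z.1, q)) :
    qD (domDbar p0 q0) u z = qD (domDbar p0 q0) v z := by
  have e : {s | (z.1, s) ∈ domDbar p0 q0} = Ici q0 := by
    ext s; exact ⟨fun hs => hs.2, fun hs => ⟨hz.1, hs⟩⟩
  have h1 := hasDerivWithinAt_qD hu one_le_two hz
  have h2 := hasDerivWithinAt_qD hv one_le_two hz
  rw [e] at h1 h2
  exact (uniqueDiffOn_Ici q0 z.2 hz.2).eq_deriv _ h1 (h2.congr h (h _ hz.2))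

theorem pD_domDbar_congr (hp : p0 < 0) {u v : ℝ × ℝ → ℝ} {z : ℝ × ℝ} (hz : z ∈ domDbar p0 q0)
    (hu : ContDiffOn ℝ 2 u (domDbar p0 q0)) (hv : ContDiffOn ℝ 2 v (domDbar p0 q0))
    (h : ∀ p ∈ Icc p0 0, u (p, z.2) = v (p, z.2)) :
    pD (domDbar p0 q0) u z = pD (domDbar p0 q0) v z := by
  have e : {s | (s, z.2) ∈ domDbar p0 q0} = Icc p0 0 := by
    ext s; exact ⟨fun hs => hs.1, fun hs => ⟨hs, hz.2⟩⟩
  have h1 := hasDerivWithinAt_pD hu one_le_two hz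
  have h2 := hasDerivWithinAt_pD hv one_le_two hz
  rw [e] at h1 h2
  exact (uniqueDiffOn_Icc hp z.1 hz.1).eq_deriv _ h1 (h2.congr h (h _ hz.1))

/-- Uniqueness for the characteristic problem. -/
theorem IsCharacteristicSolution.unique (h0 : 0 < ε) (h1 : ε < 1) (hN : Np = Nm - 4 * eta ε)
    (hθ : 0 < θ) (hθ1 : θ < 1) (hν : 0 ≤ 2 * eta ε + nu ε Np Nm) (hp : p0 < 0) (hq : 0 < q0)
    (HF : IsCharacteristicSolution ε θ Np Nm p0 q0 B d F)
    (HG : IsCharacteristicSolution ε θ Np Nm p0 q0 B d G) {z : ℝ × ℝ} (hz : z ∈ domDbar p0 q0) :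
    F.fP z = G.fP z ∧ F.fM z = G.fM z ∧ F.Om z = G.Om z ∧ F.r z = G.r z := by
  set S := domDbar p0 q0 with hS
  set x0 := log q0 with hx0
  have hI : ∀ {a b : ℝ}, Ioo a b ⊆ Icc a b := fun h => Ioo_subset_Icc_self h
  have hmS : ∀ t ∈ Icc 0 (-p0), ∀ x ∈ Ici x0, polarMap p0 (t, x) ∈ S := fun t ht x hx =>
    ⟨⟨by simp [polarMap, ht.1], by have := ht.2; simp only [polarMap]; linarith⟩,
      (log_le_iff_le_exp hq).1 hx⟩
  have hmO : ∀ t ∈ Ioo 0 (-p0), ∀ x ∈ Ioi x0, polarMap p0 (t, x) ∈ domD p0 q0 := fun t ht x hx =>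
    ⟨⟨by simp [polarMap, ht.1], by have := ht.2; simp only [polarMap]; linarith⟩,
      (Real.log_lt_iff_lt_exp hq).1 hx⟩
  have h00 : (0 : ℝ) ∈ Icc 0 (-p0) := ⟨le_rfl, by linarith⟩
  have ep : ∀ x, (polarMap p0 (0, x)).1 = p0 := fun x => add_zero p0
  have eq : ∀ t, (polarMap p0 (t, x0)).2 = q0 := fun t => exp_log hq
  have htr : ∀ {G}, IsCharacteristicSolution ε θ Np Nm p0 q0 B d G → ∀ z ∈ S, z.1 = p0 ∨ z.2 = q0 →
      F.fP z = G.fP z ∧ F.fM z = G.fM z ∧ F.Om z = G.Om z ∧ F.r z = G.r z := by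
    rintro G HG ⟨p, q⟩ hz (h | h) <;> dsimp only at h <;> rw [h]
    · obtain ⟨a1, a2, a3, a4⟩ := HF.outgoing _ hz.2
      obtain ⟨b1, b2, b3, b4⟩ := HG.outgoing _ hz.2
      exact ⟨a1.trans b1.symm, a2.trans b2.symm, a3.trans b3.symm, a4.trans b4.symm⟩
    · obtain ⟨a1, a2, a3, a4⟩ := HF.ingoing _ hz.1
      obtain ⟨b1, b2, b3, b4⟩ := HG.ingoing _ hz.1
      exact ⟨a1.trans b1.symm, a2.trans b2.symm, a3.trans b3.symm, a4.trans b4.symm⟩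
  set π : Fin 2 → ℝ → ℝ := fun k t => if k = 0 then F.logOm p0 t x0 else exp x0 * F.rsqP S p0 t x0
    with hπ
  have hcw : ∀ {g : ℝ → ℝ → ℝ}, ContDiffOn ℝ 0 (uncurry g) (polarMap p0 ⁻¹' S) →
      ContinuousOn (uncurry g) (Icc 0 (-p0) ×ˢ Ici x0) := fun hg =>
    hg.continuousOn.mono fun y hy => hmS y.1 hy.1 y.2 hy.2
  have hcu : ∀ {G}, IsCharacteristicSolution ε θ Np Nm p0 q0 B d G → ∀ i,
      ContinuousOn (uncurry (G.unknowns θ Np Nm S p0 i)) (Icc 0 (-p0) ×ˢ Ici x0) := fun HG i =>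
    hcw ((HG.regular hp hq).contDiffOn_unknowns (HG.fP_C1.of_le zero_le_one)
      (HG.fM_C1.of_le zero_le_one) (HG.Om_C2.of_le (by norm_num)) (HG.r_C2.of_le (by norm_num)) i)
  have hunk : ∀ i, ∀ t ∈ Icc 0 (-p0), ∀ x ∈ Ici x0,
      F.unknowns θ Np Nm S p0 i t x = G.unknowns θ Np Nm S p0 i t x := by
    intro i t ht x hx
    set X := max x (x0 + 1)
    have hxX : x0 < X := (lt_add_one x0).trans_le (le_max_right _ _)
    have hsub : Icc 0 (-p0) ×ˢ Icc x0 X ⊆ Icc 0 (-p0) ×ˢ Ici x0 :=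
      prod_mono le_rfl Icc_subset_Ici_self
    have hcx : ∀ {u : ℝ × ℝ → ℝ} (N : ℝ), ContDiffOn ℝ 1 u S → (∀ z ∈ S, 0 < u z) →
        ContinuousOn (uncurry (Fields.logX S p0 N u)) (Icc 0 (-p0) ×ˢ Ici x0) := by
      intro u N hu hpos
      have c0 : ContDiffOn ℝ 0 (fun y : ℝ × ℝ => exp y.2) (polarMap p0 ⁻¹' S) := by fun_prop
      exact hcw (((c0.mul (Fields.Regular.contDiffOn_comp_polarMap (contDiffOn_qD
        (uniqueDiffOn_domDbar hp) hu (by norm_num)))).div (Fields.Regular.contDiffOn_comp_polarMap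
        (hu.of_le zero_le_one)) fun y hy => (hpos _ hy).ne').add contDiffOn_const)
    obtain ⟨K1, hK1⟩ : ∃ K1, ∀ i, ∀ y ∈ Icc 0 (-p0) ×ˢ Icc x0 X,
        |G.unknownsX Np Nm S p0 i y.1 y.2| ≤ K1 := by
      have hc : ∀ i, ContinuousOn (uncurry (G.unknownsX Np Nm S p0 i)) (Icc 0 (-p0) ×ˢ Ici x0) := by
        intro i
        unfold Fields.unknownsX
        split_ifs
        exacts [hcx Np HG.fP_C1 fun z hz => (HG.pos z hz).1,
          hcx Nm HG.fM_C1 fun z hz => (HG.pos z hz).2.1]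
      choose K hK using fun i =>
        (isCompact_Icc.prod isCompact_Icc).exists_bound_of_continuousOn ((hc i).mono hsub)
      obtain ⟨L, hL⟩ := Finite.bddAbove_range K
      exact ⟨L, fun i y hy => (hK i y hy).trans (hL ⟨i, rfl⟩)⟩
    obtain ⟨K2, hK2⟩ : ∃ K2, ∀ k, ∀ t ∈ Icc 0 (-p0), |π k t| ≤ K2 := by
      have hs : ∀ {g : ℝ → ℝ → ℝ}, ContDiffOn ℝ 0 (uncurry g) (polarMap p0 ⁻¹' S) →
          ContinuousOn (fun t => g t x0) (Icc 0 (-p0)) := fun hg =>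
        (hcw hg).comp (by fun_prop : ContinuousOn (fun t : ℝ => (t, x0)) (Icc 0 (-p0)))
          fun t ht => ⟨ht, self_mem_Ici⟩
      have hc : ∀ k, ContinuousOn (π k) (Icc 0 (-p0)) := by
        have RF := HF.regular hp hq
        intro k
        match k with
        | 0 => exact hs (RF.contDiffOn_logOm (RF.Om_C2.of_le zero_le_two))
        | 1 => exact continuousOn_const.mul (hs (RF.contDiffOn_rsqP (RF.r_C2.of_le (by norm_num))))
      choose K hK using fun k => isCompact_Icc.exists_bound_of_continuousOn (hc k)
      obtain ⟨L, hL⟩ := Finite.bddAbove_range K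
      exact ⟨L, fun k t ht => (hK k t ht).trans (hL ⟨k, rfl⟩)⟩
    have hsys : ∀ {G}, IsCharacteristicSolution ε θ Np Nm p0 q0 B d G → ∀ i, ∀ t ∈ Ioo 0 (-p0),
        ∀ x ∈ Ioo x0 X, _ := fun {G} HG i t ht x hx =>
      (HG.regular hp hq).unknowns_system h0 h1 hN (X := X) (θ := θ)
        (w := withParam (fun j => G.unknowns θ Np Nm S p0 j t) fun k => π k t)
        ((HG.regular hp hq).sliceData h0 h1 hN (fun y hy => hmS t (hI ht) y hy.1)
          (fun y hy => ⟨hmO t ht y hy.1, HG.eqns _ (hmO t ht y hy.1)⟩)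
          (by
            have := (htr HG _ (hmS t (hI ht) x0 self_mem_Ici) (.inr (eq t))).2.2.1
            simp only [hπ, Fields.logOm, this, if_true])
          (by
            have h3 := (htr HG _ (hmS t (hI ht) x0 self_mem_Ici) (.inr (eq t))).2.2.2
            have h4 := pD_domDbar_congr hp (hmS t (hI ht) x0 self_mem_Ici) HF.r_C2 HG.r_C2
              fun p hp' => (htr HG (p, _) ⟨hp', (eq t).ge⟩ (.inr (eq t))).2.2.2
            simp only [hπ, Fields.rsqP, hS, h3, h4, one_ne_zero, if_false])
          fun _ _ _ => rfl) (hI hx) (hmO t ht x hx.1) (HG.eqns _ (hmO t ht x hx.1)) i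
    refine causal_unique (π := π) (K := max K1 K2) (by linarith : 0 < -p0) hxX (causal_speed hθ)
      (causal_source hθ hθ1 hν) (fun i v x => speedOp_nonneg h0 h1 i v x)
      (fun k t ht => (hK2 k t ht).trans (le_max_right _ _)) (fun i => (hcu HF i).mono hsub)
      (fun i => (hcu HG i).mono hsub) (fun i x hx => ?_) (fun i => ?_) i t ht x
      ⟨hx, le_max_left _ _⟩
    · have hz := hmS 0 h00 x hx.1
      obtain ⟨a1, a2, a3, a4⟩ := htr HG _ hz (.inl (ep x))
      have hd := fun q hq' => htr HG (_, q) ⟨hz.1, hq'⟩ (.inl (ep x))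
      have dO := qD_domDbar_congr hz HF.Om_C2 HG.Om_C2 fun q hq' => (hd q hq').2.2.1
      have dr := qD_domDbar_congr hz HF.r_C2 HG.r_C2 fun q hq' => (hd q hq').2.2.2
      match i with
      | 0 => simp only [Fields.unknowns, Fields.logP, a1]
      | 1 => simp only [Fields.unknowns, Fields.logM, a2]
      | 2 => simp only [Fields.unknowns, Fields.logOmQ, a3, hS, dO]
      | 3 => simp only [Fields.unknowns, Fields.logR, a4]
      | 4 => simp only [Fields.unknowns, Fields.rsqQ, a4, hS, dr]
    · by_cases hi : i = 0 ∨ i = 1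
      · refine .inl ⟨fun t ht => ?_, fun t ht x hx => ?_⟩
        · obtain ⟨a1, a2, -⟩ := htr HG _ (hmS t ht x0 self_mem_Ici) (.inr (eq t))
          rcases hi with rfl | rfl
          · simp only [Fields.unknowns, Fields.logP, a1]
          · simp only [Fields.unknowns, Fields.logM, a2]
        · obtain ⟨-, ut, a1, a2, a3⟩ := (hsys HF i t ht x hx).resolve_right fun h => h.1 hi
          obtain ⟨-, vt, b1, b2, b3⟩ := (hsys HG i t ht x hx).resolve_right fun h => h.1 hi
          exact ⟨_, _, _, _, a1, a2, b1, b2,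
            (hK1 i (t, x) ⟨hI ht, hI hx⟩).trans (le_max_left _ _), a3, b3⟩
      · exact .inr fun t ht x hx => ⟨((hsys HF i t ht x hx).resolve_left fun h => hi h.1).2.2,
          ((hsys HG i t ht x hx).resolve_left fun h => hi h.1).2.2⟩
  -- back to the fields
  have hback : ∀ w ∈ S, w.1 - p0 ∈ Icc 0 (-p0) ∧ log w.2 ∈ Ici x0 ∧
      polarMap p0 (w.1 - p0, log w.2) = w := fun w hw =>
    ⟨⟨by linarith [hw.1.1], by linarith [hw.1.2]⟩, log_le_log hq hw.2,
      polarMap_log (hq.trans_le hw.2)⟩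
  obtain ⟨b1, b2, b3⟩ := hback z hz
  have u0 := hunk 0 _ b1 _ b2
  have u1 := hunk 1 _ b1 _ b2
  have u3 := hunk 3 _ b1 _ b2
  simp only [Fields.unknowns, Fields.logP, Fields.logM, Fields.logR, b3] at u0 u1 u3
  obtain ⟨f1, f2, f3, f4⟩ := HF.pos z hz
  obtain ⟨g1, g2, g3, g4⟩ := HG.pos z hz
  refine ⟨log_injOn_pos f1 g1 (by linarith), log_injOn_pos f2 g2 (by linarith), ?_,
    log_injOn_pos f4 g4 (by linarith)⟩
  have hd : ∀ q ∈ Ici q0, HasDerivWithinAt (fun q => log (F.Om (z.1, q)) - log (G.Om (z.1, q)))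
      0 (Ici q0) q := by
    intro q hq'
    have hw : (z.1, q) ∈ S := ⟨hz.1, hq'⟩
    have e : {s | (z.1, s) ∈ S} = Ici q0 := by
      ext s; exact ⟨fun hs => hs.2, fun hs => ⟨hz.1, hs⟩⟩
    have d1 := (hasDerivWithinAt_qD HF.Om_C2 one_le_two hw).log (HF.pos _ hw).2.2.1.ne'
    have d2 := (hasDerivWithinAt_qD HG.Om_C2 one_le_two hw).log (HG.pos _ hw).2.2.1.ne'
    rw [e] at d1 d2
    refine (d1.sub d2).congr_deriv ?_
    obtain ⟨c1, c2, c3⟩ := hback _ hw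
    have u2 := hunk 2 _ c1 _ c2
    simp only [Fields.unknowns, Fields.logOmQ, c3] at u2
    have u2' := mul_left_cancel₀ (exp_pos _).ne' u2
    rw [mul_div_assoc, mul_div_assoc] at u2'
    exact sub_eq_zero.2 (mul_left_cancel₀ (exp_pos _).ne' u2')
  have h2 := eq_of_hasDerivWithinAt_zero (convex_Ici q0) hd self_mem_Ici hz.2
  rw [(HF.ingoing _ hz.1).2.2.1, (HG.ingoing _ hz.1).2.2.1, sub_self] at h2
  exact log_injOn_pos f3 g3 (sub_eq_zero.1 h2)

end

/-! ### Smooth solutions near the ingoing curve -/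

theorem exists_smooth_eq_nhdsSet {E : Type*} [NormedAddCommGroup E] [NormedSpace ℝ E]
    [FiniteDimensional ℝ E] {f : E → ℝ} {V K : Set E} (hV : IsOpen V) (hf : ContDiffOn ℝ ∞ f V)
    (hK : IsCompact K) (hKV : K ⊆ V) :
    ∃ g : E → ℝ, ContDiff ℝ ∞ g ∧ HasCompactSupport g ∧ ∀ z ∈ K, g =ᶠ[𝓝 z] f := by
  obtain ⟨δ, hδ, hs⟩ := hK.exists_cthickening_subset_open hV hKV
  obtain ⟨χ, h0, h1, -⟩ := exists_contMDiffMap_zero_one_nhds_of_isClosed (n := ⊤)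
    (modelWithCornersSelf ℝ E) (Metric.isOpen_thickening (δ := δ) (E := K)).isClosed_compl hK.isClosed
    (disjoint_compl_left_iff_subset.2 (Metric.self_subset_thickening hδ K))
  have hχ : ContDiff ℝ ∞ χ := χ.contMDiff.contDiff
  have hz : ∀ x ∉ Metric.thickening δ K, ∀ᶠ y in 𝓝 x, χ y = 0 := fun x hx => nhds_le_nhdsSet hx h0
  refine ⟨fun x => χ x * f x, contDiff_iff_contDiffAt.2 fun x => ?_,
    HasCompactSupport.of_support_subset_isCompact (hK.cthickening (r := δ)) fun x hx => ?_, fun z hz' => ?_⟩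
  · by_cases hx : x ∈ Metric.thickening δ K
    · exact hχ.contDiffAt.mul (hf.contDiffAt (hV.mem_nhds (hs (Metric.thickening_subset_cthickening _ _ hx))))
    · refine contDiffAt_const (c := (0 : ℝ)) |>.congr_of_eventuallyEq ?_
      filter_upwards [hz x hx] with y hy
      rw [hy, zero_mul]
  · by_contra h
    exact hx (show χ x * f x = 0 by rw [(hz x fun h' => h (Metric.thickening_subset_cthickening _ _ h')).self_of_nhds, zero_mul])
  · filter_upwards [nhds_le_nhdsSet hz' h1] with y hy
    rw [hy, one_mul]

namespace IsSmoothSolutionOn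

variable {ε : ℝ} {V : Set (ℝ × ℝ)} {B : FluidMetric}

theorem eqOn (h0 : 0 < ε) (h1 : ε < 1) (H : IsSmoothSolutionOn ε V B) :
    FluidMetric.EqOn V ((B.toFields ε).toFluidMetric ε) B := by
  have rt := fun w hw => roundtrip h0 h1 (H.pos w hw).2.2.2.2 (H.pos w hw).1 (H.pos w hw).2.2.1
  refine ⟨fun w hw => (rt w hw).1, fun w hw => ?_, fun w hw => (rt w hw).2,
    fun _ _ => rfl, fun _ _ => rfl⟩
  obtain ⟨-, -, hu, ho, -⟩ := H.pos w hw
  have e : ((B.toFields ε).toFluidMetric ε).uP w = 1 / (B.Om w ^ 2 *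
    uQOf ε (fPlusOf ε (B.r w) (B.rho w) (B.uQ w)) (fMinusOf ε (B.r w) (B.rho w) (B.uQ w)) (B.r w)) := rfl
  rw [e, (rt w hw).2, div_eq_iff (by positivity), ← mul_left_comm, (H.eqns w hw).1]
  field_simp

theorem smooth_fields (H : IsSmoothSolutionOn ε V B) :
    ContDiffOn ℝ ∞ (B.toFields ε).fP V ∧ ContDiffOn ℝ ∞ (B.toFields ε).fM V := by
  have hr : ∀ a : ℝ, ContDiffOn ℝ ∞ (fun z => B.r z ^ a) V := fun a =>
    H.smooth_r.rpow_const_of_ne fun z hz => (H.pos z hz).2.2.2.2.ne'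
  have hρ : ∀ a : ℝ, ContDiffOn ℝ ∞ (fun z => B.rho z ^ a) V := fun a =>
    H.smooth_rho.rpow_const_of_ne fun z hz => (H.pos z hz).1.ne'
  exact ⟨((contDiffOn_const.mul (hr _)).mul (hρ _)).mul (H.smooth_uQ.pow 2),
    contDiffOn_const.mul (((hr _).mul (hρ _)).div (H.smooth_uQ.pow 2) fun z hz =>
      (pow_pos (H.pos z hz).2.2.1 2).ne')⟩

theorem mono {V' : Set (ℝ × ℝ)} (H : IsSmoothSolutionOn ε V B) (ho : IsOpen V') (hs : V' ⊆ V) :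
    IsSmoothSolutionOn ε V' B :=
  ⟨ho, H.smooth_rho.mono hs, H.smooth_uP.mono hs, H.smooth_uQ.mono hs, H.smooth_Om.mono hs,
    H.smooth_r.mono hs, fun z hz => H.pos z (hs hz), fun z hz => H.eqns z (hs hz)⟩

theorem regular (h0 : 0 < ε) (h1 : ε < 1) (H : IsSmoothSolutionOn ε V B) (hV : ∀ z ∈ V, 0 < z.2) :
    (B.toFields ε).Regular V V where
  isOpen := H.isOpen
  subset := subset_rfl
  unique := H.isOpen.uniqueDiffOn
  pos_q := hV
  pos z hz := by
    obtain ⟨a, -, b, c, e⟩ := H.pos z hz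
    have : 0 < 1 - ε := by linarith
    refine ⟨?_, ?_, c, e⟩ <;> simp only [FluidMetric.toFields, fPlusOf, fMinusOf] <;> positivity
  fP_C1 := (H.smooth_fields).1.of_le (by exact_mod_cast le_top)
  fM_C1 := (H.smooth_fields).2.of_le (by exact_mod_cast le_top)
  Om_C2 := H.smooth_Om.of_le ENat.LEInfty.out
  r_C2 := H.smooth_r.of_le ENat.LEInfty.out

theorem evolutionAt (h0 : 0 < ε) (h1 : ε < 1) (H : IsSmoothSolutionOn ε V B) (hV : ∀ z ∈ V, 0 < z.2)
    {z : ℝ × ℝ} (hz : z ∈ V) : EvolutionAt ε (B.toFields ε) z := by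
  have R := H.regular h0 h1 hV
  have E := H.eqOn h0 h1
  have E' : FluidMetric.EqOn V B ((B.toFields ε).toFluidMetric ε) :=
    ⟨fun w hw => (E.rho w hw).symm, fun w hw => (E.uP w hw).symm, fun w hw => (E.uQ w hw).symm,
      fun _ _ => rfl, fun _ _ => rfl⟩
  obtain ⟨-, e1, e2, -, -, e5, e6⟩ := H.eqns z hz
  obtain ⟨a, b, c, e⟩ := R.pos z hz
  have hl : ∀ {u : ℝ × ℝ → ℝ}, ContDiffOn ℝ 1 u V → 0 < u z →
      HasDerivAt (fun s => log (u (s, z.2))) (pD V u z / u z) z.1 ∧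
      HasDerivAt (fun s => log (u (z.1, s))) (qD V u z / u z) z.2 := fun hu hp =>
    ⟨(hasDerivAt_pD H.isOpen subset_rfl hu le_rfl hz).log hp.ne',
      (hasDerivAt_qD H.isOpen subset_rfl hu le_rfl hz).log hp.ne'⟩
  have lP := hl R.fP_C1 a
  have lM := hl R.fM_C1 b
  have lO := hl (R.Om_C2.of_le one_le_two) c
  have lr := hl (R.r_C2.of_le one_le_two) e
  have J : LogJet (B.toFields ε) V z (fun w => log ((B.toFields ε).fP w))
      (fun w => log ((B.toFields ε).fM w)) (fun w => log ((B.toFields ε).Om w))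
      (fun w => log ((B.toFields ε).r w)) _ _ _ _ _ _ :=
    ⟨H.isOpen, hz, fun w hw => (exp_log (R.pos w hw).1).symm,
      fun w hw => (exp_log (R.pos w hw).2.1).symm,
      fun w hw => (exp_log (R.pos w hw).2.2.1).symm,
      fun w hw => (exp_log (R.pos w hw).2.2.2).symm, lP.1, lP.2, lM.1, lM.2, lO.2, lr.2⟩
  exact ⟨E'.rWave H.isOpen hz e1, E'.omegaWave H.isOpen hz e2,
    (J.euler_iff h0 h1).1 ⟨E'.continuity H.isOpen hz e5, E'.momentum H.isOpen hz e6⟩⟩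

end IsSmoothSolutionOn

theorem contDiffOn_iterate_qD {V : Set (ℝ × ℝ)} (hV : IsOpen V) {u : ℝ × ℝ → ℝ} (hu : ContDiffOn ℝ ∞ u V)
    (j : ℕ) : ContDiffOn ℝ ∞ ((qD V)^[j] u) V := by
  induction j generalizing u with
  | zero => exact hu
  | succ j ih => exact ih (contDiffOn_qD hV.uniqueDiffOn hu le_rfl)

theorem iteratedDeriv_eq_qD {V : Set (ℝ × ℝ)} (hV : IsOpen V) {u : ℝ × ℝ → ℝ} (hu : ContDiffOn ℝ ∞ u V)
    (j : ℕ) {z : ℝ × ℝ} (hz : z ∈ V) :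
    iteratedDeriv j (fun s => u (z.1, s)) z.2 = (qD V)^[j] u z := by
  induction j generalizing u with
  | zero => rfl
  | succ j ih =>
    rw [iteratedDeriv_succ', Function.iterate_succ_apply, ← ih (contDiffOn_qD hV.uniqueDiffOn hu le_rfl)]
    refine Filter.EventuallyEq.iteratedDeriv_eq j ?_
    exact eventually_snd (P := fun w => deriv (fun s => u (w.1, s)) w.2 = qD V u w) hV hz fun w hw =>
      (hasDerivAt_qD hV subset_rfl hu (by exact_mod_cast le_top) hw).deriv

/-! ### Weak derivatives on a half line -/

section HalfLine

variable {q0 c k K : ℝ} {M : ℝ≥0} {v g : ℝ → ℝ}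

theorem exists_isWeakDeriv_of_weakSup_le {E : Type*} [NormedAddCommGroup E] [NormedSpace ℝ E]
    [MeasureSpace E] {U : Set E} {e : E} {w u : E → ℝ} {j : ℕ} (h : weakSup U e w j u ≤ M) :
    ∃ g, IsWeakDeriv U e j u g ∧ ∀ᵐ x ∂volume.restrict U, |w x * g x| ≤ M + 1 := by
  have h1 : weakSup U e w j u < ((M + 1 : ℝ≥0) : ℝ≥0∞) :=
    h.trans_lt (by exact_mod_cast lt_add_one M)
  obtain ⟨g, hg⟩ := iInf_lt_iff.1 h1
  obtain ⟨hg, hl⟩ := iInf_lt_iff.1 hg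
  refine ⟨g, hg, ?_⟩
  filter_upwards [enorm_ae_le_eLpNormEssSup (fun x => w x * g x) (volume.restrict U)] with x hx
  have h2 := hx.trans hl.le
  rw [enorm_le_coe] at h2
  exact_mod_cast h2

theorem IsWeakDeriv.ae_eq {E : Type*} [NormedAddCommGroup E] [NormedSpace ℝ E] [MeasureSpace E]
    [BorelSpace E] [FiniteDimensional ℝ E] {U : Set E} (hU : IsOpen U) {e : E} {u g : E → ℝ}
    (h : IsWeakDeriv U e 0 u g) : ∀ᵐ x, x ∈ U → u x = g x := by
  have := hU.ae_eq_zero_of_integral_contDiff_smul_eq_zero (h.1.sub h.2.1) fun φ hφ hφc hφU => ?_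
  · filter_upwards [this] with x hx hU using sub_eq_zero.1 (hx hU)
  · have hint : ∀ {f : E → ℝ}, LocallyIntegrableOn f U volume → Integrable fun x => f x * φ x := by
      intro f hf
      have h1 := (hf.integrableOn_compact_subset hφU hφc).mul_continuousOn hφ.continuous.continuousOn hφc
      exact (integrableOn_iff_integrable_of_support_subset
        ((Function.support_mul_subset_right _ _).trans (subset_tsupport φ))).1 h1
    have hset : ∀ f : E → ℝ, ∫ x in U, f x * φ x = ∫ x, f x * φ x := fun f =>
      setIntegral_eq_integral_of_forall_compl_eq_zero fun x hx => by
        rw [image_eq_zero_of_notMem_tsupport (f := φ) fun h => hx (hφU h), mul_zero]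
    have h2 := h.2.2 φ hφ hφc hφU
    simp only [iteratedFDeriv_zero_apply, pow_zero, one_mul] at h2
    rw [hset, hset] at h2
    calc ∫ x, φ x • (u - g) x = ∫ x, (u x * φ x - g x * φ x) :=
          integral_congr_ae (.of_forall fun x => by simp only [smul_eq_mul, Pi.sub_apply]; ring)
      _ = 0 := by rw [integral_sub (hint h.1) (hint h.2.1), h2, sub_self]

theorem weakSup_deriv_le {w u u' : ℝ → ℝ} {j : ℕ} (hd : ∀ q ∈ Ioi q0, HasDerivAt u (u' q) q)
    (hc : ContinuousOn u' (Ioi q0)) :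
    weakSup (Ioi q0) (1 : ℝ) w j u' ≤ weakSup (Ioi q0) (1 : ℝ) w (j + 1) u := by
  have h1 : IsWeakDeriv (Ioi q0) (1 : ℝ) 1 u u' := isWeakDeriv_of_hasLineDerivAt isOpen_Ioi
    (fun q hq => (hd q hq).continuousAt.continuousWithinAt) hc fun q hq => by
      simpa using (hd q hq).hasFDerivAt.hasLineDerivAt 1
  exact le_iInf₂ fun g hg => iInf₂_le g (h1.succ_iff.1 hg)

theorem le_on_Ici_of_ae {f g : ℝ → ℝ} (h : ∀ᵐ q, q ∈ Ioi q0 → f q ≤ g q) (hf : ContinuousOn f (Ici q0))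
    (hg : ContinuousOn g (Ici q0)) {q : ℝ} (hq : q ∈ Ici q0) : f q ≤ g q := by
  have hcl := closure_mono ((Measure.dense_of_ae h).open_subset_closure_inter (isOpen_Ioi (a := q0)))
  rw [closure_closure, closure_Ioi] at hcl
  have hcl' : closure (Ioi q0 ∩ {q | q ∈ Ioi q0 → f q ≤ g q}) ⊆ Ici q0 :=
    (closure_mono inter_subset_left).trans (closure_Ioi q0).subset
  exact le_on_closure (fun q hq => hq.2 hq.1) (hf.mono hcl') (hg.mono hcl') (hcl hq)

theorem abs_le_of_essSup_le {f : ℝ → ℝ}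
    (h : essSup (fun q => ‖g q‖ₑ / ‖f q‖ₑ) (volume.restrict (Ioi q0)) ≤ M)
    (hg : ContinuousOn g (Ici q0)) (hf : ContinuousOn v (Ici q0)) (hv : ∀ q ∈ Ioi q0, f q = v q)
    {q : ℝ} (hq : q ∈ Ici q0) : |g q| ≤ M * |v q| := by
  refine le_on_Ici_of_ae ?_ hg.abs (continuousOn_const.mul hf.abs) hq
  rw [← ae_restrict_iff' measurableSet_Ioi]
  filter_upwards [ENNReal.ae_le_essSup (μ := volume.restrict (Ioi q0)) fun q => ‖g q‖ₑ / ‖f q‖ₑ,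
    ae_restrict_mem measurableSet_Ioi] with q h1 h2
  have h3 := (ENNReal.div_le_iff_le_mul (Or.inr ENNReal.coe_ne_top) (Or.inl enorm_ne_top)).1 (h1.trans h)
  rw [hv q h2, enorm_eq_nnnorm, enorm_eq_nnnorm] at h3
  exact_mod_cast h3

theorem abs_le_of_weakSup_le (hq : 0 < q0) (hv : ContinuousOn v (Ici q0))
    (h : weakSup (Ioi q0) (1 : ℝ) (fun q => q ^ k) 0 v ≤ M) {q : ℝ} (hx : q ∈ Ici q0) :
    |q ^ k * v q| ≤ M + 1 := by
  obtain ⟨g, hg, hb⟩ := exists_isWeakDeriv_of_weakSup_le h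
  rw [ae_restrict_iff' measurableSet_Ioi] at hb
  refine le_on_Ici_of_ae (f := fun q => |q ^ k * v q|) ?_
    ((continuousOn_id.rpow_const fun q h => Or.inl (hq.trans_le h).ne').mul hv).abs continuousOn_const hx
  filter_upwards [hb, hg.ae_eq isOpen_Ioi] with q h1 h2 hq using by rw [h2 hq]; exact h1 hq

theorem abs_sub_le_of_isWeakDeriv (hv : ContinuousOn v (Ioi q0)) (h : IsWeakDeriv (Ioi q0) (1 : ℝ) 1 v g)
    (hc : q0 ≤ c) (hg : ∀ᵐ q, q ∈ Ioi c → |g q| ≤ K) {a b : ℝ} (ha : c < a) (hab : a ≤ b) :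
    |v b - v a| ≤ K * (b - a) := by
  obtain ⟨δ, hδ⟩ : ∃ δ, δ = (a - c) / 2 := ⟨_, rfl⟩
  have hδ0 : 0 < δ := by rw [hδ]; linarith
  set f : ℝ → ℝ := indicator (Icc (a - δ) (b + δ)) v
  have hsub : Icc (a - δ) (b + δ) ⊆ Ioi q0 := fun x hx => by
    have := hx.1; simp only [mem_Ioi]; linarith
  have hf : LocallyIntegrable f := ((integrable_indicator_iff measurableSet_Icc).2
    ((hv.mono hsub).integrableOn_compact isCompact_Icc)).locallyIntegrable
  let φ : ℕ → ContDiffBump (0 : ℝ) := fun n =>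
    ⟨δ / (n + 1) / 2, δ / (n + 1), by positivity, half_lt_self (by positivity)⟩
  have hφδ : ∀ n, (φ n).rOut ≤ δ := fun n => div_le_self hδ0.le (by simp)
  have hlim : ∀ x ∈ Icc a b, Tendsto (fun n => convolution ((φ n).normed volume) f
      (ContinuousLinearMap.lsmul ℝ ℝ) volume x) atTop (𝓝 (v x)) := by
    intro x hx
    have hnh : Icc (a - δ) (b + δ) ∈ 𝓝 x := Icc_mem_nhds (by linarith [hx.1]) (by linarith [hx.2])
    have e : f =ᶠ[𝓝 x] v := by filter_upwards [hnh] with y hy using indicator_of_mem hy v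
    refine ContDiffBump.convolution_tendsto_right ?_ (.of_forall fun _ => hf.aestronglyMeasurable)
      (((hv.continuousAt (mem_of_superset hnh hsub)).tendsto.congr' e.symm).comp tendsto_snd)
      tendsto_const_nhds
    have := tendsto_one_div_add_atTop_nhds_zero_nat (𝕜 := ℝ).const_mul δ
    simpa [φ, div_eq_mul_inv] using this
  refine le_of_tendsto ((hlim b ⟨hab, le_rfl⟩).sub (hlim a ⟨le_rfl, hab⟩)).abs (.of_forall fun n => ?_)
  have hψ := (φ n).contDiff_normed (μ := volume) (n := ⊤)
  have hd : ∀ x ∈ Icc a b, HasDerivWithinAt (convolution ((φ n).normed volume) f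
      (ContinuousLinearMap.lsmul ℝ ℝ) volume) (convolution (deriv ((φ n).normed volume)) f
      (ContinuousLinearMap.lsmul ℝ ℝ) volume x) (Icc a b) x := fun x _ =>
    (HasCompactSupport.hasDerivAt_convolution_left _ (φ n).hasCompactSupport_normed
      (hψ.of_le (by exact_mod_cast le_top)) hf x).hasDerivWithinAt
  have := (convex_Icc a b).abs_image_sub_le hd (C := K) (fun x hx => norm_eq_abs _ ▸ ?_)
    ⟨le_rfl, hab⟩ ⟨hab, le_rfl⟩
  · rwa [abs_of_nonneg (sub_nonneg.2 hab)] at this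
  -- the derivative of the mollification
  set ψ : ℝ → ℝ := fun t => (φ n).normed volume (x - t) with hψd
  have hts : tsupport ψ ⊆ Icc (x - δ) (x + δ) := by
    refine closure_minimal (fun t ht => ?_) isClosed_Icc
    have h1 : x - t ∈ Function.support ((φ n).normed volume) := ht
    rw [(φ n).support_normed_eq, mem_ball_zero_iff, norm_eq_abs] at h1
    obtain ⟨h2, h3⟩ := abs_le.1 (h1.le.trans (hφδ n))
    exact ⟨by linarith, by linarith⟩
  have hIc : Icc (x - δ) (x + δ) ⊆ Ioi c := fun t ht => by
    have := ht.1; have := hx.1; simp only [mem_Ioi]; linarith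
  have hψs : ContDiff ℝ ∞ ψ := hψ.comp (contDiff_const.sub contDiff_id)
  have hψc : HasCompactSupport ψ := isCompact_Icc.of_isClosed_subset (isClosed_tsupport _) hts
  have hdψ : ∀ t, deriv ψ t = -deriv ((φ n).normed volume) (x - t) := deriv_comp_const_sub _ _
  have hw := h.2.2 ψ hψs hψc (hts.trans (hIc.trans (Ioi_subset_Ioi hc)))
  simp only [iteratedFDeriv_one_apply, fderiv_eq_smul_deriv, one_smul, pow_one, neg_one_mul] at hw
  have e1 : convolution (deriv ((φ n).normed volume)) f (ContinuousLinearMap.lsmul ℝ ℝ) volume x =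
      ∫ t in Ioi q0, g t * ψ t := by
    rw [← neg_eq_iff_eq_neg.2 hw, convolution_eq_swap, ← integral_neg,
      ← integral_indicator measurableSet_Ioi]
    refine integral_congr_ae (.of_forall fun t => ?_)
    simp only [ContinuousLinearMap.lsmul_apply, smul_eq_mul]
    by_cases ht : t ∈ Icc (x - δ) (x + δ)
    · have h1 : f t = v t := indicator_of_mem (mem_Icc.2
        ⟨by linarith [ht.1, hx.1], by linarith [ht.2, hx.2]⟩) v
      rw [h1, indicator_of_mem (Ioi_subset_Ioi hc (hIc ht)), hdψ]; ring
    · have h1 : deriv ψ t = 0 := image_eq_zero_of_notMem_tsupport fun h' =>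
        ht (hts (tsupport_deriv_subset h'))
      have h2 : deriv ((φ n).normed volume) (x - t) = 0 := by rw [← neg_eq_zero, ← hdψ, h1]
      rw [h2, zero_mul, indicator_apply, h1]; simp
  have hone : ∫ t, ψ t = 1 := by
    rw [hψd, integral_sub_left_eq_self]; exact (φ n).integral_normed
  have hψi : Integrable ψ := hψs.continuous.integrable_of_hasCompactSupport hψc
  have hψ0 : ∀ t, 0 ≤ ψ t := fun t => (φ n).nonneg_normed _
  rw [e1, ← setIntegral_eq_integral_of_forall_compl_eq_zero (s := Ioi q0) (f := ψ) fun t ht =>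
    image_eq_zero_of_notMem_tsupport fun h' => ht (Ioi_subset_Ioi hc (hIc (hts h')))] at *
  refine (norm_integral_le_of_norm_le (hψi.const_mul K).integrableOn ?_).trans_eq ?_ (b := ∫ t in Ioi q0, K * ψ t)
  · refine ae_restrict_of_ae ?_
    filter_upwards [hg] with t ht
    rw [norm_mul, norm_eq_abs, norm_eq_abs, abs_of_nonneg (hψ0 t)]
    by_cases h' : t ∈ Ioi c
    · exact mul_le_mul_of_nonneg_right (ht h') (hψ0 t)
    · rw [image_eq_zero_of_notMem_tsupport (f := ψ) fun h2 => h' (hIc (hts h2)), mul_zero, mul_zero]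
  · rw [integral_const_mul, hone, mul_one]

theorem abs_sub_le_of_weakSup_le (hq : 0 < q0) (hv : ContinuousOn v (Ici q0)) (hk : 0 ≤ k)
    (h : weakSup (Ioi q0) (1 : ℝ) (fun q => q ^ k) 1 v ≤ M) {a b : ℝ} (ha : a ∈ Ici q0) (hab : a ≤ b) :
    |v b - v a| ≤ (M + 1) * a ^ (-k) * (b - a) := by
  obtain ⟨g, hg, hb⟩ := exists_isWeakDeriv_of_weakSup_le h
  rw [ae_restrict_iff' measurableSet_Ioi] at hb
  rcases hab.eq_or_lt with rfl | hab
  · simp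
  have ha0 : 0 < a := hq.trans_le ha
  have h1 : ∀ᶠ c in 𝓝[>] a, |v b - v c| ≤ (M + 1) * a ^ (-k) * (b - c) := by
    filter_upwards [Ioo_mem_nhdsGT hab] with c hc
    refine abs_sub_le_of_isWeakDeriv (hv.mono Ioi_subset_Ici_self) hg ha ?_ hc.1 hc.2.le
    filter_upwards [hb] with q hq1 hq2
    have hq0' : 0 < q := ha0.trans hq2
    have h2 := hq1 (lt_of_le_of_lt (mem_Ici.1 ha) hq2)
    rw [abs_mul, abs_of_pos (rpow_pos_of_pos hq0' k)] at h2
    have h3 : a ^ k ≤ q ^ k := Real.rpow_le_rpow ha0.le (le_of_lt hq2) hk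
    rw [Real.rpow_neg ha0.le, ← div_eq_mul_inv, le_div_iff₀ (by positivity)]
    nlinarith [abs_nonneg (g q)]
  have hva : Tendsto v (𝓝[>] a) (𝓝 (v a)) :=
    (hv a ha).mono_left (nhdsWithin_mono _ fun x hx => mem_Ici.2 ((mem_Ici.1 ha).trans (le_of_lt hx)))
  exact le_of_tendsto_of_tendsto (tendsto_const_nhds.sub hva).abs
    (tendsto_const_nhds.mul (tendsto_const_nhds.sub (tendsto_id.mono_left nhdsWithin_le_nhds))) h1

end HalfLine

/-! ### Bounds of the unknowns along outgoing curves -/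

/-- Weighted bounds for a function and its difference quotients. -/
structure WeightedLip (I : Set ℝ) (K k : ℝ) (f : ℝ → ℝ) : Prop where
  bound : ∀ q ∈ I, |q ^ k * f q| ≤ K
  lip : ∀ a ∈ I, ∀ b ∈ I, a ≤ b → |f b - f a| ≤ K * a ^ (-(k + 1)) * (b - a)

theorem WeightedLip.comp_exp {I : Set ℝ} {K k : ℝ} {f : ℝ → ℝ} (H : WeightedLip I K k f) (hk : 0 ≤ k)
    {x y : ℝ} (hx : x ∈ exp ⁻¹' I) (hy : y ∈ exp ⁻¹' I) :
    |exp (k * x) * f (exp x)| ≤ K ∧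
      |exp (k * y) * f (exp y) - exp (k * x) * f (exp x)| ≤ (k + 3) * K * |y - x| := by
  have hb : ∀ x ∈ exp ⁻¹' I, |exp (k * x) * f (exp x)| ≤ K := fun x hx => by
    have := H.bound _ hx
    rwa [← exp_mul, mul_comm x] at this
  refine ⟨hb x hx, ?_⟩
  have hK : 0 ≤ K := (abs_nonneg _).trans (hb x hx)
  wlog hxy : x ≤ y generalizing x y
  · rw [abs_sub_comm, abs_sub_comm y]; exact this hy hx (le_of_not_ge hxy)
  obtain ⟨d, rfl⟩ : ∃ d, y = x + d := ⟨y - x, by ring⟩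
  have hd : 0 ≤ d := by linarith
  rw [add_sub_cancel_left, abs_of_nonneg hd]
  rcases le_total 1 d with h1 | h1
  · have h2 := hb _ hx
    have h3 := hb _ hy
    have := (abs_sub _ _).trans (add_le_add h3 h2)
    nlinarith [mul_nonneg hK hd, mul_nonneg hk (mul_nonneg hK hd), mul_nonneg hK (sub_nonneg.2 h1)]
  · have h2 := H.lip _ hx _ hy (Real.exp_le_exp.2 hxy)
    have e1 : exp (k * (x + d)) * f (exp (x + d)) - exp (k * x) * f (exp x) =
        (1 - exp (-(k * d))) * (exp (k * (x + d)) * f (exp (x + d))) +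
        exp (k * x) * (f (exp (x + d)) - f (exp x)) := by
      have : exp (-(k * d)) * exp (k * (x + d)) = exp (k * x) := by
        rw [← exp_add]; ring_nf
      linear_combination f (exp (x + d)) * this
    have h3 : |1 - exp (-(k * d))| ≤ k * d := by
      have := add_one_le_exp (-(k * d))
      have h4 : exp (-(k * d)) ≤ 1 := Real.exp_le_one_iff.2 (by nlinarith)
      rw [abs_of_nonneg (by linarith)]; linarith
    have h4 : exp d - 1 ≤ 3 * d := by
      have h5 := add_one_le_exp (-d)
      have h6 : exp (-d) * exp d = 1 := by rw [← exp_add]; simp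
      have h7 : exp d ≤ 3 := (Real.exp_le_exp.2 h1).trans (by linarith [Real.exp_one_lt_d9])
      nlinarith [exp_pos d]
    have e2 : exp (k * x) * (K * exp x ^ (-(k + 1)) * (exp (x + d) - exp x)) =
        K * (exp d - 1) := by
      have : exp (k * x) * exp x ^ (-(k + 1)) * exp x = 1 := by
        rw [← exp_mul, ← exp_add, ← exp_add]; ring_nf; simp
      rw [exp_add]
      linear_combination K * (exp d - 1) * this
    rw [e1]
    calc _ ≤ |1 - exp (-(k * d))| * |exp (k * (x + d)) * f (exp (x + d))| +
          exp (k * x) * |f (exp (x + d)) - f (exp x)| := by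
            refine (abs_add_le _ _).trans_eq ?_
            rw [abs_mul, abs_mul (exp (k * x)), abs_of_pos (exp_pos (k * x))]
      _ ≤ k * d * K + K * (exp d - 1) := by
            rw [← e2]
            exact add_le_add (mul_le_mul h3 (hb _ hy) (abs_nonneg _) (mul_nonneg hk hd))
              (mul_le_mul_of_nonneg_left h2 (exp_pos _).le)
      _ ≤ (k + 3) * K * d := by nlinarith

/-- Bound for the unknowns of the first order system. -/
def unknownBound (θ Np Nm K : ℝ) : ℝ :=
  (4 * K + |Np|) + (4 * K + |Nm|) + ((1 + θ) * (2 + θ) + 5 + θ) * K + 5 * K +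
    (K + (K ^ 2 + 2) + K * (2 * K) + K * (K ^ 2 + 2) * K)

/-- Bounds for fields on the part `I` of an outgoing curve. -/
structure SliceBounds (θ Np Nm K : ℝ) (I : Set ℝ) (S : Set (ℝ × ℝ)) (F : Fields) (p : ℝ) : Prop where
  ord : I.OrdConnected
  mem : ∀ q ∈ I, (p, q) ∈ S
  P_le : ∀ q ∈ I, |log (F.fP (p, q)) + Np * log q| ≤ K
  M_le : ∀ q ∈ I, |log (F.fM (p, q)) + Nm * log q| ≤ K
  Om_le : ∀ q ∈ I, |q ^ (1 + θ) * qD S (fun z => log (F.Om z)) (p, q)| ≤ K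
  r_le : ∀ q ∈ I, |q ^ (-2 : ℝ) * F.r (p, q) ^ 2| ≤ K
  r_ge : ∀ q ∈ I, |q ^ 2| ≤ K * |F.r (p, q) ^ 2|
  r_q_le : ∀ q ∈ I, |q ^ (-1 : ℝ) * qD S (fun z => F.r z ^ 2) (p, q)| ≤ K
  P_q : WeightedLip I K 1 fun q => qD S (fun z => log (F.fP z)) (p, q)
  M_q : WeightedLip I K 1 fun q => qD S (fun z => log (F.fM z)) (p, q)
  Om_qq : WeightedLip I K (2 + θ) fun q => qD S (qD S fun z => log (F.Om z)) (p, q)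
  r_qq : WeightedLip I K 0 fun q => qD S (qD S fun z => F.r z ^ 2) (p, q)

namespace Fields.Regular

variable {S O : Set (ℝ × ℝ)} {F : Fields} {θ Np Nm p0 t K : ℝ} {I : Set ℝ}

theorem logs_contDiffOn (H : F.Regular S O) :
    ContDiffOn ℝ 1 (fun z => log (F.fP z)) S ∧ ContDiffOn ℝ 1 (fun z => log (F.fM z)) S ∧
      ContDiffOn ℝ 2 (fun z => log (F.Om z)) S ∧ ContDiffOn ℝ 2 (fun z => F.r z ^ 2) S :=
  ⟨H.fP_C1.log fun z hz => (H.pos z hz).1.ne', H.fM_C1.log fun z hz => (H.pos z hz).2.1.ne',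
    H.Om_C2.log fun z hz => (H.pos z hz).2.2.1.ne', H.r_C2.pow 2⟩

theorem qD_logOm (H : F.Regular S O) {z : ℝ × ℝ} (hz : z ∈ S) :
    qD S (fun z => log (F.Om z)) z = qD S F.Om z / F.Om z := by
  have := fderivWithin.log (H.Om_C2.differentiableOn (by simp) z hz) (H.pos z hz).2.2.1.ne' (H.unique z hz)
  rw [qD, this, qD]; simp [div_eq_inv_mul]

theorem qD_rsq (H : F.Regular S O) {z : ℝ × ℝ} (hz : z ∈ S) :
    qD S (fun z => F.r z ^ 2) z = 2 * F.r z * qD S F.r z := by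
  rw [qD, fderivWithin_fun_pow (H.unique z hz) 2 (H.r_C2.differentiableOn (by simp) z hz), qD]; simp

theorem c11On_unknowns (H : F.Regular S O) (hθ : 0 < θ) (B : SliceBounds θ Np Nm K I S F (p0 + t))
    (i : Fin 5) : ∃ u', C11On (exp ⁻¹' I) (unknownBound θ Np Nm K) (F.unknowns θ Np Nm S p0 i t) u' := by
  rcases (exp ⁻¹' I).eq_empty_or_nonempty with h | ⟨y, hy⟩
  · rw [h]; exact ⟨0, by simp, by simp, by simp⟩
  have hK : 0 ≤ K := (abs_nonneg _).trans (B.P_le _ hy)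
  have hcv : Convex ℝ (exp ⁻¹' I) := (B.ord.preimage_mono Real.exp_monotone).convex
  have hlip : ∀ {f f' : ℝ → ℝ} {C : ℝ}, (∀ x ∈ exp ⁻¹' I, HasDerivWithinAt f (f' x) (exp ⁻¹' I) x) →
      (∀ x ∈ exp ⁻¹' I, |f' x| ≤ C) → ∀ x ∈ exp ⁻¹' I, ∀ y ∈ exp ⁻¹' I,
      |f y - f x| ≤ C * |y - x| := fun hd hb x hx y hy =>
    hcv.abs_image_sub_le hd hb hx hy
  have hsub : exp ⁻¹' I ⊆ {y | polarMap p0 (t, y) ∈ S} := fun x hx => B.mem _ hx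
  have hde : ∀ {u : ℝ × ℝ → ℝ}, ContDiffOn ℝ 1 u S → ∀ x ∈ exp ⁻¹' I,
      HasDerivWithinAt (fun x => u (p0 + t, exp x)) (exp x * qD S u (p0 + t, exp x))
        (exp ⁻¹' I) x := fun hu x hx =>
    (hasDerivWithinAt_comp_exp hu le_rfl (hsub hx)).mono hsub
  have hex : ∀ k x : ℝ, HasDerivWithinAt (fun x => exp (k * x)) (k * exp (k * x))
      (exp ⁻¹' I) x := fun k x => by
    simpa [mul_comm] using ((hasDerivAt_id x).const_mul k).exp.hasDerivWithinAt
  have hlin : ∀ (k x : ℝ), HasDerivWithinAt (fun x : ℝ => k * x) k (exp ⁻¹' I) x := fun k x => by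
    simpa using (hasDerivWithinAt_id x (exp ⁻¹' I)).const_mul k
  have p1 : 0 ≤ 4 * K + |Np| := by positivity
  have p2 : 0 ≤ 4 * K + |Nm| := by positivity
  have p3 : 0 ≤ ((1 + θ) * (2 + θ) + 5 + θ) * K := by positivity
  have p4 : 0 ≤ K + (K ^ 2 + 2) + K * (2 * K) + K * (K ^ 2 + 2) * K := by positivity
  obtain ⟨cP, cM, cO, cr⟩ := H.logs_contDiffOn
  have hlog : ∀ {u : ℝ × ℝ → ℝ} {N : ℝ}, ContDiffOn ℝ 1 u S → (∀ q ∈ I, |u (p0 + t, q) + N * log q| ≤ K) →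
      WeightedLip I K 1 (fun q => qD S u (p0 + t, q)) →
      C11On (exp ⁻¹' I) (4 * K + |N|) (fun x => u (p0 + t, exp x) + N * x)
        fun x => exp (1 * x) * qD S u (p0 + t, exp x) + N := by
    intro u N hu hb hw
    refine C11On.of_hasDeriv hcv (fun x hx => ?_) (fun x hx => ?_) (fun x hx => ?_) fun x hx y hy => ?_
    · rw [one_mul]; exact (hde hu x hx).add (hlin N x)
    · have := hb _ hx; rw [log_exp] at this; linarith [abs_nonneg N]
    · have := (hw.comp_exp zero_le_one hx hx).1; linarith [abs_add_le (exp (1 * x) * qD S u (p0 + t, exp x)) N]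
    · rw [add_sub_add_right_eq_sub]
      have := (hw.comp_exp zero_le_one hx hy).2
      nlinarith [abs_nonneg N, mul_nonneg (abs_nonneg N) (abs_nonneg (y - x))]
  -- the radius
  set g : ℝ → ℝ := fun x => exp (-1 * x) * qD S (fun z => F.r z ^ 2) (p0 + t, exp x)
  set f : ℝ → ℝ := fun x => exp (0 * x) * qD S (qD S fun z => F.r z ^ 2) (p0 + t, exp x)
  have hgd : ∀ x ∈ exp ⁻¹' I, HasDerivWithinAt g (f x - g x) (exp ⁻¹' I) x := fun x hx => by
    refine ((hex (-1) x).mul (hde (contDiffOn_qD (m := 1) H.unique cr (by norm_num)) x hx)).congr_deriv ?_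
    have : exp (-1 * x) * exp x = exp (0 * x) := by rw [← exp_add]; ring_nf
    linear_combination qD S (qD S fun z => F.r z ^ 2) (p0 + t, exp x) * this
  have hgb : ∀ x ∈ exp ⁻¹' I, |g x| ≤ K := fun x hx => by
    have := B.r_q_le _ hx; rwa [← exp_mul, mul_comm x] at this
  have hfb := fun x (hx : x ∈ exp ⁻¹' I) => (B.r_qq.comp_exp le_rfl hx hx).1
  have hgb' : ∀ x ∈ exp ⁻¹' I, |f x - g x| ≤ 2 * K := fun x hx => by
    linarith [abs_sub (f x) (g x), hgb x hx, hfb x hx]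
  have hgl := hlip hgd hgb'
  have eR : ∀ x ∈ exp ⁻¹' I, F.unknowns θ Np Nm S p0 4 t x = g x := fun x hx => by
    simp only [Fields.unknowns, rsqQ, g, polarMap, H.qD_rsq (B.mem _ hx), neg_one_mul]; ring
  match i with
  | 0 => exact ⟨_, (hlog cP B.P_le B.P_q).mono (by rw [unknownBound]; linarith)⟩
  | 1 => exact ⟨_, (hlog cM B.M_le B.M_q).mono (by rw [unknownBound]; linarith)⟩
  | 2 =>
    set h : ℝ → ℝ := fun x => exp ((1 + θ) * x) * qD S (fun z => log (F.Om z)) (p0 + t, exp x)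
    set k : ℝ → ℝ := fun x => exp ((2 + θ) * x) *
      qD S (qD S fun z => log (F.Om z)) (p0 + t, exp x)
    have hhd : ∀ x ∈ exp ⁻¹' I, HasDerivWithinAt h ((1 + θ) * h x + k x) (exp ⁻¹' I) x := by
      intro x hx
      refine ((hex (1 + θ) x).mul (hde (contDiffOn_qD (m := 1) H.unique cO (by norm_num)) x hx)).congr_deriv ?_
      have : exp ((1 + θ) * x) * exp x = exp ((2 + θ) * x) := by rw [← exp_add]; ring_nf
      linear_combination qD S (qD S fun z => log (F.Om z)) (p0 + t, exp x) * this
    have hhb : ∀ x ∈ exp ⁻¹' I, |h x| ≤ K := fun x hx => by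
      have := B.Om_le _ hx; rwa [← exp_mul, mul_comm x] at this
    have hk0 : 0 ≤ 2 + θ := by linarith
    have hhb' : ∀ x ∈ exp ⁻¹' I, |(1 + θ) * h x + k x| ≤ (2 + θ) * K := fun x hx => by
      have h1 := (B.Om_qq.comp_exp hk0 hx hx).1
      have h2 := abs_add_le ((1 + θ) * h x) (k x)
      rw [abs_mul, abs_of_pos (by linarith : 0 < 1 + θ)] at h2
      nlinarith [hhb x hx]
    refine ⟨_, (C11On.of_hasDeriv (K := ((1 + θ) * (2 + θ) + 5 + θ) * K) hcv hhd (fun x hx => ?_)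
      (fun x hx => ?_) fun x hx y hy => ?_).mono (by rw [unknownBound]; linarith) |>.congr (fun x hx => ?_)
      fun x hx => rfl⟩
    · nlinarith [hhb x hx, mul_nonneg hθ.le hK, mul_nonneg hθ.le (mul_nonneg hθ.le hK)]
    · nlinarith [hhb' x hx, mul_nonneg hθ.le hK, mul_nonneg hθ.le (mul_nonneg hθ.le hK)]
    · have h1 := (B.Om_qq.comp_exp hk0 hx hy).2
      have h2 := hlip hhd hhb' x hx y hy
      have h3 := abs_add_le ((1 + θ) * (h y - h x)) (k y - k x)
      rw [abs_mul, abs_of_pos (by linarith : 0 < 1 + θ)] at h3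
      have e : (1 + θ) * h y + k y - ((1 + θ) * h x + k x) = (1 + θ) * (h y - h x) + (k y - k x) := by ring
      rw [e]
      have h4 := mul_le_mul_of_nonneg_left h2 (by linarith : 0 ≤ 1 + θ)
      linarith
    · simp only [Fields.unknowns, logOmQ, h, polarMap, H.qD_logOm (B.mem _ hx)]
      rw [mul_div_assoc, ← mul_assoc, ← exp_add]; ring_nf
  | 3 =>
    have es : ∀ x ∈ exp ⁻¹' I, F.r (p0 + t, exp x) ^ 2 =
        exp (2 * x) * exp (F.logR p0 t x) := fun x hx => by
      have := H.exp_logR (p0 := p0) (t := t) (x := x) (B.mem _ hx)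
      rw [polarMap] at this
      rw [this, ← exp_nat_mul, ← exp_add]; push_cast; ring_nf
    have hsd : ∀ x ∈ exp ⁻¹' I, HasDerivWithinAt (F.logR p0 t)
        (exp (-F.logR p0 t x) * g x - 2) (exp ⁻¹' I) x := fun x hx =>
      ((H.hasDerivWithinAt_logR (hsub hx)).mono hsub).congr_deriv (by rw [← eR x hx]; rfl)
    have hup : ∀ x ∈ exp ⁻¹' I, exp (F.logR p0 t x) ≤ K ∧ exp (-F.logR p0 t x) ≤ K := fun x hx => by
      have h1 := B.r_le _ hx
      have h2 := B.r_ge _ hx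
      rw [es x hx] at h1 h2
      have h4 : exp x ^ 2 = exp (2 * x) := by rw [← exp_nat_mul]; norm_num
      rw [← exp_mul, ← mul_assoc, ← exp_add, abs_of_pos (by positivity)] at h1
      rw [h4, abs_of_pos (by positivity), abs_of_pos (by positivity)] at h2
      have h3 : exp (-F.logR p0 t x) * exp (F.logR p0 t x) = 1 := by rw [← exp_add]; simp
      refine ⟨by ring_nf at h1; simpa using h1, ?_⟩
      have h5 := exp_pos (2 * x)
      have h6 : 1 ≤ K * exp (F.logR p0 t x) := by nlinarith
      rw [exp_neg, inv_le_iff_one_le_mul₀ (exp_pos _)]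
      exact h6
    have hem : ∀ x ∈ exp ⁻¹' I, |exp (-F.logR p0 t x)| ≤ K := fun x hx => by
      rw [abs_of_pos (exp_pos _)]; exact (hup x hx).2
    have hsb : ∀ x ∈ exp ⁻¹' I, |exp (-F.logR p0 t x) * g x - 2| ≤ K ^ 2 + 2 := fun x hx => by
      have h1 := abs_sub (exp (-F.logR p0 t x) * g x) 2
      rw [abs_mul, abs_two] at h1
      have := mul_le_mul (hem x hx) (hgb x hx) (abs_nonneg _) hK
      nlinarith
    have hel := hlip (fun x hx => (hsd x hx).neg.exp) (C := K * (K ^ 2 + 2)) fun x hx => by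
      rw [abs_mul, abs_neg]
      exact mul_le_mul (hem x hx) (hsb x hx) (abs_nonneg _) hK
    refine ⟨_, (C11On.of_hasDeriv (K := K + (K ^ 2 + 2) + K * (2 * K) + K * (K ^ 2 + 2) * K) hcv hsd
      (fun x hx => ?_) (fun x hx => ?_) fun x hx y hy => ?_).mono (by rw [unknownBound]; linarith)⟩
    · have h1 := hup x hx
      have : |F.logR p0 t x| ≤ K := abs_le.2 ⟨by linarith [add_one_le_exp (-F.logR p0 t x)],
        by linarith [add_one_le_exp (F.logR p0 t x)]⟩
      have : 0 ≤ K * (K ^ 2 + 2) * K := by positivity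
      nlinarith
    · have : 0 ≤ K * (K ^ 2 + 2) * K := by positivity
      have := hsb x hx; nlinarith
    · have e : exp (-F.logR p0 t y) * g y - 2 - (exp (-F.logR p0 t x) * g x - 2) =
          exp (-F.logR p0 t y) * (g y - g x) +
          (exp (-F.logR p0 t y) - exp (-F.logR p0 t x)) * g x := by ring
      rw [e]
      have h1 := abs_add_le (exp (-F.logR p0 t y) * (g y - g x))
        ((exp (-F.logR p0 t y) - exp (-F.logR p0 t x)) * g x)
      rw [abs_mul, abs_mul] at h1
      have h2 := mul_le_mul (hem y hy) (hgl x hx y hy) (abs_nonneg _) hK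
      have h3 := mul_le_mul (hel x hx y hy) (hgb x hx) (abs_nonneg _) (by positivity)
      have : 0 ≤ (K + (K ^ 2 + 2)) * |y - x| := by positivity
      simp only [Pi.neg_apply] at h3
      nlinarith
  | 4 =>
    refine ⟨_, (C11On.of_hasDeriv (K := 5 * K) hcv hgd (fun x hx => ?_) (fun x hx => ?_)
      fun x hx y hy => ?_).mono (by rw [unknownBound]; linarith) |>.congr eR fun x hx => rfl⟩
    · linarith [hgb x hx]
    · linarith [hgb' x hx]
    · have h1 := (B.r_qq.comp_exp le_rfl hx hy).2
      have h2 := hgl x hx y hy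
      have h3 := abs_sub (f y - f x) (g y - g x)
      have e : f y - g y - (f x - g x) = f y - f x - (g y - g x) := by ring
      rw [e]; linarith

end Fields.Regular

/-! ### Bounds from the data norm -/

section Constructors

variable {q0 q1 k K : ℝ} {M : ℝ≥0}

theorem weightedLip_of_weakSup {u v : ℝ → ℝ} (hq : 0 < q0) (hk : 0 ≤ k)
    (hd : ∀ q ∈ Ioi q0, HasDerivAt u (v q) q) (hv : ContinuousOn v (Ici q0))
    (h0 : weakSup (Ioi q0) (1 : ℝ) (fun q => q ^ k) 1 u ≤ M)
    (h1 : weakSup (Ioi q0) (1 : ℝ) (fun q => q ^ (k + 1)) 2 u ≤ M) :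
    WeightedLip (Ici q0) (M + 1) k v :=
  ⟨fun _ hx => abs_le_of_weakSup_le hq hv ((weakSup_deriv_le hd (hv.mono Ioi_subset_Ici_self)).trans h0) hx,
    fun _ ha _ _ hab => abs_sub_le_of_weakSup_le hq hv (by linarith)
      ((weakSup_deriv_le hd (hv.mono Ioi_subset_Ici_self)).trans h1) ha hab⟩

theorem weightedLip_of_deriv {v v' : ℝ → ℝ} (hq : 0 < q0) (hk : 0 ≤ k)
    (hd : ∀ q ∈ Icc q0 q1, HasDerivWithinAt v (v' q) (Icc q0 q1) q)
    (h0 : ∀ q ∈ Icc q0 q1, |q ^ k * v q| ≤ K) (h1 : ∀ q ∈ Icc q0 q1, |q ^ (k + 1) * v' q| ≤ K) :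
    WeightedLip (Icc q0 q1) K k v := by
  refine ⟨h0, fun a ha b hb hab => ?_⟩
  have ha0 := hq.trans_le ha.1
  have hs : Icc a b ⊆ Icc q0 q1 := Icc_subset_Icc ha.1 hb.2
  have := (convex_Icc a b).abs_image_sub_le (C := K * a ^ (-(k + 1)))
    (fun q hq => (hd q (hs hq)).mono hs) (fun q hq' => ?_) (left_mem_Icc.2 hab) (right_mem_Icc.2 hab)
  · rwa [abs_of_nonneg (sub_nonneg.2 hab)] at this
  have h2 := h1 q (hs hq')
  have h3 : a ^ (k + 1) ≤ q ^ (k + 1) := Real.rpow_le_rpow ha0.le hq'.1 (by linarith)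
  rw [abs_mul, abs_of_pos (rpow_pos_of_pos (ha0.trans_le hq'.1) _)] at h2
  rw [Real.rpow_neg ha0.le, ← div_eq_mul_inv, le_div_iff₀ (by positivity)]
  nlinarith [abs_nonneg (v' q)]

theorem eventually_abs_iterate_qD_le {V : Set (ℝ × ℝ)} (hV : IsOpen V) {p0 w : ℝ} (hq : 0 < q0) {j : ℕ}
    {u : ℝ × ℝ → ℝ} (hu : ContDiffOn ℝ ∞ u V) (hm : ∀ p ∈ Icc p0 0, (p, q0) ∈ V) (hV0 : ∀ z ∈ V, 0 < z.2)
    (h : ⨆ p ∈ Icc p0 0, ‖q0 ^ w * iteratedDeriv j (fun s => u (p, s)) q0‖ₑ ≤ M) :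
    ∀ᶠ q1 in 𝓝[>] q0, ∀ p ∈ Icc p0 0, ∀ q ∈ Icc q0 q1,
      (p, q) ∈ V ∧ |q ^ w * (qD V)^[j] u (p, q)| ≤ M + 1 := by
  have hc : ContinuousOn (fun z : ℝ × ℝ => |z.2 ^ w * (qD V)^[j] u z|) V :=
    ((continuousOn_snd.rpow_const fun z hz => Or.inl (hV0 z hz).ne').mul
      (contDiffOn_iterate_qD hV hu j).continuousOn).abs
  obtain ⟨a, b, -, hb, ha', hb', hab⟩ := generalized_tube_lemma (isCompact_Icc (a := p0) (b := 0))
    (isCompact_singleton (x := q0)) (hc.isOpen_inter_preimage hV (isOpen_Iio (a := (M : ℝ) + 1))) (by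
      rintro ⟨p, q⟩ ⟨hp, rfl⟩
      have h1 := (iSup₂_le_iff.1 h) p hp
      rw [iteratedDeriv_eq_qD hV hu j (z := (p, q)) (hm p hp), enorm_le_coe] at h1
      have h2 : |q ^ w * (qD V)^[j] u (p, q)| ≤ M := by exact_mod_cast h1
      exact ⟨hm p hp, lt_of_le_of_lt h2 (lt_add_one _)⟩)
  obtain ⟨e, he, hs⟩ := (mem_nhdsGE_iff_exists_Ico_subset (a := q0)).1
    (mem_nhdsWithin_of_mem_nhds (hb.mem_nhds (hb' rfl)))
  filter_upwards [Ioo_mem_nhdsGT he] with q1 hq1 p hp q hq2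
  obtain ⟨h1, h2⟩ := hab (mk_mem_prod (ha' hp) (hs ⟨hq2.1, hq2.2.trans_lt hq1.2⟩))
  exact ⟨h1, le_of_lt h2⟩

end Constructors

/-- Outgoing data as fields that do not depend on `p`. -/
def OutgoingData.toFields (d : OutgoingData) : Fields :=
  ⟨fun z => d.fP z.2, fun z => d.fM z.2, fun z => d.Om z.2, fun z => d.r z.2⟩

namespace IsAdmissibleData

variable {ε θ Np Nm p0 q0 A0 : ℝ} {V : Set (ℝ × ℝ)} {B : FluidMetric} {d : OutgoingData} {M : ℝ≥0}

theorem regular_toFields (H : IsAdmissibleData ε p0 q0 A0 V B d) (hq : 0 < q0) :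
    d.toFields.Regular (univ ×ˢ Ici q0) (univ ×ˢ Ioi q0) where
  isOpen := isOpen_univ.prod isOpen_Ioi
  subset := prod_mono_right Ioi_subset_Ici_self
  unique := uniqueDiffOn_univ.prod (uniqueDiffOn_Ici q0)
  pos_q _ hz := hq.trans_le hz.2
  pos _ hz := H.pos _ hz.2
  fP_C1 := H.fP_C1.comp contDiffOn_snd fun _ hz => hz.2
  fM_C1 := H.fM_C1.comp contDiffOn_snd fun _ hz => hz.2
  Om_C2 := H.Om_C2.comp contDiffOn_snd fun _ hz => hz.2
  r_C2 := H.r_C2.comp contDiffOn_snd fun _ hz => hz.2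

theorem le_and_le_of_add_le {a b c : ℝ≥0∞} (h : a + b ≤ c) : a ≤ c ∧ b ≤ c :=
  ⟨le_self_add.trans h, le_add_self.trans h⟩

theorem le_of_sum_le {s : Finset ℕ} {f : ℕ → ℝ≥0∞} {c : ℝ≥0∞} (h : ∑ j ∈ s, f j ≤ c) :
    ∀ j ∈ s, f j ≤ c := fun _ hj => (Finset.single_le_sum (fun _ _ => zero_le) hj).trans h

/-- Quantitative information contained in the data norm. -/
theorem bounds (h0 : 0 < ε) (h1 : ε < 1) (hθ : 0 < θ) (hq : 0 < q0) (hA : q0 < A0)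
    (H : IsAdmissibleData ε p0 q0 A0 V B d)
    (hM : dataNorm θ Np Nm p0 q0 (B.toFields ε) d ≤ (M : ℝ≥0∞)) :
    (∀ p, SliceBounds θ Np Nm (M + 1) (Ici q0) (univ ×ˢ Ici q0) d.toFields p) ∧
    (∃ q1 > q0, q1 ≤ A0 ∧ ∀ p ∈ Icc p0 0,
      SliceBounds θ Np Nm (M + 1) (Icc q0 q1) (V ∩ {z | 0 < z.2}) (B.toFields ε) p) ∧
    (∀ p ∈ Icc p0 0, |log (B.Om (p, q0))| ≤ M ∧ |q0⁻¹ * dp (fun x => B.r x ^ 2) (p, q0)| ≤ M) ∧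
    ∀ p, ∀ q ∈ Ici q0, |q| ≤ M * |qD (univ ×ˢ Ici q0) (fun z => d.toFields.r z ^ 2) (p, q)| := by
  unfold dataNorm at hM
  dsimp only at hM
  obtain ⟨hM, -⟩ := le_and_le_of_add_le hM
  obtain ⟨hM, nW⟩ := le_and_le_of_add_le hM
  obtain ⟨hM, nR⟩ := le_and_le_of_add_le hM
  obtain ⟨hM, nr'⟩ := le_and_le_of_add_le hM
  obtain ⟨hM, nr⟩ := le_and_le_of_add_le hM
  obtain ⟨hM, nO⟩ := le_and_le_of_add_le hM
  obtain ⟨hM, nO0⟩ := le_and_le_of_add_le hM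
  obtain ⟨hM, nM⟩ := le_and_le_of_add_le hM
  obtain ⟨hM, nM0⟩ := le_and_le_of_add_le hM
  obtain ⟨nP0, nP⟩ := le_and_le_of_add_le hM
  have gP := fun j hj => max_le_iff.1 (le_of_sum_le nP j hj)
  have gM := fun j hj => max_le_iff.1 (le_of_sum_le nM j hj)
  have gO := fun j hj => max_le_iff.1 (le_of_sum_le nO j hj)
  have gr := fun j hj => max_le_iff.1 (le_of_sum_le nr j hj)
  have nP1 := gP 1 (by decide)
  have nP2 := gP 2 (by decide)
  have nM1 := gM 1 (by decide)
  have nM2 := gM 2 (by decide)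
  have nO1 := gO 1 (by decide)
  have nO2 := gO 2 (by decide)
  have nO3 := gO 3 (by decide)
  have nr0 := gr 0 (by decide)
  have nr1 := gr 1 (by decide)
  have nr2 := gr 2 (by decide)
  have nr3 := gr 3 (by decide)
  rw [max_le_iff] at nP0 nM0 nO0 nr' nR
  rw [show ((2 : ℕ) : ℝ) = 1 + 1 by norm_num] at nP2 nM2
  rw [Nat.cast_ofNat] at nO2
  rw [show ((3 : ℕ) : ℝ) + θ = 2 + θ + 1 by norm_num; ring] at nO3
  rw [show ((0 : ℕ) : ℝ) - 2 = -2 by norm_num] at nr0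
  rw [show ((1 : ℕ) : ℝ) - 2 = -1 by norm_num] at nr1
  rw [show ((2 : ℕ) : ℝ) - 2 = 0 by norm_num] at nr2
  rw [show ((3 : ℕ) : ℝ) - 2 = 0 + 1 by norm_num] at nr3
  rw [Nat.cast_one] at nP1 nM1 nO1
  have hk0 : 0 ≤ 2 + θ := by linarith
  have hM1 : (M : ℝ) ≤ M + 1 := by linarith
  refine ⟨fun p => ?_, ?_, fun p hp => ⟨?_, ?_⟩, fun p q hx => ?_⟩
  · have R := H.regular_toFields hq
    obtain ⟨cP, cM, cO, cr⟩ := R.logs_contDiffOn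
    have hcs : ∀ {u : ℝ × ℝ → ℝ} {n : ℕ∞ω}, ContDiffOn ℝ n u (univ ×ˢ Ici q0) →
        ContinuousOn (fun q => u (p, q)) (Ici q0) := fun hu =>
      hu.continuousOn.comp (by fun_prop) fun q hx => ⟨mem_univ _, hx⟩
    have hsl : ∀ {u : ℝ × ℝ → ℝ}, ContDiffOn ℝ 1 u (univ ×ˢ Ici q0) → (∀ q ∈ Ioi q0,
        HasDerivAt (fun s => u (p, s)) (qD (univ ×ˢ Ici q0) u (p, q)) q) ∧
        ContinuousOn (fun q => qD (univ ×ˢ Ici q0) u (p, q)) (Ici q0) := fun hu =>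
      ⟨fun q hx => hasDerivAt_qD (z := (p, q)) R.isOpen R.subset hu le_rfl ⟨mem_univ _, hx⟩,
        hcs (n := 0) (contDiffOn_qD R.unique hu (by norm_num))⟩
    have sO := hsl (cO.of_le one_le_two)
    have sr := hsl (cr.of_le one_le_two)
    have sO' := hsl (contDiffOn_qD (m := 1) R.unique cO (by norm_num))
    have sr' := hsl (contDiffOn_qD (m := 1) R.unique cr (by norm_num))
    have low : ∀ {u v : ℝ → ℝ} {k : ℝ} {j : ℕ}, (∀ q ∈ Ioi q0, HasDerivAt u (v q) q) ∧ ContinuousOn v (Ici q0) →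
        weakSup (Ioi q0) (1 : ℝ) (fun q => q ^ k) (j + 1) u ≤ M →
        weakSup (Ioi q0) (1 : ℝ) (fun q => q ^ k) j v ≤ M := fun h h' =>
      (weakSup_deriv_le h.1 (h.2.mono Ioi_subset_Ici_self)).trans h'
    have hl0 : ∀ {f : ℝ → ℝ} {N : ℝ}, ContinuousOn (fun q => log (f q)) (Ici q0) → (∀ q ∈ Ici q0, 0 < f q) →
        weakSup (Ioi q0) (1 : ℝ) (fun q => q ^ (0 : ℝ)) 0 (fun q => log (q ^ N * f q)) ≤ M →
        ∀ q ∈ Ici q0, |log (f q) + N * log q| ≤ M + 1 := fun {f N} hc hp h q hx => by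
      have e : ∀ q ∈ Ici q0, log (q ^ N * f q) = N * log q + log (f q) := fun q hx => by
        have := hq.trans_le hx
        rw [Real.log_mul (rpow_pos_of_pos this N).ne' (hp q hx).ne', Real.log_rpow this]
      have hcl : ContinuousOn (fun q => log (q ^ N * f q)) (Ici q0) :=
        ((continuousOn_const.mul (continuousOn_id.log fun q hx => (hq.trans_le hx).ne')).add hc).congr e
      have := abs_le_of_weakSup_le hq hcl h hx
      rwa [rpow_zero, one_mul, e q hx, add_comm] at this
    exact
      { ord := ordConnected_Ici
        mem := fun q hx => ⟨mem_univ _, hx⟩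
        P_le := hl0 (hcs cP) (fun q hx => (H.pos q hx).1) nP0.1
        M_le := hl0 (hcs cM) (fun q hx => (H.pos q hx).2.1) nM0.1
        Om_le := fun q hx => abs_le_of_weakSup_le hq sO.2 (low sO nO1.1) hx
        r_le := fun q hx => abs_le_of_weakSup_le hq (hcs cr) nr0.1 hx
        r_ge := fun q hx => (abs_le_of_essSup_le nr'.1 (continuousOn_pow 2) (hcs cr) (fun _ _ => rfl) hx).trans
          (mul_le_mul_of_nonneg_right hM1 (abs_nonneg _))
        r_q_le := fun q hx => abs_le_of_weakSup_le hq sr.2 (low sr nr1.1) hx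
        P_q := weightedLip_of_weakSup hq zero_le_one (hsl cP).1 (hsl cP).2 nP1.1 nP2.1
        M_q := weightedLip_of_weakSup hq zero_le_one (hsl cM).1 (hsl cM).2 nM1.1 nM2.1
        Om_qq := weightedLip_of_weakSup hq hk0 sO'.1 sO'.2 (low sO nO2.1) (low sO nO3.1)
        r_qq := weightedLip_of_weakSup hq le_rfl sr'.1 sr'.2 (low sr nr2.1) (low sr nr3.1) }
  · have H' := H.background.mono (H.background.isOpen.inter (isOpen_lt continuous_const continuous_snd))
      (inter_subset_left (t := {z : ℝ × ℝ | 0 < z.2}))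
    set S := V ∩ {z : ℝ × ℝ | 0 < z.2}
    have hS0 : ∀ z ∈ S, 0 < z.2 := fun z hz => hz.2
    have R := H'.regular h0 h1 hS0
    have hm : ∀ p ∈ Icc p0 0, (p, q0) ∈ S := fun p hp => ⟨H.ingoing_subset p hp, hq⟩
    have cl : ∀ {f : ℝ × ℝ → ℝ}, ContDiffOn ℝ ∞ f S → (∀ z ∈ S, 0 < f z) →
        ContDiffOn ℝ ∞ (fun z => log (f z)) S := fun hf hp => hf.log fun z hz => (hp z hz).ne'
    have sP := H'.smooth_fields.1
    have sM := H'.smooth_fields.2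
    have hn : ∀ N : ℝ, ContDiffOn ℝ ∞ (fun z : ℝ × ℝ => z.2 ^ N) S := fun N =>
      contDiffOn_snd.rpow_const_of_ne fun z hz => (hS0 z hz).ne'
    have hn0 : ∀ (N : ℝ), ∀ z ∈ S, 0 < z.2 ^ N := fun N z hz => rpow_pos_of_pos (hS0 z hz) N
    have cP := cl sP fun z hz => (R.pos z hz).1
    have cM := cl sM fun z hz => (R.pos z hz).2.1
    have cO := cl H'.smooth_Om fun z hz => (R.pos z hz).2.2.1
    have cr := H'.smooth_r.pow 2
    have E : ∀ {w : ℝ} {j : ℕ} {u : ℝ × ℝ → ℝ}, ContDiffOn ℝ ∞ u S →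
        (⨆ p ∈ Icc p0 0, ‖q0 ^ w * iteratedDeriv j (fun s => u (p, s)) q0‖ₑ ≤ M) →
        ∀ᶠ q1 in 𝓝[>] q0, ∀ p ∈ Icc p0 0, ∀ q ∈ Icc q0 q1, _ :=
      fun hu h => eventually_abs_iterate_qD_le H'.isOpen hq hu hm hS0 h
    have nr'' : ⨆ p ∈ Icc p0 0, ‖q0 ^ (0 : ℝ) * iteratedDeriv 0
        (fun s => (fun z : ℝ × ℝ => z.2 ^ 2 / B.r z ^ 2) (p, s)) q0‖ₑ ≤ M := by
      refine (iSup₂_mono fun p hp => ?_).trans nr'.2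
      have : B.r (p, q0) ^ 2 ≠ 0 := pow_ne_zero 2 (H'.pos _ (hm p hp)).2.2.2.2.ne'
      rw [rpow_zero, one_mul, iteratedDeriv_zero, enorm_eq_nnnorm, nnnorm_div,
        ENNReal.coe_div (nnnorm_ne_zero_iff.2 this)]
      exact le_rfl
    have cP0 : ContDiffOn ℝ ∞ (fun z => log (z.2 ^ Np * (B.toFields ε).fP z)) S :=
      cl ((hn Np).mul sP) fun z hz => mul_pos (hn0 Np z hz) (R.pos z hz).1
    have cM0 : ContDiffOn ℝ ∞ (fun z => log (z.2 ^ Nm * (B.toFields ε).fM z)) S :=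
      cl ((hn Nm).mul sM) fun z hz => mul_pos (hn0 Nm z hz) (R.pos z hz).2.1
    have cr' : ContDiffOn ℝ ∞ (fun z : ℝ × ℝ => z.2 ^ 2 / B.r z ^ 2) S :=
      (contDiffOn_snd.pow 2).div cr fun z hz => pow_ne_zero 2 (R.pos z hz).2.2.2.ne'
    obtain ⟨q1, hA', eP0, eM0, eP1, eP2, eM1, eM2, eO1, eO2, eO3, er0, er1, er2, er3, er⟩ :=
      ((show ∀ᶠ q1 in 𝓝[>] q0, q1 ∈ Ioo q0 A0 from Ioo_mem_nhdsGT hA).and <| (E cP0 nP0.2).and <| (E cM0 nM0.2).and <| (E cP nP1.2).and <| (E cP nP2.2).and <| (E cM nM1.2).and <|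
        (E cM nM2.2).and <| (E cO nO1.2).and <| (E cO nO2.2).and <| (E cO nO3.2).and <|
        (E cr nr0.2).and <| (E cr nr1.2).and <| (E cr nr2.2).and <| (E cr nr3.2).and (E cr' nr'')).exists
    refine ⟨q1, hA'.1, hA'.2.le, fun p hp => ?_⟩
    have hsl : ∀ {u : ℝ × ℝ → ℝ}, ContDiffOn ℝ ∞ u S → ∀ q ∈ Icc q0 q1,
        HasDerivWithinAt (fun q => u (p, q)) (qD S u (p, q)) (Icc q0 q1) q := fun hu q hx =>
      (hasDerivAt_qD (z := (p, q)) H'.isOpen subset_rfl hu (by exact_mod_cast le_top)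
        (eP0 p hp q hx).1).hasDerivWithinAt
    have hsm : ∀ {u : ℝ × ℝ → ℝ}, ContDiffOn ℝ ∞ u S → ContDiffOn ℝ ∞ (qD S u) S := fun hu =>
      contDiffOn_iterate_qD H'.isOpen hu 1
    have hl0 : ∀ {f : ℝ × ℝ → ℝ} {N : ℝ}, (∀ z ∈ S, 0 < f z) → ∀ q ∈ Icc q0 q1,
        |q ^ (0 : ℝ) * log (q ^ N * f (p, q))| ≤ M + 1 →
        |log (f (p, q)) + N * log q| ≤ M + 1 := fun {f N} hf q hx h => by
      have := hq.trans_le hx.1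
      rwa [Real.log_mul (rpow_pos_of_pos this N).ne' (hf _ (eP0 p hp q hx).1).ne', Real.log_rpow this,
        rpow_zero, one_mul, add_comm] at h
    exact
      { ord := ordConnected_Icc
        mem := fun q hx => (eP0 p hp q hx).1
        P_le := fun q hx => hl0 (fun z hz => (R.pos z hz).1) q hx (eP0 p hp q hx).2
        M_le := fun q hx => hl0 (fun z hz => (R.pos z hz).2.1) q hx (eM0 p hp q hx).2
        Om_le := fun q hx => (eO1 p hp q hx).2
        r_le := fun q hx => (er0 p hp q hx).2
        r_ge := fun q hx => by
          have h2 := (er p hp q hx).2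
          have h3 : 0 < |B.r (p, q) ^ 2| := abs_pos.2 (pow_ne_zero 2 (R.pos _ (eP0 p hp q hx).1).2.2.2.ne')
          rwa [rpow_zero, one_mul, Function.iterate_zero_apply, abs_div, div_le_iff₀ h3] at h2
        r_q_le := fun q hx => (er1 p hp q hx).2
        P_q := weightedLip_of_deriv hq zero_le_one (hsl (hsm cP)) (fun q hx => (eP1 p hp q hx).2)
          fun q hx => (eP2 p hp q hx).2
        M_q := weightedLip_of_deriv hq zero_le_one (hsl (hsm cM)) (fun q hx => (eM1 p hp q hx).2)
          fun q hx => (eM2 p hp q hx).2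
        Om_qq := weightedLip_of_deriv hq hk0 (hsl (hsm (hsm cO))) (fun q hx => (eO2 p hp q hx).2)
          fun q hx => (eO3 p hp q hx).2
        r_qq := weightedLip_of_deriv hq le_rfl (hsl (hsm (hsm cr))) (fun q hx => (er2 p hp q hx).2)
          fun q hx => (er3 p hp q hx).2 }
  · have := (iSup₂_le_iff.1 nO0.2) p hp
    rw [rpow_zero, one_mul, enorm_le_coe] at this
    exact_mod_cast this
  · have := (iSup₂_le_iff.1 nW) p hp
    rw [enorm_le_coe] at this
    exact_mod_cast this
  · have R := H.regular_toFields hq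
    have hr := (R.r_C2.pow 2).of_le one_le_two
    exact abs_le_of_essSup_le nR.1 continuousOn_id ((contDiffOn_qD (m := 0) R.unique hr (by norm_num)).continuousOn.comp
      (by fun_prop) fun q hx => ⟨mem_univ _, hx⟩)
      (fun q hx => (hasDerivAt_qD (z := (p, q)) R.isOpen R.subset hr le_rfl ⟨mem_univ _, hx⟩).deriv) hx

end IsAdmissibleData

/-! ### Existence -/

/-- A smooth solution near the ingoing curve as boundary data for the first order system. -/
theorem IsSmoothSolutionOn.exists_boundary_data {ε θ Np Nm p0 q0 q1 K : ℝ} {V : Set (ℝ × ℝ)}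
    {B : FluidMetric} (h0 : 0 < ε) (h1 : ε < 1) (hN : Np = Nm - 4 * eta ε) (hθ : 0 < θ) (hq : 0 < q0)
    (hq1 : q0 < q1) (H : IsSmoothSolutionOn ε V B) (hV : ∀ z ∈ V, 0 < z.2)
    (hB : ∀ p ∈ Icc p0 0, SliceBounds θ Np Nm K (Icc q0 q1) V (B.toFields ε) p) :
    ∃ (π : Fin 2 → ℝ → ℝ) (b : Fin 5 → ℝ → ℝ → ℝ), (∀ k, ContDiff ℝ ∞ (π k)) ∧
      (∀ t ∈ Icc 0 (-p0), π 0 t = (B.toFields ε).logOm p0 t (log q0) ∧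
        π 1 t = exp (log q0) * (B.toFields ε).rsqP V p0 t (log q0)) ∧
      (∀ i, ContDiff ℝ ∞ (uncurry (b i))) ∧ (∀ i, HasCompactSupport (uncurry (b i))) ∧
      (∀ i, ∀ t ∈ Icc 0 (-p0), ∀ x ∈ Icc (log q0) (log q1),
        b i t x = (B.toFields ε).unknowns θ Np Nm V p0 i t x) ∧
      (∀ i, ∀ t ∈ Icc 0 (-p0), C11On (Icc (log q0) (log q1)) (unknownBound θ Np Nm K) (b i t)
        (dx (b i) t)) ∧
      ∀ i, ∀ t ∈ Icc 0 (-p0), ∀ v : Fin 5 → ℝ → ℝ,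
        (∀ j, ∀ x ∈ Icc (log q0) (log q1), v j x = b j t x) →
        (B.toFields ε).IsSlice ε θ Np Nm (log q0) (log q1) V p0 t (withParam v fun k => π k t) ∧
        ∀ x ∈ Icc (log q0) (log q1),
          dt (b i) t x + speedOp ε θ (log q0) i (withParam v fun k => π k t) x * dx (b i) t x =
            sourceOp ε θ Np Nm (log q0) i (withParam v fun k => π k t) x := by
  set G := B.toFields ε
  set x0 := log q0
  set x1 := log q1
  have hx01 : x0 < x1 := log_lt_log hq hq1
  have R := H.regular h0 h1 hV
  have hpre : exp ⁻¹' Icc q0 q1 = Icc x0 x1 := by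
    ext x
    rw [mem_preimage, mem_Icc, mem_Icc, log_le_iff_le_exp hq, Real.le_log_iff_exp_le (hq.trans hq1)]
  have hp : ∀ t ∈ Icc 0 (-p0), p0 + t ∈ Icc p0 0 := fun t ht => ⟨by linarith [ht.1], by linarith [ht.2]⟩
  have hm : ∀ t ∈ Icc 0 (-p0), ∀ x ∈ Icc x0 x1, polarMap p0 (t, x) ∈ V := fun t ht x hx =>
    (hB _ (hp t ht)).mem _ (by rw [← mem_preimage, hpre]; exact hx)
  have hO : IsOpen (polarMap p0 ⁻¹' V) := R.isOpen_preimage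
  have hK : IsCompact (Icc 0 (-p0) ×ˢ Icc x0 x1) := isCompact_Icc.prod isCompact_Icc
  have hKV : Icc 0 (-p0) ×ˢ Icc x0 x1 ⊆ polarMap p0 ⁻¹' V := fun y hy => hm _ hy.1 _ hy.2
  choose b' hbs hbc hbe using fun i => exists_smooth_eq_nhdsSet hO (R.contDiffOn_unknowns (n := ∞) (θ := θ)
    (Np := Np) (Nm := Nm) (p0 := p0) H.smooth_fields.1 H.smooth_fields.2 H.smooth_Om H.smooth_r i) hK hKV
  obtain ⟨g0, hg0, -, he0⟩ := exists_smooth_eq_nhdsSet hO (R.contDiffOn_logOm (p0 := p0) H.smooth_Om) hK hKV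
  obtain ⟨g1, hg1, -, he1⟩ := exists_smooth_eq_nhdsSet hO
    (R.contDiffOn_rsqP (n := ∞) (p0 := p0) H.smooth_r) hK hKV
  have hx0 : x0 ∈ Icc x0 x1 := ⟨le_rfl, hx01.le⟩
  have e_x : ∀ i, ∀ t ∈ Icc 0 (-p0), ∀ x ∈ Icc x0 x1,
      HasDerivAt (G.unknowns θ Np Nm V p0 i t) (dx (fun t x => b' i (t, x)) t x) x := by
    intro i t ht x hx
    exact (hasDerivAt_dx (g := fun t x => b' i (t, x)) (hbs i) t x).congr_of_eventuallyEq
      ((hbe i (t, x) ⟨ht, hx⟩).comp_tendsto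
        ((by fun_prop : Continuous fun y : ℝ => (t, y)).tendsto' x _ rfl)).symm
  have e_t : ∀ i, ∀ t ∈ Icc 0 (-p0), ∀ x ∈ Icc x0 x1,
      HasDerivAt (fun t => G.unknowns θ Np Nm V p0 i t x) (dt (fun t x => b' i (t, x)) t x) t := by
    intro i t ht x hx
    exact (hasDerivAt_dt (g := fun t x => b' i (t, x)) (hbs i) t x).congr_of_eventuallyEq
      ((hbe i (t, x) ⟨ht, hx⟩).comp_tendsto
        ((by fun_prop : Continuous fun s : ℝ => (s, x)).tendsto' t _ rfl)).symm
  have hbv : ∀ i, ∀ t ∈ Icc 0 (-p0), ∀ x ∈ Icc x0 x1, b' i (t, x) = G.unknowns θ Np Nm V p0 i t x :=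
    fun i t ht x hx => (hbe i (t, x) ⟨ht, hx⟩).self_of_nhds
  let π : Fin 2 → ℝ → ℝ := fun k t => if k = 0 then g0 (t, x0) else exp x0 * g1 (t, x0)
  have hπ : ∀ t ∈ Icc 0 (-p0), π 0 t = G.logOm p0 t x0 ∧ π 1 t = exp x0 * G.rsqP V p0 t x0 := fun t ht =>
    ⟨(he0 (t, x0) ⟨ht, hx0⟩).self_of_nhds,
      congrArg (exp x0 * ·) (he1 (t, x0) ⟨ht, hx0⟩).self_of_nhds⟩
  refine ⟨π, fun i t x => b' i (t, x), fun k => ?_, hπ, hbs, hbc, hbv, fun i t ht => ?_,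
    fun i t ht v hv => ?_⟩
  · have hc : ∀ {g : ℝ × ℝ → ℝ}, ContDiff ℝ ∞ g → ContDiff ℝ ∞ fun t => g (t, x0) := fun hg =>
      hg.comp (contDiff_id.prodMk contDiff_const)
    match k with
    | 0 => exact hc hg0
    | 1 => exact contDiff_const.mul (hc hg1)
  · obtain ⟨u', hu'⟩ := R.c11On_unknowns (p0 := p0) hθ (hB _ (hp t ht)) i
    rw [hpre] at hu'
    refine hu'.congr (fun x hx => hbv i t ht x hx) fun x hx => ?_
    exact (uniqueDiffOn_Icc hx01 x hx).eq_deriv _ (e_x i t ht x hx).hasDerivWithinAt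
      (hu'.hasDerivWithinAt hx)
  · have hE : ∀ x ∈ Icc x0 x1, EvolutionAt ε G (polarMap p0 (t, x)) := fun x hx =>
      H.evolutionAt h0 h1 hV (hm t ht x hx)
    have hs := R.sliceData (π := fun k => π k t) h0 h1 hN (p0 := p0) (t := t) (hm t ht)
      (fun y hy => ⟨hm t ht y (Ioo_subset_Icc_self hy), hE y (Ioo_subset_Icc_self hy)⟩)
      (hπ t ht).1 (hπ t ht).2 fun j y hy => (hv j y hy).trans (hbv j t ht y hy)
    refine ⟨hs, fun x hx => ?_⟩
    rcases R.unknowns_system h0 h1 hN hs hx (hm t ht x hx) (hE x hx) i with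
      ⟨-, a, a1, a2, a3⟩ | ⟨-, e1, e2⟩
    · rw [(e_t i t ht x hx).unique a1, (e_x i t ht x hx).unique a2]; exact a3
    · rw [(e_t i t ht x hx).unique e2, e1, zero_mul, add_zero]

theorem stripFields_eq {Np Nm p0 t x : ℝ} {A B om s : ℝ → ℝ → ℝ} {F : Fields} {z : ℝ × ℝ}
    (hz : polarMap p0 (t, x) = z) (hF : 0 < F.fP z ∧ 0 < F.fM z ∧ 0 < F.Om z ∧ 0 < F.r z)
    (hA : A t x = F.logP p0 Np t x) (hB : B t x = F.logM p0 Nm t x) (hom : om t x = F.logOm p0 t x)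
    (hs : s t x = F.logR p0 t x) :
    (stripFields Np Nm p0 A B om s).fP z = F.fP z ∧ (stripFields Np Nm p0 A B om s).fM z = F.fM z ∧
      (stripFields Np Nm p0 A B om s).Om z = F.Om z ∧ (stripFields Np Nm p0 A B om s).r z = F.r z := by
  subst hz
  have et : (polarMap p0 (t, x)).1 - p0 = t := by rw [polarMap]; ring
  have ex : log (polarMap p0 (t, x)).2 = x := log_exp x
  simp only [stripFields, et, ex, hA, hB, hom, hs, Fields.logP, Fields.logM, Fields.logOm, Fields.logR,
    add_sub_cancel_right, exp_log hF.1, exp_log hF.2.1, exp_log hF.2.2.1, true_and]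
  have : (polarMap p0 (t, x)).2 = exp x := rfl
  rw [this, ← exp_add]
  ring_nf
  exact exp_log hF.2.2.2

namespace StripSol

variable {ε θ Np Nm T p0 q0 : ℝ} {A B om m s R W A' B' m' R' omt Wt : ℝ → ℝ → ℝ}
    {V Y μ : ℝ → ℝ → ℝ} {F : Fields}

/-- The full system, when the ingoing constraint holds somewhere on every outgoing curve. -/
theorem einsteinEulerAt (h0 : 0 < ε) (h1 : ε < 1) (hN : Np = Nm - 4 * eta ε)
    (H : StripSol ε θ Np Nm T (log q0) A B om m s R W A' B' m' R' omt Wt V Y μ)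
    (hF : F = stripFields Np Nm p0 A B om s) (hq : 0 < q0) (hT : p0 + T = 0)
    (hK : ∀ t ∈ Icc 0 T, ∀ x ∈ Ici (log q0),
      outgoingF ε (nu ε Np Nm) (A t x) (B t x) (s t x) (μ t x) (R t x) (R' t x) x = 0)
    (hP : ∀ p ∈ Ioo p0 0, ∃ y, q0 < y ∧
      ConstraintPAt ε (F.toFluidMetric ε) (p, y))
    {z : ℝ × ℝ} (hz : z ∈ domD p0 q0) :
    EinsteinEulerAt ε (F.toFluidMetric ε) z := by
  obtain ⟨⟨e1, e2, -, -⟩, e3, e4⟩ := H.evolutionAt h0 h1 hN hF hq hT hz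
  have P := H.polar hF hq hT
  have hx : ∀ {q}, q0 < q → log q0 < log q := fun h => log_lt_log hq h
  have ht0 : 0 < z.1 - p0 := by linarith [hz.1.1]
  have htT : z.1 - p0 < T := by linarith [hz.1.2]
  have ht : z.1 - p0 ∈ Icc 0 T := ⟨ht0.le, htT.le⟩
  have nt := Icc_mem_nhds ht0 htT
  have hRx := (H.R_x _ ht _ (hx hz.2).le).hasDerivAt (Ici_mem_nhds (hx hz.2))
  have hpz : ∀ {q} (hq' : q0 < q), _ := fun {q} hq' => P.constraintP_iff h0 h1 hN (z := (z.1, q)) ⟨hz.1, hq'⟩ rfl rfl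
    ((H.om_t _ ht _ (hx hq').le).hasDerivAt nt) ((H.W_t _ ht _ (hx hq').le).hasDerivAt nt)
  obtain ⟨y, hy, hPy⟩ := hP z.1 hz.1
  refine ⟨?_, e1, e2, (P.constraintQ_iff h0 h1 hN hz rfl rfl hRx).2 (hK _ ht _ (hx hz.2).le),
    (hpz hz.2).2 (H.constraintP hN h0 h1 ht (hx hz.2).le (hx hy).le ((hpz hy).1 hPy)), e3, e4⟩
  subst hF
  have hOm : 0 < (stripFields Np Nm p0 A B om s).Om z := exp_pos _
  have hu : 0 < uQOf ε ((stripFields Np Nm p0 A B om s).fP z) ((stripFields Np Nm p0 A B om s).fM z)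
      ((stripFields Np Nm p0 A B om s).r z) :=
    uQOf_pos h0 h1 (exp_pos _) (exp_pos _) (mul_pos (hq.trans hz.2) (exp_pos _))
  simp only [Fields.toFluidMetric, uPOf]
  field_simp

end StripSol

namespace IsAdmissibleData

variable {ε θ Np Nm p0 q0 A0 : ℝ} {V : Set (ℝ × ℝ)} {B : FluidMetric} {d : OutgoingData}

theorem qD_toFields (H : IsAdmissibleData ε p0 q0 A0 V B d) (hq : 0 < q0) (hA : q0 < A0)
    {u v : ℝ × ℝ → ℝ} (hu : ContDiffOn ℝ 2 u (univ ×ˢ Ici q0)) (hv : ContDiffOn ℝ ∞ v V)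
    (h : ∀ q ∈ Icc q0 A0, u (p0, q) = v (p0, q)) {q : ℝ} (hx : q ∈ Icc q0 A0) :
    qD (univ ×ˢ Ici q0) u (p0, q) = qD (V ∩ {z | 0 < z.2}) v (p0, q) := by
  have e1 := (hasDerivWithinAt_qD (z := (p0, q)) hu one_le_two ⟨mem_univ _, hx.1⟩).mono
    (s := Icc q0 A0) fun s hs => ⟨mem_univ _, hs.1⟩
  have e2 := (hasDerivWithinAt_qD (z := (p0, q)) (hv.mono (inter_subset_left (t := {z : ℝ × ℝ | 0 < z.2})))
    (by exact_mod_cast le_top) ⟨H.outgoing_subset q hx, hq.trans_le hx.1⟩).mono (s := Icc q0 A0)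
    fun s hs => ⟨H.outgoing_subset s hs, hq.trans_le hs.1⟩
  exact (uniqueDiffOn_Icc hA q hx).eq_deriv _ e1 (e2.congr (fun s hs => h s hs) (h q hx))

theorem toFields_unknowns (H : IsAdmissibleData ε p0 q0 A0 V B d) (hq : 0 < q0) (hA : q0 < A0) (i : Fin 5)
    {x : ℝ} (hx : exp x ∈ Icc q0 A0) :
    d.toFields.unknowns θ Np Nm (univ ×ˢ Ici q0) p0 i 0 x =
      (B.toFields ε).unknowns θ Np Nm (V ∩ {z | 0 < z.2}) p0 i 0 x := by
  obtain ⟨a, b, c, e⟩ := H.eq_background _ hx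
  have R := H.regular_toFields hq
  have hO := H.qD_toFields hq hA R.Om_C2 H.background.smooth_Om (fun q h => (H.eq_background q h).2.2.1) hx
  have hr := H.qD_toFields hq hA R.r_C2 H.background.smooth_r (fun q h => (H.eq_background q h).2.2.2) hx
  match i with
  | 0 => simp only [Fields.unknowns, Fields.logP, polarMap, add_zero, OutgoingData.toFields, a]
  | 1 => simp only [Fields.unknowns, Fields.logM, polarMap, add_zero, OutgoingData.toFields, b]
  | 2 =>
    simp only [Fields.unknowns, Fields.logOmQ, polarMap, add_zero, hO]
    rw [show d.toFields.Om (p0, exp x) = B.Om (p0, exp x) from c]; rfl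
  | 3 => simp only [Fields.unknowns, Fields.logR, polarMap, add_zero, OutgoingData.toFields, e]; rfl
  | 4 =>
    simp only [Fields.unknowns, Fields.rsqQ, polarMap, add_zero, hr]
    rw [show d.toFields.r (p0, exp x) = B.r (p0, exp x) from e]; rfl

theorem constraint_toFields (h0 : 0 < ε) (h1 : ε < 1) (hN : Np = Nm - 4 * eta ε)
    (H : IsAdmissibleData ε p0 q0 A0 V B d) (hq : 0 < q0) {x Rx : ℝ} (hx : log q0 < x)
    (hRx : HasDerivAt (d.toFields.rsqQ (univ ×ˢ Ici q0) p0 0) Rx x) :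
    outgoingF ε (nu ε Np Nm) (d.toFields.logP p0 Np 0 x) (d.toFields.logM p0 Nm 0 x)
      (d.toFields.logR p0 0 x) (d.toFields.logOmQ (univ ×ˢ Ici q0) p0 0 x)
      (d.toFields.rsqQ (univ ×ˢ Ici q0) p0 0 x) Rx x = 0 := by
  have hxq : q0 < exp x := (Real.log_lt_iff_lt_exp hq).1 hx
  exact (((H.regular_toFields hq).polar Np Nm p0).constraintQ_iff h0 h1 hN (z := (p0, exp x))
    ⟨mem_univ _, hxq⟩ (sub_self p0).symm (log_exp x).symm hRx).1 (H.constraint _ hxq)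

end IsAdmissibleData

theorem one_lt_decay {ε Np Nm : ℝ} (h0 : 0 < ε) (h1 : ε < 1) (hN : Np = Nm - 4 * eta ε)
    (hN' : (kPlus ε - kMinus ε) / 2 + 2 * eta ε < Nm) : 1 < 2 * eta ε + nu ε Np Nm := by
  have hη := eta_pos h0 h1
  have hk := kap_pos h0 h1
  rw [kPlus_sub_kMinus] at hN'
  have : 1 < nu ε Np Nm := by
    rw [nu_eq, one_div_mul_eq_div, lt_div_iff₀ (by positivity)]
    linarith
  linarith

/-- The characteristic problem on a thin strip. -/
theorem exists_characteristic_solution {ε Np Nm θ q0 : ℝ} (h0 : 0 < ε) (h1 : ε < 1) (hNp : 0 < Np)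
    (hNm : 0 < Nm) (hN : Np = Nm - 4 * eta ε) (hν : 1 < 2 * eta ε + nu ε Np Nm) (hθ : 0 < θ)
    (hθ1 : θ < 1) (hq : 0 < q0) (M : ℝ≥0) :
    ∃ δ0 : ℝ, 0 < δ0 ∧ ∀ p0 < 0, -p0 < δ0 → ∀ A0 > q0, ∀ (V : Set (ℝ × ℝ)) (B : FluidMetric)
      (d : OutgoingData), IsAdmissibleData ε p0 q0 A0 V B d →
      dataNorm θ Np Nm p0 q0 (B.toFields ε) d ≤ (M : ℝ≥0∞) →
      ∃ F : Fields, IsCharacteristicSolution ε θ Np Nm p0 q0 B d F ∧ AsymptoticallyFlat p0 F ∧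
        ∀ z ∈ domD p0 q0, EinsteinEulerAt ε (F.toFluidMetric ε) z := by
  have hK0 : (0 : ℝ) < M + 1 := by positivity
  have hν0 : 0 ≤ 2 * eta ε + nu ε Np Nm := by linarith
  have hD : 0 ≤ unknownBound θ Np Nm (M + 1) := by rw [unknownBound]; positivity
  set x0 := log q0 with hx0
  obtain ⟨K', hK', T0, hT0, hex⟩ := exists_causal_solution (x0 := x0) (P := max (M : ℝ) (q0 * M))
    (causal_speed (ε := ε) hθ) (causal_source (Np := Np) (Nm := Nm) hθ hθ1 hν0)
    (fun i v x => speedOp_nonneg h0 h1 i v x) hD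
  refine ⟨min T0 (1 / (2 * (M + 1) * K')), by positivity, fun p0 hp hδ A0 hA V B d H hM => ?_⟩
  obtain ⟨bC, ⟨q1, hq1, hqA, bB⟩, bπ, bR⟩ := H.bounds h0 h1 hθ hq hA hM
  have HB := H.background.mono (H.background.isOpen.inter (isOpen_lt continuous_const continuous_snd))
    (inter_subset_left (t := {z : ℝ × ℝ | 0 < z.2}))
  set S := V ∩ {z : ℝ × ℝ | 0 < z.2}
  set S0 : Set (ℝ × ℝ) := univ ×ˢ Ici q0
  set G := B.toFields ε
  have RG : G.Regular S S := HB.regular h0 h1 fun z hz => hz.2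
  have RC := H.regular_toFields hq
  obtain ⟨π, b, hπs, hπ, hbs, hbc, hb, hb11, hcomp⟩ :=
    HB.exists_boundary_data h0 h1 hN hθ hq hq1 (fun z hz => hz.2) bB
  set x1 := log q1 with hx1
  have hx01 : x0 < x1 := log_lt_log hq hq1
  obtain ⟨T, hTd⟩ : ∃ T, T = -p0 := ⟨_, rfl⟩
  have hT : 0 < T := by linarith
  have hT' : p0 + T = 0 := by linarith
  rw [← hTd] at hδ hπ hb hb11 hcomp
  have h0T : (0 : ℝ) ∈ Icc 0 T := ⟨le_rfl, hT.le⟩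
  have hpI : ∀ t ∈ Icc 0 T, p0 + t ∈ Icc p0 0 := fun t ht => ⟨by linarith [ht.1], by linarith [ht.2]⟩
  have hxI : ∀ x ∈ Icc x0 x1, exp x ∈ Icc q0 q1 := fun x hx =>
    ⟨(log_le_iff_le_exp hq).1 hx.1, (Real.le_log_iff_exp_le (hq.trans hq1)).1 hx.2⟩
  have hxC : ∀ x ∈ Ici x0, exp x ∈ Ici q0 := fun x hx => (log_le_iff_le_exp hq).1 hx
  have hprC : exp ⁻¹' Ici q0 = Ici x0 := by ext x; exact (log_le_iff_le_exp hq).symm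
  have hmG : ∀ t ∈ Icc 0 T, ∀ x ∈ Icc x0 x1, polarMap p0 (t, x) ∈ S := fun t ht x hx =>
    (bB _ (hpI t ht)).mem _ (hxI x hx)
  -- initial data
  have hu0 : ∀ i, ∃ u', C11On (Ici x0) (unknownBound θ Np Nm (M + 1))
      (d.toFields.unknowns θ Np Nm S0 p0 i 0) u' := fun i => by
    rw [← hprC]; exact RC.c11On_unknowns hθ (bC _) i
  choose u0' hu0 using hu0
  have hu0b : ∀ i, ∀ x ∈ Icc x0 x1, d.toFields.unknowns θ Np Nm S0 p0 i 0 x = b i 0 x := fun i x hx => by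
    rw [hb i 0 h0T x hx]
    exact H.toFields_unknowns hq hA i ⟨(hxI x hx).1, (hxI x hx).2.trans hqA⟩
  have hπb : ∀ k, ∀ t ∈ Icc 0 T, |π k t| ≤ max (M : ℝ) (q0 * M) := by
    intro k t ht
    have hz : polarMap p0 (t, x0) = (p0 + t, q0) := by rw [polarMap, hx0, exp_log hq]
    have hzS : (p0 + t, q0) ∈ S := by rw [← hz]; exact hmG t ht x0 ⟨le_rfl, hx01.le⟩
    obtain ⟨c1, c2⟩ := bπ _ (hpI t ht)
    match k with
    | 0 =>
      rw [(hπ t ht).1, Fields.logOm, hz]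
      exact c1.trans (le_max_left _ _)
    | 1 =>
      have e1 : dp (fun x => B.r x ^ 2) (p0 + t, q0) = 2 * B.r (p0 + t, q0) * pD S B.r (p0 + t, q0) := by
        have := (hasDerivAt_pD HB.isOpen subset_rfl RG.r_C2 one_le_two hzS).pow 2
        refine this.deriv.trans ?_
        simp [G, FluidMetric.toFields]
      have e2 : exp x0 * exp (-x0) = 1 := by rw [← exp_add]; simp
      have e3 : π 1 t = q0 * (q0⁻¹ * dp (fun x => B.r x ^ 2) (p0 + t, q0)) := by
        rw [(hπ t ht).2, Fields.rsqP, hz, mul_inv_cancel_left₀ hq.ne', e1]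
        have : G.r = B.r := rfl
        rw [this]
        linear_combination 2 * B.r (p0 + t, q0) * pD S B.r (p0 + t, q0) * e2
      rw [e3, abs_mul, abs_of_pos hq]
      exact (mul_le_mul_of_nonneg_left c2 hq.le).trans (le_max_right _ _)
  obtain ⟨u, u', cu, cu', hui, hub, hut, hux, hS⟩ := hex T hT (hδ.trans_le (min_le_left _ _)) x1 hx01 π hπs hπb
    b (d.toFields.unknowns θ Np Nm S0 p0 · 0) u0' hbs hbc hb11 hu0 hu0b
    fun i t ht v v' _ hv => (hcomp i t ht v hv).2
  have hdata : ∀ x ∈ Ici x0, u' 3 0 x = exp (-u 3 0 x) * u 4 0 x - 2 := fun x hx => by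
    have e1 := (hux 3 0 h0T x hx).congr (fun y hy => (hui 3 y hy).symm) (hui 3 x hx).symm
    have e2 := (RC.hasDerivWithinAt_logR (p0 := p0) (t := 0) (x := x) ⟨mem_univ _, hxC x hx⟩).mono
      (s := Ici x0) fun y hy => ⟨mem_univ _, hxC y hy⟩
    rw [hui 3 x hx, hui 4 x hx]
    exact (uniqueDiffOn_Ici x0 x hx).eq_deriv _ e1 e2
  obtain ⟨omt, Wt, SS⟩ := stripSol_of_system hθ hθ1 hν0 hT hπs cu cu' hut hux hdata
  have hsl := fun t ht => (hcomp 0 t ht (fun j => u j t) fun j => hub j t ht).1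
  have hub' : ∀ i, ∀ t ∈ Icc 0 T, ∀ x ∈ Icc x0 x1, u i t x = G.unknowns θ Np Nm S p0 i t x :=
    fun i t ht x hx => (hub i t ht x hx).trans (hb i t ht x hx)
  have hmu0 : ∀ x ∈ Ici x0, muOp θ join[u, π, 0] x =
      d.toFields.logOmQ S0 p0 0 x := fun x hx => by
    have : join[u, π, 0] (Sum.inl 2) x = u 2 0 x := rfl
    rw [muOp, this, hui 2 x hx, Fields.unknowns, ← mul_assoc, ← exp_add]; simp
  have hom0 : ∀ x ∈ Ici x0, omOp θ x0 join[u, π, 0] x =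
      d.toFields.logOm p0 0 x := by
    intro x hx
    have h2 := eq_of_hasDerivWithinAt_zero (convex_Ici x0) (fun y hy =>
      ((SS.om_x 0 h0T y hy).sub ((RC.hasDerivWithinAt_logOm (p0 := p0) (t := 0) (x := y)
        ⟨mem_univ _, hxC y hy⟩).mono (s := Ici x0) fun y hy => ⟨mem_univ _, hxC y hy⟩)).congr_deriv
        (by rw [hmu0 y hy, sub_self])) self_mem_Ici hx
    have h3 : omOp θ x0 join[u, π, 0] x0 = G.logOm p0 0 x0 :=
      (hsl 0 h0T).omOp_eq ⟨le_rfl, hx01.le⟩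
    have h4 : d.toFields.logOm p0 0 x0 = G.logOm p0 0 x0 := by
      have := (H.eq_background q0 ⟨le_rfl, hA.le⟩).2.2.1
      simp only [Fields.logOm, polarMap, add_zero, hx0, exp_log hq, OutgoingData.toFields, this]
      rfl
    simp only [Pi.sub_apply] at h2
    linarith
  -- the outgoing constraint
  have hRx : ∀ x ∈ Ioi x0, HasDerivAt (d.toFields.rsqQ S0 p0 0) (u' 4 0 x) x := fun x hx =>
    have hx' : x ∈ Ici x0 := Ioi_subset_Ici_self hx
    ((hux 4 0 h0T x hx').congr (fun y hy => (hui 4 y hy).symm) (hui 4 x hx').symm).hasDerivAt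
      (Ici_mem_nhds hx)
  have hKdata : ∀ x ∈ Ici x0, outgoingF ε (nu ε Np Nm) (u 0 0 x) (u 1 0 x) (u 3 0 x)
      (muOp θ join[u, π, 0] x) (u 4 0 x) (u' 4 0 x) x = 0 := by
    have hc : ∀ i, ContinuousOn (u i 0) (Ici x0) := fun i x hx => (hux i 0 h0T x hx).continuousWithinAt
    have hc' : ContinuousOn (u' 4 0) (Ici x0) := (cu' 4).continuousOn_slice h0T
    have hcm : ContinuousOn (muOp θ join[u, π, 0]) (Ici x0) :=
      (by fun_prop : Continuous fun x => exp (-(θ * x))).continuousOn.mul (hc 2)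
    have hcp : ContinuousOn (fun x => ppF ε (nu ε Np Nm) (u 0 0 x) (u 1 0 x) x) (Ici x0) := by
      have := hc 0; have := hc 1
      simp only [ppF]; fun_prop
    have := Set.EqOn.of_subset_closure (s := Ioi x0) (t := Ici x0) (f := fun x => outgoingF ε
      (nu ε Np Nm) (u 0 0 x) (u 1 0 x) (u 3 0 x) (muOp θ join[u, π, 0] x) (u 4 0 x) (u' 4 0 x) x)
      (g := fun _ => 0) (fun x hx => ?_)
      (((((hc 4).add hc').div_const 2).sub ((((hc 3).neg.rexp).mul ((hc 4).pow 2)).div_const 4)).sub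
        (hcm.mul (hc 4)) |>.add (continuousOn_const.mul hcp)) continuousOn_const Ioi_subset_Ici_self
      (closure_Ioi x0).symm.subset
    · exact fun x hx => this hx
    have hx' : x ∈ Ici x0 := Ioi_subset_Ici_self hx
    have := H.constraint_toFields h0 h1 hN hq hx (hRx x hx)
    simp only [hmu0 x hx', hui 0 x hx', hui 1 x hx', hui 3 x hx', hui 4 x hx']
    exact this
  have hK := fun t (ht : t ∈ Icc 0 T) x (hx : x ∈ Ici x0) => SS.constraintQ h0 h1 hKdata ht hx
  -- the radius grows
  have hRlow : ∀ t ∈ Icc 0 T, ∀ x ∈ Ici x0, 1 / (2 * (M + 1)) ≤ |u 4 t x| := by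
    intro t ht x hx
    have e1 := (convex_Icc 0 T).abs_image_sub_le (C := K')
      (fun τ hτ => (hut 4 τ hτ x hx).congr_deriv (by simp only [speedOp, zero_mul, sub_zero]))
      (fun τ hτ => hS 4 τ hτ x hx) h0T ht
    rw [sub_zero, abs_of_nonneg ht.1] at e1
    have e2 : 1 ≤ (M + 1) * |u 4 0 x| := by
      have e3 := bR p0 _ (hxC x hx)
      rw [RC.qD_rsq ⟨mem_univ _, hxC x hx⟩, abs_of_pos (exp_pos x)] at e3
      have e4 : 2 * d.toFields.r (p0, exp x) * qD S0 d.toFields.r (p0, exp x) =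
          exp x * u 4 0 x := by
        have : exp x * exp (-x) = 1 := by rw [← exp_add]; simp
        rw [hui 4 x hx]
        simp only [Fields.unknowns, Fields.rsqQ, polarMap, add_zero]
        linear_combination -(2 * d.toFields.r (p0, exp x) * qD S0 d.toFields.r (p0, exp x)) * this
      rw [e4, abs_mul, abs_of_pos (exp_pos x)] at e3
      have e5 : 1 ≤ M * |u 4 0 x| := by
        by_contra hlt
        nlinarith [exp_pos x]
      linarith [abs_nonneg (u 4 0 x)]
    have e3 := abs_sub_abs_le_abs_sub (u 4 0 x) (u 4 t x)
    rw [abs_sub_comm] at e3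
    have e4 : K' * t ≤ 1 / (2 * (M + 1)) := by
      have h5 := (ht.2.trans_lt (hδ.trans_le (min_le_right _ _))).le
      rw [le_div_iff₀ (by positivity)] at h5 ⊢
      linarith
    have e5 : 1 / (M + 1) ≤ |u 4 0 x| := by rw [div_le_iff₀ hK0]; linarith
    have e6 : 1 / ((M : ℝ) + 1) = 1 / (2 * (M + 1)) + 1 / (2 * (M + 1)) := by field_simp; norm_num
    linarith
  -- comparison with the data
  set F := stripFields Np Nm p0 (u 0) (u 1)
    (fun t => omOp θ x0 join[u, π, t]) (u 3) with hF
  have hFG : ∀ t ∈ Icc 0 T, ∀ x ∈ Icc x0 x1, ∀ z, polarMap p0 (t, x) = z → F.fP z = G.fP z ∧ F.fM z = G.fM z ∧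
      F.Om z = G.Om z ∧ F.r z = G.r z := fun t ht x hx z hz =>
    stripFields_eq hz (RG.pos _ (hz ▸ hmG t ht x hx)) (hub' 0 t ht x hx) (hub' 1 t ht x hx)
      ((hsl t ht).omOp_eq hx) (hub' 3 t ht x hx)
  refine ⟨F, SS.isCharacteristicSolution h0 h1 hNp hNm hN hθ hF hq hT' hp (by positivity) hRlow
    (fun p hp' => ?_) (fun q hq' => ?_), SS.asymptoticallyFlat hν hF hq hT' hp hK,
    fun z hz => SS.einsteinEulerAt h0 h1 hN hF hq hT' hK (fun p hp' => ?_) hz⟩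
  · refine hFG (p - p0) ⟨by linarith [hp'.1], by linarith [hp'.2]⟩ x0 ⟨le_rfl, hx01.le⟩ _ ?_
    rw [polarMap, hx0, exp_log hq, add_sub_cancel]
  · have hx : log q ∈ Ici x0 := log_le_log hq hq'
    exact stripFields_eq (F := d.toFields) (t := 0) (x := log q)
      (by rw [polarMap, add_zero, exp_log (hq.trans_le hq')]) (H.pos q hq') (hui 0 _ hx) (hui 1 _ hx)
      (hom0 _ hx) (hui 3 _ hx)
  · have hN' : IsOpen (Ioo p0 0 ×ˢ Ioo q0 q1) := isOpen_Ioo.prod isOpen_Ioo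
    have hmN : ∀ w ∈ Ioo p0 0 ×ˢ Ioo q0 q1, w ∈ S ∧ F.fP w = G.fP w ∧ F.fM w = G.fM w ∧
        F.Om w = G.Om w ∧ F.r w = G.r w := by
      intro w hw
      have hw2 : 0 < w.2 := hq.trans hw.2.1
      have ht : w.1 - p0 ∈ Icc 0 T := ⟨by linarith [hw.1.1], by linarith [hw.1.2]⟩
      have hx : log w.2 ∈ Icc x0 x1 := ⟨log_le_log hq hw.2.1.le, log_le_log hw2 hw.2.2.le⟩
      exact ⟨polarMap_log (p0 := p0) hw2 ▸ hmG _ ht _ hx, hFG _ ht _ hx w (polarMap_log hw2)⟩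
    have E := HB.eqOn h0 h1
    have hE : FluidMetric.EqOn (Ioo p0 0 ×ˢ Ioo q0 q1) B (F.toFluidMetric ε) := by
      constructor <;> intro w hw <;> obtain ⟨h, e1, e2, e3, e4⟩ := hmN w hw
      · rw [← E.rho w h]; simp only [Fields.toFluidMetric, e1, e2, e4]; rfl
      · rw [← E.uP w h]; simp only [Fields.toFluidMetric, e1, e2, e3, e4]; rfl
      · rw [← E.uQ w h]; simp only [Fields.toFluidMetric, e1, e2, e4]; rfl
      · exact e3.symm
      · exact e4.symm
    have hz : (p, (q0 + q1) / 2) ∈ Ioo p0 0 ×ˢ Ioo q0 q1 := ⟨hp', ⟨by simp only; linarith, by simp only; linarith⟩⟩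
    exact ⟨_, hz.2.1, hE.constraintP hN' hz (HB.eqns _ (hmN _ hz).1).2.2.2.2.1⟩

end EinsteinEuler
end

theorem theorem9 (ε : ℝ) (hε0 : 0 < ε) (hε1 : ε < 1)
    (Np Nm : ℝ) (hNp : 0 < Np) (hNm : 0 < Nm)
    (hN : Np = Nm - 4 * EinsteinEuler.eta ε)
    (hN' : (EinsteinEuler.kPlus ε - EinsteinEuler.kMinus ε) / 2 + 2 * EinsteinEuler.eta ε < Nm)
    (θ : ℝ) (hθ0 : 0 < θ) (hθ1 : θ < 1) (q0 : ℝ) (hq0 : 0 < q0) (M : NNReal) :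
    ∃ δ0 : ℝ, 0 < δ0 ∧ ∀ δ : ℝ, 0 < δ → δ < δ0 → ∀ p0 : ℝ, p0 = -δ →
      ∀ (A0 : ℝ), q0 < A0 → ∀ (V : Set (ℝ × ℝ)) (B : EinsteinEuler.FluidMetric)
        (d : EinsteinEuler.OutgoingData),
        EinsteinEuler.IsAdmissibleData ε p0 q0 A0 V B d →
        EinsteinEuler.dataNorm θ Np Nm p0 q0 (B.toFields ε) d ≤ (M : ENNReal) →
        ∃ F : EinsteinEuler.Fields,
          EinsteinEuler.IsCharacteristicSolution ε θ Np Nm p0 q0 B d F ∧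
          EinsteinEuler.AsymptoticallyFlat p0 F ∧
          (∀ z ∈ EinsteinEuler.domD p0 q0,
            EinsteinEuler.EinsteinEulerAt ε (F.toFluidMetric ε) z) ∧
          ∀ F' : EinsteinEuler.Fields,
            EinsteinEuler.IsCharacteristicSolution ε θ Np Nm p0 q0 B d F' →
            ∀ z ∈ EinsteinEuler.domDbar p0 q0,
              F'.fP z = F.fP z ∧ F'.fM z = F.fM z ∧ F'.Om z = F.Om z ∧ F'.r z = F.r z := by
  obtain ⟨δ0, hδ0, h⟩ := EinsteinEuler.exists_characteristic_solution hε0 hε1 hNp hNm hN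
    (EinsteinEuler.one_lt_decay hε0 hε1 hN hN') hθ0 hθ1 hq0 M
  refine ⟨δ0, hδ0, fun δ hδ hδ' p0 hp0 A0 hA0 V B d hd hM => ?_⟩
  obtain ⟨F, hF, haf, hEE⟩ := h p0 (by linarith) (by linarith) A0 hA0 V B d hd hM
  exact ⟨F, hF, haf, hEE, fun F' hF' z hz => hF'.unique hε0 hε1 hN hθ0 hθ1
    (by linarith [EinsteinEuler.one_lt_decay hε0 hε1 hN hN']) (by linarith) hq0 hF hz⟩
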